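/- \textbf{Setting.} Let $K:\mathbb R\to\mathbb R$ be a kernel with $K(z)=K(|z|)$, $K\in C^0(\mathbb R)\cap C^2(\mathbb R\setminus\{0\})$, $K,K'\in L^\infty(\mathbb R)$, $K''\in L^\infty(\mathbb R\setminus\{0\})$ and $K'\in L^1(\mathbb R)$. Let $\phi(\rho)=\rho W'(\rho)-W(\rho)$ be a $C^1$ function on $[0,\infty)$ with $W\ge 0$, $\phi(0)=0$, $\phi$ strictly increasing, $\phi'(\rho)\rho\le c_0\phi(\rho)$ and $\phi(\rho)\le\max\{\rho,c_0W(\rho)\}$ for some $c_0>0$, and such that for some $c_1,c_2>0$ and $0<\hat\rho<1<\bar\rho$ one has $\phi(\rho)\le c_1\rho$ for $\rho\le\hat\rho$ and $\phi(\rho)\ge c_2\rho$ for $\rho\ge\bar\rho$. Consider $$\partial_t\rho=\partial_x\big(\rho\,\partial_x(K*\rho)+\partial_x\phi(\rho)\big).\qquad(\ast)$$ \textbf{Particle approximation.} For $\rho_0\in L^1\cap L^\infty(\mathbb R)$ with $\rho_0>0$ and $L>0$ let $\rho_{0,L}$ be $\rho_0$ cut on $[-L/2,L/2)$ and extended $L$-periodically,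 and $c_L=\int_{-L/2}^{L/2}\rho_{0,L}$. For $N\ge1$ put $x_0=-L/2$, $x_{k+1}=\sup\{x:\int_{x_k}^x\rho_{0,L}<c_L/N\}$, and let $x_k(t)$ solve, on the torus $\mathbb T_L=\mathbb R/L\mathbb Z$ (indices modulo $N$), $$\dot x_k=-\frac{c_L}N\sum_{j\ne k}K'(x_k-x_j)-\frac N{c_L}\big[\phi(\rho_k)-\phi(\rho_{k-1})\big],\qquad \rho_k=\frac{c_L}{N(x_{k+1}-x_k)},\qquad x_k(0)=x_k.$$ The approximation is well defined on $[0,T]$ if $x_0(t)<\dots<x_{N-1}(t)<x_0(t)+L$ there, and then $\rho_L^N(t,x)=\sum_k\rho_k(t)\chi_{[x_k(t),x_{k+1}(t))}(x)$. Here $K'$ on $\mathbb T_L$ may be understood in either of the following two ways: (i) $K'(z)$ is evaluated at the representative $z\in[-L/2,L/2]$ of least modulus, any value between $K'(-L/2)$ and $K'(L/2)$ being admitted for two points at distance exactly $L/2$ (the ODEs then hold for a.e. $t$ along Lipschitz curves); or (ii) $K'$ is replaced by its periodization $\sum_{n\in\mathbb Z}K'(\cdot+nL)$, provided that for $L\ge1$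 these series converge absolutely off $L\mathbb Z$, with $\sum_n|K'(\cdot+nL)|$ bounded and the sum Lipschitz on $(0,L)$, uniformly in $L$. A \emph{torus limit} $\rho_L$ is a limit in $L^1([0,T]\times\mathbb T_L)$ of a subsequence, as $N\to\infty$, of approximations $\rho_L^N$ that are well defined on $[0,T]$ for all large $N$. \textbf{Theorem.} Let $\rho_0\in L^1(\mathbb R)\cap L^\infty(\mathbb R)$ with $\rho_0>0$ and $\int_{\mathbb R}|x|\rho_0(x)\,dx<\infty$, and let $T>0$. Then torus limits $\rho_L$ exist for every $L>0$. Moreover, for every sequence $L_n\to\infty$ and all torus limits $\rho_{L_n}$, a subsequence of the functions $\rho_{L_n}\chi_{[-L_n/2,L_n/2)}$ converges in $L^1([0,T]\times\mathbb R)$ to a nonnegative bounded function $\rho\in L^1([0,T]\times\mathbb R)$ which is a weak solution of $(\ast)$ on $\mathbb R$ with initial datum $\rho_0$: for all $\psi\in C_c^\infty([0,T)\times\mathbb R)$, $$\int_0^T\!\!\int_{\mathbb R}\big(\rho\,\partial_t\psi-\rho\,(K'*\rho)\,\partial_x\psi+\phi(\rho)\,\partial_{xx}\psi\big)\,dx\,dt+\int_{\mathbb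 R}\rho_0(x)\,\psi(0,x)\,dx=0.$$ -/

import Mathlib

open MeasureTheory Set Filter Topology
open scoped ENNReal ContDiff

noncomputable section

/-- Assumptions on the interaction kernel `K`: even, continuous, `C²` off the origin, with `K`, `K'`,
`K''` bounded (off the origin) and `K'` integrable. -/
structure AdmissibleKernel (K : ℝ → ℝ) : Prop where
  even : ∀ z, K z = K |z|
  continuous : Continuous K
  contDiffOn : ContDiffOn ℝ 2 K {0}ᶜ
  bounded : ∃ M, ∀ z, |K z| ≤ M
  deriv_bounded : ∃ M, ∀ z, z ≠ 0 → |deriv K z| ≤ M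
  deriv2_bounded : ∃ M, ∀ z, z ≠ 0 → |deriv (deriv K) z| ≤ M
  deriv_integrable : Integrable (deriv K)

/-- Assumptions on the nonlinear diffusion `φ(ρ) = ρ W'(ρ) - W(ρ)`; all functions of the density are
only used on `[0, ∞)`. -/
structure AdmissibleDiffusion (φ W : ℝ → ℝ) : Prop where
  contDiffOn : ContDiffOn ℝ 1 φ (Ici 0)
  W_continuousOn : ContinuousOn W (Ici 0)
  W_differentiableOn : DifferentiableOn ℝ W (Ioi 0)
  eq_W : ∀ r, 0 < r → φ r = r * deriv W r - W r
  W_nonneg : ∀ r, 0 ≤ r → 0 ≤ W r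
  map_zero : φ 0 = 0
  strictMonoOn : StrictMonoOn φ (Ici 0)
  growth : ∃ c₀ : ℝ, 0 < c₀ ∧ (∀ r, 0 < r → deriv φ r * r ≤ c₀ * φ r) ∧
    ∀ r, 0 ≤ r → φ r ≤ max r (c₀ * W r)
  small : ∃ c₁ r₁ : ℝ, 0 < c₁ ∧ 0 < r₁ ∧ r₁ < 1 ∧ ∀ r, 0 ≤ r → r ≤ r₁ → φ r ≤ c₁ * r
  large : ∃ c₂ r₂ : ℝ, 0 < c₂ ∧ 1 < r₂ ∧ ∀ r, r₂ ≤ r → c₂ * r ≤ φ r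

/-- The force exerted across a displacement `z` of the torus `ℝ / Lℤ`, first form: `K'` evaluated at
the representative of `z` of least modulus. Two points at distance exactly `L / 2` have the two such
representatives `± L / 2`, and any value between `K'(-L/2)` and `K'(L/2)` is admitted. -/
def nearestImageForce (K : ℝ → ℝ) (L z : ℝ) : Set ℝ :=
  {p | ∃ n : ℤ, |z + n * L| < L / 2 ∧ p = deriv K (z + n * L)} ∪
  {p | ∃ n : ℤ, z + n * L = L / 2 ∧ |p| ≤ |deriv K (L / 2)|}

/-- Second form of the torus force: the `L`-periodization of `K'`, which corresponds to convolving
`K'` over all of `ℝ` with `L`-periodic densities. -/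
def periodizedForce (K : ℝ → ℝ) (L z : ℝ) : Set ℝ :=
  {∑' n : ℤ, deriv K (z + n * L)}

/-- The `L`-periodizations of `K'`, `L ≥ 1`, converge absolutely off `Lℤ` and are bounded and
Lipschitz on `(0, L)`, uniformly in `L`. -/
def HasBoundedPeriodization (K : ℝ → ℝ) : Prop :=
  ∃ M : ℝ, ∀ L, 1 ≤ L → ∀ z ∈ Ioo 0 L,
    Summable (fun n : ℤ => |deriv K (z + n * L)|) ∧
    ∑' n : ℤ, |deriv K (z + n * L)| ≤ M ∧
    ∀ w ∈ Ioo 0 L,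
      |∑' n : ℤ, deriv K (z + n * L) - ∑' n : ℤ, deriv K (w + n * L)| ≤ M * |z - w|

/-- Cut `ρ₀` on `[-L/2, L/2)` and extend it `L`-periodically. -/
def periodicCut (ρ₀ : ℝ → ℝ) (L x : ℝ) : ℝ := ρ₀ (x - L * ⌊x / L + 1 / 2⌋)

/-- The mass `c_L` of the periodized cutoff on one period. -/
def cutMass (ρ₀ : ℝ → ℝ) (L : ℝ) : ℝ := ∫ x in Ico (-(L / 2)) (L / 2), periodicCut ρ₀ L x

/-- Initial particle positions: `x₀ = -L/2` and `x_{k+1} = sup {x : ∫_{x_k}^x ρ_{0,L} < c_L / N}`. -/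
def initialPosition (ρ₀ : ℝ → ℝ) (L : ℝ) (N : ℕ) : ℕ → ℝ
  | 0 => -(L / 2)
  | k + 1 => sSup {x | x ∈ Icc (-(L / 2)) (L / 2) ∧
      ∫ y in initialPosition ρ₀ L N k..x, periodicCut ρ₀ L y < cutMass ρ₀ L / N}

/-- The particle density `ρ_k = c / (N (x_{k+1} - x_k))` at a given configuration. -/
def cellDensity (c : ℝ) (N : ℕ) (x : ℤ → ℝ) (k : ℤ) : ℝ := c / (N * (x (k + 1) - x k))

/-- The piecewise constant density `∑ ρ_k χ_{[x_k, x_{k+1})}` at a given configuration. The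
configuration is indexed by `ℤ`, so this is the `L`-periodic function on `ℝ`. -/
def particleDensity (c : ℝ) (N : ℕ) (x : ℤ → ℝ) (y : ℝ) : ℝ :=
  ∑' k : ℤ, (Ico (x k) (x (k + 1))).indicator (fun _ => cellDensity c N x k) y

/-- `x` is the particle system with `N` particles on the torus of length `L`, well defined on
`[0, T]`. The particles are lifted to `ℝ` and indexed by `ℤ`, with `x_{k+N} = x_k + L`; thus the
indices in `(k, k + N)` run once through the particles other than the `k`-th one. `F` is the torus
force. As `F` may be set-valued at isolated displacements, the system of ODEs is imposed for almost
every time on Lipschitz curves. -/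
structure IsParticleSystem (φ ρ₀ : ℝ → ℝ) (F : ℝ → ℝ → Set ℝ) (T L : ℝ) (N : ℕ)
    (x : ℤ → ℝ → ℝ) : Prop where
  lift : ∀ k t, x (k + N) t = x k t + L
  initial : ∀ k : ℕ, k < N → x k 0 = initialPosition ρ₀ L N k
  ordered : ∀ t ∈ Icc 0 T, ∀ k, x k t < x (k + 1) t
  lipschitz : ∀ k, ∃ C, LipschitzOnWith C (x k) (Icc 0 T)
  ode : ∀ k, ∀ᵐ t ∂(volume.restrict (Icc 0 T)), ∃ g : ℤ → ℝ,
    (∀ j ∈ Finset.Ioo k (k + (N : ℤ)), g j ∈ F L (x k t - x j t)) ∧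
    HasDerivAt (x k)
      (-(cutMass ρ₀ L / N) * ∑ j ∈ Finset.Ioo k (k + (N : ℤ)), g j
        - (N / cutMass ρ₀ L) *
          (φ (cellDensity (cutMass ρ₀ L) N (fun i => x i t) k)
            - φ (cellDensity (cutMass ρ₀ L) N (fun i => x i t) (k - 1)))) t

/-- `r` (considered on `[0, T] × [-L/2, L/2)`) is an `L¹` limit, along a subsequence `N → ∞`, of the
particle densities on the torus of length `L`, which are well defined on `[0, T]` for all large
`N`. -/
def IsTorusLimit (φ ρ₀ : ℝ → ℝ) (F : ℝ → ℝ → Set ℝ) (T L : ℝ) (r : ℝ → ℝ → ℝ) : Prop :=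
  IntegrableOn (fun p : ℝ × ℝ => r p.1 p.2) (Icc 0 T ×ˢ Ico (-(L / 2)) (L / 2)) ∧
  ∃ x : ℕ → ℤ → ℝ → ℝ,
    (∃ N₀ : ℕ, 0 < N₀ ∧ ∀ N, N₀ ≤ N → IsParticleSystem φ ρ₀ F T L N (x N)) ∧
    ∃ s : ℕ → ℕ, StrictMono s ∧
      Tendsto (fun n => ∫⁻ p in Icc 0 T ×ˢ Ico (-(L / 2)) (L / 2),
        ‖particleDensity (cutMass ρ₀ L) (s n) (fun k => x (s n) k p.1) p.2 - r p.1 p.2‖ₑ)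
        atTop (𝓝 0)

/-- `ρ` is a bounded, nonnegative, integrable weak solution on `[0, T] × ℝ` of
`∂ₜ ρ = ∂ₓ (ρ ∂ₓ (K * ρ) + ∂ₓ φ(ρ))` with initial datum `ρ₀`. The test functions are the smooth
functions with compact support in `[0, T) × ℝ`. -/
structure IsBoundedWeakSolution (K φ ρ₀ : ℝ → ℝ) (T : ℝ) (ρ : ℝ → ℝ → ℝ) : Prop where
  measurable : Measurable (fun p : ℝ × ℝ => ρ p.1 p.2)
  nonneg : ∀ t x, 0 ≤ ρ t x
  bounded : ∃ M, ∀ t x, ρ t x ≤ M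
  integrable : IntegrableOn (fun p : ℝ × ℝ => ρ p.1 p.2) (Icc 0 T ×ˢ univ)
  weak : ∀ ψ : ℝ → ℝ → ℝ, ContDiff ℝ ∞ (fun p : ℝ × ℝ => ψ p.1 p.2) →
    HasCompactSupport (fun p : ℝ × ℝ => ψ p.1 p.2) →
    tsupport (fun p : ℝ × ℝ => ψ p.1 p.2) ⊆ Iio T ×ˢ univ →
    (∫ p in Icc 0 T ×ˢ univ,
        (ρ p.1 p.2 * deriv (fun t => ψ t p.2) p.1
          - ρ p.1 p.2 * (∫ y, deriv K (p.2 - y) * ρ p.1 y) * deriv (ψ p.1) p.2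
          + φ (ρ p.1 p.2) * deriv (deriv (ψ p.1)) p.2))
      + ∫ x, ρ₀ x * ψ 0 x = 0

end

/-! The proof rests on particle estimates that are uniform in `N` and in `L`, once `L` is bounded
below and `N` is large compared with `L`. Write m = c/N for the mass of a particle, d_k for the
gaps, ρ_k = m/d_k and Δ_k = φ(ρ_k) - φ(ρ_{k-1}).

Energy. The derivative of d ↦ d W(m/d) is -φ(m/d), so summation by parts gives the energy E = Σ d_k
W(ρ_k) the derivative Σ ẋ_k Δ_k. The diffusive velocity -Δ_k/m contributes -Σ Δ_k²/m, and Young's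
inequality absorbs the bounded interaction velocity (`sum_neg_mul_sub_le`). Hence Σ Δ_k²/m is
bounded in L¹(0,T) (`ParticleFlow.integral_cellDissipation_le`), and so is the total variation Σ
|Δ_k| of φ(ρ) (`cellVariation_le`).

Density bound. At a smallest gap δ the pressure pushes the particles apart. The interaction closes
the gap at rate at most 6Bm + cΛδ, because the force is Lipschitz except across the displacements 0
and L/2, which concern a bounded number of particles (`IsForceSum.le_sub`). Thus (-log δ)' ≤ 6B max
ρ + cΛ. As φ grows at least linearly, max ρ is controlled by the variation of φ(ρ), which is
integrable in time, and integration bounds the density (`ParticleFlow.cellDensity_le`).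

Compactness. The variation of φ(ρ) controls translations in space, the total displacement of the
particles makes the integrals of ρ against Lipschitz functions equicontinuous in time, and the first
moment gives tightness. Strict monotonicity of φ transfers control from φ(ρ) to ρ. Mollifying in
space and extracting a subsequence that converges at rational points yields L¹ convergence
(`IsCompactSequence.exists_limit`).

Equation. Differentiating Σ m ψ(t, x_k(t)) gives the weak formulation for the piecewise constant
density up to an explicit error that vanishes with cL/N, with the mass far out and with the local L¹
distance of the torus force from K' (`ParticleFlow.abs_sum_add_integral_weakIntegrand_le`). On
uniformly bounded densities the weak formulation is Lipschitz in L¹, so it passes to the limit. Each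
torus limit is replaced by a nearby particle density with `N` large depending on `L`; the estimates
then apply to this diagonal sequence.

Existence of the particles. The force is averaged over short intervals and the pressure is frozen
below a gap δ. Since W(r)/r tends to infinity, δ can be chosen so small that a gap δ would cost more
energy than is available (`lt_gap_of_truncated`). The regularized curves are equi-Lipschitz; their
limit has an admissible velocity because the force at displacement L/2 takes every intermediate
value (`exists_particleFlow`). -/

section AbsolutelyContinuous

/-! ### Integrating almost everywhere derivative bounds along Lipschitz curves. -/

/-- One-sided fundamental theorem of calculus for Lipschitz functions. -/
theorem sub_le_integral_of_lipschitzOnWith {g h : ℝ → ℝ} {a b : ℝ} {C : NNReal} (hab : a ≤ b)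
    (hg : LipschitzOnWith C g (Icc a b)) (hh : IntervalIntegrable h volume a b)
    (hd : ∀ᵐ t ∂(volume.restrict (Icc a b)), ∃ g', HasDerivAt g g' t ∧ g' ≤ h t) :
    g b - g a ≤ ∫ t in a..b, h t := by
  have hac : AbsolutelyContinuousOnInterval g a b :=
    LipschitzOnWith.absolutelyContinuousOnInterval (K := C) (by rwa [uIcc_of_le hab])
  rw [← hac.integral_deriv_eq_sub]
  refine intervalIntegral.integral_mono_ae_restrict hab hac.intervalIntegrable_deriv hh ?_
  filter_upwards [hd] with t ⟨g', h1, h2⟩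
  rw [h1.deriv]; exact h2

theorem abs_sub_le_integral_of_lipschitzOnWith {g h : ℝ → ℝ} {a b : ℝ} {C : NNReal} (hab : a ≤ b)
    (hg : LipschitzOnWith C g (Icc a b)) (hh : IntervalIntegrable h volume a b)
    (hd : ∀ᵐ t ∂(volume.restrict (Icc a b)), ∃ g', HasDerivAt g g' t ∧ |g'| ≤ h t) :
    |g b - g a| ≤ ∫ t in a..b, h t := by
  rw [abs_le']
  refine ⟨sub_le_integral_of_lipschitzOnWith hab hg hh ?_, ?_⟩
  · filter_upwards [hd] with t ⟨g', h1, h2⟩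
    exact ⟨g', h1, (le_abs_self _).trans h2⟩
  · have := sub_le_integral_of_lipschitzOnWith (g := fun t => - g t) hab hg.neg hh ?_
    · linarith
    · filter_upwards [hd] with t ⟨g', h1, h2⟩
      exact ⟨-g', h1.neg, (neg_le_abs _).trans h2⟩

/-- Turns a consistency error `e` that holds at almost every time into an error for the
time-integrated weak formulation. -/
theorem abs_sub_sub_integral_le_of_lipschitzOnWith {g h : ℝ → ℝ} {a b e : ℝ} {C : NNReal}
    (hab : a ≤ b) (hg : LipschitzOnWith C g (Icc a b)) (hh : IntervalIntegrable h volume a b)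
    (hd : ∀ᵐ t ∂(volume.restrict (Icc a b)), ∃ g', HasDerivAt g g' t ∧ |g' - h t| ≤ e) :
    |g b - g a - ∫ t in a..b, h t| ≤ e * (b - a) := by
  have he : IntervalIntegrable (fun _ : ℝ => e) volume a b := intervalIntegrable_const
  have h1 := sub_le_integral_of_lipschitzOnWith hab hg (hh.add he) (by
    filter_upwards [hd] with t ⟨g', h1, h2⟩
    exact ⟨g', h1, by linarith [(abs_le.1 h2).2]⟩)
  have h2 := sub_le_integral_of_lipschitzOnWith (g := fun t => - g t) hab hg.neg (he.sub hh) (by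
    filter_upwards [hd] with t ⟨g', h1, h2⟩
    exact ⟨-g', h1.neg, by linarith [(abs_le.1 h2).1]⟩)
  rw [intervalIntegral.integral_add hh he] at h1
  rw [intervalIntegral.integral_sub he hh] at h2
  simp only [intervalIntegral.integral_const, smul_eq_mul] at h1 h2
  rw [abs_le]
  constructor <;> nlinarith

end AbsolutelyContinuous

/-! ### Pointwise properties of the kernel derivative. -/

namespace AdmissibleKernel

variable {K : ℝ → ℝ}

theorem comp_neg (hK : AdmissibleKernel K) (z : ℝ) : K (-z) = K z := by
  rw [hK.even (-z), hK.even z, abs_neg]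

/-- Holds at every point: where `K` is not differentiable at `z`, it is not at `-z` either, and both
sides take the default value 0. -/
theorem deriv_neg (hK : AdmissibleKernel K) (z : ℝ) : deriv K (-z) = -deriv K z := by
  have h := deriv_comp_neg K z
  rw [show (fun x => K (-x)) = K from funext hK.comp_neg] at h
  linarith

theorem deriv_zero (hK : AdmissibleKernel K) : deriv K 0 = 0 := by
  have := hK.deriv_neg 0
  rw [neg_zero] at this
  linarith

theorem exists_deriv_le (hK : AdmissibleKernel K) : ∃ B, 0 ≤ B ∧ ∀ z, |deriv K z| ≤ B := by
  obtain ⟨M, hM⟩ := hK.deriv_bounded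
  refine ⟨max M 0, le_max_right _ _, fun z => ?_⟩
  by_cases hz : z = 0
  · rw [hz, hK.deriv_zero, abs_zero]; exact le_max_right _ _
  · exact (hM z hz).trans (le_max_left _ _)

/-- The half-lines are kept apart because `K'` may jump at the origin. On the positive one this is
the mean value inequality with the bound on `K''`; oddness gives the negative one. -/
theorem exists_lipschitz (hK : AdmissibleKernel K) : ∃ Λ, 0 ≤ Λ ∧
    (∀ z w, 0 < z → 0 < w → |deriv K z - deriv K w| ≤ Λ * |z - w|) ∧
    (∀ z w, z < 0 → w < 0 → |deriv K z - deriv K w| ≤ Λ * |z - w|) := by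
  obtain ⟨M, hM⟩ := hK.deriv2_bounded
  have hdiff : ∀ z, z ≠ 0 → DifferentiableAt ℝ (deriv K) z := by
    intro z hz
    have h1 : ContDiffOn ℝ 1 (deriv K) {0}ᶜ :=
      hK.contDiffOn.deriv_of_isOpen isOpen_compl_singleton (by norm_num)
    exact (h1.contDiffAt (isOpen_compl_singleton.mem_nhds hz)).differentiableAt (by norm_num)
  have hpos : ∀ z w, 0 < z → 0 < w → |deriv K z - deriv K w| ≤ (max M 0) * |z - w| := by
    intro z w hz hw
    have := (convex_Ioi (0 : ℝ)).norm_image_sub_le_of_norm_deriv_le (f := deriv K) (C := max M 0)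
      (fun x hx => hdiff x (ne_of_gt hx))
      (fun x hx => (hM x (ne_of_gt hx)).trans (le_max_left _ _)) (x := w) (y := z) hw hz
    simpa [Real.norm_eq_abs] using this
  refine ⟨max M 0, le_max_right _ _, hpos, fun z w hz hw => ?_⟩
  have := hpos (-z) (-w) (by linarith) (by linarith)
  rw [hK.deriv_neg, hK.deriv_neg] at this
  rw [← abs_neg, ← abs_neg (z - w)]
  convert this using 2 <;> ring_nf

end AdmissibleKernel

/-! ### A common description of the two torus forces. -/

/-- A force `f` on the torus of length `L`, bounded by `B`, Lipschitz with constant `Λ` away from the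
displacements `0` and `L / 2`, with a symmetric jump of height at most `κ` at `L / 2`, where the
set-valued force `S` takes every intermediate value. -/
structure TorusForce (S : ℝ → Set ℝ) (f : ℝ → ℝ) (L B Λ κ : ℝ) : Prop where
  periodic : Function.Periodic f L
  measurable : Measurable f
  bound_nonneg : 0 ≤ B
  lip_nonneg : 0 ≤ Λ
  jump_nonneg : 0 ≤ κ
  jump_le : κ ≤ B
  bound : ∀ z, |f z| ≤ B
  lip_left : ∀ z ∈ Ioo (-L) (-(L / 2)), ∀ w ∈ Ioo (-L) (-(L / 2)), |f z - f w| ≤ Λ * |z - w|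
  lip_right : ∀ z ∈ Ioo (-(L / 2)) 0, ∀ w ∈ Ioo (-(L / 2)) 0, |f z - f w| ≤ Λ * |z - w|
  eq_singleton : ∀ z ∈ Ioo (-L) 0, z ≠ -(L / 2) → S z = {f z}
  eq_mid : S (-(L / 2)) = {p | |p| ≤ κ}
  near_mid : ∀ z ∈ Ioo (-L) 0, z ≠ -(L / 2) → |f z| ≤ κ + Λ * |z + L / 2|

noncomputable section

/-- The single-valued nearest image force. -/
def nearestImage (K : ℝ → ℝ) (L z : ℝ) : ℝ := deriv K (z - L * round (z / L))

/-- The single-valued periodized force, set to `0` on `Lℤ`. -/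
def periodization (K : ℝ → ℝ) (L z : ℝ) : ℝ :=
  {z | ∃ n : ℤ, z + n * L = 0}ᶜ.indicator (fun z => ∑' n : ℤ, deriv K (z + n * L)) z

end

theorem nearestImage_eq {K : ℝ → ℝ} {L z : ℝ} (n : ℤ) (hz : |z + n * L| < L / 2) :
    nearestImage K L z = deriv K (z + n * L) := by
  have hL : 0 < L := by have := abs_nonneg (z + n * L); linarith
  have : round (z / L) = -n := by
    rw [round_eq, Int.floor_eq_iff]
    obtain ⟨h1, h2⟩ := abs_lt.1 hz
    push_cast
    constructor
    · have : -(n : ℝ) - 1 / 2 ≤ z / L := by rw [le_div_iff₀ hL]; nlinarith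
      linarith
    · have : z / L < -(n : ℝ) + 1 / 2 := by rw [div_lt_iff₀ hL]; nlinarith
      linarith
  rw [nearestImage, this]
  congr 1
  push_cast; ring

/-- The representative of least modulus is `z + L > 0` on `(-L, -L/2)` and `z < 0` on `(-L/2, 0)`.
Each half therefore sees only one side of the singularity of `K'`, and the jump between them has
half-height `|K'(L/2)|`. -/
theorem torusForce_nearestImage {K : ℝ → ℝ} (hK : AdmissibleKernel K) {B Λ L : ℝ} (hL : 0 < L)
    (hB0 : 0 ≤ B) (hB : ∀ z, |deriv K z| ≤ B) (hΛ0 : 0 ≤ Λ)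
    (hΛ : ∀ z w, 0 < z → 0 < w → |deriv K z - deriv K w| ≤ Λ * |z - w|)
    (hΛ' : ∀ z w, z < 0 → w < 0 → |deriv K z - deriv K w| ≤ Λ * |z - w|) :
    TorusForce (nearestImageForce K L) (nearestImage K L) L B Λ |deriv K (L / 2)| := by
  have hr : ∀ z ∈ Ioo (-(L / 2)) 0, nearestImage K L z = deriv K z := by
    intro z hz
    have := nearestImage_eq (K := K) (L := L) (z := z) 0
      (by rw [abs_lt]; constructor <;> push_cast <;> linarith [hz.1, hz.2])
    simpa using this
  have hl : ∀ z ∈ Ioo (-L) (-(L / 2)), nearestImage K L z = deriv K (z + L) := by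
    intro z hz
    have := nearestImage_eq (K := K) (L := L) (z := z) 1
      (by rw [abs_lt]; constructor <;> push_cast <;> linarith [hz.1, hz.2])
    simpa using this
  refine ⟨?_, ?_, hB0, hΛ0, abs_nonneg _, hB _, fun z => hB _, ?_, ?_, ?_, ?_, ?_⟩
  · intro z
    simp only [nearestImage]
    rw [add_div, div_self hL.ne', round_add_one]
    congr 1; push_cast; ring
  · have : Measurable fun z : ℝ => round (z / L) := by
      simp only [round_eq]
      exact Int.measurable_floor.comp (by fun_prop)
    have h2 : Measurable fun z : ℝ => z - L * (round (z / L) : ℝ) :=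
      measurable_id.sub (measurable_const.mul (measurable_from_top.comp this))
    exact (measurable_deriv K).comp h2
  · intro z hz w hw
    rw [hl z hz, hl w hw]
    convert hΛ (z + L) (w + L) (by linarith [hz.1]) (by linarith [hw.1]) using 3
    ring
  · intro z hz w hw
    rw [hr z hz, hr w hw]
    exact hΛ' z w hz.2 hw.2
  · intro z hz hz2
    ext p
    simp only [nearestImageForce, mem_union, mem_ofPred_eq, mem_singleton_iff]
    constructor
    · rintro (⟨n, h1, rfl⟩ | ⟨n, h1, -⟩)
      · exact (nearestImage_eq n h1).symm
      · exfalso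
        -- From `z + n * L = L / 2` and `-L < z < 0` only `n = 1` remains, and this is the excluded
        -- midpoint.
        have h3 : (n : ℝ) * L < 2 * L := by linarith [hz.1]
        have h4 : (0 : ℝ) * L < n * L := by linarith [hz.2]
        have h5 := lt_of_mul_lt_mul_right h3 hL.le
        have h6 := lt_of_mul_lt_mul_right h4 hL.le
        have : n = 1 := by
          have h7 : n < 2 := by exact_mod_cast h5
          have h8 : 0 < n := by exact_mod_cast h6
          omega
        subst this
        apply hz2; push_cast at h1; linarith
    · rintro rfl
      left
      rcases lt_or_gt_of_ne hz2 with h | h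
      · refine ⟨1, ?_, ?_⟩
        · rw [abs_lt]; constructor <;> push_cast <;> linarith [hz.1]
        · rw [hl z ⟨hz.1, h⟩]; simp
      · refine ⟨0, ?_, ?_⟩
        · rw [abs_lt]; constructor <;> push_cast <;> linarith [hz.2]
        · rw [hr z ⟨h, hz.2⟩]; simp
  · ext p
    simp only [nearestImageForce, mem_union, mem_ofPred_eq]
    constructor
    · rintro (⟨n, h1, -⟩ | ⟨n, h1, h2⟩)
      · exfalso
        obtain ⟨h1, h2⟩ := abs_lt.1 h1
        have h3 : (n : ℝ) * L < 1 * L := by linarith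
        have h4 : (0 : ℝ) * L < n * L := by linarith
        have h5 := lt_of_mul_lt_mul_right h3 hL.le
        have h6 := lt_of_mul_lt_mul_right h4 hL.le
        have h7 : n < 1 := by exact_mod_cast h5
        have h8 : 0 < n := by exact_mod_cast h6
        omega
      · exact h2
    · intro h
      exact Or.inr ⟨1, by push_cast; ring, h⟩
  · intro z hz hz2
    have key : |deriv K (-(L / 2))| = |deriv K (L / 2)| := by rw [hK.deriv_neg, abs_neg]
    rcases lt_or_gt_of_ne hz2 with h | h
    · rw [hl z ⟨hz.1, h⟩]
      have h1 := hΛ (z + L) (L / 2) (by linarith [hz.1]) (by linarith)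
      have h2 := abs_sub_abs_le_abs_sub (deriv K (z + L)) (deriv K (L / 2))
      rw [show z + L - L / 2 = z + L / 2 by ring] at h1
      linarith
    · rw [hr z ⟨h, hz.2⟩]
      have h1 := hΛ' z (-(L / 2)) hz.2 (by linarith)
      have h2 := abs_sub_abs_le_abs_sub (deriv K z) (deriv K (-(L / 2)))
      rw [show z - -(L / 2) = z + L / 2 by ring] at h1
      linarith

/-! ### The periodized force. -/

theorem periodization_of_exists (K : ℝ → ℝ) {L z : ℝ} (hz : ∃ n : ℤ, z + n * L = 0) :
    periodization K L z = 0 :=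
  indicator_of_notMem (s := {z : ℝ | ∃ n : ℤ, z + n * L = 0}ᶜ) (fun h => h hz) _

theorem periodization_of_not_exists (K : ℝ → ℝ) {L z : ℝ} (hz : ¬ ∃ n : ℤ, z + n * L = 0) :
    periodization K L z = ∑' n : ℤ, deriv K (z + n * L) :=
  indicator_of_mem (s := {z : ℝ | ∃ n : ℤ, z + n * L = 0}ᶜ) hz _

theorem periodization_periodic (K : ℝ → ℝ) (L : ℝ) : Function.Periodic (periodization K L) L := by
  intro z
  have h : ∀ n : ℤ, z + L + n * L = z + ((n + 1 : ℤ) : ℝ) * L := by intro n; push_cast; ring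
  have h1 : (∃ n : ℤ, z + L + n * L = 0) ↔ ∃ n : ℤ, z + n * L = 0 := by
    simp only [h]
    constructor
    · rintro ⟨n, hn⟩; exact ⟨n + 1, hn⟩
    · rintro ⟨n, hn⟩; exact ⟨n - 1, by simpa using hn⟩
  by_cases hz : ∃ n : ℤ, z + n * L = 0
  · rw [periodization_of_exists K hz, periodization_of_exists K (h1.2 hz)]
  · rw [periodization_of_not_exists K hz, periodization_of_not_exists K (mt h1.1 hz)]
    simp only [h]
    exact (Equiv.addRight (1 : ℤ)).tsum_eq (fun n : ℤ => deriv K (z + n * L))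

theorem periodization_neg {K : ℝ → ℝ} (hK : AdmissibleKernel K) (L z : ℝ) :
    periodization K L (-z) = -periodization K L z := by
  have h1 : (∃ n : ℤ, -z + n * L = 0) ↔ ∃ n : ℤ, z + n * L = 0 := by
    constructor
    · rintro ⟨n, hn⟩; exact ⟨-n, by push_cast; linarith⟩
    · rintro ⟨n, hn⟩; exact ⟨-n, by push_cast; linarith⟩
  have h2 : ∑' n : ℤ, deriv K (-z + n * L) = -∑' n : ℤ, deriv K (z + n * L) := by
    rw [← (Equiv.neg ℤ).tsum_eq (fun n : ℤ => deriv K (-z + n * L)), ← tsum_neg]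
    congr 1; ext n
    rw [← hK.deriv_neg]
    congr 1
    simp only [Equiv.neg_apply]; push_cast; ring
  by_cases hz : ∃ n : ℤ, z + n * L = 0
  · rw [periodization_of_exists K hz, periodization_of_exists K (h1.2 hz), neg_zero]
  · rw [periodization_of_not_exists K hz, periodization_of_not_exists K (mt h1.1 hz), h2]

/-- Points off `Lℤ` can be translated into `(0, L)`. -/
theorem exists_translate_mem_Ioo {L z : ℝ} (hL : 0 < L) (hz : ¬ ∃ n : ℤ, z + n * L = 0) :
    ∃ n : ℤ, z + n * L ∈ Ioo 0 L := by
  refine ⟨-⌊z / L⌋, ?_⟩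
  have h1 := Int.floor_le (z / L)
  have h2 := Int.lt_floor_add_one (z / L)
  rw [le_div_iff₀ hL] at h1
  rw [div_lt_iff₀ hL] at h2
  push_cast
  refine ⟨lt_of_le_of_ne (by linarith) fun h => hz ⟨-⌊z / L⌋, ?_⟩, by linarith⟩
  push_cast; linarith

theorem not_exists_translate {L z : ℝ} (hz : z ∈ Ioo 0 L) : ¬ ∃ n : ℤ, z + n * L = 0 := by
  rintro ⟨n, hn⟩
  have hL : 0 < L := hz.1.trans hz.2
  have h3 : (n : ℝ) * L < 0 * L := by linarith [hz.1]
  have h4 : (-1 : ℝ) * L < n * L := by linarith [hz.2]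
  have h5 := lt_of_mul_lt_mul_right h3 hL.le
  have h6 := lt_of_mul_lt_mul_right h4 hL.le
  have h7 : n < 0 := by exact_mod_cast h5
  have h8 : -1 < n := by exact_mod_cast h6
  omega

theorem summable_translate {K : ℝ → ℝ} {L z : ℝ} (m : ℤ)
    (h : Summable fun n : ℤ => |deriv K (z + m * L + n * L)|) :
    Summable fun n : ℤ => |deriv K (z + n * L)| := by
  rw [← (Equiv.addRight m).summable_iff]
  convert h using 1
  ext n
  simp only [Function.comp, Equiv.coe_addRight]
  congr 2; push_cast; ring

/-- A pointwise limit of symmetric partial sums. Summability is available only off `Lℤ`, and the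
indicator removes the other points. -/
theorem measurable_periodization {K : ℝ → ℝ} {L : ℝ}
    (hs : ∀ z, (¬ ∃ n : ℤ, z + n * L = 0) → Summable fun n : ℤ => |deriv K (z + n * L)|) :
    Measurable (periodization K L) := by
  have hm : MeasurableSet {z : ℝ | ∃ n : ℤ, z + n * L = 0} := by
    rw [ofPred_exists]
    exact MeasurableSet.iUnion fun n => measurableSet_eq_fun (by fun_prop) (by fun_prop)
  refine measurable_of_tendsto_metrizable (f := fun (m : ℕ) => {z | ∃ n : ℤ, z + n * L = 0}ᶜ.indicator
    (fun z => ∑ n ∈ Finset.Icc (-(m : ℤ)) m, deriv K (z + n * L))) (fun m => ?_) ?_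
  · refine Measurable.indicator ?_ hm.compl
    exact Finset.measurable_sum _ fun n _ => (measurable_deriv K).comp (by fun_prop)
  · rw [tendsto_pi_nhds]
    intro z
    by_cases hz : ∃ n : ℤ, z + n * L = 0
    · have : z ∉ {z | ∃ n : ℤ, z + n * L = 0}ᶜ := fun h => h hz
      simp only [periodization, indicator_of_notMem this]
      exact tendsto_const_nhds
    · have : z ∈ {z | ∃ n : ℤ, z + n * L = 0}ᶜ := hz
      simp only [periodization, indicator_of_mem this]
      have h1 : Tendsto (fun m : ℕ => Finset.Icc (-(m : ℤ)) m) atTop atTop :=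
        tendsto_atTop_finset_of_monotone
          (fun a b hab => Finset.Icc_subset_Icc (by omega) (by omega))
          (fun x => ⟨x.natAbs, by simp only [Finset.mem_Icc]; omega⟩)
      exact ((hs z hz).of_abs.hasSum).comp h1

/-- The interval `(-L, 0)` is a translate of `(0, L)`, where the sum is Lipschitz throughout; no
jump occurs at the midpoint, hence `κ = 0`. -/
theorem torusForce_periodization {K : ℝ → ℝ} (hK : AdmissibleKernel K) {L M : ℝ} (hL : 0 < L)
    (h : ∀ z ∈ Ioo 0 L, Summable (fun n : ℤ => |deriv K (z + n * L)|) ∧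
      ∑' n : ℤ, |deriv K (z + n * L)| ≤ M ∧
      ∀ w ∈ Ioo 0 L,
        |∑' n : ℤ, deriv K (z + n * L) - ∑' n : ℤ, deriv K (w + n * L)| ≤ M * |z - w|) :
    TorusForce (periodizedForce K L) (periodization K L) L M M 0 := by
  have hM : 0 ≤ M :=
    (tsum_nonneg fun n => abs_nonneg _).trans (h (L / 2) ⟨by linarith, by linarith⟩).2.1
  have hs : ∀ z, (¬ ∃ n : ℤ, z + n * L = 0) → Summable fun n : ℤ => |deriv K (z + n * L)| := by
    intro z hz
    obtain ⟨m, hm⟩ := exists_translate_mem_Ioo hL hz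
    exact summable_translate m (h _ hm).1
  have hval : ∀ z ∈ Ioo 0 L, periodization K L z = ∑' n : ℤ, deriv K (z + n * L) := by
    intro z hz
    have : z ∈ {z | ∃ n : ℤ, z + n * L = 0}ᶜ := not_exists_translate hz
    simp only [periodization, indicator_of_mem this]
  have hper := periodization_periodic K L
  have hbd : ∀ z, |periodization K L z| ≤ M := by
    intro z
    by_cases hz : ∃ n : ℤ, z + n * L = 0
    · have : z ∉ {z | ∃ n : ℤ, z + n * L = 0}ᶜ := fun h => h hz
      simp only [periodization, indicator_of_notMem this, abs_zero, hM]
    · obtain ⟨m, hm⟩ := exists_translate_mem_Ioo hL hz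
      rw [← hper.int_mul m z, hval _ hm]
      have h1 := (h _ hm).1
      have h2 : |∑' n : ℤ, deriv K (z + m * L + n * L)| ≤
          ∑' n : ℤ, |deriv K (z + m * L + n * L)| := by
        have h3 := norm_tsum_le_tsum_norm (f := fun n : ℤ => deriv K (z + m * L + n * L))
          (by simpa only [Real.norm_eq_abs] using h1)
        simpa only [Real.norm_eq_abs] using h3
      exact h2.trans (h _ hm).2.1
  have hlip : ∀ z ∈ Ioo (-L) 0, ∀ w ∈ Ioo (-L) 0,
      |periodization K L z - periodization K L w| ≤ M * |z - w| := by
    intro z hz w hw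
    have hz' : z + L ∈ Ioo 0 L := ⟨by linarith [hz.1], by linarith [hz.2]⟩
    have hw' : w + L ∈ Ioo 0 L := ⟨by linarith [hw.1], by linarith [hw.2]⟩
    rw [← hper z, ← hper w, hval _ hz', hval _ hw']
    convert (h _ hz').2.2 _ hw' using 3
    ring
  have hsing : ∀ z ∈ Ioo (-L) 0, periodizedForce K L z = {periodization K L z} := by
    intro z hz
    have : z ∈ {z | ∃ n : ℤ, z + n * L = 0}ᶜ := by
      rintro ⟨n, hn⟩
      exact not_exists_translate (z := z + L) (L := L) ⟨by linarith [hz.1], by linarith [hz.2]⟩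
        ⟨n - 1, by push_cast; linarith⟩
    simp only [periodizedForce, periodization, indicator_of_mem this]
  -- The function is odd and `L`-periodic, so its values at `L / 2` and `-(L / 2)` are both opposite
  -- and equal.
  have hmid : periodization K L (-(L / 2)) = 0 := by
    have h1 := periodization_neg hK L (L / 2)
    have h2 := hper (-(L / 2))
    rw [show -(L / 2) + L = L / 2 by ring] at h2
    linarith
  have hmem : -(L / 2) ∈ Ioo (-L) 0 := ⟨by linarith, by linarith⟩
  refine ⟨hper, measurable_periodization hs, hM, hM, le_rfl, hM, hbd, ?_, ?_, ?_, ?_, ?_⟩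
  · intro z hz w hw
    exact hlip z ⟨hz.1, by linarith [hz.2]⟩ w ⟨hw.1, by linarith [hw.2]⟩
  · intro z hz w hw
    exact hlip z ⟨by linarith [hz.1], hz.2⟩ w ⟨by linarith [hw.1], hw.2⟩
  · intro z hz _
    exact hsing z hz
  · rw [hsing _ hmem, hmid]
    ext p
    simp
  · intro z hz _
    have := hlip z hz _ hmem
    rw [hmid, sub_zero, sub_neg_eq_add] at this
    linarith

/-- A bounded periodization is also available, with worse constants, for small periods. -/
theorem HasBoundedPeriodization.exists_of_pos {K : ℝ → ℝ} (h : HasBoundedPeriodization K) {L : ℝ}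
    (hL : 0 < L) : ∃ M, ∀ z ∈ Ioo 0 L, Summable (fun n : ℤ => |deriv K (z + n * L)|) ∧
      ∑' n : ℤ, |deriv K (z + n * L)| ≤ M ∧
      ∀ w ∈ Ioo 0 L,
        |∑' n : ℤ, deriv K (z + n * L) - ∑' n : ℤ, deriv K (w + n * L)| ≤ M * |z - w| := by
  obtain ⟨M, hM⟩ := h
  -- Sorting the translates by their residue modulo `m` writes the `L`-periodization as a sum of `m`
  -- periodizations with the long period `m * L ≥ 1`.
  obtain ⟨m, hm⟩ := exists_nat_ge (1 / L)
  have hm1 : 1 ≤ m * L := by rwa [div_le_iff₀ hL] at hm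
  have hm0 : 0 < m := by
    rcases Nat.eq_zero_or_pos m with h | h
    · rw [h] at hm1; norm_num at hm1
    · exact h
  have hmem : ∀ z ∈ Ioo 0 L, ∀ r ∈ Finset.range m, z + r * L ∈ Ioo 0 (m * L) := by
    intro z hz r hr
    have h1 : (r : ℝ) + 1 ≤ m := by exact_mod_cast Finset.mem_range.1 hr
    have h2 : (0 : ℝ) ≤ r := by positivity
    constructor
    · nlinarith [hz.1]
    · nlinarith [hz.2]
  have hsum : ∀ F : ℝ → ℝ, ∀ z, (∀ r ∈ Finset.range m, Summable fun n : ℤ => F (z + r * L + n * (m * L))) →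
      HasSum (fun n : ℤ => F (z + n * L))
        (∑ r ∈ Finset.range m, ∑' n : ℤ, F (z + r * L + n * (m * L))) := by
    intro F z hF
    have h1 : ∀ r ∈ Finset.range m, HasSum
        (fun n : ℤ => if n % m = r then F (z + n * L) else 0)
        (∑' n : ℤ, F (z + r * L + n * (m * L))) := by
      intro r hr
      have hr' := Finset.mem_range.1 hr
      have hinj : Function.Injective fun n : ℤ => n * m + r := by
        intro a b hab
        have : a * m = b * m := by simpa using hab
        exact mul_right_cancel₀ (by exact_mod_cast hm0.ne') this
      rw [← hinj.hasSum_iff]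
      · convert (hF r hr).hasSum using 1
        ext n
        have : (n * m + r) % (m : ℤ) = r := by
          rw [add_comm, Int.add_mul_emod_self_right]
          exact Int.emod_eq_of_lt (by omega) (by omega)
        simp only [Function.comp, this, if_true]
        congr 1; push_cast; ring
      · intro n hn
        rw [if_neg]
        intro h
        apply hn
        refine ⟨n / m, ?_⟩
        have := Int.mul_ediv_add_emod n m
        simp only
        rw [← h]; linarith
    have h2 := hasSum_sum h1
    convert h2 using 1
    ext n
    have hn1 := Int.emod_nonneg n (show (m : ℤ) ≠ 0 by omega)
    have hn2 := Int.emod_lt_of_pos n (show (0 : ℤ) < m by omega)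
    rw [Finset.sum_eq_single (n % m).toNat]
    · rw [if_pos (by omega)]
    · intro r _ hr
      rw [if_neg (by omega)]
    · intro h
      exfalso; apply h; rw [Finset.mem_range]; omega
  refine ⟨m * M, fun z hz => ?_⟩
  have hz1 := fun r hr => hM (m * L) hm1 _ (hmem z hz r hr)
  have ha := hsum (fun x => |deriv K x|) z (fun r hr => (hz1 r hr).1)
  have hb := hsum (deriv K) z (fun r hr => (hz1 r hr).1.of_abs)
  refine ⟨ha.summable, ?_, fun w hw => ?_⟩
  · rw [ha.tsum_eq]
    refine (Finset.sum_le_sum fun r hr => (hz1 r hr).2.1).trans ?_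
    simp
  · have hw1 := fun r hr => hM (m * L) hm1 _ (hmem w hw r hr)
    have hc := hsum (deriv K) w (fun r hr => (hw1 r hr).1.of_abs)
    rw [hb.tsum_eq, hc.tsum_eq, ← Finset.sum_sub_distrib]
    refine (Finset.abs_sum_le_sum_abs _ _).trans ?_
    refine (Finset.sum_le_sum fun r hr => (hz1 r hr).2.2 _ (hmem w hw r hr)).trans ?_
    simp [mul_assoc]

/-- The periodized force converges to `K'` locally in `L¹` as the period grows. -/
theorem lintegral_periodization_sub_le {K : ℝ → ℝ} {L : ℝ} (hL : 0 < L)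
    (hs : ∀ z ∈ Ioo 0 L, Summable fun n : ℤ => |deriv K (z + n * L)|) :
    ∫⁻ z in Ioc (-(L / 2)) (L / 2), ‖periodization K L z - deriv K z‖ₑ ≤
      ∫⁻ z in (Ioc (-(L / 2)) (L / 2))ᶜ, ‖deriv K z‖ₑ := by
  set I := Ioc (-(L / 2)) (L / 2) with hI
  -- For `z` in the period `I` the sum of `G (z + n * L)` over all `n` omits exactly the term `n =
  -- 0`, that is, `K'` itself.
  set G : ℝ → ℝ≥0∞ := Iᶜ.indicator fun z => ‖deriv K z‖ₑ with hG
  have hGm : Measurable G := (measurable_deriv K).enorm.indicator measurableSet_Ioc.compl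
  have h0 : ∀ᵐ z : ℝ ∂volume.restrict I, z ≠ 0 :=
    ae_restrict_of_ae (Measure.ae_ne volume 0)
  have hle : ∀ᵐ z : ℝ ∂volume.restrict I,
      ‖periodization K L z - deriv K z‖ₑ ≤ ∑' n : ℤ, G (z + n * L) := by
    filter_upwards [h0, ae_restrict_mem measurableSet_Ioc] with z hz hzI
    have hn0 : ∀ n : ℤ, n ≠ 0 → z + n * L ∉ I := by
      intro n hn hmem
      have h3 : (n : ℝ) * L < 1 * L := by linarith [hzI.1, hmem.2]
      have h4 : (-1 : ℝ) * L < n * L := by linarith [hzI.2, hmem.1]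
      have h5 := lt_of_mul_lt_mul_right h3 hL.le
      have h6 := lt_of_mul_lt_mul_right h4 hL.le
      have h7 : n < 1 := by exact_mod_cast h5
      have h8 : -1 < n := by exact_mod_cast h6
      omega
    have hzn : ¬ ∃ n : ℤ, z + n * L = 0 := by
      rintro ⟨n, hn⟩
      by_cases h : n = 0
      · apply hz; simpa [h] using hn
      · apply hn0 n h; rw [hn]; exact ⟨by linarith, by linarith⟩
    have hsum : Summable fun n : ℤ => |deriv K (z + n * L)| := by
      obtain ⟨m, hm⟩ := exists_translate_mem_Ioo hL hzn
      exact summable_translate m (hs _ hm)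
    rw [periodization_of_not_exists K hzn, hsum.of_abs.tsum_eq_add_tsum_ite 0]
    simp only [Int.cast_zero, zero_mul, add_zero, add_sub_cancel_left]
    have h9 : Summable fun n : ℤ => ‖if n = 0 then 0 else deriv K (z + n * L)‖ := by
      refine Summable.of_nonneg_of_le (fun n => norm_nonneg _) (fun n => ?_) hsum
      split_ifs
      · simp
      · exact le_rfl
    have henorm : ‖∑' n : ℤ, if n = 0 then 0 else deriv K (z + n * L)‖ₑ ≤
        ∑' n : ℤ, ‖if n = 0 then 0 else deriv K (z + n * L)‖ₑ := by
      rw [← ofReal_norm]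
      refine (ENNReal.ofReal_le_ofReal (norm_tsum_le_tsum_norm h9)).trans ?_
      rw [ENNReal.ofReal_tsum_of_nonneg (fun n => norm_nonneg _) h9]
      simp only [ofReal_norm, le_refl]
    refine henorm.trans (ENNReal.tsum_le_tsum fun n => ?_)
    split_ifs with h
    · simp
    · rw [hG, indicator_of_mem (hn0 n h)]
  calc ∫⁻ z in I, ‖periodization K L z - deriv K z‖ₑ
      ≤ ∫⁻ z in I, ∑' n : ℤ, G (z + n * L) := lintegral_mono_ae hle
    _ = ∑' n : ℤ, ∫⁻ z in I, G (z + n * L) :=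
        lintegral_tsum fun n => (hGm.comp (by fun_prop)).aemeasurable
    -- The translates of a period tile the line, so integrating the sum over one period integrates
    -- `G` over ℝ.
    _ = ∑' n : ℤ, ∫⁻ z in Ioc (-(L / 2) + n • L) (-(L / 2) + (n + 1) • L), G z := by
        congr 1; ext n
        have h := (measurePreserving_add_right volume ((n : ℝ) * L)).setLIntegral_comp_preimage
          (s := Ioc (-(L / 2) + n • L) (-(L / 2) + (n + 1) • L)) measurableSet_Ioc hGm
        rw [← h]
        congr 2
        ext z
        simp only [hI, mem_Ioc, mem_preimage, zsmul_eq_mul, Int.cast_add, Int.cast_one]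
        constructor <;> rintro ⟨h1, h2⟩ <;> constructor <;> linarith
    _ = ∫⁻ z, G z := by
        rw [← lintegral_iUnion (fun n => measurableSet_Ioc)
          (pairwise_disjoint_Ioc_add_zsmul (-(L / 2)) L), iUnion_Ioc_add_zsmul hL, setLIntegral_univ]
    _ = ∫⁻ z in Iᶜ, ‖deriv K z‖ₑ := lintegral_indicator measurableSet_Ioc.compl _

/-! ### Quadrature with cells of equal mass. -/

/-- Replacing a density by point masses at the left endpoints of cells of equal mass costs at most
the Lipschitz constant times the mass of a cell times the total length. -/
theorem abs_sum_sub_integral_le {N : ℕ} {p : ℕ → ℝ} {w ζ : ℝ → ℝ} {m C : ℝ}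
    (hp : ∀ k < N, p k ≤ p (k + 1)) (hw0 : ∀ᵐ y, 0 ≤ w y)
    (hwi : ∀ k < N, IntervalIntegrable w volume (p k) (p (k + 1)))
    (hw : ∀ k < N, ∫ y in p k..p (k + 1), w y = m) (hC : 0 ≤ C)
    (hζ : ∀ x y, |ζ x - ζ y| ≤ C * |x - y|) :
    |∑ k ∈ Finset.range N, m * ζ (p k) - ∫ y in p 0..p N, w y * ζ y| ≤ C * m * (p N - p 0) := by
  have hcont : Continuous ζ := by
    refine LipschitzWith.continuous (K := C.toNNReal) (LipschitzWith.of_dist_le_mul fun x y => ?_)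
    rw [Real.coe_toNNReal _ hC]; exact hζ x y
  have hi : ∀ k < N, IntervalIntegrable (fun y => w y * ζ y) volume (p k) (p (k + 1)) :=
    fun k hk => (hwi k hk).mul_continuousOn hcont.continuousOn
  rw [← intervalIntegral.sum_integral_adjacent_intervals hi, ← Finset.sum_sub_distrib]
  refine (Finset.abs_sum_le_sum_abs _ _).trans ?_
  have hcell : ∀ k ∈ Finset.range N, |m * ζ (p k) - ∫ y in p k..p (k + 1), w y * ζ y| ≤
      C * m * (p (k + 1) - p k) := by
    intro k hk
    rw [Finset.mem_range] at hk
    -- The cell carries mass `m`, so the point mass is the integral of `w` times the constant `ζ (p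
    -- k)`.
    have h1 : m * ζ (p k) - ∫ y in p k..p (k + 1), w y * ζ y =
        ∫ y in p k..p (k + 1), w y * (ζ (p k) - ζ y) := by
      rw [← hw k hk, ← intervalIntegral.integral_mul_const,
        ← intervalIntegral.integral_sub ((hwi k hk).mul_const _) (hi k hk)]
      simp only [mul_sub]
    rw [h1]
    have h2 : ∫ y in p k..p (k + 1), w y * (C * (p (k + 1) - p k)) = C * m * (p (k + 1) - p k) := by
      rw [intervalIntegral.integral_mul_const, hw k hk]; ring
    rw [← h2, ← Real.norm_eq_abs]
    refine intervalIntegral.norm_integral_le_of_norm_le (hp k hk) ?_ ((hwi k hk).mul_const _)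
    filter_upwards [hw0] with y hy hmem
    rw [Real.norm_eq_abs, abs_mul, abs_of_nonneg hy]
    refine mul_le_mul_of_nonneg_left ((hζ _ _).trans ?_) hy
    refine mul_le_mul_of_nonneg_left ?_ hC
    rw [abs_sub_comm, abs_of_nonneg] <;> linarith [hmem.1, hmem.2]
  refine (Finset.sum_le_sum hcell).trans ?_
  rw [← Finset.mul_sum, Finset.sum_range_sub]

/-! ### The initial particle positions. -/

section Initial

variable {ρ₀ : ℝ → ℝ} {L : ℝ}

theorem periodicCut_eq (ρ₀ : ℝ → ℝ) (hL : 0 < L) {x : ℝ} (hx : x ∈ Ico (-(L / 2)) (L / 2)) :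
    periodicCut ρ₀ L x = ρ₀ x := by
  have : ⌊x / L + 1 / 2⌋ = 0 := by
    rw [Int.floor_eq_iff]
    have h1 : -(1 / 2) ≤ x / L := by rw [le_div_iff₀ hL]; linarith [hx.1]
    have h2 : x / L < 1 / 2 := by rw [div_lt_iff₀ hL]; linarith [hx.2]
    constructor <;> push_cast <;> linarith
  rw [periodicCut, this]; simp

theorem integral_periodicCut (ρ₀ : ℝ → ℝ) (hL : 0 < L) {a b : ℝ} (ha : a ∈ Icc (-(L / 2)) (L / 2))
    (hb : b ∈ Icc (-(L / 2)) (L / 2)) : ∫ y in a..b, periodicCut ρ₀ L y = ∫ y in a..b, ρ₀ y := by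
  refine intervalIntegral.integral_congr_ae ?_
  filter_upwards [Measure.ae_ne volume (L / 2)] with y hy hmem
  have h := uIoc_subset_uIcc hmem
  have h2 := uIcc_subset_Icc ha hb h
  exact periodicCut_eq ρ₀ hL ⟨h2.1, lt_of_le_of_ne h2.2 hy⟩

theorem cutMass_eq (ρ₀ : ℝ → ℝ) (hL : 0 < L) : cutMass ρ₀ L = ∫ y in -(L / 2)..L / 2, ρ₀ y := by
  rw [intervalIntegral.integral_of_le (by linarith), ← integral_Ico_eq_integral_Ioc]
  exact setIntegral_congr_fun measurableSet_Ico fun x hx => periodicCut_eq ρ₀ hL hx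

/-- Makes the quantiles of the initial datum unique, so that a position is determined by the mass to
its left. -/
theorem integral_strictMono (hint : Integrable ρ₀) (hpos : ∀ᵐ x, 0 < ρ₀ x) (c : ℝ) :
    StrictMono fun x => ∫ y in c..x, ρ₀ y := by
  intro a b hab
  have h1 : 0 < ∫ y in a..b, ρ₀ y := by
    rw [intervalIntegral.integral_of_le hab.le,
      integral_pos_iff_support_of_nonneg_ae (ae_restrict_of_ae (hpos.mono fun x hx => hx.le))
      hint.integrableOn]
    have h2 : (volume.restrict (Ioc a b)) (Function.support ρ₀) = volume.restrict (Ioc a b) univ := by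
      refine measure_congr ?_
      filter_upwards [ae_restrict_of_ae hpos] with x hx
      exact propext ⟨fun _ => trivial, fun _ => hx.ne'⟩
    rw [h2, Measure.restrict_apply_univ, Real.volume_Ioc]
    simpa using hab
  have h2 := intervalIntegral.integral_add_adjacent_intervals (μ := volume) (f := ρ₀)
    (a := c) (b := a) (c := b) hint.intervalIntegrable hint.intervalIntegrable
  simp only
  linarith

theorem cutMass_pos (hint : Integrable ρ₀) (hpos : ∀ᵐ x, 0 < ρ₀ x) (hL : 0 < L) :
    0 < cutMass ρ₀ L := by
  rw [cutMass_eq ρ₀ hL]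
  have := integral_strictMono hint hpos (-(L / 2)) (show -(L / 2) < L / 2 by linarith)
  simpa using this

theorem cutMass_le (hint : Integrable ρ₀) (hpos : ∀ᵐ x, 0 < ρ₀ x) (hL : 0 < L) :
    cutMass ρ₀ L ≤ ∫ x, ρ₀ x := by
  rw [cutMass_eq ρ₀ hL, intervalIntegral.integral_of_le (by linarith)]
  exact setIntegral_le_integral hint (hpos.mono fun x hx => hx.le)

/-- The cumulative mass is continuous and strictly increasing. The intermediate value theorem
provides the point `y` with mass `(k + 1) c / N` to its left, and the supremum in the definition is
that point. -/
theorem initialPosition_spec (hint : Integrable ρ₀) (hpos : ∀ᵐ x, 0 < ρ₀ x) (hL : 0 < L) {N : ℕ}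
    (hN : 0 < N) : ∀ k ≤ N, initialPosition ρ₀ L N k ∈ Icc (-(L / 2)) (L / 2) ∧
      ∫ y in -(L / 2)..initialPosition ρ₀ L N k, ρ₀ y = k * (cutMass ρ₀ L / N) := by
  have hc := cutMass_pos hint hpos hL
  have hNr : (0 : ℝ) < N := by exact_mod_cast hN
  have hmono := integral_strictMono hint hpos (-(L / 2))
  have hcont : Continuous fun x => ∫ y in -(L / 2)..x, ρ₀ y :=
    intervalIntegral.continuous_primitive (fun a b => hint.intervalIntegrable) _
  intro k
  induction k with
  | zero =>
    intro _
    simp only [initialPosition]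
    exact ⟨⟨le_rfl, by linarith⟩, by simp⟩
  | succ k ih =>
    intro hk
    obtain ⟨hmem, hval⟩ := ih (by omega)
    set x := initialPosition ρ₀ L N k with hx
    have hkr : ((k : ℝ) + 1) * (cutMass ρ₀ L / N) ≤ cutMass ρ₀ L := by
      have : (k : ℝ) + 1 ≤ N := by exact_mod_cast hk
      calc ((k : ℝ) + 1) * (cutMass ρ₀ L / N) ≤ N * (cutMass ρ₀ L / N) := by gcongr
        _ = cutMass ρ₀ L := by field_simp
    obtain ⟨y, hy, hyval⟩ := intermediate_value_Icc (show -(L / 2) ≤ L / 2 by linarith)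
      hcont.continuousOn (show ((k : ℝ) + 1) * (cutMass ρ₀ L / N) ∈ Icc _ _ from
        ⟨by simp only [intervalIntegral.integral_same]; positivity, by
          simp only [← cutMass_eq ρ₀ hL]; exact hkr⟩)
    -- Points to the left of `x` also qualify, since their integral is nonpositive; hence the set
    -- reaches down to `-(L / 2)`.
    have hset : {z | z ∈ Icc (-(L / 2)) (L / 2) ∧
        ∫ y in x..z, periodicCut ρ₀ L y < cutMass ρ₀ L / N} = Ico (-(L / 2)) y := by
      ext z
      simp only [mem_ofPred_eq, mem_Ico]
      constructor
      · rintro ⟨hz, h⟩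
        refine ⟨hz.1, hmono.lt_iff_lt.1 ?_⟩
        rw [integral_periodicCut ρ₀ hL hmem hz] at h
        simp only [hyval]
        rw [← intervalIntegral.integral_add_adjacent_intervals (b := x) hint.intervalIntegrable
          hint.intervalIntegrable, hval]
        linarith
      · rintro ⟨h1, h2⟩
        have hz : z ∈ Icc (-(L / 2)) (L / 2) := ⟨h1, h2.le.trans hy.2⟩
        refine ⟨hz, ?_⟩
        rw [integral_periodicCut ρ₀ hL hmem hz]
        have h3 := hmono h2
        simp only [hyval] at h3
        rw [← intervalIntegral.integral_add_adjacent_intervals (b := x) hint.intervalIntegrable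
          hint.intervalIntegrable, hval] at h3
        linarith
    have hlt : -(L / 2) < y := by
      rw [← hmono.lt_iff_lt]
      simp only [hyval, intervalIntegral.integral_same]
      positivity
    have heq : initialPosition ρ₀ L N (k + 1) = y := by
      rw [initialPosition, ← hx, hset, csSup_Ico hlt]
    rw [heq]
    exact ⟨hy, by simp only [hyval]; push_cast; ring⟩

theorem initialPosition_last (hint : Integrable ρ₀) (hpos : ∀ᵐ x, 0 < ρ₀ x) (hL : 0 < L) {N : ℕ}
    (hN : 0 < N) : initialPosition ρ₀ L N N = L / 2 := by
  have h := (initialPosition_spec hint hpos hL hN N le_rfl).2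
  have hNr : (0 : ℝ) < N := by exact_mod_cast hN
  rw [mul_div_cancel₀ _ hNr.ne', cutMass_eq ρ₀ hL] at h
  exact (integral_strictMono hint hpos (-(L / 2))).injective h

theorem integral_initialCell (hint : Integrable ρ₀) (hpos : ∀ᵐ x, 0 < ρ₀ x) (hL : 0 < L) {N : ℕ}
    (hN : 0 < N) {k : ℕ} (hk : k < N) :
    ∫ y in initialPosition ρ₀ L N k..initialPosition ρ₀ L N (k + 1), ρ₀ y = cutMass ρ₀ L / N := by
  have h1 := (initialPosition_spec hint hpos hL hN k hk.le).2
  have h2 := (initialPosition_spec hint hpos hL hN (k + 1) hk).2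
  rw [← intervalIntegral.integral_add_adjacent_intervals (b := initialPosition ρ₀ L N k)
    hint.intervalIntegrable hint.intervalIntegrable, h1] at h2
  push_cast at h2
  linarith

theorem initialPosition_lt (hint : Integrable ρ₀) (hpos : ∀ᵐ x, 0 < ρ₀ x) (hL : 0 < L) {N : ℕ}
    (hN : 0 < N) {k : ℕ} (hk : k < N) :
    initialPosition ρ₀ L N k < initialPosition ρ₀ L N (k + 1) := by
  rw [← (integral_strictMono hint hpos (-(L / 2))).lt_iff_lt,
    (initialPosition_spec hint hpos hL hN k hk.le).2,
    (initialPosition_spec hint hpos hL hN (k + 1) hk).2]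
  have := cutMass_pos hint hpos hL
  have hNr : (0 : ℝ) < N := by exact_mod_cast hN
  push_cast
  gcongr
  linarith

/-- A bound on the initial datum is a lower bound on the initial gaps, hence a bound on the initial
particle densities. -/
theorem cutMass_div_le (hint : Integrable ρ₀) (hpos : ∀ᵐ x, 0 < ρ₀ x) {M : ℝ}
    (hM : ∀ᵐ x, ρ₀ x ≤ M) (hL : 0 < L) {N : ℕ} (hN : 0 < N) {k : ℕ} (hk : k < N) :
    cutMass ρ₀ L / N ≤ M * (initialPosition ρ₀ L N (k + 1) - initialPosition ρ₀ L N k) := by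
  rw [← integral_initialCell hint hpos hL hN hk]
  have hlt := initialPosition_lt hint hpos hL hN hk
  refine (intervalIntegral.integral_mono_ae (g := fun _ => M) hlt.le hint.intervalIntegrable
    intervalIntegrable_const hM).trans ?_
  rw [intervalIntegral.integral_const, smul_eq_mul, mul_comm]

theorem abs_sum_initialPosition_sub_le (hint : Integrable ρ₀) (hpos : ∀ᵐ x, 0 < ρ₀ x) (hL : 0 < L)
    {N : ℕ} (hN : 0 < N) {C : ℝ} (hC : 0 ≤ C) {ζ : ℝ → ℝ} (hζ : ∀ x y, |ζ x - ζ y| ≤ C * |x - y|) :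
    |∑ k ∈ Finset.range N, cutMass ρ₀ L / N * ζ (initialPosition ρ₀ L N k) -
      ∫ y in -(L / 2)..L / 2, ρ₀ y * ζ y| ≤ C * (cutMass ρ₀ L / N) * L := by
  have h := abs_sum_sub_integral_le (N := N) (p := initialPosition ρ₀ L N) (w := ρ₀) (ζ := ζ)
    (m := cutMass ρ₀ L / N) (C := C) (fun k hk => (initialPosition_lt hint hpos hL hN hk).le)
    (hpos.mono fun x hx => hx.le) (fun k _ => hint.intervalIntegrable)
    (fun k hk => integral_initialCell hint hpos hL hN hk) hC hζ
  rw [initialPosition_last hint hpos hL hN] at h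
  simp only [initialPosition] at h
  convert h using 2
  ring

/-- The first moment of the initial configurations is bounded. -/
theorem sum_abs_initialPosition_le (hint : Integrable ρ₀) (hpos : ∀ᵐ x, 0 < ρ₀ x)
    (hmom : Integrable fun x => |x| * ρ₀ x) (hL : 0 < L) {N : ℕ} (hN : 0 < N) :
    ∑ k ∈ Finset.range N, cutMass ρ₀ L / N * |initialPosition ρ₀ L N k| ≤
      (∫ x, |x| * ρ₀ x) + cutMass ρ₀ L / N * L := by
  have h := abs_sum_initialPosition_sub_le hint hpos hL hN zero_le_one (ζ := fun x => |x|)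
    (fun x y => by rw [one_mul]; exact abs_abs_sub_abs_le _ _)
  have h2 : ∫ y in -(L / 2)..L / 2, ρ₀ y * |y| ≤ ∫ x, |x| * ρ₀ x := by
    rw [intervalIntegral.integral_of_le (by linarith)]
    simp only [mul_comm (ρ₀ _)]
    exact setIntegral_le_integral hmom (hpos.mono fun x hx => mul_nonneg (abs_nonneg _) hx.le)
  have := (abs_le.1 h).2
  linarith

end Initial

/-! ### Cyclic sums and periodic configurations. -/

theorem sum_Ico_int_eq_sum_range (f : ℤ → ℝ) (a : ℤ) (n : ℕ) :
    ∑ i ∈ Finset.Ico a (a + n), f i = ∑ j ∈ Finset.range n, f (a + j) := by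
  refine Finset.sum_nbij' (fun z => (z - a).toNat) (fun j => a + j) ?_ ?_ ?_ ?_ ?_
  · intro i hi; simp only [Finset.mem_Ico, Finset.mem_range] at *; omega
  · intro i hi; simp only [Finset.mem_Ico, Finset.mem_range] at *; omega
  · intro i hi; simp only [Finset.mem_Ico] at *; omega
  · intro i hi; simp
  · intro i hi
    simp only [Finset.mem_Ico] at hi
    congr 1; omega

/-- Shifting the window by one exchanges `f a` for the equal value `f (a + N)`. This is the
boundary-free reindexing behind all summations by parts on the torus. -/
theorem sum_range_add_int {f : ℤ → ℝ} {N : ℕ} (hf : ∀ k, f (k + N) = f k) (a : ℤ) :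
    ∑ j ∈ Finset.range N, f (a + j) = ∑ j ∈ Finset.range N, f j := by
  have hstep : ∀ a, ∑ j ∈ Finset.range N, f (a + 1 + j) = ∑ j ∈ Finset.range N, f (a + j) := by
    intro a
    have h1 := Finset.sum_range_succ (fun j : ℕ => f (a + j)) N
    have h2 := Finset.sum_range_succ' (fun j : ℕ => f (a + j)) N
    rw [h1] at h2
    simp only [hf, Nat.cast_zero, add_zero, Nat.cast_add, Nat.cast_one] at h2
    have h3 : ∀ j : ℕ, f (a + 1 + j) = f (a + (j + 1)) := fun j => by congr 1; ring
    simp only [h3]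
    linarith
  induction a with
  | zero => simp
  | succ n ih => rw [hstep, ih]
  | pred n ih =>
    rw [← ih, ← hstep]
    congr 1; ext j; congr 1; ring

theorem sum_range_mul_int {f : ℤ → ℝ} {N : ℕ} (hf : ∀ k, f (k + N) = f k) (a : ℤ) (m : ℕ) :
    ∑ j ∈ Finset.range (m * N), f (a + j) = m * ∑ j ∈ Finset.range N, f j := by
  induction m with
  | zero => simp
  | succ m ih =>
    rw [Nat.succ_mul, Finset.sum_range_add, ih]
    have h : ∀ j : ℕ, f (a + ((m * N + j : ℕ) : ℤ)) = f ((a + m * N) + j) := by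
      intro j; congr 1; push_cast; ring
    simp only [h]
    rw [sum_range_add_int hf]
    push_cast; ring

/-- Ordered configurations of `N` particles on the torus of length `L`, lifted to `ℝ`. -/
structure PeriodicConfig (L : ℝ) (N : ℕ) (x : ℤ → ℝ) : Prop where
  pos : 0 < N
  per : ∀ k, x (k + N) = x k + L
  lt : ∀ k, x k < x (k + 1)

namespace PeriodicConfig

variable {L c : ℝ} {N : ℕ} {x : ℤ → ℝ}

theorem strictMono (h : PeriodicConfig L N x) : StrictMono x := strictMono_int_of_lt_succ h.lt

theorem cast_pos (h : PeriodicConfig L N x) : (0 : ℝ) < N := by exact_mod_cast h.pos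

theorem per_mul (h : PeriodicConfig L N x) (k m : ℤ) : x (k + m * N) = x k + m * L := by
  induction m with
  | zero => simp
  | succ n ih =>
    rw [show k + ((n : ℤ) + 1) * N = (k + n * N) + N by ring, h.per, ih]
    push_cast; ring
  | pred n ih =>
    have := h.per (k + (-(n : ℤ) - 1) * N)
    rw [show k + (-(n : ℤ) - 1) * N + N = k + -(n : ℤ) * N by ring, ih] at this
    push_cast at this ⊢
    linarith

theorem length_pos (h : PeriodicConfig L N x) : 0 < L := by
  have h1 := h.per 0
  have h2 := h.strictMono (show (0 : ℤ) < 0 + N by have := h.pos; omega)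
  linarith

/-- The cell is given by the largest index with `x k ≤ y`; it exists since the positions are
unbounded in both directions by `per_mul`. -/
theorem exists_cell (h : PeriodicConfig L N x) (y : ℝ) : ∃ k, y ∈ Ico (x k) (x (k + 1)) := by
  have hL := h.length_pos
  have h1 : ∃ k, x k ≤ y := by
    obtain ⟨m, hm⟩ := exists_int_lt ((y - x 0) / L)
    refine ⟨0 + m * N, ?_⟩
    rw [h.per_mul]
    rw [lt_div_iff₀ hL] at hm
    linarith
  have h2 : ∃ b, ∀ k, x k ≤ y → k ≤ b := by
    obtain ⟨m, hm⟩ := exists_int_gt ((y - x 0) / L)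
    refine ⟨0 + m * N, fun k hk => ?_⟩
    rw [div_lt_iff₀ hL] at hm
    refine (h.strictMono.lt_iff_lt.1 (hk.trans_lt ?_)).le
    rw [h.per_mul]
    linarith
  obtain ⟨k, hk1, hk2⟩ := Int.exists_greatest_of_bdd h2 h1
  refine ⟨k, hk1, ?_⟩
  by_contra hlt
  have := hk2 (k + 1) (not_lt.1 hlt)
  omega

theorem cell_unique (h : PeriodicConfig L N x) {y : ℝ} {k l : ℤ} (hk : y ∈ Ico (x k) (x (k + 1)))
    (hl : y ∈ Ico (x l) (x (l + 1))) : k = l := by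
  have h1 := h.strictMono.lt_iff_lt.1 (hk.1.trans_lt hl.2)
  have h2 := h.strictMono.lt_iff_lt.1 (hl.1.trans_lt hk.2)
  omega

theorem density_eq (h : PeriodicConfig L N x) {y : ℝ} {k : ℤ} (hk : y ∈ Ico (x k) (x (k + 1))) :
    particleDensity c N x y = cellDensity c N x k := by
  rw [particleDensity, tsum_eq_single k]
  · rw [indicator_of_mem hk]
  · intro l hl
    exact indicator_of_notMem (fun hy => hl (h.cell_unique hy hk)) _

theorem gap_per (h : PeriodicConfig L N x) (k : ℤ) :
    x (k + N + 1) - x (k + N) = x (k + 1) - x k := by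
  rw [show k + (N : ℤ) + 1 = k + 1 + N by ring, h.per, h.per]; ring

theorem cellDensity_per (h : PeriodicConfig L N x) (k : ℤ) :
    cellDensity c N x (k + N) = cellDensity c N x k := by
  rw [cellDensity, h.gap_per, cellDensity]

theorem cellDensity_pos (h : PeriodicConfig L N x) (hc : 0 < c) (k : ℤ) :
    0 < cellDensity c N x k :=
  div_pos hc (mul_pos h.cast_pos (sub_pos.2 (h.lt k)))

theorem cellDensity_mul_gap (h : PeriodicConfig L N x) (k : ℤ) :
    cellDensity c N x k * (x (k + 1) - x k) = c / N := by
  have h1 := h.cast_pos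
  have h2 := sub_pos.2 (h.lt k)
  rw [cellDensity]; field_simp

theorem density_pos (h : PeriodicConfig L N x) (hc : 0 < c) (y : ℝ) : 0 < particleDensity c N x y := by
  obtain ⟨k, hk⟩ := h.exists_cell y
  rw [h.density_eq hk]
  exact h.cellDensity_pos hc k

theorem density_le (h : PeriodicConfig L N x) {M : ℝ} (hM : ∀ k, cellDensity c N x k ≤ M) (y : ℝ) :
    particleDensity c N x y ≤ M := by
  obtain ⟨k, hk⟩ := h.exists_cell y
  rw [h.density_eq hk]
  exact hM k

theorem density_periodic (h : PeriodicConfig L N x) :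
    Function.Periodic (particleDensity c N x) L := by
  intro y
  obtain ⟨k, hk⟩ := h.exists_cell y
  have hk' : y + L ∈ Ico (x (k + N)) (x (k + N + 1)) := by
    rw [show k + (N : ℤ) + 1 = k + 1 + N by ring, h.per, h.per]
    exact ⟨by linarith [hk.1], by linarith [hk.2]⟩
  rw [h.density_eq hk, h.density_eq hk', h.cellDensity_per]

theorem sum_gap (h : PeriodicConfig L N x) :
    ∑ k ∈ Finset.range N, (x ((k : ℤ) + 1) - x k) = L := by
  have h1 := Finset.sum_range_sub (fun k : ℕ => x k) N
  have h2 := h.per 0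
  simp only [zero_add] at h2
  push_cast at h1
  rw [h1, h2]; ring

/-- A periodic step function is controlled under translations by its total variation. -/
theorem lintegral_translate_sub_le (h : PeriodicConfig L N x) (φ : ℝ → ℝ) {R z : ℝ}
    (hz : 0 < z) {m : ℕ} (hm : 2 * R + z ≤ m * L) :
    ∫⁻ y in Icc (-R) R, ENNReal.ofReal
        |φ (particleDensity c N x (y + z)) - φ (particleDensity c N x y)| ≤
      ENNReal.ofReal (z * (m * ∑ k ∈ Finset.range N,
        |φ (cellDensity c N x k) - φ (cellDensity c N x (k - 1))|)) := by
  obtain ⟨a, ha⟩ := h.exists_cell (-R)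
  set D : ℤ → ℝ := fun k => |φ (cellDensity c N x k) - φ (cellDensity c N x (k - 1))| with hD
  have hDper : ∀ k, D (k + N) = D k := by
    intro k
    simp only [hD]
    rw [h.cellDensity_per, show k + (N : ℤ) - 1 = k - 1 + N by ring, h.cellDensity_per]
  -- These are all jumps that can matter: they start after the cell of `-R`, and `m` periods later
  -- the point `R + z` has been passed.
  set J := Finset.Ico (a + 1) (a + 1 + (m * N : ℕ)) with hJ
  have hsum : ∑ i ∈ J, D i = m * ∑ k ∈ Finset.range N, D k := by
    rw [hJ, sum_Ico_int_eq_sum_range, sum_range_mul_int hDper]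
  have htel : ∀ (k : ℤ) (n : ℕ), |φ (cellDensity c N x (k + n)) - φ (cellDensity c N x k)| ≤
      ∑ i ∈ Finset.Ico (k + 1) (k + 1 + n), D i := by
    intro k n
    rw [sum_Ico_int_eq_sum_range]
    have h1 := Finset.sum_range_sub (fun j : ℕ => φ (cellDensity c N x (k + j))) n
    simp only [Nat.cast_zero, add_zero] at h1
    rw [← h1]
    refine (Finset.abs_sum_le_sum_abs _ _).trans (Finset.sum_le_sum fun j _ => ?_)
    simp only [hD]
    rw [show k + ((j + 1 : ℕ) : ℤ) = k + 1 + j by push_cast; ring,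
      show k + 1 + (j : ℤ) - 1 = k + j by ring]
  -- A jump at `x i` lies between `y` and `y + z` only if `y` is in the interval of length `z` to
  -- the left of `x i`. Integrating in `y` therefore costs `z` per jump.
  have hpt : ∀ y ∈ Icc (-R) R, ENNReal.ofReal
        |φ (particleDensity c N x (y + z)) - φ (particleDensity c N x y)| ≤
      ∑ i ∈ J, (Ico (x i - z) (x i)).indicator (fun _ => ENNReal.ofReal (D i)) y := by
    intro y hy
    obtain ⟨k, hk⟩ := h.exists_cell y
    obtain ⟨l, hl⟩ := h.exists_cell (y + z)
    have hkl : k < l + 1 := h.strictMono.lt_iff_lt.1 ((hk.1.trans (by linarith)).trans_lt hl.2)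
    obtain ⟨n, rfl⟩ : ∃ n : ℕ, l = k + n := ⟨(l - k).toNat, by omega⟩
    rw [h.density_eq hk, h.density_eq hl]
    refine (ENNReal.ofReal_le_ofReal (htel k n)).trans ?_
    rw [ENNReal.ofReal_sum_of_nonneg fun i _ => abs_nonneg _]
    have hsub : Finset.Ico (k + 1) (k + 1 + n) ⊆ J := by
      intro i hi
      rw [Finset.mem_Ico] at hi
      have h1 : a < k + 1 := h.strictMono.lt_iff_lt.1 ((ha.1.trans hy.1).trans_lt hk.2)
      have h2 : x i ≤ y + z := (h.strictMono.monotone (by omega)).trans hl.1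
      have h3 : x (a + 1 + (m : ℤ) * N) = x (a + 1) + (m : ℤ) * L := h.per_mul _ _
      have h4 : i < a + 1 + (m : ℤ) * N := by
        refine h.strictMono.lt_iff_lt.1 (h2.trans_lt ?_)
        rw [h3]
        push_cast
        linarith [hy.2, ha.2]
      rw [hJ, Finset.mem_Ico]
      push_cast
      omega
    refine (Finset.sum_le_sum fun i hi => ?_).trans
      (Finset.sum_le_sum_of_subset hsub)
    rw [Finset.mem_Ico] at hi
    rw [indicator_of_mem]
    refine ⟨?_, ?_⟩
    · have h2 : x i ≤ y + z := (h.strictMono.monotone (by omega)).trans hl.1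
      linarith
    · exact hk.2.trans_le (h.strictMono.monotone (by omega))
  calc _ ≤ ∫⁻ y in Icc (-R) R,
        ∑ i ∈ J, (Ico (x i - z) (x i)).indicator (fun _ => ENNReal.ofReal (D i)) y :=
        setLIntegral_mono' measurableSet_Icc hpt
    _ ≤ ∫⁻ y, ∑ i ∈ J, (Ico (x i - z) (x i)).indicator (fun _ => ENNReal.ofReal (D i)) y :=
        setLIntegral_le_lintegral _ _
    _ = ∑ i ∈ J, ENNReal.ofReal (D i) * ENNReal.ofReal z := by
        rw [lintegral_finsetSum]
        · refine Finset.sum_congr rfl fun i _ => ?_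
          rw [lintegral_indicator_const measurableSet_Ico, Real.volume_Ico]
          congr 2; ring
        · exact fun i _ => measurable_const.indicator measurableSet_Ico
    _ = ENNReal.ofReal (z * (m * ∑ k ∈ Finset.range N, D k)) := by
        rw [← Finset.sum_mul, ← ENNReal.ofReal_sum_of_nonneg fun i _ => abs_nonneg _,
          ← ENNReal.ofReal_mul (Finset.sum_nonneg fun i _ => abs_nonneg _), hsum, mul_comm]

end PeriodicConfig

/-- Continuous paths of ordered periodic configurations. -/
structure ConfigPath (L : ℝ) (N : ℕ) (x : ℤ → ℝ → ℝ) : Prop where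
  cont : ∀ k, Continuous (x k)
  config : ∀ t, PeriodicConfig L N fun k => x k t

namespace ConfigPath

variable {L c : ℝ} {N : ℕ} {x : ℤ → ℝ → ℝ}

theorem continuous_cellDensity (h : ConfigPath L N x) (k : ℤ) :
    Continuous fun t => cellDensity c N (fun i => x i t) k := by
  unfold cellDensity
  refine continuous_const.div (continuous_const.mul ((h.cont _).sub (h.cont _))) fun t => ?_
  exact (mul_pos (h.config t).cast_pos (sub_pos.2 ((h.config t).lt k))).ne'

theorem measurable_density (h : ConfigPath L N x) :
    Measurable fun p : ℝ × ℝ => particleDensity c N (fun k => x k p.1) p.2 := by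
  refine measurable_of_tendsto_metrizable (f := fun (m : ℕ) p => ∑ k ∈ Finset.Icc (-(m : ℤ)) m,
    {p : ℝ × ℝ | x k p.1 ≤ p.2 ∧ p.2 < x (k + 1) p.1}.indicator
      (fun p => cellDensity c N (fun i => x i p.1) k) p) (fun m => ?_) ?_
  · refine Finset.measurable_sum _ fun k _ => Measurable.indicator ?_ ?_
    · exact (h.continuous_cellDensity k).measurable.comp measurable_fst
    · exact (measurableSet_le ((h.cont k).measurable.comp measurable_fst) measurable_snd).inter
        (measurableSet_lt measurable_snd ((h.cont (k + 1)).measurable.comp measurable_fst))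
  · rw [tendsto_pi_nhds]
    rintro ⟨t, y⟩
    obtain ⟨k, hk⟩ := (h.config t).exists_cell y
    refine tendsto_const_nhds.congr' ?_
    filter_upwards [eventually_ge_atTop k.natAbs] with m hm
    rw [(h.config t).density_eq hk, Finset.sum_eq_single k]
    · rw [indicator_of_mem]
      exact hk
    · intro l _ hl
      exact indicator_of_notMem (s := {p : ℝ × ℝ | x l p.1 ≤ p.2 ∧ p.2 < x (l + 1) p.1})
        (fun hy => hl ((h.config t).cell_unique hy hk)) _
    · intro hk'
      exfalso; apply hk'; rw [Finset.mem_Icc]; omega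

theorem measurable_density_right (h : ConfigPath L N x) (t : ℝ) :
    Measurable (particleDensity c N fun k => x k t) :=
  (h.measurable_density (c := c)).comp (measurable_const.prodMk measurable_id)

end ConfigPath

/-! ### Integrals of the particle density over cells and periods. -/

namespace PeriodicConfig

variable {L c : ℝ} {N : ℕ} {x : ℤ → ℝ}

theorem measurable_density (h : PeriodicConfig L N x) : Measurable (particleDensity c N x) :=
  ConfigPath.measurable_density_right (x := fun k _ => x k) ⟨fun _ => continuous_const, fun _ => h⟩ 0

theorem intervalIntegrable_density (h : PeriodicConfig L N x) (a b : ℝ) :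
    IntervalIntegrable (particleDensity c N x) volume a b := by
  obtain ⟨M, hM⟩ : ∃ M, ∀ y, ‖particleDensity c N x y‖ ≤ M := by
    refine ⟨∑ k ∈ Finset.range N, |cellDensity c N x k|, fun y => ?_⟩
    obtain ⟨k, hk⟩ := h.exists_cell y
    rw [h.density_eq hk, Real.norm_eq_abs]
    have hN : (0 : ℤ) < N := by exact_mod_cast h.pos
    have h1 := Int.emod_nonneg k hN.ne'
    have h2 := Int.emod_lt_of_pos k hN
    have h3 : cellDensity c N x k = cellDensity c N x ((k % N).toNat : ℤ) := by
      rw [Int.toNat_of_nonneg h1, cellDensity, cellDensity]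
      have h4 : k = k % N + k / N * N := by rw [mul_comm]; exact (Int.emod_add_mul_ediv k N).symm
      have h5 := h.per_mul (k % N) (k / N)
      have h6 := h.per_mul (k % N + 1) (k / N)
      rw [← h4] at h5
      rw [show k % N + 1 + k / N * (N : ℤ) = k + 1 by omega] at h6
      rw [h5, h6]
      congr 2; ring
    rw [h3]
    exact Finset.single_le_sum (f := fun j : ℕ => |cellDensity c N x j|)
      (fun j _ => abs_nonneg _) (Finset.mem_range.2 (by omega))
  rw [intervalIntegrable_iff]
  exact Measure.integrableOn_of_bounded measure_Ioc_lt_top.ne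
    h.measurable_density.aestronglyMeasurable (ae_of_all _ hM)

theorem integral_cell (h : PeriodicConfig L N x) (f : ℝ → ℝ → ℝ) (k : ℤ) :
    ∫ y in x k..x (k + 1), f (particleDensity c N x y) y =
      ∫ y in x k..x (k + 1), f (cellDensity c N x k) y := by
  refine intervalIntegral.integral_congr_ae ?_
  filter_upwards [Measure.ae_ne volume (x (k + 1))] with y hy hmem
  rw [uIoc_of_le (h.lt k).le] at hmem
  rw [h.density_eq (k := k) ⟨hmem.1.le, lt_of_le_of_ne hmem.2 hy⟩]

theorem integral_density_cell (h : PeriodicConfig L N x) (k : ℤ) :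
    ∫ y in x k..x (k + 1), particleDensity c N x y = c / N := by
  rw [h.integral_cell (fun r _ => r), intervalIntegral.integral_const, smul_eq_mul, mul_comm,
    h.cellDensity_mul_gap]

/-- Riemann sums over the particles approximate integrals against the density. -/
theorem abs_sum_sub_integral_density_le (h : PeriodicConfig L N x) (hc : 0 < c) {C : ℝ}
    (hC : 0 ≤ C) {ζ : ℝ → ℝ} (hζ : ∀ y z, |ζ y - ζ z| ≤ C * |y - z|) (a : ℤ) :
    |∑ k ∈ Finset.range N, c / N * ζ (x (a + k)) -
      ∫ y in x a..x a + L, particleDensity c N x y * ζ y| ≤ C * (c / N) * L := by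
  have h1 := abs_sum_sub_integral_le (N := N) (p := fun k : ℕ => x (a + k))
    (w := particleDensity c N x) (ζ := ζ) (m := c / N) (C := C)
    (fun k _ => by push_cast; rw [← add_assoc]; exact (h.lt _).le)
    (ae_of_all _ fun y => (h.density_pos hc y).le) (fun k _ => h.intervalIntegrable_density _ _)
    (fun k _ => by push_cast; rw [← add_assoc]; exact h.integral_density_cell _) hC hζ
  simp only [h.per, Nat.cast_zero, add_zero] at h1
  convert h1 using 2
  ring

theorem abs_sum_sub_integral_period_le (h : PeriodicConfig L N x) (hc : 0 < c) {C : ℝ}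
    (hC : 0 ≤ C) {ζ : ℝ → ℝ} (hζ : ∀ y z, |ζ y - ζ z| ≤ C * |y - z|)
    (hper : Function.Periodic ζ L) :
    |∑ k ∈ Finset.range N, c / N * ζ (x k) -
      ∫ y in -(L / 2)..L / 2, particleDensity c N x y * ζ y| ≤ C * (c / N) * L := by
  have h1 := h.abs_sum_sub_integral_density_le hc hC hζ 0
  have h2 := ((h.density_periodic (c := c)).mul hper).intervalIntegral_add_eq (x 0) (-(L / 2))
  rw [show -(L / 2) + L = L / 2 by ring] at h2
  simp only [Pi.mul_apply] at h2
  rw [h2] at h1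
  simpa using h1

theorem integral_density_period (h : PeriodicConfig L N x) (a : ℝ) :
    ∫ y in a..a + L, particleDensity c N x y = c := by
  rw [(h.density_periodic (c := c)).intervalIntegral_add_eq a (x 0)]
  have h1 := intervalIntegral.sum_integral_adjacent_intervals (μ := volume)
    (f := particleDensity c N x) (a := fun k : ℕ => x k) (n := N)
    (fun k _ => h.intervalIntegrable_density _ _)
  have h2 := h.per 0
  simp only [zero_add] at h2
  simp only [Nat.cast_zero] at h1
  rw [← h2, ← h1]
  push_cast
  simp only [h.integral_density_cell, Finset.sum_const, Finset.card_range, nsmul_eq_mul]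
  have := h.cast_pos
  field_simp

/-- Summation by parts. -/
theorem sum_mul_sub_eq_neg_integral (h : PeriodicConfig L N x) (φ : ℝ → ℝ) {g g' : ℝ → ℝ}
    (hg : ∀ y, HasDerivAt g (g' y) y) (hg' : Continuous g') (hper : Function.Periodic g L)
    (hper' : Function.Periodic g' L) :
    ∑ k ∈ Finset.range N, g (x k) * (φ (cellDensity c N x k) - φ (cellDensity c N x (k - 1))) =
      -∫ y in -(L / 2)..L / 2, φ (particleDensity c N x y) * g' y := by
  have hcellint : ∀ k : ℤ, ∫ y in x k..x (k + 1), φ (particleDensity c N x y) * g' y =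
      φ (cellDensity c N x k) * (g (x (k + 1)) - g (x k)) := by
    intro k
    rw [h.integral_cell (fun r y => φ r * g' y), intervalIntegral.integral_const_mul,
      intervalIntegral.integral_eq_sub_of_hasDerivAt (fun y _ => hg y)
        (hg'.intervalIntegrable _ _)]
  have hint : ∀ k : ℤ, IntervalIntegrable (fun y => φ (particleDensity c N x y) * g' y) volume
      (x k) (x (k + 1)) := by
    intro k
    have h1 : IntervalIntegrable (fun y => φ (cellDensity c N x k) * g' y) volume
      (x k) (x (k + 1)) := (hg'.intervalIntegrable _ _).const_mul _
    refine h1.congr_ae ?_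
    rw [Filter.EventuallyEq, ae_restrict_iff' measurableSet_uIoc]
    filter_upwards [Measure.ae_ne volume (x (k + 1))] with y hy hmem
    rw [uIoc_of_le (h.lt k).le] at hmem
    rw [h.density_eq (k := k) ⟨hmem.1.le, lt_of_le_of_ne hmem.2 hy⟩]
  have hp2 : Function.Periodic (fun y => φ (particleDensity c N x y) * g' y) L := by
    intro y
    simp only [h.density_periodic (c := c) y, hper' y]
  have h1 := intervalIntegral.sum_integral_adjacent_intervals (μ := volume)
    (f := fun y => φ (particleDensity c N x y) * g' y) (a := fun k : ℕ => x k) (n := N)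
    (fun k _ => by push_cast; exact hint k)
  have h2 := h.per 0
  simp only [zero_add] at h2
  have h3 := hp2.intervalIntegral_add_eq (-(L / 2)) (x 0)
  rw [show -(L / 2) + L = L / 2 by ring] at h3
  rw [h3, ← h2]
  simp only [Nat.cast_zero] at h1
  rw [← h1]
  push_cast
  simp only [hcellint]
  -- The two sides differ by the sum of `q (1 + k) - q k` over a period, which vanishes.
  set q : ℤ → ℝ := fun k => φ (cellDensity c N x (k - 1)) * g (x k) with hq
  have hqper : ∀ k, q (k + N) = q k := by
    intro k
    simp only [hq]
    rw [show k + (N : ℤ) - 1 = k - 1 + N by ring, h.cellDensity_per, h.per, hper]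
  have h4 := sum_range_add_int hqper 1
  rw [← Finset.sum_neg_distrib, ← sub_eq_zero, ← Finset.sum_sub_distrib]
  have h5 : ∑ k ∈ Finset.range N, (q (1 + k) - q k) = 0 := by
    rw [Finset.sum_sub_distrib, h4, sub_self]
  rw [← h5]
  refine Finset.sum_congr rfl fun k _ => ?_
  simp only [hq]
  rw [show (1 : ℤ) + k - 1 = k by ring, add_comm (1 : ℤ)]
  ring

end PeriodicConfig

/-! ### Interaction velocities of the particles. -/

namespace TorusForce

variable {S : ℝ → Set ℝ} {f : ℝ → ℝ} {L B Λ κ : ℝ}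

theorem abs_le_of_mem (h : TorusForce S f L B Λ κ) {z p : ℝ} (hz : z ∈ Ioo (-L) 0) (hp : p ∈ S z) :
    |p| ≤ B := by
  by_cases hz2 : z = -(L / 2)
  · rw [hz2, h.eq_mid] at hp
    exact le_trans hp h.jump_le
  · rw [h.eq_singleton z hz hz2, mem_singleton_iff] at hp
    rw [hp]; exact h.bound z

theorem abs_sub_le_of_mem (h : TorusForce S f L B Λ κ) {z w p q : ℝ} (hp : p ∈ S z) (hq : q ∈ S w)
    (hzw : (z ∈ Ioo (-L) (-(L / 2)) ∧ w ∈ Ioo (-L) (-(L / 2))) ∨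
      (z ∈ Ioo (-(L / 2)) 0 ∧ w ∈ Ioo (-(L / 2)) 0)) : |p - q| ≤ Λ * |z - w| := by
  rcases hzw with ⟨hz, hw⟩ | ⟨hz, hw⟩
  · have hL : 0 < L := by linarith [hz.1, hz.2]
    rw [h.eq_singleton z ⟨hz.1, by linarith [hz.2]⟩ hz.2.ne, mem_singleton_iff] at hp
    rw [h.eq_singleton w ⟨hw.1, by linarith [hw.2]⟩ hw.2.ne, mem_singleton_iff] at hq
    rw [hp, hq]; exact h.lip_left z hz w hw
  · have hL : 0 < L := by linarith [hz.1, hz.2]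
    rw [h.eq_singleton z ⟨by linarith [hz.1], hz.2⟩ hz.1.ne', mem_singleton_iff] at hp
    rw [h.eq_singleton w ⟨by linarith [hw.1], hw.2⟩ hw.1.ne', mem_singleton_iff] at hq
    rw [hp, hq]; exact h.lip_right z hz w hw

end TorusForce

/-- `v` is an admissible interaction velocity of the particle `k`. -/
def IsForceSum (S : ℝ → Set ℝ) (c : ℝ) (N : ℕ) (x : ℤ → ℝ) (k : ℤ) (v : ℝ) : Prop :=
  ∃ g : ℤ → ℝ, (∀ j ∈ Finset.Ioo k (k + (N : ℤ)), g j ∈ S (x k - x j)) ∧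
    v = -(c / N) * ∑ j ∈ Finset.Ioo k (k + (N : ℤ)), g j

section ForceSum

variable {S : ℝ → Set ℝ} {f : ℝ → ℝ} {L B Λ κ c : ℝ} {N : ℕ} {x : ℤ → ℝ}

theorem PeriodicConfig.sub_mem_Ioo (hx : PeriodicConfig L N x) {k j : ℤ}
    (hj : j ∈ Finset.Ioo k (k + (N : ℤ))) : x k - x j ∈ Ioo (-L) 0 := by
  rw [Finset.mem_Ioo] at hj
  have h1 := hx.strictMono hj.1
  have h2 := hx.strictMono hj.2
  rw [hx.per] at h2
  constructor <;> linarith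

theorem IsForceSum.abs_velocity_le {k : ℤ} {v : ℝ} (hv : IsForceSum S c N x k v)
    (hS : TorusForce S f L B Λ κ) (hx : PeriodicConfig L N x) (hc : 0 < c) : |v| ≤ c * B := by
  obtain ⟨g, hg, rfl⟩ := hv
  have hN := hx.cast_pos
  have h1 : |∑ j ∈ Finset.Ioo k (k + (N : ℤ)), g j| ≤ N * B := by
    refine (Finset.abs_sum_le_sum_abs _ _).trans ((Finset.sum_le_card_nsmul _ _ B
      fun j hj => hS.abs_le_of_mem (hx.sub_mem_Ioo hj) (hg j hj)).trans ?_)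
    rw [nsmul_eq_mul]
    refine mul_le_mul_of_nonneg_right ?_ hS.bound_nonneg
    rw [Int.card_Ioo]
    have : (k + (N : ℤ) - k - 1).toNat ≤ N := by omega
    exact_mod_cast this
  rw [abs_mul, abs_neg, abs_of_pos (div_pos hc hN)]
  calc c / N * |∑ j ∈ Finset.Ioo k (k + (N : ℤ)), g j| ≤ c / N * (N * B) := by gcongr
    _ = c * B := by field_simp

/-- At a smallest gap, the interaction closes the gap at a controlled rate only. -/
theorem IsForceSum.le_sub {k : ℤ} {v v' : ℝ} (hv : IsForceSum S c N x k v)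
    (hv' : IsForceSum S c N x (k + 1) v')
    (hS : TorusForce S f L B Λ κ) (hx : PeriodicConfig L N x) (hc : 0 < c)
    (hmin : ∀ j, x (k + 1) - x k ≤ x (j + 1) - x j) :
    -(6 * B * (c / N)) - c * Λ * (x (k + 1) - x k) ≤ v' - v := by
  obtain ⟨g, hg, rfl⟩ := hv
  obtain ⟨g', hg', rfl⟩ := hv'
  have hN := hx.cast_pos
  have hB := hS.bound_nonneg
  have hΛ := hS.lip_nonneg
  have hd := sub_pos.2 (hx.lt k)
  have hN1 : 1 ≤ N := hx.pos
  rcases hN1.eq_or_lt with h1 | h2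
  · have e1 : Finset.Ioo k (k + (N : ℤ)) = ∅ := by
      ext i; simp only [Finset.mem_Ioo, Finset.notMem_empty, iff_false]; omega
    have e2 : Finset.Ioo (k + 1) (k + 1 + (N : ℤ)) = ∅ := by
      ext i; simp only [Finset.mem_Ioo, Finset.notMem_empty, iff_false]; omega
    rw [e1, e2]
    simp only [Finset.sum_empty, mul_zero, sub_zero]
    have : 0 ≤ 6 * B * (c / N) := by positivity
    have : 0 ≤ c * Λ * (x (k + 1) - x k) := by positivity
    linarith
  -- `J` collects the particles that act on both ends of the gap. Their forces are compared
  -- pairwise; one term on each side stays unpaired.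
  set J := Finset.Ioo (k + 1) (k + (N : ℤ)) with hJ
  have e1 : Finset.Ioo k (k + (N : ℤ)) = insert (k + 1) J := by
    ext i; simp only [hJ, Finset.mem_Ioo, Finset.mem_insert]; omega
  have e2 : Finset.Ioo (k + 1) (k + 1 + (N : ℤ)) = insert (k + (N : ℤ)) J := by
    ext i; simp only [hJ, Finset.mem_Ioo, Finset.mem_insert]; omega
  have n1 : k + 1 ∉ J := by simp [hJ]
  have n2 : k + (N : ℤ) ∉ J := by simp [hJ]
  have hb1 : |g (k + 1)| ≤ B :=
    hS.abs_le_of_mem (hx.sub_mem_Ioo (by rw [e1]; simp)) (hg _ (by rw [e1]; simp))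
  have hb2 : |g' (k + N)| ≤ B :=
    hS.abs_le_of_mem (hx.sub_mem_Ioo (by rw [e2]; simp)) (hg' _ (by rw [e2]; simp))
  -- A pair straddles the jump only if the particle lies in `[x k + L/2, x (k+1) + L/2]`. This
  -- interval is as long as the smallest gap, so only `j₀` and `j₀ + 1` can lie in it.
  obtain ⟨j₀, hj₀⟩ := hx.exists_cell (x k + L / 2)
  have hJb : ∀ j ∈ J, |g' j - g j| ≤ Λ * (x (k + 1) - x k) +
      ((if j = j₀ then 2 * B else 0) + (if j = j₀ + 1 then 2 * B else 0)) := by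
    intro j hj
    have hjm1 : j ∈ Finset.Ioo k (k + (N : ℤ)) := by rw [e1]; exact Finset.mem_insert_of_mem hj
    have hjm2 : j ∈ Finset.Ioo (k + 1) (k + 1 + (N : ℤ)) := by
      rw [e2]; exact Finset.mem_insert_of_mem hj
    have hz1 := hx.sub_mem_Ioo hjm1
    have hz2 := hx.sub_mem_Ioo hjm2
    have h0 : 0 ≤ (if j = j₀ then 2 * B else 0) := by split_ifs <;> positivity
    have h0' : 0 ≤ (if j = j₀ + 1 then 2 * B else 0) := by split_ifs <;> positivity
    by_cases hgood : (x (k + 1) - x j ∈ Ioo (-L) (-(L / 2)) ∧ x k - x j ∈ Ioo (-L) (-(L / 2))) ∨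
      (x (k + 1) - x j ∈ Ioo (-(L / 2)) 0 ∧ x k - x j ∈ Ioo (-(L / 2)) 0)
    · have := hS.abs_sub_le_of_mem (hg' j hjm2) (hg j hjm1) hgood
      rw [show x (k + 1) - x j - (x k - x j) = x (k + 1) - x k by ring, abs_of_pos hd] at this
      linarith
    · have h3 : x k + L / 2 ≤ x j ∧ x j ≤ x (k + 1) + L / 2 := by
        by_contra hcon
        apply hgood
        rw [not_and_or, not_le, not_le] at hcon
        rcases hcon with h | h
        · right; exact ⟨⟨by linarith, hz2.2⟩, ⟨by linarith, hz1.2⟩⟩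
        · left; exact ⟨⟨hz2.1, by linarith⟩, ⟨hz1.1, by linarith⟩⟩
      have h4 : j₀ ≤ j := hx.strictMono.le_iff_le.1 (hj₀.1.trans h3.1)
      have h5 : j < j₀ + 1 + 1 := by
        refine hx.strictMono.lt_iff_lt.1 (h3.2.trans_lt ?_)
        have := hmin (j₀ + 1)
        linarith [hj₀.2]
      have h6 : |g' j - g j| ≤ 2 * B := by
        refine (abs_sub _ _).trans ?_
        linarith [hS.abs_le_of_mem hz1 (hg j hjm1), hS.abs_le_of_mem hz2 (hg' j hjm2)]
      have h7 : j = j₀ ∨ j = j₀ + 1 := by omega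
      have h8 : 0 ≤ Λ * (x (k + 1) - x k) := by positivity
      rcases h7 with h7 | h7
      · rw [if_pos h7]; linarith
      · rw [if_pos h7]; linarith
  have hsum : |∑ j ∈ J, (g' j - g j)| ≤ N * (Λ * (x (k + 1) - x k)) + 4 * B := by
    refine (Finset.abs_sum_le_sum_abs _ _).trans ((Finset.sum_le_sum hJb).trans ?_)
    rw [Finset.sum_add_distrib, Finset.sum_add_distrib, Finset.sum_const, nsmul_eq_mul,
      Finset.sum_ite_eq', Finset.sum_ite_eq']
    have h1 : (J.card : ℝ) ≤ N := by
      rw [hJ, Int.card_Ioo]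
      have : (k + (N : ℤ) - (k + 1) - 1).toNat ≤ N := by omega
      exact_mod_cast this
    have h3 : (if j₀ ∈ J then 2 * B else 0) ≤ 2 * B := by split_ifs <;> linarith
    have h4 : (if j₀ + 1 ∈ J then 2 * B else 0) ≤ 2 * B := by split_ifs <;> linarith
    have h5 : (J.card : ℝ) * (Λ * (x (k + 1) - x k)) ≤ N * (Λ * (x (k + 1) - x k)) := by gcongr
    linarith
  rw [Finset.sum_sub_distrib] at hsum
  rw [e1, e2, Finset.sum_insert n1, Finset.sum_insert n2]
  -- The constant `6 * B` consists of `2 * B` for each of the two exceptional particles and `B` for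
  -- each of the two unpaired terms.
  have hfin : (g' (k + N) + ∑ j ∈ J, g' j) - (g (k + 1) + ∑ j ∈ J, g j) ≤
      6 * B + N * (Λ * (x (k + 1) - x k)) := by
    have := (abs_le.1 hsum).2
    have := (abs_le.1 hb1).1
    have := (abs_le.1 hb2).2
    linarith
  have hcN : 0 < c / N := div_pos hc hN
  have h9 := mul_le_mul_of_nonneg_left hfin hcN.le
  have h10 : c / N * (6 * B + N * (Λ * (x (k + 1) - x k))) =
      6 * B * (c / N) + c * Λ * (x (k + 1) - x k) := by field_simp
  rw [h10] at h9
  linarith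

/-- The interaction velocity is close to the convolution of the force with the density. -/
theorem IsForceSum.abs_add_integral_le {k : ℤ} {v : ℝ} (hv : IsForceSum S c N x k v)
    (hS : TorusForce S f L B Λ κ) (hx : PeriodicConfig L N x) (hc : 0 < c) :
    |v + ∫ y in x k..x k + L, particleDensity c N x y * f (x k - y)| ≤
      (c / N) * (Λ * L + 4 * B) := by
  obtain ⟨g, hg, rfl⟩ := hv
  have hN := hx.cast_pos
  have hB := hS.bound_nonneg
  have hΛ := hS.lip_nonneg
  have hL := hx.length_pos
  have hcN : 0 < c / N := div_pos hc hN
  have hint : ∀ a b, IntervalIntegrable (fun y => particleDensity c N x y * f (x k - y)) volume a b := by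
    intro a b
    rw [intervalIntegrable_iff]
    have h1 := (hx.intervalIntegrable_density (c := c) a b)
    rw [intervalIntegrable_iff] at h1
    exact h1.mul_bdd (c := B) ((hS.measurable.comp (by fun_prop)).aestronglyMeasurable)
      (ae_of_all _ fun y => hS.bound _)
  have h1 := intervalIntegral.sum_integral_adjacent_intervals (μ := volume)
    (f := fun y => particleDensity c N x y * f (x k - y)) (a := fun j : ℕ => x (k + j)) (n := N)
    (fun _ _ => hint _ _)
  simp only [Nat.cast_zero, add_zero, hx.per] at h1
  -- Adding a zero self-force matches the `N` cells with `N` terms. The price is an error of at most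
  -- `2 * B` in the cell `j = 0`, next to the singularity.
  set G : ℤ → ℝ := fun j => if j = k then 0 else g j with hG
  have h2 : ∑ j ∈ Finset.Ioo k (k + (N : ℤ)), g j = ∑ j ∈ Finset.range N, G (k + j) := by
    rw [← sum_Ico_int_eq_sum_range]
    have : Finset.Ico k (k + (N : ℤ)) = insert k (Finset.Ioo k (k + (N : ℤ))) := by
      have := hx.pos
      ext i; simp only [Finset.mem_Ico, Finset.mem_Ioo, Finset.mem_insert]; omega
    rw [this, Finset.sum_insert (by simp)]
    simp only [hG, if_true, zero_add]
    refine Finset.sum_congr rfl fun j hj => ?_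
    rw [Finset.mem_Ioo] at hj
    rw [if_neg (by omega)]
  -- The cell of the antipodal point may contain the jump of the force and also costs `2 * B`; on
  -- every other cell the Lipschitz bound applies.
  obtain ⟨j₀, hj₀⟩ := hx.exists_cell (x k + L / 2)
  have hcell : ∀ j ∈ Finset.range N,
      |(∫ y in x (k + j)..x (k + (j + 1 : ℕ)), particleDensity c N x y * f (x k - y)) -
        c / N * G (k + j)| ≤ c / N * (Λ * (x (k + (j + 1 : ℕ)) - x (k + j)) +
          ((if j = 0 then 2 * B else 0) + (if k + (j : ℤ) = j₀ then 2 * B else 0))) := by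
    intro j hj
    rw [Finset.mem_range] at hj
    set i := k + (j : ℤ) with hi
    have hi1 : k + ((j + 1 : ℕ) : ℤ) = i + 1 := by push_cast; rw [hi]; ring
    rw [hi1]
    have hlt := hx.lt i
    set R := Λ * (x (i + 1) - x i) +
          ((if j = 0 then 2 * B else 0) + (if i = j₀ then 2 * B else 0)) with hR
    have hGB : |G i| ≤ B := by
      simp only [hG]
      split_ifs with h
      · simpa using hB
      · have hm : i ∈ Finset.Ioo k (k + (N : ℤ)) := by rw [Finset.mem_Ioo]; omega
        exact hS.abs_le_of_mem (hx.sub_mem_Ioo hm) (hg i hm)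
    have hR1 : 0 ≤ Λ * (x (i + 1) - x i) := mul_nonneg hΛ (by linarith)
    have hR2 : 0 ≤ (if j = 0 then 2 * B else 0) := by split_ifs <;> positivity
    have hR3 : 0 ≤ (if i = j₀ then 2 * B else 0) := by split_ifs <;> positivity
    have hpt : ∀ y ∈ Ioo (x i) (x (i + 1)), |f (x k - y) - G i| ≤ R := by
      intro y hy
      have htriv : |f (x k - y) - G i| ≤ 2 * B := by
        refine (abs_sub _ _).trans ?_
        linarith [hS.bound (x k - y)]
      by_cases hj0 : j = 0
      · rw [hR, if_pos hj0]; linarith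
      by_cases hij : i = j₀
      · rw [hR, if_pos hij]; linarith
      have hm : i ∈ Finset.Ioo k (k + (N : ℤ)) := by rw [Finset.mem_Ioo]; omega
      have hz := hx.sub_mem_Ioo hm
      have hGi : G i = g i := by simp only [hG]; rw [if_neg (by omega)]
      have hle : x (i + 1) ≤ x k + L := by
        rw [← hx.per]; exact hx.strictMono.monotone (by rw [Finset.mem_Ioo] at hm; omega)
      have hki : x k ≤ x i := hx.strictMono.monotone (by omega)
      have hmain : |f (x k - y) - G i| ≤ Λ * |(x k - y) - (x k - x i)| := by
        rw [hGi]
        rcases lt_or_gt_of_ne hij with h | h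
        · have h3 : x (i + 1) ≤ x k + L / 2 := (hx.strictMono.monotone (by omega)).trans hj₀.1
          have hm1 : x k - x i ∈ Ioo (-(L / 2)) 0 := ⟨by linarith, hz.2⟩
          have hgi := hg i hm
          rw [hS.eq_singleton _ hz hm1.1.ne', mem_singleton_iff] at hgi
          rw [hgi]
          exact hS.lip_right _ ⟨by linarith [hy.2], by linarith [hy.1]⟩ _ hm1
        · have h3 : x k + L / 2 < x i := hj₀.2.trans_le (hx.strictMono.monotone (by omega))
          have hm1 : x k - x i ∈ Ioo (-L) (-(L / 2)) := ⟨hz.1, by linarith⟩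
          have hgi := hg i hm
          rw [hS.eq_singleton _ hz hm1.2.ne, mem_singleton_iff] at hgi
          rw [hgi]
          exact hS.lip_left _ ⟨by linarith [hy.2], by linarith [hy.1]⟩ _ hm1
      refine hmain.trans ?_
      have : |(x k - y) - (x k - x i)| ≤ x (i + 1) - x i := by
        rw [show (x k - y) - (x k - x i) = -(y - x i) by ring, abs_neg,
          abs_of_pos (by linarith [hy.1])]
        linarith [hy.2]
      have := mul_le_mul_of_nonneg_left this hΛ
      linarith
    have h3 : (∫ y in x i..x (i + 1), particleDensity c N x y * f (x k - y)) - c / N * G i =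
        ∫ y in x i..x (i + 1), particleDensity c N x y * (f (x k - y) - G i) := by
      rw [← hx.integral_density_cell (c := c) i, ← intervalIntegral.integral_mul_const,
        ← intervalIntegral.integral_sub (hint _ _) ((hx.intervalIntegrable_density _ _).mul_const _)]
      simp only [mul_sub]
    have h4 : c / N * R = ∫ y in x i..x (i + 1), particleDensity c N x y * R := by
      rw [intervalIntegral.integral_mul_const, hx.integral_density_cell]
    rw [h3, h4, ← Real.norm_eq_abs]
    refine intervalIntegral.norm_integral_le_of_norm_le hlt.le ?_
      ((hx.intervalIntegrable_density _ _).mul_const _)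
    filter_upwards [Measure.ae_ne volume (x (i + 1))] with y hy hmem
    rw [Real.norm_eq_abs, abs_mul, abs_of_pos (hx.density_pos hc y)]
    exact mul_le_mul_of_nonneg_left (hpt y ⟨hmem.1, lt_of_le_of_ne hmem.2 hy⟩)
      (hx.density_pos hc y).le
  rw [h2, ← h1, neg_mul, neg_add_eq_sub, Finset.mul_sum, ← Finset.sum_sub_distrib]
  refine (Finset.abs_sum_le_sum_abs _ _).trans ((Finset.sum_le_sum hcell).trans ?_)
  rw [← Finset.mul_sum]
  refine mul_le_mul_of_nonneg_left ?_ hcN.le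
  rw [Finset.sum_add_distrib, Finset.sum_add_distrib, ← Finset.mul_sum]
  have h5 : ∑ j ∈ Finset.range N, (x (k + (j + 1 : ℕ)) - x (k + j)) = L := by
    have := Finset.sum_range_sub (fun j : ℕ => x (k + j)) N
    rw [this, hx.per]; simp
  have h6 : ∑ j ∈ Finset.range N, (if j = 0 then 2 * B else 0) ≤ 2 * B := by
    rw [Finset.sum_ite_eq']; split_ifs <;> linarith
  have h7 : ∑ j ∈ Finset.range N, (if k + (j : ℤ) = j₀ then 2 * B else 0) ≤ 2 * B := by
    have : ∀ j : ℕ, (if k + (j : ℤ) = j₀ then 2 * B else 0) ≤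
        if j = (j₀ - k).toNat then 2 * B else 0 := by
      intro j
      split_ifs <;> first | omega | linarith
    refine (Finset.sum_le_sum fun j _ => this j).trans ?_
    rw [Finset.sum_ite_eq']; split_ifs <;> linarith
  rw [h5]
  linarith

end ForceSum

/-! ### The nonlinear diffusion and its energy. -/

namespace AdmissibleDiffusion

variable {φ W : ℝ → ℝ}

theorem continuousOn (h : AdmissibleDiffusion φ W) : ContinuousOn φ (Ici 0) :=
  h.contDiffOn.continuousOn

theorem nonneg (h : AdmissibleDiffusion φ W) {r : ℝ} (hr : 0 ≤ r) : 0 ≤ φ r := by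
  rw [← h.map_zero]
  exact h.strictMonoOn.monotoneOn self_mem_Ici hr hr

theorem mono (h : AdmissibleDiffusion φ W) {r s : ℝ} (hr : 0 ≤ r) (hrs : r ≤ s) : φ r ≤ φ s :=
  h.strictMonoOn.monotoneOn hr (hr.trans hrs) hrs

theorem hasDerivAt_W (h : AdmissibleDiffusion φ W) {r : ℝ} (hr : 0 < r) :
    HasDerivAt W (deriv W r) r :=
  ((h.W_differentiableOn r hr).differentiableAt (Ioi_mem_nhds hr)).hasDerivAt

theorem hasDerivAt_W_div (h : AdmissibleDiffusion φ W) {r : ℝ} (hr : 0 < r) :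
    HasDerivAt (fun r => W r / r) (φ r / r ^ 2) r := by
  have := (h.hasDerivAt_W hr).div (hasDerivAt_id r) hr.ne'
  refine this.congr_deriv ?_
  rw [h.eq_W r hr]
  simp; ring

/-- A gap of mass `μ` and density `r` has energy `μ * (W r / r)`; with this monotonicity the density
bound alone controls the initial energy. -/
theorem W_div_mono (h : AdmissibleDiffusion φ W) {r s : ℝ} (hr : 0 < r) (hrs : r ≤ s) :
    W r / r ≤ W s / s := by
  refine monotoneOn_of_deriv_nonneg (convex_Ioi 0)
    (fun x hx => (h.hasDerivAt_W_div hx).continuousAt.continuousWithinAt) (fun x hx => ?_)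
    (fun x hx => ?_) hr (hr.trans_le hrs) hrs
  · rw [interior_Ioi] at hx
    exact (h.hasDerivAt_W_div hx).differentiableAt.differentiableWithinAt
  · rw [interior_Ioi] at hx
    rw [(h.hasDerivAt_W_div hx).deriv]
    exact div_nonneg (h.nonneg (le_of_lt hx)) (sq_nonneg _)

/-- The energy of a gap of length `d` carrying the mass `μ`. -/
theorem hasDerivAt_gapEnergy (h : AdmissibleDiffusion φ W) {μ d : ℝ} (hμ : 0 < μ) (hd : 0 < d) :
    HasDerivAt (fun d => d * W (μ / d)) (-φ (μ / d)) d := by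
  have hr : 0 < μ / d := div_pos hμ hd
  have h1 : HasDerivAt (fun d => μ / d) (-(μ / d ^ 2)) d := by
    have := (hasDerivAt_inv hd.ne').const_mul μ
    simp only [← div_eq_mul_inv] at this
    refine this.congr_deriv ?_
    field_simp
  have h2 := (hasDerivAt_id d).mul ((h.hasDerivAt_W hr).comp d h1)
  refine h2.congr_deriv ?_
  rw [h.eq_W _ hr]
  simp only [Function.comp, id]
  field_simp
  ring

theorem exists_lipschitz (h : AdmissibleDiffusion φ W) (M : ℝ) :
    ∃ C, 0 ≤ C ∧ ∀ r s, r ∈ Icc 0 M → s ∈ Icc 0 M → |φ r - φ s| ≤ C * |r - s| := by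
  have h1 : ContDiffOn ℝ 1 φ (Icc 0 M) := h.contDiffOn.mono Icc_subset_Ici_self
  obtain ⟨K, hK⟩ := h1.exists_lipschitzOnWith one_ne_zero (convex_Icc 0 M) isCompact_Icc
  exact ⟨K, K.2, fun r s hr hs => hK.dist_le_mul r hr s hs⟩

/-- Densities are controlled by differences of `φ`, up to an arbitrarily small error. -/
theorem exists_abs_sub_le (h : AdmissibleDiffusion φ W) (M : ℝ) {ε : ℝ} (hε : 0 < ε) :
    ∃ C, 0 ≤ C ∧ ∀ r s, r ∈ Icc 0 M → s ∈ Icc 0 M → |r - s| ≤ ε + C * |φ r - φ s| := by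
  by_cases hne : ∃ p : ℝ × ℝ, p ∈ {p : ℝ × ℝ | p.1 ∈ Icc 0 M ∧ p.2 ∈ Icc 0 M ∧ ε ≤ |p.1 - p.2|}
  · have hcomp : IsCompact {p : ℝ × ℝ | p.1 ∈ Icc 0 M ∧ p.2 ∈ Icc 0 M ∧ ε ≤ |p.1 - p.2|} := by
      have h1 : IsCompact (Icc (0 : ℝ) M ×ˢ Icc (0 : ℝ) M) := isCompact_Icc.prod isCompact_Icc
      have h2 : IsClosed {p : ℝ × ℝ | ε ≤ |p.1 - p.2|} :=
        isClosed_le continuous_const (by fun_prop)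
      convert h1.inter_right h2 using 1
      ext p; simp only [mem_inter_iff, mem_prod, mem_ofPred_eq, and_assoc]
    have hcont : ContinuousOn (fun p : ℝ × ℝ => |φ p.1 - φ p.2|)
        {p : ℝ × ℝ | p.1 ∈ Icc 0 M ∧ p.2 ∈ Icc 0 M ∧ ε ≤ |p.1 - p.2|} := by
      refine ContinuousOn.abs (ContinuousOn.sub ?_ ?_)
      · exact h.continuousOn.comp continuousOn_fst fun p hp => hp.1.1
      · exact h.continuousOn.comp continuousOn_snd fun p hp => hp.2.1.1
    obtain ⟨p, hp, hmin⟩ := hcomp.exists_isMinOn hne hcont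
    have hpos : 0 < |φ p.1 - φ p.2| := by
      rw [abs_pos, sub_ne_zero]
      intro heq
      have := h.strictMonoOn.injOn hp.1.1 hp.2.1.1 heq
      have h3 := hp.2.2
      rw [this] at h3
      simp at h3
      linarith
    have hM : 0 ≤ M := hp.1.1.trans hp.1.2
    -- On pairs at distance at least `ε`, a compact set, `|φ r - φ s|` has a positive minimum while
    -- `|r - s| ≤ M`. For the remaining pairs `ε` alone suffices.
    refine ⟨M / |φ p.1 - φ p.2|, div_nonneg hM hpos.le, fun r s hr hs => ?_⟩
    by_cases hrs : ε ≤ |r - s|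
    · have h4 : |φ p.1 - φ p.2| ≤ |φ r - φ s| := isMinOn_iff.1 hmin (r, s) ⟨hr, hs, hrs⟩
      have h5 : |r - s| ≤ M := by
        rw [abs_le]; constructor <;> linarith [hr.1, hr.2, hs.1, hs.2]
      have h6 : M ≤ M / |φ p.1 - φ p.2| * |φ r - φ s| := by
        rw [div_mul_eq_mul_div, le_div_iff₀ hpos]
        gcongr
      linarith
    · have : 0 ≤ M / |φ p.1 - φ p.2| * |φ r - φ s| := by positivity
      linarith [not_le.1 hrs]
  · refine ⟨0, le_rfl, fun r s hr hs => ?_⟩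
    have : ¬ ε ≤ |r - s| := fun h => hne ⟨(r, s), hr, hs, h⟩
    linarith [not_le.1 this]

end AdmissibleDiffusion

/-! ### Operations on Lipschitz curves. -/

section Lipschitz

theorem exists_lipschitzOnWith_iff {g : ℝ → ℝ} {s : Set ℝ} :
    (∃ C, LipschitzOnWith C g s) ↔ ∃ C : ℝ, 0 ≤ C ∧ ∀ a ∈ s, ∀ b ∈ s, |g a - g b| ≤ C * |a - b| := by
  constructor
  · rintro ⟨C, hC⟩
    exact ⟨C, C.2, fun a ha b hb => hC.dist_le_mul a ha b hb⟩
  · rintro ⟨C, hC0, hC⟩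
    refine ⟨C.toNNReal, LipschitzOnWith.of_dist_le_mul fun a ha b hb => ?_⟩
    rw [Real.coe_toNNReal _ hC0]; exact hC a ha b hb

theorem exists_lipschitzOnWith_sub {g h : ℝ → ℝ} {s : Set ℝ} (hg : ∃ C, LipschitzOnWith C g s)
    (hh : ∃ C, LipschitzOnWith C h s) : ∃ C, LipschitzOnWith C (fun t => g t - h t) s := by
  obtain ⟨C, hC⟩ := hg
  obtain ⟨D, hD⟩ := hh
  exact ⟨C + D, hC.sub hD⟩

theorem exists_lipschitzOnWith_sum {ι : Type*} {g : ι → ℝ → ℝ} {s : Set ℝ} (J : Finset ι)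
    (hg : ∀ i ∈ J, ∃ C, LipschitzOnWith C (g i) s) :
    ∃ C, LipschitzOnWith C (fun t => ∑ i ∈ J, g i t) s := by
  classical
  induction J using Finset.induction_on with
  | empty => exact ⟨0, by simp⟩
  | insert i J hi ih =>
    obtain ⟨C, hC⟩ := hg i (Finset.mem_insert_self _ _)
    obtain ⟨D, hD⟩ := ih fun j hj => hg j (Finset.mem_insert_of_mem hj)
    refine ⟨C + D, ?_⟩
    simp only [Finset.sum_insert hi]
    exact hC.add hD

theorem exists_lipschitzOnWith_comp {H H' g : ℝ → ℝ} {s : Set ℝ} {p q C : ℝ}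
    (hH : ∀ d ∈ Icc p q, HasDerivAt H (H' d) d) (hC : ∀ d ∈ Icc p q, |H' d| ≤ C)
    (hmaps : ∀ t ∈ s, g t ∈ Icc p q) (hg : ∃ C, LipschitzOnWith C g s) :
    ∃ C, LipschitzOnWith C (fun t => H (g t)) s := by
  obtain ⟨D, hD⟩ := hg
  have h1 : LipschitzOnWith C.toNNReal H (Icc p q) := by
    refine (convex_Icc p q).lipschitzOnWith_of_nnnorm_hasDerivWithin_le (f' := H')
      (fun d hd => (hH d hd).hasDerivWithinAt) fun d hd => ?_
    rw [← NNReal.coe_le_coe, coe_nnnorm]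
    exact (hC d hd).trans (Real.le_coe_toNNReal C)
  exact ⟨_, h1.comp hD hmaps⟩

theorem ae_differentiableAt_of_lipschitzOnWith {g : ℝ → ℝ} {a b : ℝ}
    (hg : ∃ C, LipschitzOnWith C g (Icc a b)) :
    ∀ᵐ t ∂(volume.restrict (Icc a b)), t ∈ Ioo a b ∧ DifferentiableAt ℝ g t := by
  obtain ⟨C, hC⟩ := hg
  rw [ae_restrict_iff' measurableSet_Icc]
  filter_upwards [hC.ae_differentiableWithinAt_of_mem, Measure.ae_ne volume a,
    Measure.ae_ne volume b] with t h1 h2 h3 ht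
  have hmem : t ∈ Ioo a b := ⟨lt_of_le_of_ne ht.1 h2.symm, lt_of_le_of_ne ht.2 h3⟩
  exact ⟨hmem, (h1 ht).differentiableAt (Icc_mem_nhds hmem.1 hmem.2)⟩

end Lipschitz

/-! ### Particle flows and energy dissipation. -/

/-- Particle systems, with the interaction velocities made explicit. -/
structure ParticleFlow (φ : ℝ → ℝ) (S : ℝ → Set ℝ) (T L c : ℝ) (N : ℕ) (x : ℤ → ℝ → ℝ) : Prop where
  per : ∀ k t, x (k + N) t = x k t + L
  config : ∀ t ∈ Icc 0 T, PeriodicConfig L N fun k => x k t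
  lip : ∀ k, ∃ C, LipschitzOnWith C (x k) (Icc 0 T)
  ode : ∀ᵐ t ∂(volume.restrict (Icc 0 T)), ∃ v : ℤ → ℝ, ∀ k,
    IsForceSum S c N (fun i => x i t) k (v k) ∧
    HasDerivAt (x k) (v k - (N / c) *
      (φ (cellDensity c N (fun i => x i t) k) - φ (cellDensity c N (fun i => x i t) (k - 1)))) t

theorem IsParticleSystem.particleFlow {φ ρ₀ : ℝ → ℝ} {F : ℝ → ℝ → Set ℝ} {T L : ℝ} {N : ℕ}
    {x : ℤ → ℝ → ℝ} (h : IsParticleSystem φ ρ₀ F T L N x) (hN : 0 < N) :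
    ParticleFlow φ (F L) T L (cutMass ρ₀ L) N x := by
  refine ⟨h.lift, fun t ht => ⟨hN, fun k => h.lift k t, fun k => h.ordered t ht k⟩, h.lipschitz, ?_⟩
  filter_upwards [ae_all_iff.2 h.ode] with t ht
  choose g hg using ht
  exact ⟨fun k => -(cutMass ρ₀ L / N) * ∑ j ∈ Finset.Ioo k (k + (N : ℤ)), g k j,
    fun k => ⟨⟨g k, (hg k).1, rfl⟩, (hg k).2⟩⟩

noncomputable section

/-- The total variation of `φ` of the density over a period. -/
def cellVariation (φ : ℝ → ℝ) (c : ℝ) (N : ℕ) (x : ℤ → ℝ) : ℝ :=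
  ∑ k ∈ Finset.range N, |φ (cellDensity c N x k) - φ (cellDensity c N x (k - 1))|

/-- The dissipation of the diffusion. -/
def cellDissipation (φ : ℝ → ℝ) (c : ℝ) (N : ℕ) (x : ℤ → ℝ) : ℝ :=
  ∑ k ∈ Finset.range N, N / c * (φ (cellDensity c N x k) - φ (cellDensity c N x (k - 1))) ^ 2

end

theorem cellVariation_nonneg (φ : ℝ → ℝ) (c : ℝ) (N : ℕ) (x : ℤ → ℝ) :
    0 ≤ cellVariation φ c N x := Finset.sum_nonneg fun _ _ => abs_nonneg _

/-- Young's inequality with weight `l` in each term. The weight stays free because the dissipation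
is only integrable in time: a small `l` makes its contribution small on every time interval. -/
theorem cellVariation_le {φ : ℝ → ℝ} {c : ℝ} {N : ℕ} {x : ℤ → ℝ} (hc : 0 < c) (hN : 0 < N) {l : ℝ}
    (hl : 0 < l) : cellVariation φ c N x ≤ l * cellDissipation φ c N x + c / (4 * l) := by
  have hNr : (0 : ℝ) < N := by exact_mod_cast hN
  have h1 : ∀ a : ℝ, |a| ≤ l * (N / c * a ^ 2) + c / N * (1 / (4 * l)) := by
    intro a
    have h2 : l * (N / c * a ^ 2) + c / N * (1 / (4 * l)) - |a| =
        l * N / c * (|a| - c / (2 * l * N)) ^ 2 := by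
      have : a ^ 2 = |a| ^ 2 := (sq_abs a).symm
      rw [this]
      field_simp
      ring
    have h3 : 0 ≤ l * N / c * (|a| - c / (2 * l * N)) ^ 2 := by positivity
    linarith
  refine (Finset.sum_le_sum fun k _ => h1 _).trans (le_of_eq ?_)
  rw [Finset.sum_add_distrib, ← Finset.mul_sum, cellDissipation, Finset.sum_const,
    Finset.card_range, nsmul_eq_mul]
  field_simp

/-- Some gap is at least the average `L / N`, so the density there is at most `c / L`; the other
cells are reached from it at the cost of the variation. -/
theorem PeriodicConfig.map_cellDensity_le {φ W : ℝ → ℝ} (hφ : AdmissibleDiffusion φ W) {L c : ℝ}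
    {N : ℕ} {x : ℤ → ℝ} (hx : PeriodicConfig L N x) (hc : 0 < c) (k : ℤ) :
    φ (cellDensity c N x k) ≤ φ (c / L) + cellVariation φ c N x := by
  have hN := hx.cast_pos
  have hL := hx.length_pos
  obtain ⟨j, hj, hjd⟩ : ∃ j ∈ Finset.range N, L / N ≤ x ((j : ℤ) + 1) - x j := by
    by_contra hcon
    push Not at hcon
    have h1 := Finset.sum_lt_sum_of_nonempty (Finset.nonempty_range_iff.2 hx.pos.ne') hcon
    rw [hx.sum_gap, Finset.sum_const, Finset.card_range, nsmul_eq_mul, mul_div_cancel₀ _ hN.ne'] at h1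
    exact lt_irrefl _ h1
  have h2 : φ (cellDensity c N x j) ≤ φ (c / L) := by
    refine hφ.mono (hx.cellDensity_pos hc _).le ?_
    rw [cellDensity]
    refine div_le_div_of_nonneg_left hc.le hL ?_
    rw [div_le_iff₀ hN] at hjd
    linarith
  have hN' : (0 : ℤ) < N := by exact_mod_cast hx.pos
  set D : ℤ → ℝ := fun k => |φ (cellDensity c N x k) - φ (cellDensity c N x (k - 1))| with hD
  have hDper : ∀ k, D (k + N) = D k := by
    intro k
    simp only [hD]
    rw [hx.cellDensity_per, show k + (N : ℤ) - 1 = k - 1 + N by ring, hx.cellDensity_per]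
  obtain ⟨n, hn, q, hq⟩ : ∃ n : ℕ, n ≤ N ∧ ∃ q : ℤ, k = j + n + q * N := by
    have h1 := Int.emod_nonneg (k - j) hN'.ne'
    have h3 := Int.emod_lt_of_pos (k - j) hN'
    refine ⟨((k - j) % N).toNat, by omega, (k - j) / N, ?_⟩
    rw [Int.toNat_of_nonneg h1]
    have := Int.emod_add_mul_ediv (k - j) N
    linarith
  have hρ : cellDensity c N x k = cellDensity c N x (j + n) := by
    have h5 := hx.per_mul (j + n) q
    have h6 := hx.per_mul (j + n + 1) q
    rw [cellDensity, cellDensity, hq, h5, show (j : ℤ) + n + q * N + 1 = j + n + 1 + q * N by ring, h6]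
    congr 2; ring
  have htel : φ (cellDensity c N x (j + n)) - φ (cellDensity c N x j) ≤
      ∑ i ∈ Finset.range n, D (j + 1 + i) := by
    have h1 := Finset.sum_range_sub (fun i : ℕ => φ (cellDensity c N x (j + i))) n
    simp only [Nat.cast_zero, add_zero] at h1
    rw [← h1]
    refine Finset.sum_le_sum fun i _ => ?_
    simp only [hD]
    rw [show (j : ℤ) + ((i + 1 : ℕ) : ℤ) = j + 1 + i by push_cast; ring,
      show (j : ℤ) + 1 + (i : ℤ) - 1 = j + i by ring]
    exact le_abs_self _
  have hle : ∑ i ∈ Finset.range n, D (j + 1 + i) ≤ cellVariation φ c N x := by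
    rw [cellVariation, ← sum_range_add_int hDper (j + 1)]
    exact Finset.sum_le_sum_of_subset_of_nonneg (Finset.range_mono hn) fun _ _ _ => abs_nonneg _
  rw [hρ]
  linarith

/-- The algebra behind the energy dissipation. -/
theorem sum_neg_mul_sub_le {N : ℕ} {c b : ℝ} (hc : 0 < c) (hN : 0 < N) {Φ v a : ℤ → ℝ}
    (hΦ : ∀ k, Φ (k + N) = Φ k) (haper : ∀ k, a (k + N) = a k)
    (ha : ∀ k, a k = v k - N / c * (Φ k - Φ (k - 1))) (hv : ∀ k, |v k| ≤ b) :
    ∑ k ∈ Finset.range N, -Φ k * (a (k + 1) - a k) ≤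
      c * b ^ 2 / 2 - 1 / 2 * ∑ k ∈ Finset.range N, N / c * (Φ k - Φ (k - 1)) ^ 2 := by
  have hNr : (0 : ℝ) < N := by exact_mod_cast hN
  set q : ℤ → ℝ := fun k => Φ (k - 1) * a k with hqdef
  have hq : ∀ k, q (k + N) = q k := by
    intro k
    simp only [hqdef]
    rw [show k + (N : ℤ) - 1 = k - 1 + N by ring, hΦ, haper]
  have hsh := sum_range_add_int hq 1
  -- Summation by parts on the cycle.
  have hre : ∑ k ∈ Finset.range N, -Φ k * (a (k + 1) - a k) =
      ∑ k ∈ Finset.range N, a k * (Φ k - Φ (k - 1)) := by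
    have h5 : ∑ k ∈ Finset.range N, (q (1 + k) - q k) = 0 := by
      rw [Finset.sum_sub_distrib, hsh, sub_self]
    rw [← sub_eq_zero, ← Finset.sum_sub_distrib, ← neg_eq_zero, ← Finset.sum_neg_distrib, ← h5]
    refine Finset.sum_congr rfl fun k _ => ?_
    simp only [hqdef]
    rw [show (1 : ℤ) + k - 1 = k by ring, add_comm (1 : ℤ)]
    ring
  rw [hre]
  have hterm : ∀ k ∈ Finset.range N, a k * (Φ k - Φ (k - 1)) ≤
      c / N * b ^ 2 / 2 - 1 / 2 * (N / c * (Φ k - Φ (k - 1)) ^ 2) := by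
    intro k _
    have hv2 : v k ^ 2 ≤ b ^ 2 := by
      rw [← sq_abs]; exact pow_le_pow_left₀ (abs_nonneg _) (hv k) 2
    rw [ha]
    set D := Φ k - Φ (k - 1)
    -- Young's inequality in the form of a completed square.
    have h7 : c / N * v k ^ 2 / 2 - 1 / 2 * (N / c * D ^ 2) - (v k - N / c * D) * D =
        N / (2 * c) * (c / N * v k - D) ^ 2 := by
      field_simp; ring
    have h8 : 0 ≤ N / (2 * c) * (c / N * v k - D) ^ 2 := by positivity
    have h9 : c / N * v k ^ 2 / 2 ≤ c / N * b ^ 2 / 2 := by gcongr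
    linarith
  refine (Finset.sum_le_sum hterm).trans (le_of_eq ?_)
  rw [Finset.sum_sub_distrib, ← Finset.mul_sum, Finset.sum_const, Finset.card_range,
    nsmul_eq_mul]
  congr 1
  field_simp

namespace ParticleFlow

variable {φ W f : ℝ → ℝ} {S : ℝ → Set ℝ} {T L c B Λ κ : ℝ} {N : ℕ} {x : ℤ → ℝ → ℝ}

theorem continuousOn (h : ParticleFlow φ S T L c N x) (k : ℤ) : ContinuousOn (x k) (Icc 0 T) := by
  obtain ⟨C, hC⟩ := h.lip k
  exact hC.continuousOn

theorem continuousOn_cellDensity (h : ParticleFlow φ S T L c N x) (k : ℤ) :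
    ContinuousOn (fun t => cellDensity c N (fun i => x i t) k) (Icc 0 T) := by
  unfold cellDensity
  refine continuousOn_const.div (continuousOn_const.mul
    ((h.continuousOn _).sub (h.continuousOn _))) fun t ht => ?_
  exact (mul_pos (h.config t ht).cast_pos (sub_pos.2 ((h.config t ht).lt k))).ne'

theorem continuousOn_map_cellDensity (hφ : AdmissibleDiffusion φ W)
    (h : ParticleFlow φ S T L c N x) (hc : 0 < c) (k : ℤ) :
    ContinuousOn (fun t => φ (cellDensity c N (fun i => x i t) k)) (Icc 0 T) :=
  hφ.continuousOn.comp (h.continuousOn_cellDensity k) fun t ht =>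
    ((h.config t ht).cellDensity_pos hc k).le

theorem continuousOn_cellVariation (hφ : AdmissibleDiffusion φ W)
    (h : ParticleFlow φ S T L c N x) (hc : 0 < c) :
    ContinuousOn (fun t => cellVariation φ c N fun i => x i t) (Icc 0 T) :=
  continuousOn_finsetSum _ fun _ _ =>
    ((h.continuousOn_map_cellDensity hφ hc _).sub (h.continuousOn_map_cellDensity hφ hc _)).abs

theorem continuousOn_cellDissipation (hφ : AdmissibleDiffusion φ W)
    (h : ParticleFlow φ S T L c N x) (hc : 0 < c) :
    ContinuousOn (fun t => cellDissipation φ c N fun i => x i t) (Icc 0 T) :=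
  continuousOn_finsetSum _ fun _ _ => continuousOn_const.mul
    (((h.continuousOn_map_cellDensity hφ hc _).sub (h.continuousOn_map_cellDensity hφ hc _)).pow 2)

/-- A qualitative bound by compactness, not uniform in `N`. It only serves to keep the gaps in a
range where the energy and the logarithm are Lipschitz. -/
theorem exists_gap_pos (h : ParticleFlow φ S T L c N x) (hT : 0 ≤ T) :
    ∃ p, 0 < p ∧ ∀ t ∈ Icc 0 T, ∀ k, p ≤ x (k + 1) t - x k t := by
  have hN : 0 < N := (h.config 0 ⟨le_rfl, hT⟩).pos
  have h1 : ∀ k : ℕ, ∃ p, 0 < p ∧ ∀ t ∈ Icc 0 T, p ≤ x ((k : ℤ) + 1) t - x k t := by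
    intro k
    obtain ⟨t₀, ht₀, hmin⟩ := isCompact_Icc.exists_isMinOn (nonempty_Icc.2 hT)
      ((h.continuousOn ((k : ℤ) + 1)).sub (h.continuousOn k))
    exact ⟨_, sub_pos.2 ((h.config t₀ ht₀).lt k), fun t ht => isMinOn_iff.1 hmin t ht⟩
  choose p hp hpt using h1
  refine ⟨(Finset.range N).inf' (Finset.nonempty_range_iff.2 hN.ne') p, ?_, fun t ht k => ?_⟩
  · rw [Finset.lt_inf'_iff]
    exact fun k _ => hp k
  · have hN' : (0 : ℤ) < N := by exact_mod_cast hN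
    have h1 := Int.emod_nonneg k hN'.ne'
    have h2 := Int.emod_lt_of_pos k hN'
    have h3 := (h.config t ht).per_mul (k % N) (k / N)
    have h4 := (h.config t ht).per_mul (k % N + 1) (k / N)
    have h5 : k % N + k / N * N = k := by
      have := Int.emod_add_mul_ediv k N
      linarith
    rw [h5] at h3
    rw [show k % N + 1 + k / N * (N : ℤ) = k + 1 by omega] at h4
    have h6 := hpt (k % N).toNat t ht
    rw [Int.toNat_of_nonneg h1] at h6
    refine (Finset.inf'_le p (Finset.mem_range.2 (show (k % N).toNat < N by omega))).trans ?_
    linarith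

theorem gap_le (h : ParticleFlow φ S T L c N x) {t : ℝ} (ht : t ∈ Icc 0 T) (k : ℤ) :
    x (k + 1) t - x k t ≤ L := by
  have h1 := (h.config t ht).strictMono.monotone (show k + 1 ≤ k + N by
    have := (h.config t ht).pos; omega)
  rw [h.per] at h1
  linarith

/-- The energy dissipation estimate. -/
theorem integral_cellDissipation_le (hφ : AdmissibleDiffusion φ W) (hS : TorusForce S f L B Λ κ)
    (h : ParticleFlow φ S T L c N x) (hc : 0 < c) (hT : 0 ≤ T) {M₀ : ℝ}
    (hM₀ : ∀ k, cellDensity c N (fun i => x i 0) k ≤ M₀) :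
    ∫ t in 0..T, cellDissipation φ c N (fun i => x i t) ≤
      2 * c * (W M₀ / M₀) + T * c * (c * B) ^ 2 := by
  have h0 : (0 : ℝ) ∈ Icc 0 T := ⟨le_rfl, hT⟩
  have hNr := (h.config 0 h0).cast_pos
  have hμ : 0 < c / N := div_pos hc hNr
  obtain ⟨p, hp, hgap⟩ := h.exists_gap_pos hT
  have hden : ∀ k t, cellDensity c N (fun i => x i t) k = c / N / (x (k + 1) t - x k t) := by
    intro k t; rw [cellDensity, div_div]
  -- The energy is Lipschitz in time because all gaps stay in `[p, L]`, so almost everywhere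
  -- derivative bounds can be integrated.
  have hE : ∃ C, LipschitzOnWith C (fun t => ∑ k ∈ Finset.range N,
      (fun d => d * W (c / N / d)) (x ((k : ℤ) + 1) t - x k t)) (Icc 0 T) := by
    refine exists_lipschitzOnWith_sum _ fun k _ => ?_
    refine exists_lipschitzOnWith_comp (p := p) (q := L) (C := φ (c / N / p))
      (H := fun d => d * W (c / N / d)) (H' := fun d => -φ (c / N / d))
      (fun d hd => hφ.hasDerivAt_gapEnergy hμ (hp.trans_le hd.1)) (fun d hd => ?_)
      (fun t ht => ⟨hgap t ht k, h.gap_le ht k⟩) (exists_lipschitzOnWith_sub (h.lip _) (h.lip _))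
    have hd0 := hp.trans_le hd.1
    rw [abs_neg, abs_of_nonneg (hφ.nonneg (div_pos hμ hd0).le)]
    exact hφ.mono (div_pos hμ hd0).le (div_le_div_of_nonneg_left hμ.le hp hd.1)
  obtain ⟨C, hC⟩ := hE
  have hQ : IntervalIntegrable (fun t => cellDissipation φ c N (fun i => x i t)) volume 0 T :=
    (by rw [uIcc_of_le hT]; exact h.continuousOn_cellDissipation hφ hc :
      ContinuousOn _ (uIcc 0 T)).intervalIntegrable
  have hmain := sub_le_integral_of_lipschitzOnWith (h := fun t => c * (c * B) ^ 2 / 2 -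
      1 / 2 * cellDissipation φ c N (fun i => x i t)) hT hC
      (intervalIntegrable_const.sub (hQ.const_mul _)) (by
    filter_upwards [h.ode, ae_restrict_mem measurableSet_Icc] with t ⟨v, hv⟩ ht
    have hx := h.config t ht
    set ρ : ℤ → ℝ := fun k => cellDensity c N (fun i => x i t) k with hρ
    set a : ℤ → ℝ := fun k => v k - (N / c) * (φ (ρ k) - φ (ρ (k - 1))) with ha
    have hda : ∀ k, HasDerivAt (x k) (a k) t := fun k => (hv k).2
    have hρper : ∀ k, ρ (k + N) = ρ k := fun k => hx.cellDensity_per k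
    -- The choices of forces for different indices are unrelated, so `v` need not be periodic; the
    -- full velocity is, by uniqueness of the derivative.
    have haper : ∀ k, a (k + N) = a k := by
      intro k
      have h1 := hda (k + N)
      rw [show x (k + N) = fun t => x k t + L from funext fun t => h.per k t] at h1
      exact h1.unique ((hda k).add_const L)
    refine ⟨∑ k ∈ Finset.range N, -φ (ρ k) * (a (k + 1) - a k), ?_, ?_⟩
    · refine HasDerivAt.fun_sum fun k _ => ?_
      have hd0 := sub_pos.2 (hx.lt k)
      have h1 := (hφ.hasDerivAt_gapEnergy hμ hd0).comp t ((hda (k + 1)).sub (hda k))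
      refine h1.congr_deriv ?_
      simp only [hρ, hden]
    · exact sum_neg_mul_sub_le hc (h.config 0 h0).pos (fun k => by simp only [hρper]) haper
        (fun k => rfl) fun k => (hv k).1.abs_velocity_le hS hx hc)
  rw [intervalIntegral.integral_sub intervalIntegrable_const (hQ.const_mul _),
    intervalIntegral.integral_const, intervalIntegral.integral_const_mul, smul_eq_mul] at hmain
  have hET : 0 ≤ ∑ k ∈ Finset.range N,
      (fun d => d * W (c / N / d)) (x ((k : ℤ) + 1) T - x k T) := by
    refine Finset.sum_nonneg fun k _ => ?_
    have hd0 := sub_pos.2 ((h.config T ⟨hT, le_rfl⟩).lt k)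
    exact mul_nonneg hd0.le (hφ.W_nonneg _ (div_pos hμ hd0).le)
  -- Each gap contributes `c / N` times `W r / r`, which is largest at the maximal density `M₀`.
  have hE0 : ∑ k ∈ Finset.range N,
      (fun d => d * W (c / N / d)) (x ((k : ℤ) + 1) 0 - x k 0) ≤ c * (W M₀ / M₀) := by
    have : ∀ k ∈ Finset.range N, (fun d => d * W (c / N / d)) (x ((k : ℤ) + 1) 0 - x k 0) ≤
        c / N * (W M₀ / M₀) := by
      intro k _
      have hd0 := sub_pos.2 ((h.config 0 h0).lt k)
      have h1 := hφ.W_div_mono (s := M₀) (div_pos hμ hd0) (by rw [← hden]; exact hM₀ k)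
      have h2 := mul_le_mul_of_nonneg_left h1 hμ.le
      refine le_trans (le_of_eq ?_) h2
      simp only
      field_simp
    refine (Finset.sum_le_sum this).trans (le_of_eq ?_)
    rw [Finset.sum_const, Finset.card_range, nsmul_eq_mul]
    field_simp
  nlinarith

end ParticleFlow

theorem exists_range_eq_of_periodic {α : Type*} {f : ℤ → α} {N : ℕ} (hN : 0 < N)
    (hf : ∀ k, f (k + N) = f k) (k : ℤ) : ∃ j ∈ Finset.range N, f k = f (j : ℤ) := by
  have hN' : (0 : ℤ) < N := by exact_mod_cast hN
  have h1 := Int.emod_nonneg k hN'.ne'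
  have h2 := Int.emod_lt_of_pos k hN'
  refine ⟨(k % N).toNat, Finset.mem_range.2 (by omega), ?_⟩
  rw [Int.toNat_of_nonneg h1]
  have h3 : Function.Periodic f (N : ℤ) := hf
  have h4 := h3.sub_zsmul_eq (x := k) (k / N)
  rw [← h4, Int.emod_def]
  congr 1
  rw [smul_eq_mul, mul_comm]

/-! ### The distance to the lattice, which replaces `|x|` for the moments of lifted particles. -/

section TorusDist

noncomputable section
/-- The distance to `Lℤ`. -/
def torusDist (L y : ℝ) : ℝ := |y - L * round (y / L)|
end

variable {L : ℝ}

theorem torusDist_le (hL : 0 < L) (y : ℝ) (m : ℤ) : torusDist L y ≤ |y - L * m| := by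
  have h1 := round_le (y / L) m
  have h2 : ∀ m : ℤ, |y - L * m| = L * |y / L - m| := by
    intro m
    rw [← abs_of_pos hL, ← abs_mul, abs_of_pos hL]
    congr 1; field_simp
  rw [torusDist, h2, h2]
  exact mul_le_mul_of_nonneg_left h1 hL.le

theorem torusDist_nonneg (L y : ℝ) : 0 ≤ torusDist L y := abs_nonneg _

theorem torusDist_le_add (hL : 0 < L) (y z : ℝ) : torusDist L y ≤ torusDist L z + |y - z| := by
  refine (torusDist_le hL y (round (z / L))).trans ?_
  have h : y - L * round (z / L) = (z - L * round (z / L)) + (y - z) := by ring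
  rw [h]
  exact abs_add_le _ _

theorem abs_torusDist_sub_le (hL : 0 < L) (y z : ℝ) :
    |torusDist L y - torusDist L z| ≤ |y - z| := by
  rw [abs_le]
  have h1 := torusDist_le_add hL y z
  have h2 := torusDist_le_add hL z y
  rw [abs_sub_comm] at h2
  constructor <;> linarith

theorem torusDist_periodic (hL : 0 < L) : Function.Periodic (torusDist L) L := by
  intro y
  rw [torusDist, torusDist, add_div, div_self hL.ne', round_add_one]
  congr 1; push_cast; ring

theorem abs_le_torusDist (hL : 0 < L) {y : ℝ} (hy : |y| ≤ L / 2) : |y| ≤ torusDist L y := by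
  rw [torusDist]
  generalize round (y / L) = m
  by_cases hm : m = 0
  · simp [hm]
  · have h1 : (1 : ℝ) ≤ |(m : ℝ)| := by exact_mod_cast Int.one_le_abs hm
    have h2 : L * 1 ≤ L * |(m : ℝ)| := by gcongr
    have h3 := abs_sub_abs_le_abs_sub (L * m) y
    rw [abs_mul, abs_of_pos hL, abs_sub_comm] at h3
    linarith

end TorusDist

/-! ### The uniform density bound and the total displacement. -/

namespace ParticleFlow

variable {φ W f : ℝ → ℝ} {S : ℝ → Set ℝ} {T L c B Λ κ : ℝ} {N : ℕ} {x : ℤ → ℝ → ℝ}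

/-- The uniform bound on the density. -/
theorem cellDensity_le (hφ : AdmissibleDiffusion φ W) (hS : TorusForce S f L B Λ κ)
    (h : ParticleFlow φ S T L c N x) (hc : 0 < c) {M₀ : ℝ}
    (hM₀ : ∀ k, cellDensity c N (fun i => x i 0) k ≤ M₀) {c₂ r₂ : ℝ} (hc₂ : 0 < c₂) (hr₂ : 0 < r₂)
    (hlarge : ∀ r, r₂ ≤ r → c₂ * r ≤ φ r) {t : ℝ} (ht : t ∈ Icc 0 T) (k : ℤ) :
    cellDensity c N (fun i => x i t) k ≤ M₀ * Real.exp (6 * B * (T * (r₂ + φ (c / L) / c₂) +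
      (∫ t in 0..T, cellVariation φ c N (fun i => x i t)) / c₂) + c * Λ * T) := by
  have hT : 0 ≤ T := ht.1.trans ht.2
  have h0 : (0 : ℝ) ∈ Icc 0 T := ⟨le_rfl, hT⟩
  have hNr := (h.config 0 h0).cast_pos
  have hNp := (h.config 0 h0).pos
  have hL := (h.config 0 h0).length_pos
  have hB := hS.bound_nonneg
  have hΛ := hS.lip_nonneg
  have hμ : 0 < c / N := div_pos hc hNr
  obtain ⟨p, hp, hgap⟩ := h.exists_gap_pos hT
  have hne := Finset.nonempty_range_iff.2 hNp.ne'
  -- The smallest gap; as a minimum of finitely many Lipschitz functions it is Lipschitz, so its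
  -- logarithm can be integrated.
  set δ : ℝ → ℝ := fun t => (Finset.range N).inf' hne fun k : ℕ => x ((k : ℤ) + 1) t - x k t with hδ
  have hδatt : ∀ t, ∃ k ∈ Finset.range N, δ t = x ((k : ℤ) + 1) t - x k t :=
    fun t => Finset.exists_mem_eq_inf' hne _
  have hδle : ∀ t, ∀ j : ℤ, δ t ≤ x (j + 1) t - x j t := by
    intro t j
    set d : ℤ → ℝ := fun k : ℤ => x (k + 1) t - x k t with hd
    have hper : ∀ k, d (k + N) = d k := by
      intro k
      simp only [hd]
      rw [show k + (N : ℤ) + 1 = k + 1 + N by ring, h.per, h.per]; ring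
    obtain ⟨i, hi, hij⟩ := exists_range_eq_of_periodic hNp hper j
    simp only [hd] at hij
    rw [hij]
    exact Finset.inf'_le (fun k : ℕ => x ((k : ℤ) + 1) t - x k t) hi
  have hδp : ∀ t ∈ Icc 0 T, p ≤ δ t := by
    intro t ht
    obtain ⟨k, _, hk⟩ := hδatt t
    rw [hk]; exact hgap t ht k
  have hδL : ∀ t ∈ Icc 0 T, δ t ≤ L := fun t ht => (hδle t 0).trans (h.gap_le ht 0)
  have hδlip : ∃ C, LipschitzOnWith C δ (Icc 0 T) := by
    have h1 : ∀ k : ℕ, ∃ C : ℝ, 0 ≤ C ∧ ∀ a ∈ Icc 0 T, ∀ b ∈ Icc 0 T,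
        |(x ((k : ℤ) + 1) a - x k a) - (x ((k : ℤ) + 1) b - x k b)| ≤ C * |a - b| := fun k =>
      exists_lipschitzOnWith_iff.1 (exists_lipschitzOnWith_sub (h.lip ((k : ℤ) + 1)) (h.lip k))
    choose C hC0 hC using h1
    have hle : ∀ a ∈ Icc 0 T, ∀ b ∈ Icc 0 T,
        δ a - δ b ≤ (∑ k ∈ Finset.range N, C k) * |a - b| := by
      intro a ha b hb
      obtain ⟨k, hk, hkb⟩ := hδatt b
      have h2 := (abs_le.1 (hC k a ha b hb)).2
      have h3 := Finset.single_le_sum (f := C) (fun i _ => hC0 i) hk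
      have h4 := mul_le_mul_of_nonneg_right h3 (abs_nonneg (a - b))
      have h5 := hδle a k
      linarith
    rw [exists_lipschitzOnWith_iff]
    refine ⟨∑ k ∈ Finset.range N, C k, Finset.sum_nonneg fun i _ => hC0 i, fun a ha b hb => ?_⟩
    rw [abs_le]
    have h1 := hle a ha b hb
    have h2 := hle b hb a ha
    rw [abs_sub_comm b a] at h2
    constructor <;> linarith
  have hlog : ∃ C, LipschitzOnWith C (fun t => -Real.log (δ t)) (Icc 0 T) := by
    refine exists_lipschitzOnWith_comp (p := p) (q := L) (C := 1 / p)
      (H := fun d => -Real.log d) (H' := fun d => -d⁻¹)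
      (fun d hd => (Real.hasDerivAt_log (hp.trans_le hd.1).ne').neg) (fun d hd => ?_)
      (fun t ht => ⟨hδp t ht, hδL t ht⟩) hδlip
    have hd0 := hp.trans_le hd.1
    rw [abs_neg, abs_of_pos (inv_pos.2 hd0), inv_eq_one_div]
    exact div_le_div_of_nonneg_left zero_le_one hp hd.1
  obtain ⟨C, hC⟩ := hlog
  have hV : IntervalIntegrable (fun t => cellVariation φ c N (fun i => x i t)) volume 0 T :=
    (by rw [uIcc_of_le hT]; exact h.continuousOn_cellVariation hφ hc :
      ContinuousOn _ (uIcc 0 T)).intervalIntegrable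
  -- The Gronwall coefficient: `6 * B` times a bound on the maximal density, plus `c * Λ`. It is
  -- only integrable in time, which is enough.
  set q : ℝ → ℝ := fun t => 6 * B * (r₂ + φ (c / L) / c₂ +
    cellVariation φ c N (fun i => x i t) / c₂) + c * Λ with hq
  have hqi : IntervalIntegrable q volume 0 T :=
    ((intervalIntegrable_const.add (hV.div_const _)).const_mul _).add intervalIntegrable_const
  have hφL : 0 ≤ φ (c / L) := hφ.nonneg (div_pos hc hL).le
  have hq0 : ∀ t, 0 ≤ q t := by
    intro t
    have := cellVariation_nonneg φ c N fun i => x i t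
    positivity
  have hqT : ∫ t in 0..T, q t = 6 * B * (T * (r₂ + φ (c / L) / c₂) +
      (∫ t in 0..T, cellVariation φ c N (fun i => x i t)) / c₂) + c * Λ * T := by
    simp only [hq]
    rw [intervalIntegral.integral_add ((intervalIntegrable_const.add (hV.div_const _)).const_mul _)
      intervalIntegrable_const, intervalIntegral.integral_const_mul,
      intervalIntegral.integral_add intervalIntegrable_const (hV.div_const _),
      intervalIntegral.integral_div]
    simp
    ring
  have hsub : Icc 0 t ⊆ Icc 0 T := Icc_subset_Icc_right ht.2
  have hmain := sub_le_integral_of_lipschitzOnWith (h := q) ht.1 (hC.mono hsub)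
    (hqi.mono_set (by rw [uIcc_of_le ht.1, uIcc_of_le hT]; exact hsub)) (by
      refine ae_restrict_of_ae_restrict_of_subset hsub ?_
      filter_upwards [h.ode, ae_differentiableAt_of_lipschitzOnWith hδlip] with s ⟨v, hv⟩ ⟨hs, hd⟩
      have hsI : s ∈ Icc 0 T := Ioo_subset_Icc_self hs
      have hx := h.config s hsI
      obtain ⟨k, -, hk⟩ := hδatt s
      set ρ : ℤ → ℝ := fun k => cellDensity c N (fun i => x i s) k with hρ
      have hδs : 0 < δ s := hp.trans_le (hδp s hsI)
      have hmaxρ : ∀ j, ρ j ≤ ρ k := by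
        intro j
        simp only [hρ, cellDensity]
        rw [← hk]
        exact div_le_div_of_nonneg_left hc.le (mul_pos hNr hδs)
          (mul_le_mul_of_nonneg_left (hδle s j) hNr.le)
      have hderiv := (hv (k + 1)).2.sub (hv k).2
      -- The gap `k` lies above `δ` and touches it at time `s`, so both have the same derivative
      -- there.
      have hmin : IsLocalMin (fun t => (x ((k : ℤ) + 1) t - x k t) - δ t) s :=
        Eventually.of_forall fun a => by
          simp only
          rw [hk]
          linarith [hδle a k]
      have hzero := hmin.hasDerivAt_eq_zero (hderiv.sub hd.hasDerivAt)
      have hI := (hv k).1.le_sub (hv (k + 1)).1 hS hx hc fun j => by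
        rw [← hk]; exact hδle s j
      refine ⟨-((δ s)⁻¹ * deriv δ s), ?_, ?_⟩
      · exact ((Real.hasDerivAt_log hδs.ne').comp s hd.hasDerivAt).neg
      · have e1 : ((k : ℤ) + 1 - 1) = k := by ring
        rw [e1] at hzero
        have m1 : φ (ρ (k + 1)) ≤ φ (ρ k) := hφ.mono (hx.cellDensity_pos hc _).le (hmaxρ _)
        have m2 : φ (ρ (k - 1)) ≤ φ (ρ k) := hφ.mono (hx.cellDensity_pos hc _).le (hmaxρ _)
        -- At the smallest gap the pressure is maximal, so the diffusion can only open it.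
        have m3 : 0 ≤ N / c * ((φ (ρ k) - φ (ρ (k + 1))) + (φ (ρ k) - φ (ρ (k - 1)))) :=
          mul_nonneg (div_pos hNr hc).le (by linarith)
        simp only [hρ] at m3
        have hlow : -(6 * B * (c / N)) - c * Λ * δ s ≤ deriv δ s := by
          rw [← hk] at hI
          linarith
        have hρk : ρ k = c / N * (δ s)⁻¹ := by
          simp only [hρ, cellDensity]
          rw [← hk]
          field_simp
        -- Either the density is below the threshold `r₂`, or the linear growth of `φ` bounds it by
        -- `φ (ρ k) / c₂`, which the variation controls.
        have hρb : ρ k ≤ r₂ + φ (c / L) / c₂ + cellVariation φ c N (fun i => x i s) / c₂ := by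
          have h1 := hx.map_cellDensity_le hφ hc k
          rcases le_total r₂ (ρ k) with h2 | h2
          · have h3 := (hlarge _ h2).trans h1
            rw [add_assoc, ← add_div]
            have : ρ k ≤ (φ (c / L) + cellVariation φ c N fun i => x i s) / c₂ := by
              rw [le_div_iff₀ hc₂]; linarith
            linarith
          · have := cellVariation_nonneg φ c N fun i => x i s
            have : 0 ≤ φ (c / L) / c₂ := by positivity
            have : 0 ≤ cellVariation φ c N (fun i => x i s) / c₂ := by positivity
            linarith
        have h5 := mul_le_mul_of_nonneg_left hlow (inv_pos.2 hδs).le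
        have h6 : (δ s)⁻¹ * (-(6 * B * (c / N)) - c * Λ * δ s) = -(6 * B * ρ k) - c * Λ := by
          rw [hρk]; field_simp
        have h7 : 6 * B * ρ k ≤ 6 * B *
            (r₂ + φ (c / L) / c₂ + cellVariation φ c N (fun i => x i s) / c₂) := by gcongr
        simp only [hq]
        linarith)
  have hint_le : ∫ s in 0..t, q s ≤ ∫ s in 0..T, q s :=
    intervalIntegral.integral_mono_interval le_rfl ht.1 ht.2 (ae_of_all _ hq0) hqi
  rw [← hqT]
  obtain ⟨k₀, -, hk₀⟩ := hδatt 0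
  have hδ0 := hp.trans_le (hδp 0 h0)
  have hδt := hp.trans_le (hδp t ht)
  -- The integrated inequality for `-log δ`, exponentiated.
  have h8 : δ 0 ≤ δ t * Real.exp (∫ s in 0..T, q s) := by
    rw [← Real.log_le_log_iff hδ0 (mul_pos hδt (Real.exp_pos _)),
      Real.log_mul hδt.ne' (Real.exp_pos _).ne', Real.log_exp]
    linarith
  have h9 := hM₀ k₀
  rw [cellDensity, ← hk₀, div_le_iff₀ (mul_pos hNr hδ0)] at h9
  have hM0 : 0 < M₀ := ((h.config 0 h0).cellDensity_pos hc k₀).trans_le (hM₀ k₀)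
  have h10 : cellDensity c N (fun i => x i t) k ≤ c / (N * δ t) := by
    rw [cellDensity]
    exact div_le_div_of_nonneg_left hc.le (mul_pos hNr hδt)
      (mul_le_mul_of_nonneg_left (hδle t k) hNr.le)
  refine h10.trans ?_
  rw [div_le_iff₀ (mul_pos hNr hδt)]
  calc c ≤ M₀ * (N * δ 0) := h9
    _ ≤ M₀ * (N * (δ t * Real.exp (∫ s in 0..T, q s))) := by gcongr
    _ = _ := by ring

/-- The interaction moves a particle with speed at most `c * B`. The diffusive speed is `N / c`
times a jump of `φ`, so weighting with `c / N` and summing produces the total variation. -/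
theorem sum_displacement_le (hφ : AdmissibleDiffusion φ W) (hS : TorusForce S f L B Λ κ)
    (h : ParticleFlow φ S T L c N x) (hc : 0 < c) {s t : ℝ} (hs : 0 ≤ s) (hst : s ≤ t) (ht : t ≤ T) :
    ∑ k ∈ Finset.range N, c / N * |x k t - x k s| ≤
      c * (c * B) * (t - s) + ∫ r in s..t, cellVariation φ c N fun i => x i r := by
  have hNr := (h.config s ⟨hs, hst.trans ht⟩).cast_pos
  have hsub : Icc s t ⊆ Icc 0 T := Icc_subset_Icc hs ht
  set D : ℕ → ℝ → ℝ := fun k r =>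
    |φ (cellDensity c N (fun i => x i r) k) - φ (cellDensity c N (fun i => x i r) ((k : ℤ) - 1))| with hD
  have hDi : ∀ k, IntervalIntegrable (D k) volume s t := fun k =>
    (by rw [uIcc_of_le hst]; exact (((h.continuousOn_map_cellDensity hφ hc _).sub
      (h.continuousOn_map_cellDensity hφ hc _)).abs).mono hsub :
      ContinuousOn _ (uIcc s t)).intervalIntegrable
  have hk : ∀ k ∈ Finset.range N, c / N * |x k t - x k s| ≤
      c / N * (c * B * (t - s)) + ∫ r in s..t, D k r := by
    intro k _
    obtain ⟨C, hC⟩ := h.lip k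
    have h1 := abs_sub_le_integral_of_lipschitzOnWith
      (h := fun r => c * B + N / c * D k r) hst (hC.mono hsub)
      (intervalIntegrable_const.add ((hDi k).const_mul _)) (by
        refine ae_restrict_of_ae_restrict_of_subset hsub ?_
        filter_upwards [h.ode, ae_restrict_mem measurableSet_Icc] with r ⟨v, hv⟩ hr
        refine ⟨_, (hv k).2, ?_⟩
        refine (abs_sub _ _).trans (add_le_add ((hv k).1.abs_velocity_le hS (h.config r hr) hc) ?_)
        rw [abs_mul, abs_of_pos (div_pos hNr hc)])
    rw [intervalIntegral.integral_add intervalIntegrable_const ((hDi k).const_mul _),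
      intervalIntegral.integral_const, intervalIntegral.integral_const_mul, smul_eq_mul] at h1
    have h2 := mul_le_mul_of_nonneg_left h1 (div_pos hc hNr).le
    refine h2.trans (le_of_eq ?_)
    field_simp
  refine (Finset.sum_le_sum hk).trans (le_of_eq ?_)
  rw [Finset.sum_add_distrib, Finset.sum_const, Finset.card_range, nsmul_eq_mul,
    ← intervalIntegral.integral_finsetSum fun k _ => hDi k]
  simp only [cellVariation, hD]
  field_simp

end ParticleFlow

/-! ### Bounds uniform in the period and in the number of particles. -/

/-- Paths of configurations with quantitative bounds. -/
structure BoundedPath (φ : ℝ → ℝ) (T L c : ℝ) (N : ℕ) (x : ℤ → ℝ → ℝ) (M Q : ℝ) : Prop where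
  path : ConfigPath L N x
  mass_pos : 0 < c
  density_le : ∀ t k, cellDensity c N (fun i => x i t) k ≤ M
  variation_le : ∫ t in 0..T, cellVariation φ c N (fun i => x i t) ≤ Q
  displacement_le : ∀ s t, 0 ≤ s → s ≤ t → t ≤ T → ∀ l, 0 < l →
    ∑ k ∈ Finset.range N, c / N * |x k t - x k s| ≤ Q * l + Q * (1 + 1 / l) * (t - s)
  moment_le : ∀ t ∈ Icc 0 T, ∑ k ∈ Finset.range N, c / N * torusDist L (x k t) ≤ Q

noncomputable section
/-- Stop the time at `0` and at `T`. -/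
def clampTime (T : ℝ) (x : ℤ → ℝ → ℝ) (k : ℤ) (t : ℝ) : ℝ := x k (max 0 (min t T))
end

theorem clampTime_eq {T t : ℝ} (ht : t ∈ Icc 0 T) (x : ℤ → ℝ → ℝ) (k : ℤ) :
    clampTime T x k t = x k t := by
  rw [clampTime, min_eq_left ht.2, max_eq_right ht.1]

theorem clampTime_mem {T : ℝ} (hT : 0 ≤ T) (t : ℝ) : max 0 (min t T) ∈ Icc 0 T :=
  ⟨le_max_left _ _, max_le hT (min_le_right _ _)⟩

theorem IsParticleSystem.cellDensity_zero_le {φ ρ₀ : ℝ → ℝ} {F : ℝ → ℝ → Set ℝ} {T L : ℝ} {N : ℕ}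
    {x : ℤ → ℝ → ℝ} (h : IsParticleSystem φ ρ₀ F T L N x) (hN : 0 < N) (hL : 0 < L) (hT : 0 ≤ T)
    (hint : Integrable ρ₀) (hpos : ∀ᵐ x, 0 < ρ₀ x) {M : ℝ} (hM : ∀ᵐ x, ρ₀ x ≤ M) (k : ℤ) :
    cellDensity (cutMass ρ₀ L) N (fun i => x i 0) k ≤ M := by
  have hx : PeriodicConfig L N fun i => x i 0 :=
    ⟨hN, fun k => h.lift k 0, fun k => h.ordered 0 ⟨le_rfl, hT⟩ k⟩
  obtain ⟨j, hj, hjk⟩ := exists_range_eq_of_periodic hN (hx.cellDensity_per (c := cutMass ρ₀ L)) k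
  rw [Finset.mem_range] at hj
  have h1 : ∀ i ≤ N, x i 0 = initialPosition ρ₀ L N i := by
    intro i hi
    rcases hi.lt_or_eq with hi | rfl
    · exact h.initial i hi
    · have h2 := h.lift 0 0
      rw [zero_add] at h2
      have h3 := h.initial 0 hN
      push_cast at h3
      rw [h2, h3, initialPosition_last hint hpos hL hN, initialPosition]
      ring
  rw [hjk, cellDensity, div_le_iff₀ (mul_pos hx.cast_pos (sub_pos.2 (hx.lt j)))]
  have h2 := cutMass_div_le hint hpos hM hL hN hj
  have h3 := h1 (j + 1) hj
  push_cast at h3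
  rw [h3, h1 j hj.le]
  rw [div_le_iff₀ hx.cast_pos] at h2
  linarith

/-- Bounds which are uniform in the period and the number of particles. -/
theorem exists_boundedPath {φ W ρ₀ : ℝ → ℝ} (hφ : AdmissibleDiffusion φ W) (hint : Integrable ρ₀)
    (hpos : ∀ᵐ x, 0 < ρ₀ x) (hbdd : ∃ M, ∀ᵐ x, ρ₀ x ≤ M) (hmom : Integrable fun x => |x| * ρ₀ x)
    {T : ℝ} (hT : 0 < T) {Lmin B Λ : ℝ} (hLmin : 0 < Lmin) (hB : 0 ≤ B) (hΛ : 0 ≤ Λ) :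
    ∃ M Q : ℝ, 0 < M ∧ 0 ≤ Q ∧ ∀ (F : ℝ → ℝ → Set ℝ) (f : ℝ → ℝ) (L κ : ℝ) (N : ℕ) (x : ℤ → ℝ → ℝ),
      Lmin ≤ L → 0 < N → cutMass ρ₀ L * L ≤ N → TorusForce (F L) f L B Λ κ →
      IsParticleSystem φ ρ₀ F T L N x →
      BoundedPath φ T L (cutMass ρ₀ L) N (clampTime T x) M Q := by
  obtain ⟨M₀, hM₀⟩ := hbdd
  obtain ⟨c₂, r₂, hc₂, hr₂, hlarge⟩ := hφ.large
  have hr₂0 : 0 < r₂ := by linarith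
  set m := ∫ x, ρ₀ x with hm
  set m₁ := ∫ x, |x| * ρ₀ x with hm₁
  have hM₀0 : 0 < M₀ := by
    obtain ⟨y, hy1, hy2⟩ := (hpos.and hM₀).exists
    linarith
  have hm0 : 0 < m := (cutMass_pos hint hpos hLmin).trans_le (cutMass_le hint hpos hLmin)
  have hm₁0 : 0 ≤ m₁ := integral_nonneg_of_ae (hpos.mono fun x hx => by
    simp only [Pi.zero_apply]; exact mul_nonneg (abs_nonneg _) hx.le)
  set Q₀ := 2 * m * (W M₀ / M₀) + T * m * (m * B) ^ 2 with hQ₀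
  have hW0 : 0 ≤ W M₀ / M₀ := div_nonneg (hφ.W_nonneg _ hM₀0.le) hM₀0.le
  have hQ₀0 : 0 ≤ Q₀ := by positivity
  set V := Q₀ + T * m with hV
  have hV0 : 0 ≤ V := by positivity
  -- One constant for three estimates: `V` for the variation, `Q₀`, `m` and `m * (m * B)` for the
  -- displacement, and `V + m * (m * B) * T + m₁ + 1` for the moment.
  set Q := V + (m * (m * B) * T + m * (m * B)) + m + (m₁ + 1) with hQ
  refine ⟨M₀ * Real.exp (6 * B * (T * (r₂ + φ (m / Lmin) / c₂) + V / c₂) + m * Λ * T), Q,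
    by positivity, by positivity, ?_⟩
  intro F f L κ N x hL hN hLN hS hsys
  have hL0 : 0 < L := hLmin.trans_le hL
  set c := cutMass ρ₀ L with hcdef
  have hc : 0 < c := cutMass_pos hint hpos hL0
  have hcm : c ≤ m := cutMass_le hint hpos hL0
  have hNr : (0 : ℝ) < N := by exact_mod_cast hN
  have hflow := hsys.particleFlow hN
  have hden0 := hsys.cellDensity_zero_le hN hL0 hT.le hint hpos hM₀
  have hcl : ∀ t ∈ Icc 0 T, (fun i => clampTime T x i t) = fun i => x i t :=
    fun t ht => funext fun i => clampTime_eq ht x i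
  have hDiss : ∫ t in 0..T, cellDissipation φ c N (fun i => x i t) ≤ Q₀ := by
    refine (hflow.integral_cellDissipation_le hφ hS hc hT.le hden0).trans ?_
    rw [hQ₀]
    gcongr
  have hDi : IntervalIntegrable (fun t => cellDissipation φ c N (fun i => x i t)) volume 0 T :=
    (by rw [uIcc_of_le hT.le]; exact hflow.continuousOn_cellDissipation hφ hc :
      ContinuousOn _ (uIcc 0 T)).intervalIntegrable
  have hVi : IntervalIntegrable (fun t => cellVariation φ c N (fun i => x i t)) volume 0 T :=
    (by rw [uIcc_of_le hT.le]; exact hflow.continuousOn_cellVariation hφ hc :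
      ContinuousOn _ (uIcc 0 T)).intervalIntegrable
  have hDnn : ∀ t, 0 ≤ cellDissipation φ c N (fun i => x i t) := fun t =>
    Finset.sum_nonneg fun _ _ => mul_nonneg (div_pos hNr hc).le (sq_nonneg _)
  have hVst : ∀ s t, 0 ≤ s → s ≤ t → t ≤ T → ∀ l, 0 < l →
      ∫ r in s..t, cellVariation φ c N (fun i => x i r) ≤ Q₀ * l + m / (4 * l) * (t - s) := by
    intro s t hs hst ht l hl
    have hsub : uIcc s t ⊆ uIcc 0 T := by
      rw [uIcc_of_le hst, uIcc_of_le hT.le]; exact Icc_subset_Icc hs ht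
    have h1 := intervalIntegral.integral_mono_on (μ := volume) hst (hVi.mono_set hsub)
      (((hDi.mono_set hsub).const_mul l).add (intervalIntegrable_const (c := c / (4 * l))))
      (fun r _ => cellVariation_le (φ := φ) (x := fun i => x i r) hc hN hl)
    rw [intervalIntegral.integral_add ((hDi.mono_set hsub).const_mul l) intervalIntegrable_const,
      intervalIntegral.integral_const_mul, intervalIntegral.integral_const, smul_eq_mul] at h1
    have h2 : ∫ r in s..t, cellDissipation φ c N (fun i => x i r) ≤ Q₀ :=
      (intervalIntegral.integral_mono_interval hs hst ht (ae_of_all _ hDnn) hDi).trans hDiss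
    have h3 : c / (4 * l) ≤ m / (4 * l) := by gcongr
    have h4 := mul_le_mul_of_nonneg_left h2 hl.le
    have h5 := mul_le_mul_of_nonneg_left h3 (sub_nonneg.2 hst)
    linarith
  have hVT : ∫ t in 0..T, cellVariation φ c N (fun i => x i t) ≤ V := by
    refine (hVst 0 T le_rfl hT.le le_rfl 1 one_pos).trans ?_
    rw [hV]
    nlinarith
  have hcB : c * (c * B) ≤ m * (m * B) := by gcongr
  have hdisp : ∀ s t, 0 ≤ s → s ≤ t → t ≤ T →
      ∑ k ∈ Finset.range N, c / N * |x k t - x k s| ≤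
      m * (m * B) * (t - s) + ∫ r in s..t, cellVariation φ c N fun i => x i r := by
    intro s t hs hst ht
    have h1 := hflow.sum_displacement_le hφ hS hc hs hst ht
    have h2 := mul_le_mul_of_nonneg_right hcB (sub_nonneg.2 hst)
    linarith
  refine ⟨⟨fun k => ?_, fun t => ?_⟩, hc, fun t k => ?_, ?_, ?_, ?_⟩
  · have h1 := hflow.continuousOn k
    rw [continuousOn_iff_continuous_domRestrict] at h1
    exact h1.comp (f := fun t => (⟨max 0 (min t T), clampTime_mem hT.le t⟩ : Icc 0 T)) (by fun_prop)
  · exact hflow.config _ (clampTime_mem hT.le t)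
  · have h1 := hflow.cellDensity_le hφ hS hc hden0 hc₂ hr₂0 hlarge (clampTime_mem hT.le t) k
    refine h1.trans ?_
    -- With `c ≤ m` and `Lmin ≤ L` the density bound no longer depends on the period.
    have h2 : φ (c / L) ≤ φ (m / Lmin) :=
      hφ.mono (div_pos hc hL0).le (div_le_div₀ hm0.le hcm hLmin hL)
    gcongr
  · have h1 : ∫ t in 0..T, cellVariation φ c N (fun i => clampTime T x i t) =
        ∫ t in 0..T, cellVariation φ c N (fun i => x i t) := by
      refine intervalIntegral.integral_congr fun t ht => ?_
      rw [uIcc_of_le hT.le] at ht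
      simp only [hcl t ht]
    rw [h1]
    refine hVT.trans ?_
    have h3 : 0 ≤ m * (m * B) * T + m * (m * B) := by positivity
    linarith
  · intro s t hs hst ht l hl
    simp only [clampTime_eq (show t ∈ Icc 0 T from ⟨hs.trans hst, ht⟩),
      clampTime_eq (show s ∈ Icc 0 T from ⟨hs, hst.trans ht⟩)]
    have h1 := hdisp s t hs hst ht
    have h2 := hVst s t hs hst ht l hl
    have h3 : Q₀ * l ≤ Q * l := by
      have : Q₀ ≤ Q := by
        have : 0 ≤ m * (m * B) * T + m * (m * B) := by positivity
        have : 0 ≤ T * m := by positivity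
        linarith
      gcongr
    have h4 : m / (4 * l) ≤ Q * (1 / l) := by
      have h5 : m ≤ Q := by
        have : 0 ≤ m * (m * B) * T + m * (m * B) := by positivity
        linarith
      have h6 : m / (4 * l) = m / 4 * (1 / l) := by field_simp
      rw [h6]
      gcongr
      linarith
    have h5 : m * (m * B) ≤ Q := by
      have : 0 ≤ m * (m * B) * T := by positivity
      linarith
    have h6 : m * (m * B) + m / (4 * l) ≤ Q * (1 + 1 / l) := by linarith
    have h7 := mul_le_mul_of_nonneg_right h6 (sub_nonneg.2 hst)
    linarith
  · intro t ht
    simp only [clampTime_eq ht]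
    -- The moment at time `t` is at most the initial moment plus the total displacement.
    have h1 : ∀ k ∈ Finset.range N, c / N * torusDist L (x k t) ≤
        c / N * |initialPosition ρ₀ L N k| + c / N * |x k t - x k 0| := by
      intro k hk
      rw [← hsys.initial k (Finset.mem_range.1 hk), ← mul_add]
      have h2 := torusDist_le_add hL0 (x k t) (x k 0)
      have h3 := torusDist_le hL0 (x k 0) 0
      simp only [Int.cast_zero, mul_zero, sub_zero] at h3
      refine mul_le_mul_of_nonneg_left ?_ (div_pos hc hNr).le
      linarith
    refine (Finset.sum_le_sum h1).trans ?_
    rw [Finset.sum_add_distrib]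
    have h2 := sum_abs_initialPosition_le hint hpos hmom hL0 hN
    have h3 := hdisp 0 t le_rfl ht.1 ht.2
    have h4 : ∫ r in 0..t, cellVariation φ c N (fun i => x i r) ≤ V :=
      (intervalIntegral.integral_mono_interval le_rfl ht.1 ht.2
        (ae_of_all _ fun r => cellVariation_nonneg _ _ _ _) hVi).trans hVT
    -- The quadrature error of the initial moment; this is the `1` in `m₁ + 1`.
    have h5 : c / N * L ≤ 1 := by
      rw [div_mul_eq_mul_div, div_le_one hNr]; exact hLN
    have h6 : m * (m * B) * (t - 0) ≤ m * (m * B) * T := by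
      have : t - 0 ≤ T := by linarith [ht.2]
      gcongr
    have h7 : 0 ≤ m * (m * B) := by positivity
    linarith

/-! ### The system with frozen pressure and a Lipschitz force. -/

noncomputable section

/-- The diffusive pressure across a gap `d` carrying the mass `μ`, frozen below `δ`. -/
def truncPressure (φ : ℝ → ℝ) (μ δ d : ℝ) : ℝ := φ (μ / max d δ)

/-- The velocity of the particle `k` for the pairwise force `g` and the frozen pressure. -/
def truncVelocity (φ : ℝ → ℝ) (c : ℝ) (N : ℕ) (δ : ℝ) (g : ℝ → ℝ) (X : ℤ → ℝ) (k : ℤ) : ℝ :=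
  -(c / N) * ∑ j ∈ Finset.Ioo k (k + (N : ℤ)), g (X k - X j) - N / c *
    (truncPressure φ (c / N) δ (X (k + 1) - X k) - truncPressure φ (c / N) δ (X k - X (k - 1)))

/-- Extend the positions of `N` particles to an `L`-periodic configuration. -/
def liftConfig (L : ℝ) (N : ℕ) [NeZero N] (y : Fin N → ℝ) (k : ℤ) : ℝ :=
  y (Fin.ofNat N (k % N).toNat) + L * (k / N : ℤ)

end

section Truncated

variable {φ W g : ℝ → ℝ} {T L c B C μ δ : ℝ} {N : ℕ}

theorem truncPressure_nonneg (hφ : AdmissibleDiffusion φ W) (hμ : 0 < μ) (hδ : 0 < δ) (d : ℝ) :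
    0 ≤ truncPressure φ μ δ d :=
  hφ.nonneg (div_pos hμ (hδ.trans_le (le_max_right _ _))).le

theorem truncPressure_le (hφ : AdmissibleDiffusion φ W) (hμ : 0 < μ) (hδ : 0 < δ) (d : ℝ) :
    truncPressure φ μ δ d ≤ φ (μ / δ) :=
  hφ.mono (div_pos hμ (hδ.trans_le (le_max_right _ _))).le
    (div_le_div_of_nonneg_left hμ.le hδ (le_max_right _ _))

theorem abs_truncPressure_sub_le (hφ : AdmissibleDiffusion φ W) (hμ : 0 < μ) (hδ : 0 < δ) (d e : ℝ) :
    |truncPressure φ μ δ d - truncPressure φ μ δ e| ≤ φ (μ / δ) := by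
  have h1 := truncPressure_nonneg hφ hμ hδ d
  have h2 := truncPressure_nonneg hφ hμ hδ e
  have h3 := truncPressure_le hφ hμ hδ d
  have h4 := truncPressure_le hφ hμ hδ e
  rw [abs_le]; constructor <;> linarith

/-- The truncation keeps the density in `[0, μ / δ]`, where `φ` is Lipschitz, and `d ↦ μ / max d δ`
has Lipschitz constant `μ / δ ^ 2`. -/
theorem exists_truncPressure_lipschitz (hφ : AdmissibleDiffusion φ W) (hμ : 0 < μ) (hδ : 0 < δ) :
    ∃ C, 0 ≤ C ∧ ∀ d e, |truncPressure φ μ δ d - truncPressure φ μ δ e| ≤ C * |d - e| := by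
  obtain ⟨C, hC0, hC⟩ := hφ.exists_lipschitz (μ / δ)
  have hmem : ∀ d, μ / max d δ ∈ Icc 0 (μ / δ) := fun d =>
    ⟨(div_pos hμ (hδ.trans_le (le_max_right _ _))).le,
      div_le_div_of_nonneg_left hμ.le hδ (le_max_right _ _)⟩
  refine ⟨C * (μ / δ ^ 2), by positivity, fun d e => ?_⟩
  refine (hC _ _ (hmem d) (hmem e)).trans ?_
  rw [mul_assoc]
  refine mul_le_mul_of_nonneg_left ?_ hC0
  have hd := hδ.trans_le (le_max_right d δ)
  have he := hδ.trans_le (le_max_right e δ)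
  have h1 : μ / max d δ - μ / max e δ = μ / (max d δ * max e δ) * (max e δ - max d δ) := by
    field_simp
  rw [h1, abs_mul, abs_of_pos (div_pos hμ (mul_pos hd he))]
  have h2 : |max e δ - max d δ| ≤ |d - e| := by
    rw [abs_sub_comm d e]; exact abs_max_sub_max_le_abs _ _ _
  have h3 : μ / (max d δ * max e δ) ≤ μ / δ ^ 2 := by
    refine div_le_div_of_nonneg_left hμ.le (by positivity) ?_
    rw [sq]
    exact mul_le_mul (le_max_right _ _) (le_max_right _ _) hδ.le hd.le
  gcongr

theorem continuous_truncPressure (hφ : AdmissibleDiffusion φ W) (hμ : 0 < μ) (hδ : 0 < δ) :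
    Continuous (truncPressure φ μ δ) := by
  obtain ⟨C, hC0, hC⟩ := exists_truncPressure_lipschitz hφ hμ hδ
  refine LipschitzWith.continuous (K := C.toNNReal) (LipschitzWith.of_dist_le_mul fun d e => ?_)
  rw [Real.coe_toNNReal _ hC0]; exact hC d e

theorem abs_force_sum_le (hc : 0 < c) (hN : 0 < N) (hg : ∀ z, |g z| ≤ B) (hB : 0 ≤ B)
    (X : ℤ → ℝ) (k : ℤ) :
    |-(c / N) * ∑ j ∈ Finset.Ioo k (k + (N : ℤ)), g (X k - X j)| ≤ c * B := by
  have hNr : (0 : ℝ) < N := by exact_mod_cast hN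
  have h1 : |∑ j ∈ Finset.Ioo k (k + (N : ℤ)), g (X k - X j)| ≤ N * B := by
    refine (Finset.abs_sum_le_sum_abs _ _).trans ((Finset.sum_le_card_nsmul _ _ B
      fun j hj => hg _).trans ?_)
    rw [nsmul_eq_mul]
    refine mul_le_mul_of_nonneg_right ?_ hB
    rw [Int.card_Ioo]
    have : (k + (N : ℤ) - k - 1).toNat ≤ N := by omega
    exact_mod_cast this
  rw [abs_mul, abs_neg, abs_of_pos (div_pos hc hNr)]
  calc _ ≤ c / N * (N * B) := by gcongr
    _ = c * B := by field_simp

theorem abs_truncVelocity_le (hφ : AdmissibleDiffusion φ W) (hc : 0 < c) (hN : 0 < N) (hδ : 0 < δ)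
    (hg : ∀ z, |g z| ≤ B) (hB : 0 ≤ B) (X : ℤ → ℝ) (k : ℤ) :
    |truncVelocity φ c N δ g X k| ≤ c * B + N / c * φ (c / N / δ) := by
  have hNr : (0 : ℝ) < N := by exact_mod_cast hN
  refine (abs_sub _ _).trans (add_le_add (abs_force_sum_le hc hN hg hB X k) ?_)
  rw [abs_mul, abs_of_pos (div_pos hNr hc)]
  exact mul_le_mul_of_nonneg_left
    (abs_truncPressure_sub_le hφ (div_pos hc hNr) hδ _ _) (div_pos hNr hc).le

theorem truncVelocity_per {X : ℤ → ℝ} (hX : ∀ k, X (k + N) = X k + L) (k : ℤ) :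
    truncVelocity φ c N δ g X (k + N) = truncVelocity φ c N δ g X k := by
  have h1 : ∑ j ∈ Finset.Ioo (k + (N : ℤ)) (k + N + (N : ℤ)), g (X (k + N) - X j) =
      ∑ j ∈ Finset.Ioo k (k + (N : ℤ)), g (X k - X j) := by
    refine Finset.sum_nbij' (fun j => j - N) (fun j => j + N) ?_ ?_ ?_ ?_ ?_
    · intro j hj; simp only [Finset.mem_Ioo] at *; omega
    · intro j hj; simp only [Finset.mem_Ioo] at *; omega
    · intro j _; simp
    · intro j _; simp
    · intro j _
      have := hX (j - N)
      rw [sub_add_cancel] at this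
      rw [this, hX]
      congr 1; ring
  rw [truncVelocity, truncVelocity, h1, show k + (N : ℤ) + 1 = k + 1 + N by ring,
    show k + (N : ℤ) - 1 = k - 1 + N by ring, hX, hX, hX]
  congr 4 <;> ring

theorem exists_truncVelocity_lipschitz (hφ : AdmissibleDiffusion φ W) (hc : 0 < c) (hN : 0 < N)
    (hδ : 0 < δ) (hC : 0 ≤ C) (hg : ∀ z w, |g z - g w| ≤ C * |z - w|) :
    ∃ D, 0 ≤ D ∧ ∀ (X Y : ℤ → ℝ) (r : ℝ), (∀ k, |X k - Y k| ≤ r) → ∀ k,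
      |truncVelocity φ c N δ g X k - truncVelocity φ c N δ g Y k| ≤ D * r := by
  have hNr : (0 : ℝ) < N := by exact_mod_cast hN
  have hμ := div_pos hc hNr
  obtain ⟨P, hP0, hP⟩ := exists_truncPressure_lipschitz hφ hμ hδ
  refine ⟨c / N * (N * (C * 2)) + N / c * (P * 4), by positivity, fun X Y r hr k => ?_⟩
  have hr0 : 0 ≤ r := (abs_nonneg _).trans (hr 0)
  have hd : ∀ i j, |(X i - X j) - (Y i - Y j)| ≤ 2 * r := by
    intro i j
    rw [show (X i - X j) - (Y i - Y j) = (X i - Y i) - (X j - Y j) by ring]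
    refine (abs_sub _ _).trans ?_
    linarith [hr i, hr j]
  have h1 : |∑ j ∈ Finset.Ioo k (k + (N : ℤ)), g (X k - X j) -
      ∑ j ∈ Finset.Ioo k (k + (N : ℤ)), g (Y k - Y j)| ≤ N * (C * (2 * r)) := by
    rw [← Finset.sum_sub_distrib]
    refine (Finset.abs_sum_le_sum_abs _ _).trans ((Finset.sum_le_card_nsmul _ _ (C * (2 * r))
      fun j hj => (hg _ _).trans (mul_le_mul_of_nonneg_left (hd _ _) hC)).trans ?_)
    rw [nsmul_eq_mul]
    refine mul_le_mul_of_nonneg_right ?_ (by positivity)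
    rw [Int.card_Ioo]
    have : (k + (N : ℤ) - k - 1).toNat ≤ N := by omega
    exact_mod_cast this
  have h2 := (hP (X (k + 1) - X k) (Y (k + 1) - Y k)).trans
    (mul_le_mul_of_nonneg_left (hd (k + 1) k) hP0)
  have h3 := (hP (X k - X (k - 1)) (Y k - Y (k - 1))).trans
    (mul_le_mul_of_nonneg_left (hd k (k - 1)) hP0)
  set a := ∑ j ∈ Finset.Ioo k (k + (N : ℤ)), g (X k - X j)
  set b := ∑ j ∈ Finset.Ioo k (k + (N : ℤ)), g (Y k - Y j)
  set p := truncPressure φ (c / N) δ (X (k + 1) - X k)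
  set p' := truncPressure φ (c / N) δ (Y (k + 1) - Y k)
  set q := truncPressure φ (c / N) δ (X k - X (k - 1))
  set q' := truncPressure φ (c / N) δ (Y k - Y (k - 1))
  have e : truncVelocity φ c N δ g X k - truncVelocity φ c N δ g Y k =
      -(c / N * (a - b)) - N / c * ((p - p') - (q - q')) := by
    simp only [truncVelocity]; ring
  rw [e]
  refine (abs_sub _ _).trans ?_
  rw [abs_neg, abs_mul, abs_mul, abs_of_pos hμ, abs_of_pos (div_pos hNr hc)]
  have h4 : |(p - p') - (q - q')| ≤ P * (4 * r) := (abs_sub _ _).trans (by linarith)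
  have h5 := mul_le_mul_of_nonneg_left h1 hμ.le
  have h6 := mul_le_mul_of_nonneg_left h4 (div_pos hNr hc).le
  refine (add_le_add h5 h6).trans (le_of_eq ?_)
  ring

theorem liftConfig_per [NeZero N] (y : Fin N → ℝ) (k : ℤ) :
    liftConfig L N y (k + N) = liftConfig L N y k + L := by
  have hN : (N : ℤ) ≠ 0 := by exact_mod_cast NeZero.ne N
  have h1 : (k + (N : ℤ)) / N = k / N + 1 := by
    have := Int.add_mul_ediv_right k 1 hN
    rwa [one_mul] at this
  rw [liftConfig, liftConfig, h1, Int.add_emod_right]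
  push_cast; ring

theorem liftConfig_eq [NeZero N] {y : ℤ → ℝ} (hy : PeriodicConfig L N y) (k : ℤ) :
    liftConfig L N (fun i : Fin N => y (i : ℕ)) k = y k := by
  have hN : (0 : ℤ) < N := by exact_mod_cast hy.pos
  have h1 := Int.emod_nonneg k hN.ne'
  have h2 := Int.emod_lt_of_pos k hN
  have h3 : ((Fin.ofNat N (k % N).toNat : Fin N) : ℕ) = (k % N).toNat := by
    rw [Fin.val_ofNat]
    exact Nat.mod_eq_of_lt (by omega)
  have h4 := hy.per_mul (k % N) (k / N)
  have h5 : k % N + k / N * N = k := by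
    have := Int.emod_add_mul_ediv k N
    linarith
  rw [h5] at h4
  simp only [liftConfig, h3]
  rw [Int.toNat_of_nonneg h1, h4]; ring

/-- The truncated particle system has solutions. -/
theorem exists_truncated_solution (hφ : AdmissibleDiffusion φ W) (hc : 0 < c) (hδ : 0 < δ)
    (hT : 0 ≤ T) (hB : 0 ≤ B) (hgB : ∀ z, |g z| ≤ B) (hC : 0 ≤ C)
    (hg : ∀ z w, |g z - g w| ≤ C * |z - w|) {y : ℤ → ℝ} (hy : PeriodicConfig L N y) :
    ∃ X : ℤ → ℝ → ℝ, (∀ k t, X (k + N) t = X k t + L) ∧ (∀ k, X k 0 = y k) ∧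
      ∀ k, ∀ t ∈ Icc 0 T, HasDerivWithinAt (X k)
        (truncVelocity φ c N δ g (fun i => X i t) k) (Icc 0 T) t := by
  have hN := hy.pos
  have : NeZero N := ⟨hN.ne'⟩
  obtain ⟨D, hD0, hD⟩ := exists_truncVelocity_lipschitz hφ hc hN hδ hC hg
  set V : (Fin N → ℝ) → Fin N → ℝ := fun y i =>
    truncVelocity φ c N δ g (liftConfig L N y) ((i : ℕ) : ℤ) with hV
  set A := c * B + N / c * φ (c / N / δ) with hA
  have hA0 : 0 ≤ A := (abs_nonneg _).trans (abs_truncVelocity_le hφ hc hN hδ hgB hB (fun _ => 0) 0)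
  have hlift : ∀ (y y' : Fin N → ℝ) k, |liftConfig L N y k - liftConfig L N y' k| ≤ dist y y' := by
    intro y y' k
    rw [liftConfig, liftConfig, add_sub_add_right_eq_sub]
    exact dist_le_pi_dist y y' _
  -- The field is bounded by `A` everywhere, so the ball of radius `A * T` cannot be left before
  -- time `T` and the solution exists on the whole interval.
  have hPL : IsPicardLindelof (fun _ => V) (⟨0, le_rfl, hT⟩ : Icc 0 T)
      (fun i : Fin N => y (i : ℕ)) (A * T).toNNReal 0 A.toNNReal D.toNNReal := by
    refine ⟨fun t _ => (LipschitzWith.of_dist_le_mul fun y y' => ?_).lipschitzOnWith,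
      fun _ _ => continuousOn_const, fun t _ y _ => ?_, ?_⟩
    · rw [Real.coe_toNNReal _ hD0, dist_pi_le_iff (by positivity)]
      intro i
      exact hD _ _ _ (hlift y y') _
    · rw [Real.coe_toNNReal _ hA0, pi_norm_le_iff_of_nonneg hA0]
      intro i
      exact abs_truncVelocity_le hφ hc hN hδ hgB hB _ _
    · rw [Real.coe_toNNReal _ hA0, Real.coe_toNNReal _ (by positivity)]
      simp [hT]
  obtain ⟨α, hα0, hα⟩ := hPL.exists_eq_forall_mem_Icc_hasDerivWithinAt₀
  refine ⟨fun k t => liftConfig L N (α t) k, fun k t => liftConfig_per _ _, fun k => ?_,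
    fun k t ht => ?_⟩
  · simp only at hα0 ⊢
    rw [hα0, liftConfig_eq hy]
  · have h1 := (hasDerivWithinAt_pi.1 (hα t ht)) (Fin.ofNat N (k % N).toNat)
    have h2 := h1.add_const (L * (k / N : ℤ))
    refine h2.congr_deriv ?_
    obtain ⟨hk1, hk2⟩ : 0 ≤ k % N ∧ k % N < N :=
      ⟨Int.emod_nonneg k (by exact_mod_cast hN.ne'), Int.emod_lt_of_pos k (by exact_mod_cast hN)⟩
    have h3 : ((Fin.ofNat N (k % N).toNat : Fin N) : ℕ) = (k % N).toNat := by
      rw [Fin.val_ofNat]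
      exact Nat.mod_eq_of_lt (by omega)
    simp only [hV, h3, Int.toNat_of_nonneg hk1]
    -- Only `N` coordinates were evolved; the velocity at any other index equals that of its
    -- representative.
    have h4 : Function.Periodic (truncVelocity φ c N δ g (liftConfig L N (α t))) (N : ℤ) :=
      fun k => truncVelocity_per (fun k => liftConfig_per _ k) k
    rw [← h4.sub_zsmul_eq (x := k) (k / N), Int.emod_def, smul_eq_mul, mul_comm (k / (N : ℤ))]

/-- The energy prevents gaps from reaching the truncation threshold. -/
theorem lt_gap_of_truncated (hφ : AdmissibleDiffusion φ W) (hc : 0 < c) (hδ : 0 < δ)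
    (hT : 0 ≤ T) (hB : 0 ≤ B) (hgB : ∀ z, |g z| ≤ B) {y : ℤ → ℝ} (hy : PeriodicConfig L N y)
    (hgap : ∀ k, δ ≤ y (k + 1) - y k)
    (hbig : ∑ k ∈ Finset.range N, (y ((k : ℤ) + 1) - y k) * W (c / N / (y ((k : ℤ) + 1) - y k)) +
      T * (c * (c * B) ^ 2 / 2) < δ * W (c / N / δ)) {X : ℤ → ℝ → ℝ}
    (hper : ∀ k t, X (k + N) t = X k t + L) (h0 : ∀ k, X k 0 = y k)
    (hX : ∀ k, ∀ t ∈ Icc 0 T, HasDerivWithinAt (X k)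
        (truncVelocity φ c N δ g (fun i => X i t) k) (Icc 0 T) t) {t : ℝ} (ht : t ∈ Icc 0 T) (k : ℤ) :
    δ < X (k + 1) t - X k t := by
  have hN := hy.pos
  have hNr : (0 : ℝ) < N := by exact_mod_cast hN
  have hμ := div_pos hc hNr
  set P := truncPressure φ (c / N) δ with hP
  have hPc : Continuous P := continuous_truncPressure hφ hμ hδ
  have hP0 : ∀ d, 0 ≤ P d := truncPressure_nonneg hφ hμ hδ
  -- The gap energy for the frozen pressure. It agrees with `d * W (c / N / d)` for `d ≥ δ` and is
  -- at least its threshold value for `d ≤ δ`, since its derivative `-P` is nonpositive.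
  set H : ℝ → ℝ := fun d => δ * W (c / N / δ) - ∫ s in δ..d, P s with hH
  have hHd : ∀ d, HasDerivAt H (-P d) d := by
    intro d
    exact (intervalIntegral.integral_hasDerivAt_right (hPc.intervalIntegrable δ d)
        (hPc.stronglyMeasurableAtFilter _ _) hPc.continuousAt).const_sub (δ * W (c / N / δ))
  have hHge : ∀ d, δ ≤ d → H d = d * W (c / N / d) := by
    intro d hd
    have h1 : ∫ s in δ..d, -P s = d * W (c / N / d) - δ * W (c / N / δ) := by
      refine intervalIntegral.integral_eq_sub_of_hasDerivAt (f := fun d => d * W (c / N / d))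
        (fun s hs => ?_) (hPc.neg.intervalIntegrable _ _)
      rw [uIcc_of_le hd] at hs
      refine (hφ.hasDerivAt_gapEnergy hμ (hδ.trans_le hs.1)).congr_deriv ?_
      simp only [hP, truncPressure, max_eq_left hs.1]
    rw [intervalIntegral.integral_neg] at h1
    simp only [hH]; linarith
  have hHle : ∀ d, d ≤ δ → δ * W (c / N / δ) ≤ H d := by
    intro d hd
    have : 0 ≤ ∫ s in d..δ, P s := intervalIntegral.integral_nonneg hd fun s _ => hP0 s
    simp only [hH]
    rw [intervalIntegral.integral_symm]; linarith
  have hH0 : ∀ d, 0 ≤ H d := by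
    intro d
    rcases le_total d δ with hd | hd
    · exact (mul_nonneg hδ.le (hφ.W_nonneg _ (div_pos hμ hδ).le)).trans (hHle d hd)
    · rw [hHge d hd]
      exact mul_nonneg (hδ.le.trans hd) (hφ.W_nonneg _ (div_pos hμ (hδ.trans_le hd)).le)
  set E : ℝ → ℝ := fun t => ∑ k ∈ Finset.range N, H (X ((k : ℤ) + 1) t - X k t) with hE
  set b := c * (c * B) ^ 2 / 2 with hb
  have hEd : ∀ s ∈ Icc 0 T, ∃ e, e ≤ b ∧ HasDerivWithinAt E e (Icc 0 T) s := by
    intro s hs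
    set a : ℤ → ℝ := truncVelocity φ c N δ g (fun i => X i s) with ha
    refine ⟨∑ k ∈ Finset.range N, -P (X ((k : ℤ) + 1) s - X k s) * (a (k + 1) - a k), ?_, ?_⟩
    · have h1 := sum_neg_mul_sub_le (N := N) (c := c) (b := c * B)
        (Φ := fun k => P (X (k + 1) s - X k s)) (a := a)
        (v := fun k => -(c / N) * ∑ j ∈ Finset.Ioo k (k + (N : ℤ)), g (X k s - X j s)) hc hN
        (fun k => by
          rw [show k + (N : ℤ) + 1 = k + 1 + N by ring, hper, hper]; congr 1; ring)
        (fun k => truncVelocity_per (fun k => hper k s) k)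
        (fun k => by simp only [ha, truncVelocity, hP, sub_add_cancel])
        (fun k => abs_force_sum_le hc hN hgB hB (fun i => X i s) k)
      refine h1.trans ?_
      have : 0 ≤ ∑ k ∈ Finset.range N, N / c * (P (X ((k : ℤ) + 1) s - X k s) -
          P (X ((k : ℤ) - 1 + 1) s - X ((k : ℤ) - 1) s)) ^ 2 :=
        Finset.sum_nonneg fun _ _ => mul_nonneg (div_pos hNr hc).le (sq_nonneg _)
      linarith
    · refine HasDerivWithinAt.fun_sum fun k _ => ?_
      exact (hHd _).comp_hasDerivWithinAt s ((hX _ s hs).sub (hX _ s hs))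
  have hanti : AntitoneOn (fun t => E t - b * t) (Icc 0 T) := by
    refine antitoneOn_of_deriv_nonpos (convex_Icc 0 T) (fun s hs => ?_) (fun s hs => ?_)
      (fun s hs => ?_)
    · obtain ⟨e, -, he⟩ := hEd s hs
      exact he.continuousWithinAt.sub (by fun_prop)
    · obtain ⟨e, -, he⟩ := hEd s (interior_subset hs)
      exact ((he.mono interior_subset).sub
        ((hasDerivWithinAt_id s _).const_mul b)).differentiableWithinAt
    · rw [interior_Icc] at hs
      obtain ⟨e, heb, he⟩ := hEd s (Ioo_subset_Icc_self hs)
      have h2 := (he.hasDerivAt (Icc_mem_nhds hs.1 hs.2)).sub ((hasDerivAt_id s).const_mul b)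
      have h3 : deriv (fun t => E t - b * t) s = e - b * 1 := h2.deriv
      rw [h3]; linarith
  have h1 := hanti ⟨le_rfl, hT⟩ ht ht.1
  simp only at h1
  have hE0 : E 0 = ∑ k ∈ Finset.range N, (y ((k : ℤ) + 1) - y k) *
      W (c / N / (y ((k : ℤ) + 1) - y k)) := by
    refine Finset.sum_congr rfl fun k _ => ?_
    rw [h0, h0, hHge _ (hgap _)]
  have hbt : b * t ≤ T * b := by
    have : 0 ≤ b := by positivity
    nlinarith [ht.2]
  -- The total energy stays below the threshold value, whereas a single gap of length at most `δ`
  -- would already have that energy.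
  have hEt : E t < δ * W (c / N / δ) := by linarith
  set dd : ℤ → ℝ := fun k => X (k + 1) t - X k t with hdd
  have hdper : ∀ k, dd (k + N) = dd k := by
    intro k
    simp only [hdd]
    rw [show k + (N : ℤ) + 1 = k + 1 + N by ring, hper, hper]; ring
  obtain ⟨j, hj, hjk⟩ := exists_range_eq_of_periodic hN hdper k
  simp only [hdd] at hjk
  rw [hjk]
  by_contra hcon
  have h2 := hHle _ (not_lt.1 hcon)
  have h3 := Finset.single_le_sum (f := fun k : ℕ => H (X ((k : ℤ) + 1) t - X k t))
    (fun k _ => hH0 _) hj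
  linarith

end Truncated

/-- The derivative of `W r / r` is `φ r / r ^ 2`, which is at least `c₂ / r` for large `r`, so the
quotient grows at least like `c₂ * log r`. -/
theorem AdmissibleDiffusion.tendsto_W_div {φ W : ℝ → ℝ} (h : AdmissibleDiffusion φ W) :
    Tendsto (fun r => W r / r) atTop atTop := by
  obtain ⟨c₂, r₂, hc₂, hr₂, hlarge⟩ := h.large
  have hr₂0 : 0 < r₂ := by linarith
  have hmono : MonotoneOn (fun r => W r / r - c₂ * Real.log r) (Ici r₂) := by
    have hd : ∀ r, r₂ ≤ r → HasDerivAt (fun r => W r / r - c₂ * Real.log r)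
        (φ r / r ^ 2 - c₂ * r⁻¹) r := fun r hr =>
      (h.hasDerivAt_W_div (hr₂0.trans_le hr)).sub
        ((Real.hasDerivAt_log (hr₂0.trans_le hr).ne').const_mul c₂)
    refine monotoneOn_of_deriv_nonneg (convex_Ici r₂)
      (fun r hr => (hd r hr).continuousAt.continuousWithinAt) (fun r hr => ?_) (fun r hr => ?_)
    · exact (hd r (interior_subset hr)).differentiableAt.differentiableWithinAt
    · have hr' : r₂ ≤ r := interior_subset hr
      have hr0 := hr₂0.trans_le hr'
      rw [(hd r hr').deriv, sub_nonneg]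
      have h1 := hlarge r hr'
      rw [le_div_iff₀ (by positivity)]
      have : c₂ * r⁻¹ * r ^ 2 = c₂ * r := by field_simp
      linarith
  have h1 : Tendsto (fun r => c₂ * Real.log r + (W r₂ / r₂ - c₂ * Real.log r₂)) atTop atTop :=
    tendsto_atTop_add_const_right _ _ (Real.tendsto_log_atTop.const_mul_atTop hc₂)
  refine tendsto_atTop_mono' atTop ?_ h1
  filter_upwards [eventually_ge_atTop r₂] with r hr
  have := hmono self_mem_Ici hr hr
  simp only at this
  linarith

/-! ### Lipschitz approximation of the force by averages. -/

section AveragedForce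

noncomputable section
/-- Forward averages of a force over intervals of length `1 / (n + 1)`. -/
def averagedForce (f : ℝ → ℝ) (n : ℕ) (z : ℝ) : ℝ :=
  (n + 1 : ℝ) * ∫ s in z..z + 1 / (n + 1 : ℝ), f s
end

variable {f : ℝ → ℝ} {B : ℝ}

/-- An average of values within `b` of `a` is within `b` of `a`. Exceptional null sets are allowed,
so the value at the midpoint plays no role. -/
theorem abs_averagedForce_sub_le {a b : ℝ} {n : ℕ} {z : ℝ} (hfm : Measurable f)
    (hf : ∀ z, |f z| ≤ B)
    (h : ∀ᵐ s, s ∈ Icc z (z + 1 / (n + 1 : ℝ)) → |f s - a| ≤ b) :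
    |averagedForce f n z - a| ≤ b := by
  have hn : (0 : ℝ) < n + 1 := by positivity
  have hi : IntervalIntegrable f volume z (z + 1 / (n + 1 : ℝ)) := by
    rw [intervalIntegrable_iff]
    exact Measure.integrableOn_of_bounded measure_Ioc_lt_top.ne hfm.aestronglyMeasurable
      (ae_of_all _ hf)
  have hle : z ≤ z + 1 / (n + 1 : ℝ) := by have := div_pos one_pos hn; linarith
  have h1 : averagedForce f n z - a = (n + 1 : ℝ) * ∫ s in z..z + 1 / (n + 1 : ℝ), (f s - a) := by
    rw [intervalIntegral.integral_sub hi intervalIntegrable_const, intervalIntegral.integral_const,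
      averagedForce, smul_eq_mul]
    field_simp
    ring
  have h2 := intervalIntegral.norm_integral_le_of_norm_le (g := fun _ => b) (μ := volume) hle
    (f := fun s => f s - a) (by
      filter_upwards [h] with s hs hmem
      exact hs (Ioc_subset_Icc_self hmem)) intervalIntegrable_const
  rw [h1, abs_mul, abs_of_pos hn]
  rw [Real.norm_eq_abs, intervalIntegral.integral_const, smul_eq_mul, add_sub_cancel_left] at h2
  have h3 := mul_le_mul_of_nonneg_left h2 hn.le
  refine h3.trans (le_of_eq ?_)
  field_simp

theorem abs_averagedForce_le (hfm : Measurable f) (hf : ∀ z, |f z| ≤ B) (n : ℕ) (z : ℝ) :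
    |averagedForce f n z| ≤ B := by
  have := abs_averagedForce_sub_le (a := 0) (b := B) (n := n) (z := z) hfm hf
    (ae_of_all _ fun s _ => by rw [sub_zero]; exact hf s)
  rwa [sub_zero] at this

/-- Moving the window changes the integral only near its two ends, by at most `B * |z - w|` each. -/
theorem averagedForce_lipschitz (hfm : Measurable f) (hf : ∀ z, |f z| ≤ B) (n : ℕ) (z w : ℝ) :
    |averagedForce f n z - averagedForce f n w| ≤ (n + 1 : ℝ) * (2 * B) * |z - w| := by
  have hn : (0 : ℝ) < n + 1 := by positivity
  have hi : ∀ a b, IntervalIntegrable f volume a b := by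
    intro a b
    rw [intervalIntegrable_iff]
    exact Measure.integrableOn_of_bounded measure_Ioc_lt_top.ne hfm.aestronglyMeasurable
      (ae_of_all _ hf)
  have hb : ∀ a b, |∫ s in a..b, f s| ≤ B * |b - a| := fun a b => by
    rw [← Real.norm_eq_abs]
    exact intervalIntegral.norm_integral_le_of_norm_le_const fun s _ => hf s
  have h1 : averagedForce f n z - averagedForce f n w = (n + 1 : ℝ) *
      ((∫ s in z..w, f s) + ∫ s in w + 1 / (n + 1 : ℝ)..z + 1 / (n + 1 : ℝ), f s) := by
    rw [averagedForce, averagedForce]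
    rw [← intervalIntegral.integral_add_adjacent_intervals (hi z w) (hi w (z + 1 / (n + 1 : ℝ))),
      ← intervalIntegral.integral_add_adjacent_intervals (hi w (w + 1 / (n + 1 : ℝ)))
        (hi (w + 1 / (n + 1 : ℝ)) (z + 1 / (n + 1 : ℝ)))]
    ring
  rw [h1, abs_mul, abs_of_pos hn, mul_assoc]
  refine mul_le_mul_of_nonneg_left ?_ hn.le
  refine (abs_add_le _ _).trans ?_
  have h2 := hb z w
  have h3 := hb (w + 1 / (n + 1 : ℝ)) (z + 1 / (n + 1 : ℝ))
  rw [add_sub_add_right_eq_sub] at h3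
  rw [abs_sub_comm w z] at h2
  linarith

end AveragedForce

namespace TorusForce

variable {S : ℝ → Set ℝ} {f : ℝ → ℝ} {L B Λ κ : ℝ}

/-- Off the midpoint the averaged forces converge to the force. -/
theorem eventually_averagedForce (h : TorusForce S f L B Λ κ) {z : ℝ} (hz : z ∈ Ioo (-L) 0)
    (hz2 : z ≠ -(L / 2)) {η : ℝ} (hη : 0 < η) :
    ∀ᶠ p : ℕ × ℝ in atTop ×ˢ 𝓝 z, |averagedForce f p.1 p.2 - f z| ≤ η := by
  have hcont : ∀ᶠ s in 𝓝 z, |f s - f z| ≤ η := by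
    have key : ∀ U : Set ℝ, IsOpen U → z ∈ U →
        (∀ s ∈ U, ∀ w ∈ U, |f s - f w| ≤ Λ * |s - w|) → ∀ᶠ s in 𝓝 z, |f s - f z| ≤ η := by
      intro U hU hzU hlip
      have h1 : ∀ᶠ s in 𝓝 z, Λ * |s - z| < η := by
        have : Tendsto (fun s => Λ * |s - z|) (𝓝 z) (𝓝 (Λ * |z - z|)) :=
          Continuous.tendsto (by fun_prop) z
        rw [sub_self, abs_zero, mul_zero] at this
        exact this.eventually_lt_const hη
      filter_upwards [h1, hU.mem_nhds hzU] with s h1 h2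
      exact (hlip s h2 z hzU).trans h1.le
    rcases lt_or_gt_of_ne hz2 with hlt | hlt
    · exact key _ isOpen_Ioo ⟨hz.1, hlt⟩ h.lip_left
    · exact key _ isOpen_Ioo ⟨hlt, hz.2⟩ h.lip_right
  obtain ⟨r, hr, hball⟩ := Metric.eventually_nhds_iff.1 hcont
  have h1 : ∀ᶠ n : ℕ in atTop, 1 / ((n : ℝ) + 1) < r / 2 :=
    tendsto_one_div_add_atTop_nhds_zero_nat.eventually_lt_const (half_pos hr)
  filter_upwards [h1.prod_mk (Metric.ball_mem_nhds z (half_pos hr))] with p ⟨hp1, hp2⟩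
  refine abs_averagedForce_sub_le h.measurable h.bound (ae_of_all _ fun s hs => hball ?_)
  have h2 : |p.2 - z| < r / 2 := hp2
  rw [Real.dist_eq]
  obtain ⟨h3, h4⟩ := abs_lt.1 h2
  rw [abs_lt]
  constructor <;> linarith [hs.1, hs.2]

/-- At the midpoint the averaged forces are asymptotically bounded by the jump. -/
theorem eventually_averagedForce_mid (h : TorusForce S f L B Λ κ) (hL : 0 < L) {η : ℝ} (hη : 0 < η) :
    ∀ᶠ p : ℕ × ℝ in atTop ×ˢ 𝓝 (-(L / 2)), |averagedForce f p.1 p.2| ≤ κ + η := by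
  set z := -(L / 2) with hz
  have hcont : ∀ᶠ s in 𝓝 z, s ≠ z → |f s| ≤ κ + η := by
    have h1 : ∀ᶠ s in 𝓝 z, Λ * |s - z| < η := by
      have : Tendsto (fun s => Λ * |s - z|) (𝓝 z) (𝓝 (Λ * |z - z|)) :=
        Continuous.tendsto (by fun_prop) z
      rw [sub_self, abs_zero, mul_zero] at this
      exact this.eventually_lt_const hη
    filter_upwards [h1, Ioo_mem_nhds (show -L < z by linarith) (show z < 0 by linarith)]
      with s h1 h2 hs
    have := h.near_mid s h2 hs
    rw [show s + L / 2 = s - z by rw [hz]; ring] at this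
    linarith
  obtain ⟨r, hr, hball⟩ := Metric.eventually_nhds_iff.1 hcont
  have h1 : ∀ᶠ n : ℕ in atTop, 1 / ((n : ℝ) + 1) < r / 2 :=
    tendsto_one_div_add_atTop_nhds_zero_nat.eventually_lt_const (half_pos hr)
  filter_upwards [h1.prod_mk (Metric.ball_mem_nhds z (half_pos hr))] with p ⟨hp1, hp2⟩
  have h5 := abs_averagedForce_sub_le (a := 0) (b := κ + η) (n := p.1) (z := p.2)
    h.measurable h.bound (by
    filter_upwards [Measure.ae_ne volume z] with s hsne hs
    rw [sub_zero]
    refine hball ?_ hsne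
    have h2 : |p.2 - z| < r / 2 := hp2
    rw [Real.dist_eq]
    obtain ⟨h3, h4⟩ := abs_lt.1 h2
    rw [abs_lt]
    constructor <;> linarith [hs.1, hs.2])
  rwa [sub_zero] at h5

end TorusForce

/-! ### Limits of the regularized curves. -/

section Limit

variable {φ W f : ℝ → ℝ} {S : ℝ → Set ℝ} {T L c B Λ κ δ V : ℝ} {N : ℕ}

/-- Convergence along a fixed ultrafilter handles all indices and all times at once, without
extracting subsequences. -/
theorem exists_ultrafilter_limit {u : ℕ → ℝ} {a A : ℝ} (h : ∀ n, |u n - a| ≤ A) :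
    ∃ z, Tendsto u (hyperfilter ℕ) (𝓝 z) := by
  have h1 : IsCompact (Icc (a - A) (a + A)) := isCompact_Icc
  obtain ⟨z, -, hz⟩ := h1.ultrafilter_le_nhds' ((hyperfilter ℕ).map u) (by
    rw [Ultrafilter.mem_map]
    refine Filter.univ_mem' fun n => ?_
    obtain ⟨h2, h3⟩ := abs_le.1 (h n)
    exact ⟨by linarith, by linarith⟩)
  exact ⟨z, hz⟩

/-- Pointwise limits of equi-Lipschitz curves are limits jointly in the curve and in time. -/
theorem tendsto_prod_of_equiLipschitz {l : Filter ℕ} {x : ℕ → ℝ → ℝ} {z : ℝ} {t : ℝ} {s : Set ℝ}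
    (hs : s ∈ 𝓝 t) (hlip : ∀ n, ∀ a ∈ s, |x n a - x n t| ≤ V * |a - t|)
    (hz : Tendsto (fun n => x n t) l (𝓝 z)) :
    Tendsto (fun p : ℕ × ℝ => x p.1 p.2) (l ×ˢ 𝓝 t) (𝓝 z) := by
  have h1 : Tendsto (fun p : ℕ × ℝ => x p.1 t) (l ×ˢ 𝓝 t) (𝓝 z) := hz.comp tendsto_fst
  have h2 : Tendsto (fun p : ℕ × ℝ => x p.1 p.2 - x p.1 t) (l ×ˢ 𝓝 t) (𝓝 0) := by
    have h3 : Tendsto (fun p : ℕ × ℝ => V * |p.2 - t|) (l ×ˢ 𝓝 t) (𝓝 0) := by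
      have : Tendsto (fun a : ℝ => V * |a - t|) (𝓝 t) (𝓝 (V * |t - t|)) :=
        Continuous.tendsto (by fun_prop) t
      rw [sub_self, abs_zero, mul_zero] at this
      exact this.comp tendsto_snd
    refine squeeze_zero_norm' ?_ h3
    filter_upwards [tendsto_snd.eventually hs] with p hp
    exact hlip p.1 p.2 hp
  simpa using h2.add h1

/-- If the velocities of the curves are close to `q`, so is the velocity of their limit. -/
theorem abs_deriv_sub_le_of_tendsto {l : Filter ℕ} [l.NeBot] {x v : ℕ → ℝ → ℝ} {z : ℝ → ℝ}
    {t q b D : ℝ} {s : Set ℝ} (hs : s ∈ 𝓝 t) (hb : 0 ≤ b)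
    (hx : ∀ n, ∀ a ∈ s, HasDerivAt (x n) (v n a) a)
    (hv : ∀ᶠ p : ℕ × ℝ in l ×ˢ 𝓝 t, |v p.1 p.2 - q| ≤ b)
    (hz : ∀ a, Tendsto (fun n => x n a) l (𝓝 (z a))) (hD : HasDerivAt z D t) : |D - q| ≤ b := by
  obtain ⟨pa, hpa, pb, hpb, hab⟩ := eventually_prod_iff.1 hv
  obtain ⟨r, hr, hball⟩ := Metric.mem_nhds_iff.1 (inter_mem hs hpb)
  -- It suffices to bound the increments of `z a - q * a` by `b * |a - t|` near `t`. The mean value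
  -- inequality gives this for the approximating curves, and it survives the limit.
  have h1 : HasDerivAt (fun a => z a - q * a) (D - q) t :=
    (hD.sub ((hasDerivAt_id t).const_mul q)).congr_deriv (by simp)
  refine h1.le_of_lip' hb ?_
  filter_upwards [Metric.ball_mem_nhds t hr] with a ha
  have h2 : Tendsto (fun n => ‖(x n a - q * a) - (x n t - q * t)‖) l
      (𝓝 ‖(z a - q * a) - (z t - q * t)‖) :=
    (((hz a).sub tendsto_const_nhds).sub ((hz t).sub tendsto_const_nhds)).norm
  refine le_of_tendsto h2 ?_
  filter_upwards [hpa] with n hn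
  refine Convex.norm_image_sub_le_of_norm_hasDerivWithin_le (f := fun a => x n a - q * a)
    (f' := fun a => v n a - q) (s := Metric.ball t r) (fun a' ha' => ?_) (fun a' ha' => ?_)
    (convex_ball t r) (Metric.mem_ball_self hr) ha
  · have := (hx n a' (hball ha').1).sub ((hasDerivAt_id a').const_mul q)
    exact (this.congr_deriv (by simp)).hasDerivWithinAt
  · exact hab hn (hball ha').2

/-- The velocities of the truncated systems are asymptotically admissible. -/
theorem eventually_truncVelocity (hφ : AdmissibleDiffusion φ W) (hc : 0 < c) (hδ : 0 < δ)
    (hS : TorusForce S f L B Λ κ) {l : Filter (ℕ × ℝ)} (hl : Tendsto Prod.fst l atTop)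
    {X : ℕ → ℤ → ℝ → ℝ} {Z : ℤ → ℝ} (hZ : PeriodicConfig L N Z)
    (hX : ∀ k, Tendsto (fun p : ℕ × ℝ => X p.1 k p.2) l (𝓝 (Z k))) (k : ℤ) {η : ℝ} (hη : 0 < η) :
    ∀ᶠ p in l, |truncVelocity φ c N δ (averagedForce f p.1) (fun i => X p.1 i p.2) k -
      truncVelocity φ c N δ (fun z => if z = -(L / 2) then 0 else f z) Z k| ≤
      c / N * ∑ j ∈ Finset.Ioo k (k + (N : ℤ)), (if Z k - Z j = -(L / 2) then κ else 0) + η := by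
  have hNr : (0 : ℝ) < N := by exact_mod_cast hZ.pos
  have hμ := div_pos hc hNr
  set J := Finset.Ioo k (k + (N : ℤ)) with hJ
  -- Chosen so that `N` force errors weighted by `c / N` and one pressure error weighted by `N / c`
  -- add up to `η`.
  set η' := η / (c + N / c) with hη'
  have hη0 : 0 < η' := by positivity
  have hforce : ∀ j ∈ J, ∀ᶠ p in l, |averagedForce f p.1 (X p.1 k p.2 - X p.1 j p.2) -
      (if Z k - Z j = -(L / 2) then 0 else f (Z k - Z j))| ≤
      (if Z k - Z j = -(L / 2) then κ else 0) + η' := by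
    intro j hj
    have hz := hZ.sub_mem_Ioo hj
    have hL : 0 < L := by linarith [hz.1, hz.2]
    have htend : Tendsto (fun p : ℕ × ℝ => (p.1, X p.1 k p.2 - X p.1 j p.2)) l
        (atTop ×ˢ 𝓝 (Z k - Z j)) := hl.prodMk ((hX k).sub (hX j))
    split_ifs with hmid
    · rw [hmid] at htend
      filter_upwards [htend.eventually (hS.eventually_averagedForce_mid hL hη0)] with p hp
      rwa [sub_zero]
    · filter_upwards [htend.eventually (hS.eventually_averagedForce hz hmid hη0)] with p hp
      rwa [zero_add]
  have hpress : ∀ᶠ p in l, |(truncPressure φ (c / N) δ (X p.1 (k + 1) p.2 - X p.1 k p.2) -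
      truncPressure φ (c / N) δ (X p.1 k p.2 - X p.1 (k - 1) p.2)) -
      (truncPressure φ (c / N) δ (Z (k + 1) - Z k) -
      truncPressure φ (c / N) δ (Z k - Z (k - 1)))| ≤ η' := by
    have hP := continuous_truncPressure hφ hμ hδ
    have h1 := ((hP.tendsto _).comp ((hX (k + 1)).sub (hX k))).sub
      ((hP.tendsto _).comp ((hX k).sub (hX (k - 1))))
    filter_upwards [h1.eventually (Metric.closedBall_mem_nhds _ hη0)] with p hp
    exact hp
  filter_upwards [hpress, (Filter.eventually_all_finset J).2 hforce] with p hp hf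
  rw [truncVelocity, truncVelocity, ← hJ]
  set A := ∑ j ∈ J, averagedForce f p.1 (X p.1 k p.2 - X p.1 j p.2) with hA
  set A' := ∑ j ∈ J, (if Z k - Z j = -(L / 2) then 0 else f (Z k - Z j)) with hA'
  set E := ∑ j ∈ J, (if Z k - Z j = -(L / 2) then κ else 0) with hE
  have hAA : |A - A'| ≤ E + N * η' := by
    rw [hA, hA', ← Finset.sum_sub_distrib]
    refine (Finset.abs_sum_le_sum_abs _ _).trans ((Finset.sum_le_sum hf).trans ?_)
    rw [Finset.sum_add_distrib, Finset.sum_const, nsmul_eq_mul]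
    refine add_le_add le_rfl (mul_le_mul_of_nonneg_right ?_ hη0.le)
    rw [hJ, Int.card_Ioo]
    have : (k + (N : ℤ) - k - 1).toNat ≤ N := by omega
    exact_mod_cast this
  set a := truncPressure φ (c / N) δ (X p.1 (k + 1) p.2 - X p.1 k p.2) -
      truncPressure φ (c / N) δ (X p.1 k p.2 - X p.1 (k - 1) p.2)
  set b := truncPressure φ (c / N) δ (Z (k + 1) - Z k) -
      truncPressure φ (c / N) δ (Z k - Z (k - 1))
  have e : -(c / N) * A - N / c * a - (-(c / N) * A' - N / c * b) =
      -(c / N * (A - A')) - N / c * (a - b) := by ring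
  rw [e]
  refine (abs_sub _ _).trans ?_
  rw [abs_neg, abs_mul, abs_mul, abs_of_pos hμ, abs_of_pos (div_pos hNr hc)]
  have h1 := mul_le_mul_of_nonneg_left hAA hμ.le
  have h2 := mul_le_mul_of_nonneg_left hp (div_pos hNr hc).le
  have h3 : c / N * (N * η') + N / c * η' = η := by
    have : c / N * (N * η') + N / c * η' = (c + N / c) * η' := by field_simp
    rw [this, hη']; field_simp
  rw [mul_add] at h1
  linarith

/-- A velocity within the jump at the midpoint is attained by an admissible choice of forces. -/
theorem exists_force_of_abs_sub_le (hc : 0 < c) (hS : TorusForce S f L B Λ κ) {Z : ℤ → ℝ}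
    (hZ : PeriodicConfig L N Z) (hgap : ∀ k, δ ≤ Z (k + 1) - Z k) {k : ℤ} {D : ℝ}
    (hD : |D - truncVelocity φ c N δ (fun z => if z = -(L / 2) then 0 else f z) Z k| ≤
      c / N * ∑ j ∈ Finset.Ioo k (k + (N : ℤ)), (if Z k - Z j = -(L / 2) then κ else 0)) :
    ∃ g : ℤ → ℝ, (∀ j ∈ Finset.Ioo k (k + (N : ℤ)), g j ∈ S (Z k - Z j)) ∧
      D = -(c / N) * ∑ j ∈ Finset.Ioo k (k + (N : ℤ)), g j - (N / c) *
        (φ (cellDensity c N Z k) - φ (cellDensity c N Z (k - 1))) := by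
  have hNr : (0 : ℝ) < N := by exact_mod_cast hZ.pos
  have hμ := div_pos hc hNr
  set J := Finset.Ioo k (k + (N : ℤ)) with hJ
  set q := truncVelocity φ c N δ (fun z => if z = -(L / 2) then 0 else f z) Z k with hq
  set m : ℝ := ∑ j ∈ J, (if Z k - Z j = -(L / 2) then 1 else 0) with hm
  have hm0 : 0 ≤ m := Finset.sum_nonneg fun j _ => by split_ifs <;> norm_num
  have hE : ∀ θ : ℝ, ∑ j ∈ J, (if Z k - Z j = -(L / 2) then θ else 0) = θ * m := by
    intro θ
    rw [hm, Finset.mul_sum]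
    refine Finset.sum_congr rfl fun j _ => ?_
    split_ifs <;> simp
  rw [hE] at hD
  -- The defect is shared equally among the `m` particles at distance `L / 2`; each share is then at
  -- most `κ`. For `m = 0` the defect vanishes and the default value of the quotient is harmless.
  set θ := -((N / c) * (D - q) / m) with hθ
  have hθm : c / N * (θ * m) = -(D - q) := by
    rcases hm0.eq_or_lt with h0 | h0
    · rw [← h0, mul_zero, mul_zero] at hD
      rw [abs_nonpos_iff.1 hD, ← h0]; simp
    · rw [hθ]; field_simp
  have hθκ : 0 < m → |θ| ≤ κ := by
    intro h0
    have h1 : |c / N * (θ * m)| = c / N * (|θ| * m) := by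
      rw [abs_mul, abs_mul, abs_of_pos hμ, abs_of_pos h0]
    rw [hθm, abs_neg] at h1
    rw [h1] at hD
    exact le_of_mul_le_mul_right (le_of_mul_le_mul_left hD hμ) h0
  refine ⟨fun j => (if Z k - Z j = -(L / 2) then 0 else f (Z k - Z j)) +
    (if Z k - Z j = -(L / 2) then θ else 0), fun j hj => ?_, ?_⟩
  · dsimp only
    split_ifs with hmid
    · rw [hmid, hS.eq_mid, mem_ofPred_eq, zero_add]
      refine hθκ ?_
      refine lt_of_lt_of_le one_pos ?_
      have := Finset.single_le_sum (f := fun j => if Z k - Z j = -(L / 2) then (1 : ℝ) else 0)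
        (fun j _ => by split_ifs <;> norm_num) hj
      simp only [hmid, if_true] at this
      exact this
    · rw [hS.eq_singleton _ (hZ.sub_mem_Ioo hj) hmid, add_zero]; rfl
  -- All gaps are at least `δ`, so the truncation is inactive.
  · have hcell : ∀ i, φ (cellDensity c N Z i) = truncPressure φ (c / N) δ (Z (i + 1) - Z i) := by
      intro i
      rw [truncPressure, max_eq_left (hgap i), cellDensity, div_div]
    rw [Finset.sum_add_distrib, hE, hcell, hcell, sub_add_cancel, mul_add]
    have : q = -(c / N) * ∑ j ∈ J, (if Z k - Z j = -(L / 2) then 0 else f (Z k - Z j)) - N / c *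
      (truncPressure φ (c / N) δ (Z (k + 1) - Z k) -
        truncPressure φ (c / N) δ (Z k - Z (k - 1))) := rfl
    linarith

end Limit

/-! ### Existence of the particle systems. -/

section Existence

variable {φ W f ρ₀ : ℝ → ℝ} {S : ℝ → Set ℝ} {T L c B Λ κ : ℝ} {N : ℕ}

/-- With `δ = c / N / r` the energy of a gap `δ` is `c / N` times `W r / r`, which exceeds any given
budget `A` for large `r`. -/
theorem exists_truncation (hφ : AdmissibleDiffusion φ W) (hc : 0 < c) {y : ℤ → ℝ}
    (hy : PeriodicConfig L N y) (A : ℝ) :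
    ∃ δ, 0 < δ ∧ (∀ k, δ ≤ y (k + 1) - y k) ∧ A < δ * W (c / N / δ) := by
  have hNr : (0 : ℝ) < N := by exact_mod_cast hy.pos
  have hμ := div_pos hc hNr
  have h1 : ∀ᶠ r : ℝ in atTop, ∀ k ∈ Finset.range N, c / N / (y ((k : ℤ) + 1) - y k) ≤ r :=
    (Filter.eventually_all_finset _).2 fun k _ => eventually_ge_atTop _
  obtain ⟨r, hr1, hr2, hr0⟩ := (h1.and ((hφ.tendsto_W_div.eventually_gt_atTop (A / (c / N))).and
    (eventually_gt_atTop 0))).exists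
  refine ⟨c / N / r, div_pos hμ hr0, fun k => ?_, ?_⟩
  · have hper : ∀ k, y (k + N + 1) - y (k + N) = y (k + 1) - y k := by
      intro k
      rw [show k + (N : ℤ) + 1 = k + 1 + N by ring, hy.per, hy.per]; ring
    obtain ⟨j, hj, hjk⟩ := exists_range_eq_of_periodic (f := fun k => y (k + 1) - y k) hy.pos hper k
    rw [hjk]
    have h2 := hr1 j hj
    have h3 : 0 < y ((j : ℤ) + 1) - y j := sub_pos.2 (hy.lt j)
    rw [div_le_iff₀ h3] at h2
    rw [div_le_iff₀ hr0]; linarith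
  · have e : c / N / (c / N / r) = r := by field_simp
    rw [e]
    rw [div_lt_iff₀ hμ] at hr2
    refine hr2.trans_eq ?_
    field_simp

/-- Particle flows exist for every initial configuration. -/
theorem exists_particleFlow (hφ : AdmissibleDiffusion φ W) (hc : 0 < c) (hT : 0 < T)
    (hS : TorusForce S f L B Λ κ) {y : ℤ → ℝ} (hy : PeriodicConfig L N y) :
    ∃ X : ℤ → ℝ → ℝ, ParticleFlow φ S T L c N X ∧ ∀ k, X k 0 = y k := by
  have hN := hy.pos
  obtain ⟨δ, hδ, hgap, hbig⟩ := exists_truncation hφ hc hy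
    (∑ k ∈ Finset.range N, (y ((k : ℤ) + 1) - y k) * W (c / N / (y ((k : ℤ) + 1) - y k)) +
      T * (c * (c * B) ^ 2 / 2))
  have hgB := abs_averagedForce_le hS.measurable hS.bound
  have hsol : ∀ n, ∃ X : ℤ → ℝ → ℝ, (∀ k t, X (k + N) t = X k t + L) ∧ (∀ k, X k 0 = y k) ∧
      ∀ k, ∀ t ∈ Icc 0 T, HasDerivWithinAt (X k)
        (truncVelocity φ c N δ (averagedForce f n) (fun i => X i t) k) (Icc 0 T) t := fun n =>
    exists_truncated_solution hφ hc hδ hT.le hS.bound_nonneg (hgB n)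
      (by have := hS.bound_nonneg; positivity) (averagedForce_lipschitz hS.measurable hS.bound n) hy
  choose Y hYper hY0 hYd using hsol
  set V := c * B + N / c * φ (c / N / δ) with hV
  have hV0 : 0 ≤ V := (abs_nonneg _).trans
    (abs_truncVelocity_le hφ hc hN hδ (hgB 0) hS.bound_nonneg (fun _ => 0) 0)
  set X : ℕ → ℤ → ℝ → ℝ := fun n => clampTime T (Y n) with hX
  have hXlip : ∀ n k, ∀ a ∈ Icc 0 T, ∀ b ∈ Icc 0 T, |X n k a - X n k b| ≤ V * |a - b| := by
    intro n k a ha b hb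
    have := Convex.norm_image_sub_le_of_norm_hasDerivWithin_le (hYd n k)
      (fun t _ => abs_truncVelocity_le hφ hc hN hδ (hgB n) hS.bound_nonneg _ k)
      (convex_Icc 0 T) hb ha
    simp only [hX]
    rw [clampTime_eq ha, clampTime_eq hb]
    exact this
  have hXbd : ∀ n k t, |X n k t - y k| ≤ V * T := by
    intro n k t
    obtain ⟨s, hs, hst⟩ : ∃ s ∈ Icc 0 T, X n k t = X n k s :=
      ⟨_, clampTime_mem hT.le t, by
        simp only [hX]
        rw [clampTime_eq (clampTime_mem hT.le t), clampTime]⟩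
    have h0 : X n k 0 = y k := by
      simp only [hX]; rw [clampTime_eq ⟨le_rfl, hT.le⟩, hY0]
    rw [hst, ← h0]
    refine (hXlip n k s hs 0 ⟨le_rfl, hT.le⟩).trans (mul_le_mul_of_nonneg_left ?_ hV0)
    rw [sub_zero, abs_of_nonneg hs.1]; exact hs.2
  -- The displacements over `[0, T]` are at most `V * T`, so every coordinate has a limit along the
  -- ultrafilter.
  have hlim : ∀ k t, ∃ z, Tendsto (fun n => X n k t) (hyperfilter ℕ) (𝓝 z) := fun k t =>
    exists_ultrafilter_limit fun n => hXbd n k t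
  choose Z hZ using hlim
  have hZper : ∀ k t, Z (k + N) t = Z k t + L := by
    intro k t
    refine tendsto_nhds_unique (hZ (k + N) t) (((hZ k t).add_const L).congr fun n => ?_)
    simp only [hX, clampTime, hYper]
  have hZ0 : ∀ k, Z k 0 = y k := by
    intro k
    refine tendsto_nhds_unique (hZ k 0) (tendsto_const_nhds.congr fun n => ?_)
    simp only [hX]; rw [clampTime_eq ⟨le_rfl, hT.le⟩, hY0]
  -- The lower bound `δ` does not depend on the regularization index, so the limit particles remain
  -- strictly ordered.
  have hZgap : ∀ t ∈ Icc 0 T, ∀ k, δ ≤ Z (k + 1) t - Z k t := by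
    intro t ht k
    refine ge_of_tendsto ((hZ (k + 1) t).sub (hZ k t)) (Eventually.of_forall fun n => ?_)
    have := lt_gap_of_truncated hφ hc hδ hT.le hS.bound_nonneg (hgB n) hy hgap hbig (hYper n)
      (hY0 n) (hYd n) ht k
    simp only [hX]
    rw [clampTime_eq ht, clampTime_eq ht]
    exact this.le
  have hZlip : ∀ k, LipschitzOnWith V.toNNReal (Z k) (Icc 0 T) := by
    intro k
    refine LipschitzOnWith.of_dist_le_mul fun a ha b hb => ?_
    rw [Real.coe_toNNReal _ hV0]
    refine le_of_tendsto ((hZ k a).sub (hZ k b)).abs (Eventually.of_forall fun n => ?_)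
    exact hXlip n k a ha b hb
  have hconfig : ∀ t ∈ Icc 0 T, PeriodicConfig L N fun k => Z k t := fun t ht =>
    ⟨hN, fun k => hZper k t, fun k => by have := hZgap t ht k; linarith⟩
  refine ⟨Z, ⟨hZper, hconfig, fun k => ⟨_, hZlip k⟩, ?_⟩, hZ0⟩
  have hdiff : ∀ᵐ t ∂(volume.restrict (Icc 0 T)), t ∈ Ioo 0 T ∧ ∀ k, DifferentiableAt ℝ (Z k) t := by
    filter_upwards [ae_all_iff.2 fun k => ae_differentiableAt_of_lipschitzOnWith ⟨_, hZlip k⟩]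
      with t ht
    exact ⟨(ht 0).1, fun k => (ht k).2⟩
  filter_upwards [hdiff] with t ⟨ht, hd⟩
  have htc := Ioo_subset_Icc_self ht
  have hnhds : Ioo 0 T ∈ 𝓝 t := Ioo_mem_nhds ht.1 ht.2
  have hjoint : ∀ k, Tendsto (fun p : ℕ × ℝ => X p.1 k p.2) ((hyperfilter ℕ : Filter ℕ) ×ˢ 𝓝 t)
      (𝓝 (Z k t)) := fun k =>
    tendsto_prod_of_equiLipschitz (V := V) hnhds
      (fun n a ha => hXlip n k a (Ioo_subset_Icc_self ha) t htc) (hZ k t)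
  have hXd : ∀ n k, ∀ a ∈ Ioo 0 T, HasDerivAt (X n k)
      (truncVelocity φ c N δ (averagedForce f n) (fun i => X n i a) k) a := by
    intro n k a ha
    have h1 := (hYd n k a (Ioo_subset_Icc_self ha)).hasDerivAt (Icc_mem_nhds ha.1 ha.2)
    have h2 : (fun i => X n i a) = fun i => Y n i a :=
      funext fun i => clampTime_eq (Ioo_subset_Icc_self ha) _ _
    rw [h2]
    refine h1.congr_of_eventuallyEq ?_
    filter_upwards [Ioo_mem_nhds ha.1 ha.2] with s hs
    exact clampTime_eq (Ioo_subset_Icc_self hs) _ _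
  have hforce : ∀ k, ∃ g : ℤ → ℝ, (∀ j ∈ Finset.Ioo k (k + (N : ℤ)), g j ∈ S (Z k t - Z j t)) ∧
      deriv (Z k) t = -(c / N) * ∑ j ∈ Finset.Ioo k (k + (N : ℤ)), g j - (N / c) *
        (φ (cellDensity c N (fun i => Z i t) k) - φ (cellDensity c N (fun i => Z i t) (k - 1))) := by
    intro k
    -- The limit velocity differs from the one with zero force at the midpoint by at most the total
    -- jump plus any `η > 0`; hence an admissible choice of midpoint forces realizes it.
    refine exists_force_of_abs_sub_le hc hS (hconfig t htc) (hZgap t htc)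
      (le_of_forall_pos_le_add fun η hη => ?_)
    have hE0 : 0 ≤ c / N * ∑ j ∈ Finset.Ioo k (k + (N : ℤ)),
        (if Z k t - Z j t = -(L / 2) then κ else 0) :=
      mul_nonneg (by positivity) (Finset.sum_nonneg fun j _ => by
        split_ifs; exacts [hS.jump_nonneg, le_rfl])
    refine abs_deriv_sub_le_of_tendsto (l := (hyperfilter ℕ : Filter ℕ)) hnhds
      (add_nonneg hE0 hη.le) (fun n a ha => hXd n k a ha)
      (eventually_truncVelocity hφ hc hδ hS
        (tendsto_fst.mono_right Nat.hyperfilter_le_atTop) (hconfig t htc) hjoint k hη)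
      (hZ k) (hd k).hasDerivAt
  choose g hg hgD using hforce
  refine ⟨fun k => -(c / N) * ∑ j ∈ Finset.Ioo k (k + (N : ℤ)), g k j, fun k =>
    ⟨⟨g k, hg k, rfl⟩, ?_⟩⟩
  rw [← hgD k]
  exact (hd k).hasDerivAt

/-- Since the `N`-th quantile is `L / 2`, translating by the period continues the initial positions
to an increasing sequence. -/
theorem exists_initialConfig (hint : Integrable ρ₀) (hpos : ∀ᵐ x, 0 < ρ₀ x) (hL : 0 < L)
    (hN : 0 < N) : ∃ y : ℤ → ℝ, PeriodicConfig L N y ∧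
      ∀ k : ℕ, k < N → y k = initialPosition ρ₀ L N k := by
  have hNz : (0 : ℤ) < N := by exact_mod_cast hN
  set p := initialPosition ρ₀ L N with hp
  set y : ℤ → ℝ := fun k => p (k % N).toNat + L * (k / N : ℤ) with hy
  have hval : ∀ (i : ℕ) (q : ℤ), i < N → y (i + q * N) = p i + L * q := by
    intro i q hi
    have h1 : ((i : ℤ) + q * N) % N = i := by
      rw [Int.add_mul_emod_self_right]
      exact Int.emod_eq_of_lt (by positivity) (by exact_mod_cast hi)
    have h2 : ((i : ℤ) + q * N) / N = q := by
      rw [Int.add_mul_ediv_right _ _ hNz.ne',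
        Int.ediv_eq_zero_of_lt (by positivity) (by exact_mod_cast hi), zero_add]
    simp only [hy, h1, h2, Int.toNat_natCast]
  have hval' : ∀ (i : ℕ) (q : ℤ), i ≤ N → y (i + q * N) = p i + L * q := by
    intro i q hi
    rcases hi.lt_or_eq with h | h
    · exact hval i q h
    · have h3 := hval 0 (q + 1) hN
      rw [h]
      have e : ((0 : ℕ) : ℤ) + (q + 1) * N = N + q * N := by push_cast; ring
      rw [e] at h3
      rw [h3, hp, initialPosition_last hint hpos hL hN]
      simp only [initialPosition]
      push_cast; ring
  have hrep : ∀ k : ℤ, ∃ (i : ℕ) (q : ℤ), i < N ∧ k = i + q * N := by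
    intro k
    have h1 := Int.emod_nonneg k hNz.ne'
    have h2 := Int.emod_lt_of_pos k hNz
    refine ⟨(k % N).toNat, k / N, by omega, ?_⟩
    rw [Int.toNat_of_nonneg h1]
    have := Int.emod_add_mul_ediv k N
    linarith
  refine ⟨y, ⟨hN, fun k => ?_, fun k => ?_⟩, fun k hk => ?_⟩
  · obtain ⟨i, q, hi, rfl⟩ := hrep k
    rw [show (i : ℤ) + q * N + N = i + (q + 1) * N by ring, hval _ _ hi, hval _ _ hi]
    push_cast; ring
  · obtain ⟨i, q, hi, rfl⟩ := hrep k
    have h3 := hval' (i + 1) q hi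
    push_cast at h3
    rw [show (i : ℤ) + q * N + 1 = i + 1 + q * N by ring, h3, hval _ _ hi]
    have := initialPosition_lt hint hpos hL hN hi
    linarith
  · have := hval k 0 hk
    simpa using this

theorem exists_particleSystem (hφ : AdmissibleDiffusion φ W) (hint : Integrable ρ₀)
    (hpos : ∀ᵐ x, 0 < ρ₀ x) (hT : 0 < T) (hL : 0 < L) {F : ℝ → ℝ → Set ℝ}
    (hF : TorusForce (F L) f L B Λ κ) (hN : 0 < N) :
    ∃ x : ℤ → ℝ → ℝ, IsParticleSystem φ ρ₀ F T L N x := by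
  obtain ⟨y, hy, hy0⟩ := exists_initialConfig hint hpos hL hN
  obtain ⟨X, hX, hX0⟩ := exists_particleFlow hφ (cutMass_pos hint hpos hL) hT hF hy
  refine ⟨X, hX.per, fun k hk => by rw [hX0, hy0 k hk], fun t ht k => (hX.config t ht).lt k, hX.lip,
    fun k => ?_⟩
  filter_upwards [hX.ode] with t ⟨v, hv⟩
  obtain ⟨⟨g, hg, hgv⟩, hd⟩ := hv k
  exact ⟨g, hg, by rw [← hgv]; exact hd⟩

end Existence

/-! ### One-sided mollification in space. -/

/-- A Lipschitz probability density supported in `[0, h]`. -/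
structure IsMollifier (w : ℝ → ℝ) (h D : ℝ) : Prop where
  nonneg : ∀ s, 0 ≤ w s
  lip : ∀ s r, |w s - w r| ≤ D * |s - r|
  support : ∀ s, s ∉ Icc 0 h → w s = 0
  integrable : Integrable w
  integral_eq : ∫ s, w s = 1

theorem exists_isMollifier {h : ℝ} (hh : 0 < h) : ∃ w D, IsMollifier w h D := by
  let f : ContDiffBump (h / 2) := ⟨h / 4, h / 2, by positivity, by linarith⟩
  obtain ⟨C, hC⟩ := ContDiff.lipschitzWith_of_hasCompactSupport (𝕂 := ℝ) (n := 1)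
    (f.hasCompactSupport_normed (μ := volume)) f.contDiff_normed one_ne_zero
  refine ⟨f.normed volume, C, fun s => f.nonneg_normed s, fun s r => hC.dist_le_mul s r,
    fun s hs => ?_, f.integrable_normed, f.integral_normed⟩
  have h1 : s ∉ Function.support (f.normed volume) := by
    rw [f.support_normed_eq]
    intro hs'
    rw [Metric.mem_ball, Real.dist_eq, abs_lt] at hs'
    have : f.rOut = h / 2 := rfl
    rw [this] at hs'
    exact hs ⟨by linarith [hs'.1], by linarith [hs'.2]⟩
  exact Function.notMem_support.1 h1

namespace IsMollifier

variable {w : ℝ → ℝ} {h D : ℝ}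

theorem continuous (hw : IsMollifier w h D) : Continuous w := by
  have hD : 0 ≤ D := by have := (abs_nonneg _).trans (hw.lip 1 0); simpa using this
  refine LipschitzWith.continuous (K := D.toNNReal) (LipschitzWith.of_dist_le_mul fun s r => ?_)
  rw [Real.coe_toNNReal _ hD]; exact hw.lip s r

theorem lip_nonneg (hw : IsMollifier w h D) : 0 ≤ D := by
  have := (abs_nonneg _).trans (hw.lip 1 0); simpa using this

theorem lintegral_eq (hw : IsMollifier w h D) : ∫⁻ s, ENNReal.ofReal (w s) = 1 := by
  rw [← ofReal_integral_eq_lintegral_ofReal hw.integrable (ae_of_all _ hw.nonneg), hw.integral_eq,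
    ENNReal.ofReal_one]

/-- As `w` has integral one, the mollification error is an average of forward translation errors. -/
theorem ofReal_abs_sub_integral_le (hw : IsMollifier w h D) {v : ℝ → ℝ} (hv : Measurable v) {M : ℝ}
    (hM : ∀ y, |v y| ≤ M) (x : ℝ) :
    ENNReal.ofReal |v x - ∫ y, v y * w (y - x)| ≤
      ∫⁻ s, ENNReal.ofReal (w s) * ENNReal.ofReal |v x - v (x + s)| := by
  have h1 : ∫ y, v y * w (y - x) = ∫ s, v (x + s) * w s := by
    rw [← integral_add_right_eq_self (fun y => v y * w (y - x)) x]
    refine integral_congr_ae (ae_of_all _ fun s => ?_)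
    simp only
    rw [add_sub_cancel_right, add_comm s x]
  have hi : Integrable fun s => v (x + s) * w s :=
    hw.integrable.bdd_mul (hv.comp (measurable_const_add x)).aestronglyMeasurable
      (ae_of_all _ fun s => hM _)
  have h2 : v x - ∫ y, v y * w (y - x) = ∫ s, w s * (v x - v (x + s)) := by
    have : v x = ∫ s, v x * w s := by rw [integral_const_mul, hw.integral_eq, mul_one]
    rw [h1]
    nth_rewrite 1 [this]
    rw [← integral_sub (hw.integrable.const_mul _) hi]
    refine integral_congr_ae (ae_of_all _ fun s => ?_)
    simp only; ring
  rw [h2, ← Real.enorm_eq_ofReal_abs]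
  refine (enorm_integral_le_lintegral_enorm _).trans (lintegral_mono fun s => ?_)
  rw [enorm_mul, Real.enorm_eq_ofReal_abs, Real.enorm_eq_ofReal_abs, abs_of_nonneg (hw.nonneg s)]

/-- The mollification error is controlled by the translations of `φ ∘ v`. -/
theorem lintegral_abs_sub_integral_le (hw : IsMollifier w h D) {v : ℝ → ℝ → ℝ} {φ : ℝ → ℝ}
    (hφ : Continuous φ) (hv : Measurable fun p : ℝ × ℝ => v p.1 p.2) {M T R C ε A : ℝ}
    (hv0 : ∀ t y, v t y ∈ Icc 0 M) (hC : 0 ≤ C) (hA : 0 ≤ A)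
    (hG : ∀ z ∈ Ioc 0 h, ∫⁻ t in Icc 0 T, ∫⁻ y in Icc (-R) R,
      ENNReal.ofReal |φ (v t (y + z)) - φ (v t y)| ≤ ENNReal.ofReal (C * z))
    (hε : ∀ a ∈ Icc 0 M, ∀ b ∈ Icc 0 M, |a - b| ≤ ε + A * |φ a - φ b|) :
    ∫⁻ p in Icc 0 T ×ˢ Icc (-R) R, ENNReal.ofReal |v p.1 p.2 - ∫ y, v p.1 y * w (y - p.2)| ≤
      ENNReal.ofReal ε * volume (Icc 0 T ×ˢ Icc (-R) R) + ENNReal.ofReal (A * (C * h)) := by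
  set Q : Set (ℝ × ℝ) := Icc 0 T ×ˢ Icc (-R) R with hQ
  have hwm := hw.continuous.measurable
  have hvs : Measurable fun q : (ℝ × ℝ) × ℝ => v q.1.1 (q.1.2 + q.2) :=
    hv.comp ((measurable_fst.comp measurable_fst).prodMk
      ((measurable_snd.comp measurable_fst).add measurable_snd))
  have hvq : Measurable fun q : (ℝ × ℝ) × ℝ => v q.1.1 q.1.2 := hv.comp measurable_fst
  have hGm : Measurable fun q : (ℝ × ℝ) × ℝ => ENNReal.ofReal (w q.2) *
      ENNReal.ofReal |φ (v q.1.1 (q.1.2 + q.2)) - φ (v q.1.1 q.1.2)| := by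
    refine ((hwm.comp measurable_snd).ennreal_ofReal).mul (Measurable.ennreal_ofReal ?_)
    have := ((hφ.measurable.comp hvs).sub (hφ.measurable.comp hvq))
    exact continuous_abs.measurable.comp this
  have hpt : ∀ p : ℝ × ℝ, ENNReal.ofReal |v p.1 p.2 - ∫ y, v p.1 y * w (y - p.2)| ≤
      ENNReal.ofReal ε + ENNReal.ofReal A * ∫⁻ s, ENNReal.ofReal (w s) *
        ENNReal.ofReal |φ (v p.1 (p.2 + s)) - φ (v p.1 p.2)| := by
    intro p
    have hvp : Measurable (v p.1) := hv.comp (measurable_const.prodMk measurable_id)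
    refine (hw.ofReal_abs_sub_integral_le (M := M) hvp
      (fun y => by rw [abs_of_nonneg (hv0 _ _).1]; exact (hv0 _ _).2) p.2).trans ?_
    -- Differences of densities are traded for differences of `φ`, at the price of the slack `ε`.
    have h1 : ∀ s, ENNReal.ofReal (w s) * ENNReal.ofReal |v p.1 p.2 - v p.1 (p.2 + s)| ≤
        ENNReal.ofReal ε * ENNReal.ofReal (w s) + ENNReal.ofReal A * (ENNReal.ofReal (w s) *
          ENNReal.ofReal |φ (v p.1 (p.2 + s)) - φ (v p.1 p.2)|) := by
      intro s
      have h2 : ENNReal.ofReal |v p.1 p.2 - v p.1 (p.2 + s)| ≤ ENNReal.ofReal ε +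
          ENNReal.ofReal A * ENNReal.ofReal |φ (v p.1 (p.2 + s)) - φ (v p.1 p.2)| := by
        rw [← ENNReal.ofReal_mul hA]
        refine le_trans (ENNReal.ofReal_le_ofReal ?_) ENNReal.ofReal_add_le
        rw [abs_sub_comm (φ _)]
        exact hε _ (hv0 _ _) _ (hv0 _ _)
      refine (mul_le_mul_right h2 _).trans (le_of_eq ?_)
      ring
    refine (lintegral_mono h1).trans (le_of_eq ?_)
    have h3 : Measurable fun s => ENNReal.ofReal (w s) *
        ENNReal.ofReal |φ (v p.1 (p.2 + s)) - φ (v p.1 p.2)| :=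
      hGm.comp (measurable_const.prodMk measurable_id : Measurable fun s : ℝ => (p, s))
    rw [lintegral_add_left (hwm.ennreal_ofReal.const_mul _),
      lintegral_const_mul _ hwm.ennreal_ofReal, hw.lintegral_eq, mul_one, lintegral_const_mul _ h3]
  refine (lintegral_mono hpt).trans ?_
  rw [lintegral_add_left measurable_const, lintegral_const, Measure.restrict_apply_univ]
  refine add_le_add le_rfl ?_
  rw [ENNReal.ofReal_mul hA]
  refine (lintegral_const_mul (ENNReal.ofReal A) hGm.lintegral_prod_right').trans_le ?_
  refine mul_le_mul_right ?_ _
  refine (lintegral_lintegral_swap (f := fun (p : ℝ × ℝ) s => ENNReal.ofReal (w s) *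
        ENNReal.ofReal |φ (v p.1 (p.2 + s)) - φ (v p.1 p.2)|) hGm.aemeasurable).trans_le ?_
  -- Shifts in `(0, h]` are covered by the translation bound, the shift `0` contributes nothing, and
  -- elsewhere the weight vanishes.
  have h4 : ∀ s, ∫⁻ p in Q, ENNReal.ofReal (w s) *
      ENNReal.ofReal |φ (v p.1 (p.2 + s)) - φ (v p.1 p.2)| ≤
      ENNReal.ofReal (w s) * ENNReal.ofReal (C * h) := by
    intro s
    have hm : Measurable fun p : ℝ × ℝ =>
        ENNReal.ofReal |φ (v p.1 (p.2 + s)) - φ (v p.1 p.2)| := by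
      refine Measurable.ennreal_ofReal (continuous_abs.measurable.comp ?_)
      exact (hφ.measurable.comp (hv.comp (measurable_fst.prodMk (measurable_snd.add_const s)))).sub
        (hφ.measurable.comp hv)
    rw [lintegral_const_mul _ hm]
    rcases em (s ∈ Ioc 0 h) with hs | hs
    · refine mul_le_mul_right ?_ _
      rw [hQ, Measure.volume_eq_prod, ← Measure.prod_restrict, lintegral_prod _ hm.aemeasurable]
      refine (hG s hs).trans (ENNReal.ofReal_le_ofReal ?_)
      exact mul_le_mul_of_nonneg_left hs.2 hC
    · by_cases hs0 : s = 0
      · subst hs0; simp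
      · have : w s = 0 := hw.support s fun h' => hs ⟨lt_of_le_of_ne h'.1 (Ne.symm hs0), h'.2⟩
        rw [this]; simp
  refine (lintegral_mono h4).trans (le_of_eq ?_)
  rw [lintegral_mul_const _ hwm.ennreal_ofReal, hw.lintegral_eq, one_mul]

end IsMollifier

/-! ### Compactness in `L¹`. -/

/-- Uniformly bounded densities on growing intervals with the compactness properties of the particle
densities. -/
structure IsCompactSequence (φ : ℝ → ℝ) (T M C : ℝ) (ℓ : ℕ → ℝ) (v : ℕ → ℝ → ℝ → ℝ) : Prop where
  measurable : ∀ n, Measurable fun p : ℝ × ℝ => v n p.1 p.2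
  mem : ∀ n t y, v n t y ∈ Icc 0 M
  support : ∀ n t y, ℓ n < |y| → v n t y = 0
  translate : ∀ R R', R < R' → (∀ᶠ n in atTop, R' < ℓ n) → ∀ᶠ n in atTop, ∀ z ∈ Ioc 0 (R' - R),
    ∫⁻ t in Icc 0 T, ∫⁻ y in Icc (-R) R, ENNReal.ofReal |φ (v n t (y + z)) - φ (v n t y)| ≤
      ENNReal.ofReal (C * z)
  equicont : ∀ R, (∀ᶠ n in atTop, R < ℓ n) → ∀ (ζ : ℝ → ℝ) (D : ℝ),
    (∀ y z, |ζ y - ζ z| ≤ D * |y - z|) → (∀ y, R < |y| → ζ y = 0) → ∀ ε, 0 < ε → ∃ δ, 0 < δ ∧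
    ∀ᶠ n in atTop, ∀ s ∈ Icc 0 T, ∀ t ∈ Icc 0 T, |t - s| ≤ δ →
      |(∫ y, v n t y * ζ y) - ∫ y, v n s y * ζ y| ≤ ε
  tight : ∀ ε, 0 < ε → ∃ R R', R < R' ∧ (∀ᶠ n in atTop, R' < ℓ n) ∧
    ∀ᶠ n in atTop, ∫⁻ p in Icc 0 T ×ˢ (Icc (-R) R)ᶜ, ENNReal.ofReal (v n p.1 p.2) ≤
      ENNReal.ofReal ε

namespace IsCompactSequence

variable {φ : ℝ → ℝ} {T M C : ℝ} {ℓ : ℕ → ℝ} {v : ℕ → ℝ → ℝ → ℝ}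

theorem measurable_right (hv : IsCompactSequence φ T M C ℓ v) (n : ℕ) (t : ℝ) :
    Measurable (v n t) := (hv.measurable n).comp (measurable_const.prodMk measurable_id)

theorem bound_nonneg (hv : IsCompactSequence φ T M C ℓ v) : 0 ≤ M :=
  (hv.mem 0 0 0).1.trans (hv.mem 0 0 0).2

theorem abs_le (hv : IsCompactSequence φ T M C ℓ v) (n : ℕ) (t y : ℝ) : |v n t y| ≤ M := by
  rw [abs_of_nonneg (hv.mem n t y).1]; exact (hv.mem n t y).2

/-- The mollified densities are Lipschitz in space. -/
theorem abs_integral_sub_le (hv : IsCompactSequence φ T M C ℓ v) {w : ℝ → ℝ} {h D : ℝ}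
    (hw : IsMollifier w h D) {R x p : ℝ} (hx : -R ≤ x ∧ x + h ≤ R) (hp : -R ≤ p ∧ p + h ≤ R)
    (hR : 0 ≤ R) (n : ℕ) (t : ℝ) :
    |(∫ y, v n t y * w (y - x)) - ∫ y, v n t y * w (y - p)| ≤ M * (D * |x - p|) * (2 * R) := by
  have hi : ∀ x, Integrable fun y => v n t y * w (y - x) := fun x =>
    (hw.integrable.comp_sub_right x).bdd_mul (hv.measurable_right n t).aestronglyMeasurable
      (ae_of_all _ fun s => hv.abs_le n t s)
  rw [← integral_sub (hi x) (hi p)]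
  have h1 : ∫ y, (v n t y * w (y - x) - v n t y * w (y - p)) =
      ∫ y in Icc (-R) R, (v n t y * w (y - x) - v n t y * w (y - p)) := by
    rw [setIntegral_eq_integral_of_forall_compl_eq_zero]
    intro y hy
    rw [hw.support (y - x), hw.support (y - p), sub_self]
    · intro h'; exact hy ⟨by linarith [h'.1], by linarith [h'.2]⟩
    · intro h'; exact hy ⟨by linarith [h'.1], by linarith [h'.2]⟩
  rw [h1, ← Real.norm_eq_abs]
  refine (norm_setIntegral_le_of_norm_le_const (C := M * (D * |x - p|)) (by simp) fun y _ => ?_).trans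
    (le_of_eq ?_)
  · rw [Real.norm_eq_abs, ← mul_sub, abs_mul]
    have h2 := hw.lip (y - x) (y - p)
    rw [show y - x - (y - p) = p - x by ring, abs_sub_comm p x] at h2
    exact mul_le_mul (hv.abs_le n t y) h2 (abs_nonneg _) hv.bound_nonneg
  · rw [Real.volume_real_Icc_of_le (by linarith)]; ring

/-- If the mollified densities converge at rational points, they converge everywhere. -/
theorem cauchy_integral (hv : IsCompactSequence φ T M C ℓ v) (hT : 0 < T) {w : ℝ → ℝ} {h D : ℝ}
    (hw : IsMollifier w h D) {s : ℕ → ℕ} (hs : StrictMono s)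
    (hconv : ∀ q p : ℚ, CauchySeq fun n => ∫ y, v (s n) q y * w (y - p)) {R : ℝ} (hR : 0 < R)
    (hℓ : ∀ᶠ n in atTop, R < ℓ n) {t x : ℝ} (ht : t ∈ Icc 0 T) (hx : -R < x ∧ x + h < R) :
    CauchySeq fun n => ∫ y, v (s n) t y * w (y - x) := by
  rw [Metric.cauchySeq_iff]
  intro ε hε
  have hD := hw.lip_nonneg
  have hM := hv.bound_nonneg
  have hε5 : 0 < ε / 6 := by positivity
  have hp : ∀ᶠ p in 𝓝 x, M * (D * |x - p|) * (2 * R) < ε / 6 ∧ -R < p ∧ p + h < R := by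
    have h1 : Tendsto (fun p => M * (D * |x - p|) * (2 * R)) (𝓝 x)
        (𝓝 (M * (D * |x - x|) * (2 * R))) := Continuous.tendsto (by fun_prop) x
    rw [sub_self, abs_zero, mul_zero, mul_zero, zero_mul] at h1
    have h2 : Tendsto (fun p : ℝ => p + h) (𝓝 x) (𝓝 (x + h)) := Continuous.tendsto (by fun_prop) x
    exact (h1.eventually_lt_const hε5).and
      ((eventually_gt_nhds hx.1).and (h2.eventually_lt_const hx.2))
  obtain ⟨p, hp1, hp2, hp3⟩ := (Rat.denseRange_cast (𝕜 := ℝ)).mem_nhds hp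
  -- The point `x` is moved to the rational `p` by the Lipschitz bound of the mollified density, and
  -- the time `t` to a rational `q` by equicontinuity.
  obtain ⟨δ, hδ, heq⟩ := hv.equicont R hℓ (fun y => w (y - p)) D (fun y z => by
      have := hw.lip (y - p) (z - p)
      rwa [sub_sub_sub_cancel_right] at this) (fun y hy => hw.support _ fun h' => by
      have : |y| ≤ R := _root_.abs_le.2 ⟨by linarith [h'.1], by linarith [h'.2]⟩
      linarith) (ε / 6) hε5
  obtain ⟨q, hq1, hq2⟩ : ∃ q : ℚ, (q : ℝ) ∈ Icc 0 T ∧ |t - q| ≤ δ := by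
    have hlt : max 0 (t - δ) < min T (t + δ) := by
      rw [max_lt_iff, lt_min_iff, lt_min_iff]
      refine ⟨⟨hT, ?_⟩, ?_, ?_⟩ <;> linarith [ht.1, ht.2]
    obtain ⟨q, hq1, hq2⟩ := exists_rat_btwn hlt
    rw [max_lt_iff] at hq1
    rw [lt_min_iff] at hq2
    refine ⟨q, ⟨hq1.1.le, hq2.1.le⟩, _root_.abs_le.2 ⟨?_, ?_⟩⟩ <;> linarith [hq1.2, hq2.2]
  obtain ⟨n₁, hn₁⟩ := Metric.cauchySeq_iff.1 (hconv q p) (ε / 6) hε5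
  obtain ⟨n₂, hn₂⟩ := eventually_atTop.1 (hs.tendsto_atTop.eventually heq)
  refine ⟨max n₁ n₂, fun m hm n hn => ?_⟩
  have key : ∀ n, max n₁ n₂ ≤ n → |(∫ y, v (s n) t y * w (y - x)) - ∫ y, v (s n) q y * w (y - p)| ≤
      2 * (ε / 6) := by
    intro n hn
    have h1 := hv.abs_integral_sub_le hw ⟨hx.1.le, hx.2.le⟩ ⟨hp2.le, hp3.le⟩ hR.le (s n) t
    have h2 := hn₂ n ((le_max_right _ _).trans hn) q hq1 t ht hq2
    refine (abs_sub_le _ (∫ y, v (s n) t y * w (y - p)) _).trans ?_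
    linarith
  have h1 := key m hm
  have h2 := key n hn
  have h3 := hn₁ m ((le_max_left _ _).trans hm) n ((le_max_left _ _).trans hn)
  rw [Real.dist_eq] at h3 ⊢
  rw [_root_.abs_le] at h1 h2
  rw [abs_lt] at h3 ⊢
  constructor <;> linarith

/-- A subsequence of the mollified densities converges at rational points, for countably many
mollifiers at once. -/
theorem exists_subseq_cauchy (hv : IsCompactSequence φ T M C ℓ v) {w : ℕ → ℝ → ℝ} {h D : ℕ → ℝ}
    (hw : ∀ m, IsMollifier (w m) (h m) (D m)) :
    ∃ s : ℕ → ℕ, StrictMono s ∧ ∀ m, ∀ q p : ℚ,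
      CauchySeq fun n => ∫ y, v (s n) q y * w m (y - p) := by
  -- Sequential compactness of a countable product of intervals performs the diagonal extraction
  -- over all mollifiers and rational points.
  set K : Set (ℕ × ℚ × ℚ → ℝ) := Set.pi univ fun _ => Icc 0 M
  have hK : IsCompact K := isCompact_univ_pi fun _ => isCompact_Icc
  obtain ⟨a, -, s, hs, ha⟩ := hK.tendsto_subseq
    (x := fun n i => ∫ y, v n i.2.1 y * w i.1 (y - i.2.2)) (fun n i _ => by
      have hw' := (hw i.1).integrable.comp_sub_right (i.2.2 : ℝ)
      have hi : Integrable fun y => v n i.2.1 y * w i.1 (y - i.2.2) :=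
        hw'.bdd_mul (hv.measurable_right n _).aestronglyMeasurable
          (ae_of_all _ fun s => hv.abs_le n _ s)
      refine ⟨integral_nonneg fun y => mul_nonneg (hv.mem n _ y).1 ((hw _).nonneg _), ?_⟩
      refine (integral_mono hi (hw'.const_mul M) fun y =>
        mul_le_mul_of_nonneg_right (hv.mem n _ y).2 ((hw _).nonneg _)).trans (le_of_eq ?_)
      rw [integral_const_mul, integral_sub_right_eq_self (w i.1), (hw _).integral_eq, mul_one])
  refine ⟨s, hs, fun m q p => ?_⟩
  exact ((tendsto_pi_nhds.1 ha) (m, q, p)).cauchySeq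

end IsCompactSequence

namespace IsCompactSequence

variable {φ : ℝ → ℝ} {T M C : ℝ} {ℓ : ℕ → ℝ} {v : ℕ → ℝ → ℝ → ℝ}

theorem measurable_mollified (hv : IsCompactSequence φ T M C ℓ v) {w : ℝ → ℝ} {h D : ℝ}
    (hw : IsMollifier w h D) (n : ℕ) :
    Measurable fun p : ℝ × ℝ => ∫ y, v n p.1 y * w (y - p.2) := by
  have h1 : Measurable fun q : (ℝ × ℝ) × ℝ => v n q.1.1 q.2 * w (q.2 - q.1.2) :=
    ((hv.measurable n).comp ((measurable_fst.comp measurable_fst).prodMk measurable_snd)).mul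
      (hw.continuous.measurable.comp (measurable_snd.sub (measurable_snd.comp measurable_fst)))
  exact h1.stronglyMeasurable.integral_prod_right'.measurable

theorem abs_mollified_le (hv : IsCompactSequence φ T M C ℓ v) {w : ℝ → ℝ} {h D : ℝ}
    (hw : IsMollifier w h D) (n : ℕ) (t x : ℝ) : |∫ y, v n t y * w (y - x)| ≤ M := by
  have hw' := hw.integrable.comp_sub_right x
  have hi : Integrable fun y => v n t y * w (y - x) :=
    hw'.bdd_mul (hv.measurable_right n _).aestronglyMeasurable
      (ae_of_all _ fun s => hv.abs_le n _ s)
  rw [abs_of_nonneg (integral_nonneg fun y => mul_nonneg (hv.mem n _ y).1 (hw.nonneg _))]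
  refine (integral_mono hi (hw'.const_mul M) fun y =>
    mul_le_mul_of_nonneg_right (hv.mem n _ y).2 (hw.nonneg _)).trans (le_of_eq ?_)
  rw [integral_const_mul, integral_sub_right_eq_self w, hw.integral_eq, mul_one]

/-- Convergence of the mollified densities implies that the densities are Cauchy locally. -/
theorem cauchy_local (hv : IsCompactSequence φ T M C ℓ v) (hT : 0 < T) (hC : 0 ≤ C)
    (hφ : Continuous φ)
    (hφε : ∀ ε, 0 < ε → ∃ A, 0 ≤ A ∧ ∀ a ∈ Icc 0 M, ∀ b ∈ Icc 0 M, |a - b| ≤ ε + A * |φ a - φ b|)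
    {w : ℕ → ℝ → ℝ} {D : ℕ → ℝ} (hw : ∀ m : ℕ, IsMollifier (w m) (1 / ((m : ℝ) + 1)) (D m))
    {s : ℕ → ℕ} (hs : StrictMono s)
    (hconv : ∀ m, ∀ q p : ℚ, CauchySeq fun n => ∫ y, v (s n) q y * w m (y - p))
    {R R' : ℝ} (hRR' : R < R') (hℓ : ∀ᶠ n in atTop, R' < ℓ n) {ε : ℝ} (hε : 0 < ε) :
    ∃ n₀, ∀ n ≥ n₀, ∀ k ≥ n₀, ∫⁻ p in Icc 0 T ×ˢ Icc (-R) R,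
      ENNReal.ofReal |v (s n) p.1 p.2 - v (s k) p.1 p.2| ≤ ENNReal.ofReal ε := by
  rcases lt_or_ge R 0 with hR | hR
  · exact ⟨0, fun n _ k _ => by rw [Icc_eq_empty (by linarith : ¬ -R ≤ R)]; simp⟩
  have hR' : 0 < R' := hR.trans_lt hRR'
  set Q : Set (ℝ × ℝ) := Icc 0 T ×ˢ Icc (-R) R with hQ
  have hvol : volume Q = ENNReal.ofReal (T * (2 * R)) := by
    rw [hQ, Measure.volume_eq_prod, Measure.prod_prod, Real.volume_Icc, Real.volume_Icc,
      ← ENNReal.ofReal_mul (by linarith)]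
    congr 1; ring
  have hA1 : 0 < T * (2 * R) + 1 := by positivity
  -- The slack is chosen so that, multiplied by the volume of `Q`, it is at most `ε / 6`.
  obtain ⟨A, hA0, hA⟩ := hφε (ε / 6 / (T * (2 * R) + 1)) (by positivity)
  -- The width is small enough for the other `ε / 6`, and for the mollification window to stay
  -- inside `[-R', R']`.
  obtain ⟨m, hm1, hm2⟩ : ∃ m : ℕ, A * (C * (1 / ((m : ℝ) + 1))) ≤ ε / 6 ∧
      1 / ((m : ℝ) + 1) ≤ (R' - R) / 2 := by
    have h1 := tendsto_one_div_add_atTop_nhds_zero_nat (𝕜 := ℝ)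
    have h2 := (h1.const_mul C).const_mul A
    rw [mul_zero, mul_zero] at h2
    exact ((h2.eventually_le_const (by positivity : 0 < ε / 6)).and
      (h1.eventually_le_const (by linarith : 0 < (R' - R) / 2))).exists
  have hh : 0 < 1 / ((m : ℝ) + 1) := by positivity
  set U : ℕ → ℝ × ℝ → ℝ := fun n p => ∫ y, v n p.1 y * w m (y - p.2) with hU
  have hUm : ∀ n, Measurable (U n) := fun n => hv.measurable_mollified (hw m) n
  obtain ⟨n₁, hn₁⟩ := eventually_atTop.1 (hv.translate R R' hRR' hℓ)
  have hmoll : ∀ n ≥ n₁, ∫⁻ p in Q, ENNReal.ofReal |v n p.1 p.2 - U n p| ≤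
      ENNReal.ofReal (ε / 3) := by
    intro n hn
    refine ((hw m).lintegral_abs_sub_integral_le hφ (hv.measurable n) (hv.mem n) hC hA0
      (fun z hz => hn₁ n hn z ⟨hz.1, by linarith [hz.2]⟩) hA).trans ?_
    rw [← hQ, hvol, ← ENNReal.ofReal_mul (by positivity),
      ← ENNReal.ofReal_add (by positivity) (by positivity)]
    refine ENNReal.ofReal_le_ofReal ?_
    have : ε / 6 / (T * (2 * R) + 1) * (T * (2 * R)) ≤ ε / 6 := by
      rw [div_mul_eq_mul_div, div_le_iff₀ hA1]; nlinarith
    linarith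
  -- Pointwise Cauchy sequences with a common bound on a set of finite measure are Cauchy in `L¹`:
  -- dominated convergence over pairs of indices.
  have hlim : Tendsto (fun q : ℕ × ℕ => ∫⁻ p in Q, ENNReal.ofReal |U (s q.1) p - U (s q.2) p|)
      (atTop ×ˢ atTop) (𝓝 (∫⁻ _ in Q, 0)) := by
    refine tendsto_lintegral_filter_of_dominated_convergence (fun _ => ENNReal.ofReal (2 * M))
      (Eventually.of_forall fun q => ?_) (Eventually.of_forall fun q => ae_of_all _ fun p => ?_) ?_ ?_
    · exact (continuous_abs.measurable.comp ((hUm _).sub (hUm _))).ennreal_ofReal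
    · refine ENNReal.ofReal_le_ofReal ?_
      refine (abs_sub _ _).trans ?_
      have h1 := hv.abs_mollified_le (hw m) (s q.1) p.1 p.2
      have h2 := hv.abs_mollified_le (hw m) (s q.2) p.1 p.2
      simp only [hU]; linarith
    · rw [lintegral_const, Measure.restrict_apply_univ, hvol]
      exact ENNReal.mul_ne_top ENNReal.ofReal_ne_top ENNReal.ofReal_ne_top
    · rw [ae_restrict_iff' (measurableSet_Icc.prod measurableSet_Icc)]
      refine ae_of_all _ fun p hp => ?_
      have h1 := hv.cauchy_integral hT (hw m) hs (hconv m) hR' hℓ (t := p.1) (x := p.2) hp.1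
        ⟨by linarith [hp.2.1], by linarith [hp.2.2]⟩
      have h2 := (Metric.cauchySeq_iff.1 h1)
      rw [← ENNReal.ofReal_zero]
      refine (ENNReal.continuous_ofReal.tendsto 0).comp ?_
      rw [Metric.tendsto_nhds]
      intro η hη
      obtain ⟨n₂, hn₂⟩ := h2 η hη
      rw [prod_atTop_atTop_eq]
      filter_upwards [eventually_ge_atTop ((n₂, n₂) : ℕ × ℕ)] with q hq
      have := hn₂ q.1 hq.1 q.2 hq.2
      rw [Real.dist_eq] at this ⊢
      rw [sub_zero, abs_abs]; exact this
  rw [lintegral_zero] at hlim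
  have hev := hlim.eventually_le_const (ENNReal.ofReal_pos.2 (by positivity : 0 < ε / 3))
  rw [prod_atTop_atTop_eq, eventually_atTop] at hev
  obtain ⟨⟨n₂, n₃⟩, hn₂⟩ := hev
  refine ⟨max n₁ (max n₂ n₃), fun n hn k hk => ?_⟩
  have hn1 : n₁ ≤ s n := ((le_max_left _ _).trans hn).trans (hs.id_le n)
  have hk1 : n₁ ≤ s k := ((le_max_left _ _).trans hk).trans (hs.id_le k)
  have h3 := hn₂ (n, k) ⟨((le_max_left n₂ n₃).trans (le_max_right _ _)).trans hn,
    ((le_max_right n₂ n₃).trans (le_max_right _ _)).trans hk⟩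
  have hm' : ∀ n, Measurable fun p : ℝ × ℝ => ENNReal.ofReal |v n p.1 p.2 - U n p| := fun n =>
    (continuous_abs.measurable.comp ((hv.measurable n).sub (hUm n))).ennreal_ofReal
  have hm'' : Measurable fun p : ℝ × ℝ => ENNReal.ofReal |U (s n) p - U (s k) p| :=
    (continuous_abs.measurable.comp ((hUm _).sub (hUm _))).ennreal_ofReal
  have h4 : ∀ p : ℝ × ℝ, ENNReal.ofReal |v (s n) p.1 p.2 - v (s k) p.1 p.2| ≤
      ENNReal.ofReal |v (s n) p.1 p.2 - U (s n) p| + (ENNReal.ofReal |U (s n) p - U (s k) p| +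
        ENNReal.ofReal |v (s k) p.1 p.2 - U (s k) p|) := by
    intro p
    rw [← ENNReal.ofReal_add (abs_nonneg _) (abs_nonneg _),
      ← ENNReal.ofReal_add (abs_nonneg _) (by positivity)]
    refine ENNReal.ofReal_le_ofReal ?_
    rw [abs_sub_comm (v (s k) p.1 p.2)]
    exact (abs_sub_le _ (U (s n) p) _).trans (add_le_add le_rfl (abs_sub_le _ (U (s k) p) _))
  refine (lintegral_mono h4).trans ?_
  rw [lintegral_add_left (hm' _), lintegral_add_left hm'']
  refine (add_le_add (hmoll _ hn1) (add_le_add h3 (hmoll _ hk1))).trans (le_of_eq ?_)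
  rw [← ENNReal.ofReal_add (by positivity) (by positivity),
    ← ENNReal.ofReal_add (by positivity) (by positivity)]
  congr 1; ring

/-- A third of `ε` for the bounded region and a third for the tail of each of the two densities. -/
theorem cauchy_global (hv : IsCompactSequence φ T M C ℓ v) {s : ℕ → ℕ} (hs : StrictMono s)
    (hloc : ∀ R R', R < R' → (∀ᶠ n in atTop, R' < ℓ n) → ∀ ε, 0 < ε →
      ∃ n₀, ∀ n ≥ n₀, ∀ k ≥ n₀, ∫⁻ p in Icc 0 T ×ˢ Icc (-R) R,
        ENNReal.ofReal |v (s n) p.1 p.2 - v (s k) p.1 p.2| ≤ ENNReal.ofReal ε) {ε : ℝ} (hε : 0 < ε) :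
    ∃ n₀, ∀ n ≥ n₀, ∀ k ≥ n₀, ∫⁻ p in Icc 0 T ×ˢ (univ : Set ℝ),
      ENNReal.ofReal |v (s n) p.1 p.2 - v (s k) p.1 p.2| ≤ ENNReal.ofReal ε := by
  obtain ⟨R, R', hRR', hℓ, htail⟩ := hv.tight (ε / 3) (by positivity)
  obtain ⟨n₁, hn₁⟩ := hloc R R' hRR' hℓ (ε / 3) (by positivity)
  obtain ⟨n₂, hn₂⟩ := eventually_atTop.1 htail
  refine ⟨max n₁ n₂, fun n hn k hk => ?_⟩
  have hsplit : Icc 0 T ×ˢ (univ : Set ℝ) =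
      (Icc 0 T ×ˢ Icc (-R) R) ∪ (Icc 0 T ×ˢ (Icc (-R) R)ᶜ) := by
    rw [← prod_union, union_compl_self]
  rw [hsplit]
  refine (lintegral_union_le _ _ _).trans ?_
  have h1 := hn₁ n ((le_max_left _ _).trans hn) k ((le_max_left _ _).trans hk)
  have h2 := hn₂ (s n) (((le_max_right _ _).trans hn).trans (hs.id_le n))
  have h3 := hn₂ (s k) (((le_max_right _ _).trans hk).trans (hs.id_le k))
  have h4 : ∫⁻ p in Icc 0 T ×ˢ (Icc (-R) R)ᶜ,
      ENNReal.ofReal |v (s n) p.1 p.2 - v (s k) p.1 p.2| ≤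
      ENNReal.ofReal (ε / 3) + ENNReal.ofReal (ε / 3) := by
    refine le_trans (lintegral_mono fun p => ?_)
      ((lintegral_add_left (hv.measurable (s n)).ennreal_ofReal _).trans_le (add_le_add h2 h3))
    rw [← ENNReal.ofReal_add (hv.mem _ _ _).1 (hv.mem _ _ _).1]
    refine ENNReal.ofReal_le_ofReal ((abs_sub _ _).trans ?_)
    rw [abs_of_nonneg (hv.mem _ _ _).1, abs_of_nonneg (hv.mem _ _ _).1]
  refine (add_le_add h1 h4).trans (le_of_eq ?_)
  rw [← ENNReal.ofReal_add (by positivity) (by positivity),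
    ← ENNReal.ofReal_add (by positivity) (by positivity)]
  congr 1; ring

theorem integrableOn (hv : IsCompactSequence φ T M C ℓ v) (n : ℕ) :
    IntegrableOn (fun p : ℝ × ℝ => v n p.1 p.2) (Icc 0 T ×ˢ (univ : Set ℝ)) := by
  have h1 : IntegrableOn (fun p : ℝ × ℝ => v n p.1 p.2) (Icc 0 T ×ˢ Icc (-ℓ n) (ℓ n)) := by
    refine Measure.integrableOn_of_bounded (M := M) ?_ (hv.measurable n).aestronglyMeasurable
      (ae_of_all _ fun p => hv.abs_le n _ _)
    exact (isCompact_Icc.prod isCompact_Icc).measure_lt_top.ne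
  refine h1.of_forall_sdiff_eq_zero (measurableSet_Icc.prod .univ) fun p hp => ?_
  refine hv.support n _ _ (not_le.1 fun h2 => hp.2 ⟨hp.1.1, ?_⟩)
  exact _root_.abs_le.1 h2

/-- A compact sequence has a subsequence that converges in `L¹`. -/
theorem exists_limit (hv : IsCompactSequence φ T M C ℓ v) (hT : 0 < T) (hC : 0 ≤ C)
    (hφ : Continuous φ)
    (hφε : ∀ ε, 0 < ε → ∃ A, 0 ≤ A ∧ ∀ a ∈ Icc 0 M, ∀ b ∈ Icc 0 M,
      |a - b| ≤ ε + A * |φ a - φ b|) :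
    ∃ (s : ℕ → ℕ) (ρ : ℝ → ℝ → ℝ), StrictMono s ∧ (Measurable fun p : ℝ × ℝ => ρ p.1 p.2) ∧
      (∀ t y, ρ t y ∈ Icc 0 M) ∧
      IntegrableOn (fun p : ℝ × ℝ => ρ p.1 p.2) (Icc 0 T ×ˢ (univ : Set ℝ)) ∧
      Tendsto (fun n => ∫⁻ p in Icc 0 T ×ˢ (univ : Set ℝ),
        ‖v (s n) p.1 p.2 - ρ p.1 p.2‖ₑ) atTop (𝓝 0) := by
  choose w D hw using fun m : ℕ => exists_isMollifier (by positivity : 0 < 1 / ((m : ℝ) + 1))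
  obtain ⟨s, hs, hconv⟩ := hv.exists_subseq_cauchy hw
  have hcau := fun (ε : ℝ) (hε : 0 < ε) => hv.cauchy_global hs (fun R R' hRR' hℓ ε hε =>
    hv.cauchy_local hT hC hφ hφε hw hs hconv hRR' hℓ hε) hε
  set μ : Measure (ℝ × ℝ) := volume.restrict (Icc 0 T ×ˢ (univ : Set ℝ)) with hμ
  have hmem : ∀ n, MemLp (fun p : ℝ × ℝ => v (s n) p.1 p.2) 1 μ := fun n =>
    memLp_one_iff_integrable.2 (hv.integrableOn (s n))
  have hL : CauchySeq fun n => (hmem n).toLp _ := by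
    rw [EMetric.cauchySeq_iff]
    intro ε hε
    obtain ⟨e, he0, he⟩ := ENNReal.lt_iff_exists_real_btwn.1 hε
    have he1 : 0 < e := ENNReal.ofReal_pos.1 he.1
    obtain ⟨n₀, hn₀⟩ := hcau e he1
    refine ⟨n₀, fun m hm n hn => ?_⟩
    rw [Lp.edist_toLp_toLp, eLpNorm_one_eq_lintegral_enorm]
    refine lt_of_le_of_lt ?_ he.2
    refine le_trans (le_of_eq ?_) (hn₀ m hm n hn)
    refine lintegral_congr fun p => ?_
    rw [Pi.sub_apply, Real.enorm_eq_ofReal_abs]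
  obtain ⟨f, hf⟩ := cauchySeq_tendsto_of_complete hL
  have hM := hv.bound_nonneg
  -- Clamping the limit to `[0, M]` makes the bounds hold everywhere; since clamping is 1-Lipschitz
  -- and fixes the approximations, the distance does not grow.
  set ρ : ℝ → ℝ → ℝ := fun t y => max 0 (min M (f (t, y))) with hρ
  have hρmem : ∀ t y, ρ t y ∈ Icc 0 M := fun t y => ⟨le_max_left _ _, max_le hM (min_le_left _ _)⟩
  have hρm : Measurable fun p : ℝ × ℝ => ρ p.1 p.2 :=
    measurable_const.max (measurable_const.min (Lp.stronglyMeasurable f).measurable)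
  have hconv' : Tendsto (fun n => ∫⁻ p in Icc 0 T ×ˢ (univ : Set ℝ),
        ‖v (s n) p.1 p.2 - ρ p.1 p.2‖ₑ) atTop (𝓝 0) := by
    have h1 : Tendsto (fun n => edist ((hmem n).toLp _) f) atTop (𝓝 0) :=
      tendsto_iff_edist_tendsto_0.1 hf
    refine tendsto_of_tendsto_of_tendsto_of_le_of_le tendsto_const_nhds h1
      (fun n => zero_le) (fun n => ?_)
    simp only
    rw [Lp.edist_def, eLpNorm_one_eq_lintegral_enorm]
    refine lintegral_mono_ae ?_
    filter_upwards [(hmem n).coeFn_toLp] with p hp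
    rw [Pi.sub_apply, hp, Real.enorm_eq_ofReal_abs, Real.enorm_eq_ofReal_abs]
    refine ENNReal.ofReal_le_ofReal ?_
    have h2 : v (s n) p.1 p.2 = max 0 (min M (v (s n) p.1 p.2)) := by
      rw [min_eq_right (hv.mem _ _ _).2, max_eq_right (hv.mem _ _ _).1]
    have h3 : ρ p.1 p.2 = max 0 (min M (f p)) := rfl
    rw [h3]
    nth_rewrite 1 [h2]
    have h4 := abs_max_sub_max_le_abs (min M (v (s n) p.1 p.2)) (min M (f p)) 0
    rw [max_comm, max_comm (min M (f p))] at h4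
    refine h4.trans ?_
    rw [min_comm, min_comm M]
    refine (abs_min_sub_min_le_max _ _ _ _).trans ?_
    rw [sub_self, abs_zero, max_eq_left (abs_nonneg _)]
  refine ⟨s, ρ, hs, hρm, hρmem, ?_, hconv'⟩
  obtain ⟨n, hn⟩ := (hconv'.eventually_lt_const ENNReal.zero_lt_top).exists
  have h1 : Integrable (fun p : ℝ × ℝ => v (s n) p.1 p.2 - ρ p.1 p.2) μ :=
    ⟨((hv.measurable _).sub hρm).aestronglyMeasurable, hn⟩
  have h2 := (hv.integrableOn (s n)).sub h1
  refine h2.congr (ae_of_all _ fun p => ?_)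
  simp only [Pi.sub_apply, sub_sub_cancel]

end IsCompactSequence

/-! ### Particle densities cut to one period form a compact sequence. -/

section PeriodicCut

variable {ζ : ℝ → ℝ} {L D : ℝ}

theorem periodicCut_periodic (ζ : ℝ → ℝ) (hL : 0 < L) : Function.Periodic (periodicCut ζ L) L := by
  intro y
  have h1 : (y + L) / L + 1 / 2 = y / L + 1 / 2 + 1 := by field_simp; ring
  rw [periodicCut, periodicCut, h1, Int.floor_add_one]
  congr 1; push_cast; ring

/-- The periodization of a Lipschitz function vanishing at the ends of the period is Lipschitz. -/
theorem periodicCut_lipschitz (hL : 0 < L) (hD : ∀ y z, |ζ y - ζ z| ≤ D * |y - z|)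
    (h1 : ζ (-(L / 2)) = 0) (h2 : ζ (L / 2) = 0) (y z : ℝ) :
    |periodicCut ζ L y - periodicCut ζ L z| ≤ D * |y - z| := by
  have hD0 : 0 ≤ D := by have := (abs_nonneg _).trans (hD 1 0); simpa using this
  wlog hyz : y ≤ z generalizing y z
  · rw [abs_sub_comm, abs_sub_comm y]; exact this z y (not_le.1 hyz).le
  simp only [periodicCut]
  set n := ⌊y / L + 1 / 2⌋ with hn
  set m := ⌊z / L + 1 / 2⌋ with hm
  have hnm : n ≤ m := Int.floor_le_floor (by gcongr)
  have hy1 : L * n ≤ y + L / 2 := by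
    have := Int.floor_le (y / L + 1 / 2)
    rw [← hn] at this
    have h3 := mul_le_mul_of_nonneg_left this hL.le
    rw [mul_add, mul_div_cancel₀ _ hL.ne'] at h3; linarith
  have hy2 : y + L / 2 < L * (n + 1) := by
    have := Int.lt_floor_add_one (y / L + 1 / 2)
    rw [← hn] at this
    have h3 := mul_lt_mul_of_pos_left this hL
    rw [mul_add, mul_div_cancel₀ _ hL.ne'] at h3; linarith
  have hz1 : L * m ≤ z + L / 2 := by
    have := Int.floor_le (z / L + 1 / 2)
    rw [← hm] at this
    have h3 := mul_le_mul_of_nonneg_left this hL.le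
    rw [mul_add, mul_div_cancel₀ _ hL.ne'] at h3; linarith
  rcases hnm.eq_or_lt with h | h
  · rw [h]
    have := hD (y - L * m) (z - L * m)
    rwa [sub_sub_sub_cancel_right] at this
  -- In different periods each value is compared with the zero at an end of its own period; the two
  -- distances add up to at most `z - y`.
  · have h3 : (n : ℝ) + 1 ≤ m := by exact_mod_cast h
    have h4 := hD (y - L * n) (L / 2)
    have h5 := hD (z - L * m) (-(L / 2))
    rw [h2, sub_zero, abs_of_nonpos (by linarith : y - L * n - L / 2 ≤ 0)] at h4
    rw [h1, sub_zero, abs_of_nonneg (by linarith : 0 ≤ z - L * m - -(L / 2))] at h5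
    refine (abs_sub _ _).trans ((add_le_add h4 h5).trans ?_)
    rw [← mul_add, abs_of_nonpos (by linarith : y - z ≤ 0)]
    refine mul_le_mul_of_nonneg_left ?_ hD0
    nlinarith

end PeriodicCut

noncomputable section
/-- The particle density on the fundamental period, extended by zero. -/
def cutDensity (L c : ℝ) (N : ℕ) (x : ℤ → ℝ) : ℝ → ℝ :=
  (Ico (-(L / 2)) (L / 2)).indicator (particleDensity c N x)
end

theorem cutDensity_eq {L c : ℝ} {N : ℕ} {x : ℤ → ℝ} {y : ℝ} (hy : |y| < L / 2) :
    cutDensity L c N x y = particleDensity c N x y :=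
  indicator_of_mem (s := Ico (-(L / 2)) (L / 2)) ⟨(abs_lt.1 hy).1.le, (abs_lt.1 hy).2⟩ _

theorem integral_cutDensity_mul {L c : ℝ} (hL : 0 < L) (N : ℕ) (x : ℤ → ℝ) (ζ : ℝ → ℝ) :
    ∫ y, cutDensity L c N x y * ζ y = ∫ y in -(L / 2)..L / 2, particleDensity c N x y * ζ y := by
  rw [intervalIntegral.integral_of_le (by linarith), ← integral_Ico_eq_integral_Ioc,
    ← integral_indicator measurableSet_Ico]
  refine integral_congr_ae (ae_of_all _ fun y => ?_)
  simp only [cutDensity, indicator]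
  split_ifs <;> simp

namespace BoundedPath

variable {φ W : ℝ → ℝ} {T L c M Q : ℝ} {N : ℕ} {x : ℤ → ℝ → ℝ}

theorem density_mem (h : BoundedPath φ T L c N x M Q) (t y : ℝ) :
    particleDensity c N (fun k => x k t) y ∈ Icc 0 M :=
  ⟨((h.path.config t).density_pos h.mass_pos y).le, (h.path.config t).density_le (h.density_le t) y⟩

theorem bound_nonneg (h : BoundedPath φ T L c N x M Q) : 0 ≤ M :=
  (h.density_mem 0 0).1.trans (h.density_mem 0 0).2

theorem length_pos (h : BoundedPath φ T L c N x M Q) : 0 < L := (h.path.config 0).length_pos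

theorem cutDensity_mem (h : BoundedPath φ T L c N x M Q) (t y : ℝ) :
    cutDensity L c N (fun k => x k t) y ∈ Icc 0 M := by
  rw [cutDensity, indicator]
  split_ifs
  · exact h.density_mem t y
  · exact ⟨le_rfl, h.bound_nonneg⟩

theorem measurable_cutDensity (h : BoundedPath φ T L c N x M Q) :
    Measurable fun p : ℝ × ℝ => cutDensity L c N (fun k => x k p.1) p.2 := by
  have : (fun p : ℝ × ℝ => cutDensity L c N (fun k => x k p.1) p.2) =
      (Prod.snd ⁻¹' Ico (-(L / 2)) (L / 2)).indicator
        (fun p : ℝ × ℝ => particleDensity c N (fun k => x k p.1) p.2) := by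
    ext p; simp only [cutDensity, indicator, mem_preimage]; congr
  rw [this]
  exact (h.path.measurable_density).indicator (measurable_snd measurableSet_Ico)

/-- The window from `-R` to `R + z` fits into one period, so the multiplicity is `m = 1` and cutting
has no effect. -/
theorem lintegral_translate_le (h : BoundedPath φ T L c N x M Q) (hφ : Continuous φ) (hT : 0 ≤ T)
    {R z : ℝ} (hz : 0 < z) (hR : R + z < L / 2) :
    ∫⁻ t in Icc 0 T, ∫⁻ y in Icc (-R) R, ENNReal.ofReal
      |φ (cutDensity L c N (fun k => x k t) (y + z)) - φ (cutDensity L c N (fun k => x k t) y)| ≤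
      ENNReal.ofReal (Q * z) := by
  have h1 : ∀ t, ∫⁻ y in Icc (-R) R, ENNReal.ofReal
      |φ (cutDensity L c N (fun k => x k t) (y + z)) - φ (cutDensity L c N (fun k => x k t) y)| ≤
      ENNReal.ofReal (z * cellVariation φ c N fun k => x k t) := by
    intro t
    have h2 := (h.path.config t).lintegral_translate_sub_le (c := c) φ (R := R) hz (m := 1)
      (by push_cast; linarith)
    rw [Nat.cast_one, one_mul] at h2
    refine le_trans (le_of_eq (setLIntegral_congr_fun measurableSet_Icc fun y hy => ?_)) h2
    rw [cutDensity_eq (abs_lt.2 ⟨by linarith [hy.1], by linarith [hy.2]⟩),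
      cutDensity_eq (abs_lt.2 ⟨by linarith [hy.1], by linarith [hy.2]⟩)]
  have hcont : Continuous fun t => cellVariation φ c N fun k => x k t := by
    simp only [cellVariation]
    exact continuous_finsetSum _ fun k _ => ((hφ.comp (h.path.continuous_cellDensity _)).sub
      (hφ.comp (h.path.continuous_cellDensity _))).abs
  refine (lintegral_mono h1).trans ?_
  have hint : IntegrableOn (fun t => z * cellVariation φ c N fun k => x k t) (Icc 0 T) :=
    (continuous_const.mul hcont).integrableOn_Icc
  rw [← ofReal_integral_eq_lintegral_ofReal hint
    (ae_of_all _ fun t => mul_nonneg hz.le (cellVariation_nonneg _ _ _ _)), integral_const_mul,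
    integral_Icc_eq_integral_Ioc, ← intervalIntegral.integral_of_le hT]
  refine ENNReal.ofReal_le_ofReal ?_
  rw [mul_comm]
  exact mul_le_mul_of_nonneg_right h.variation_le hz.le

theorem abs_sum_sub_integral_le (h : BoundedPath φ T L c N x M Q) {ζ : ℝ → ℝ} {D : ℝ}
    (hD : ∀ y z, |ζ y - ζ z| ≤ D * |y - z|) (h1 : ζ (-(L / 2)) = 0) (h2 : ζ (L / 2) = 0) (t : ℝ) :
    |∑ k ∈ Finset.range N, c / N * periodicCut ζ L (x k t) -
      ∫ y, cutDensity L c N (fun k => x k t) y * ζ y| ≤ D * (c / N) * L := by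
  have hD0 : 0 ≤ D := by have := (abs_nonneg _).trans (hD 1 0); simpa using this
  have hL := h.length_pos
  have h3 := (h.path.config t).abs_sum_sub_integral_period_le h.mass_pos hD0
    (periodicCut_lipschitz hL hD h1 h2) (periodicCut_periodic ζ hL)
  have h4 : ∫ y, cutDensity L c N (fun k => x k t) y * ζ y = ∫ y in -(L / 2)..L / 2,
      particleDensity c N (fun k => x k t) y * periodicCut ζ L y := by
    rw [integral_cutDensity_mul hL, intervalIntegral.integral_of_le (by linarith),
      intervalIntegral.integral_of_le (by linarith), ← integral_Ico_eq_integral_Ioc,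
      ← integral_Ico_eq_integral_Ioc]
    refine setIntegral_congr_fun measurableSet_Ico fun y hy => ?_
    rw [periodicCut_eq ζ hL hy]
  rw [h4]; exact h3

/-- At both times the integral is replaced by a particle sum, with the quadrature error twice; the
sums differ by the Lipschitz constant times the displacement. -/
theorem abs_integral_sub_le (h : BoundedPath φ T L c N x M Q) {ζ : ℝ → ℝ} {D : ℝ}
    (hD : ∀ y z, |ζ y - ζ z| ≤ D * |y - z|) (h1 : ζ (-(L / 2)) = 0) (h2 : ζ (L / 2) = 0) {s t l : ℝ}
    (hs : 0 ≤ s) (hst : s ≤ t) (ht : t ≤ T) (hl : 0 < l) :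
    |(∫ y, cutDensity L c N (fun k => x k t) y * ζ y) -
      ∫ y, cutDensity L c N (fun k => x k s) y * ζ y| ≤
      2 * (D * (c / N) * L) + D * (Q * l + Q * (1 + 1 / l) * (t - s)) := by
  have hD0 : 0 ≤ D := by have := (abs_nonneg _).trans (hD 1 0); simpa using this
  have h3 := h.abs_sum_sub_integral_le hD h1 h2 t
  have h4 := h.abs_sum_sub_integral_le hD h1 h2 s
  have h5 : |∑ k ∈ Finset.range N, c / N * periodicCut ζ L (x k t) -
      ∑ k ∈ Finset.range N, c / N * periodicCut ζ L (x k s)| ≤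
      D * (Q * l + Q * (1 + 1 / l) * (t - s)) := by
    rw [← Finset.sum_sub_distrib]
    refine (Finset.abs_sum_le_sum_abs _ _).trans ?_
    refine le_trans ?_ (mul_le_mul_of_nonneg_left (h.displacement_le s t hs hst ht l hl) hD0)
    rw [Finset.mul_sum]
    refine Finset.sum_le_sum fun k _ => ?_
    have hcN : 0 ≤ c / N := div_nonneg h.mass_pos.le (Nat.cast_nonneg _)
    rw [← mul_sub, abs_mul, abs_of_nonneg hcN]
    refine (mul_le_mul_of_nonneg_left (periodicCut_lipschitz h.length_pos hD h1 h2 _ _)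
      hcN).trans (le_of_eq ?_)
    ring
  rw [abs_le] at h3 h4 h5 ⊢
  constructor <;> linarith [h3.1, h3.2, h4.1, h4.2, h5.1, h5.2]

/-- The moment bound controls the mass far away. -/
theorem lintegral_tail_le (h : BoundedPath φ T L c N x M Q) {t : ℝ} (ht : t ∈ Icc 0 T) {R : ℝ}
    (hR : 0 < R) :
    ∫⁻ y in (Icc (-R) R)ᶜ, ENNReal.ofReal (cutDensity L c N (fun k => x k t) y) ≤
      ENNReal.ofReal ((Q + c / N * L) / R) := by
  have hL := h.length_pos
  have hm := h.moment_le t ht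
  have h1 := (h.path.config t).abs_sum_sub_integral_period_le h.mass_pos (C := 1) zero_le_one
    (ζ := torusDist L) (fun y z => by rw [one_mul]; exact abs_torusDist_sub_le hL y z)
    (torusDist_periodic hL)
  rw [one_mul] at h1
  have h2 : ∫ y in -(L / 2)..L / 2, particleDensity c N (fun k => x k t) y * torusDist L y ≤
      Q + c / N * L := by linarith [(abs_le.1 h1).1]
  have hu := h.density_mem t
  have hmeas : Measurable (particleDensity c N fun k => x k t) :=
    h.path.measurable_density_right t
  have htc : Continuous (torusDist L) :=
    LipschitzWith.continuous (K := 1) (LipschitzWith.of_dist_le_mul fun y z => by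
      rw [NNReal.coe_one, one_mul]; exact abs_torusDist_sub_le hL y z)
  have hint : IntegrableOn (fun y => particleDensity c N (fun k => x k t) y * torusDist L y)
      (Ioc (-(L / 2)) (L / 2)) := by
    refine (((htc.intervalIntegrable _ _).1).bdd_mul hmeas.aestronglyMeasurable
      (ae_of_all _ fun y => ?_) (c := M))
    rw [Real.norm_eq_abs, abs_of_nonneg (hu y).1]; exact (hu y).2
  rw [intervalIntegral.integral_of_le (by linarith)] at h2
  have h3 : ∫⁻ y in Ioc (-(L / 2)) (L / 2),
      ENNReal.ofReal (particleDensity c N (fun k => x k t) y * torusDist L y) ≤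
      ENNReal.ofReal (Q + c / N * L) := by
    rw [← ofReal_integral_eq_lintegral_ofReal hint (ae_of_all _ fun y =>
      mul_nonneg (hu y).1 (torusDist_nonneg L y))]
    exact ENNReal.ofReal_le_ofReal h2
  -- Markov's inequality: outside `[-R, R]`, within the period, `torusDist` is at least `R`.
  rw [ENNReal.ofReal_div_of_pos hR, ENNReal.le_div_iff_mul_le
    (Or.inl (ENNReal.ofReal_pos.2 hR).ne') (Or.inl ENNReal.ofReal_ne_top), mul_comm]
  refine le_trans ?_ h3
  rw [← restrict_Ico_eq_restrict_Ioc, ← lintegral_indicator measurableSet_Ico]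
  have hcm : Measurable (cutDensity L c N fun k => x k t) := hmeas.indicator measurableSet_Ico
  rw [← lintegral_const_mul _ hcm.ennreal_ofReal, ← lintegral_indicator measurableSet_Icc.compl]
  refine lintegral_mono fun y => ?_
  by_cases hy : y ∈ (Icc (-R) R)ᶜ
  · rw [indicator_of_mem hy]
    by_cases hy2 : y ∈ Ico (-(L / 2)) (L / 2)
    · rw [indicator_of_mem hy2, cutDensity, indicator_of_mem hy2, ← ENNReal.ofReal_mul hR.le]
      refine ENNReal.ofReal_le_ofReal ?_
      rw [mul_comm]
      refine mul_le_mul_of_nonneg_left (le_trans ?_ (abs_le_torusDist hL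
        (abs_le.2 ⟨hy2.1, hy2.2.le⟩))) (hu y).1
      by_contra hcon
      exact hy (abs_le.1 (not_le.1 hcon).le)
    · rw [cutDensity, indicator_of_notMem hy2]; simp
  · rw [indicator_of_notMem hy]; exact zero_le

end BoundedPath

namespace BoundedPath

variable {φ W : ℝ → ℝ} {T M Q : ℝ}

/-- Allows `φ` to be replaced by its continuous extension `r ↦ φ (max 0 r)` to the whole line. -/
theorem congr {L c : ℝ} {N : ℕ} {x : ℤ → ℝ → ℝ} (h : BoundedPath φ T L c N x M Q) {φ' : ℝ → ℝ}
    (hφ : ∀ r, 0 ≤ r → φ' r = φ r) : BoundedPath φ' T L c N x M Q := by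
  have h1 : ∀ t, cellVariation φ' c N (fun i => x i t) = cellVariation φ c N (fun i => x i t) := by
    intro t
    refine Finset.sum_congr rfl fun k _ => ?_
    rw [hφ _ ((h.path.config t).cellDensity_pos h.mass_pos _).le,
      hφ _ ((h.path.config t).cellDensity_pos h.mass_pos _).le]
  exact ⟨h.path, h.mass_pos, h.density_le, by simp only [h1]; exact h.variation_le,
    h.displacement_le, h.moment_le⟩

variable {L c : ℕ → ℝ} {N : ℕ → ℕ} {x : ℕ → ℤ → ℝ → ℝ}

/-- For a fixed period the region outside `[-R, R]` consists of two strips of width `η` at the ends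
of the period, which carry little mass because the density is bounded. -/
theorem tight_of_const (h : ∀ n, BoundedPath φ T (L n) (c n) (N n) (x n) M Q) (hT : 0 < T) {L₀ : ℝ}
    (hL : ∀ n, L n = L₀) {ε : ℝ} (hε : 0 < ε) : ∃ R R', R < R' ∧ (∀ᶠ n in atTop, R' < L n / 2) ∧
    ∀ᶠ n in atTop, ∫⁻ p in Icc 0 T ×ˢ (Icc (-R) R)ᶜ, ENNReal.ofReal
      (cutDensity (L n) (c n) (N n) (fun k => x n k p.1) p.2) ≤ ENNReal.ofReal ε := by
  have hM := (h 0).bound_nonneg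
  set η := ε / (2 * (M * T + 1)) with hη
  have hη0 : 0 < η := by positivity
  refine ⟨L₀ / 2 - η, L₀ / 2 - η / 2, by linarith, Eventually.of_forall fun n => by
    rw [hL]; linarith, Eventually.of_forall fun n => ?_⟩
  set R := L₀ / 2 - η with hR
  set E : Set ℝ := Icc (-(L₀ / 2)) (-R) ∪ Icc R (L₀ / 2) with hE
  have hEm : MeasurableSet E := measurableSet_Icc.union measurableSet_Icc
  have hEv : volume E ≤ ENNReal.ofReal (2 * η) := by
    refine (measure_union_le _ _).trans ?_
    rw [Real.volume_Icc, Real.volume_Icc, ← ENNReal.ofReal_add (by linarith) (by linarith)]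
    refine ENNReal.ofReal_le_ofReal ?_
    linarith
  rw [← lintegral_indicator (measurableSet_Icc.prod measurableSet_Icc.compl)]
  have h1 : ∀ p : ℝ × ℝ, (Icc 0 T ×ˢ (Icc (-R) R)ᶜ).indicator (fun p : ℝ × ℝ => ENNReal.ofReal
      (cutDensity (L n) (c n) (N n) (fun k => x n k p.1) p.2)) p ≤
      (Icc 0 T ×ˢ E).indicator (fun _ => ENNReal.ofReal M) p := by
    intro p
    by_cases hp : p ∈ Icc 0 T ×ˢ (Icc (-R) R)ᶜ
    · rw [indicator_of_mem hp]
      by_cases hp2 : p.2 ∈ Ico (-(L n / 2)) (L n / 2)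
      · rw [indicator_of_mem]
        · exact ENNReal.ofReal_le_ofReal ((h n).cutDensity_mem _ _).2
        · refine ⟨hp.1, ?_⟩
          rw [hL] at hp2
          by_contra hcon
          refine hp.2 ⟨?_, ?_⟩
          · by_contra h2
            exact hcon (Or.inl ⟨hp2.1, (not_le.1 h2).le⟩)
          · by_contra h2
            exact hcon (Or.inr ⟨(not_le.1 h2).le, hp2.2.le⟩)
      · rw [cutDensity, indicator_of_notMem hp2]; simp
    · rw [indicator_of_notMem hp]; exact zero_le
  refine (lintegral_mono h1).trans ?_
  rw [lintegral_indicator_const (measurableSet_Icc.prod hEm), Measure.volume_eq_prod,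
    Measure.prod_prod, Real.volume_Icc, sub_zero]
  calc ENNReal.ofReal M * (ENNReal.ofReal T * volume E)
      ≤ ENNReal.ofReal M * (ENNReal.ofReal T * ENNReal.ofReal (2 * η)) := by gcongr
    _ = ENNReal.ofReal (M * (T * (2 * η))) := by
      rw [ENNReal.ofReal_mul hM, ENNReal.ofReal_mul hT.le]
    _ ≤ ENNReal.ofReal ε := by
      refine ENNReal.ofReal_le_ofReal ?_
      rw [hη, show M * (T * (2 * (ε / (2 * (M * T + 1))))) = ε * ((M * T) / (M * T + 1)) by
        field_simp]
      have : (M * T) / (M * T + 1) ≤ 1 := by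
        rw [div_le_one (by positivity)]; linarith
      nlinarith

/-- For growing periods the uniform first moment bounds the mass far out. -/
theorem tight_of_tendsto (h : ∀ n, BoundedPath φ T (L n) (c n) (N n) (x n) M Q) (hT : 0 < T)
    (hQ : 0 ≤ Q) (herr : Tendsto (fun n => c n / N n * L n) atTop (𝓝 0))
    (hL : Tendsto L atTop atTop) {ε : ℝ} (hε : 0 < ε) :
    ∃ R R', R < R' ∧ (∀ᶠ n in atTop, R' < L n / 2) ∧
    ∀ᶠ n in atTop, ∫⁻ p in Icc 0 T ×ˢ (Icc (-R) R)ᶜ, ENNReal.ofReal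
      (cutDensity (L n) (c n) (N n) (fun k => x n k p.1) p.2) ≤ ENNReal.ofReal ε := by
  set R := T * (Q + 1) / ε with hR
  have hR0 : 0 < R := by positivity
  refine ⟨R, R + 1, by linarith, ?_, ?_⟩
  · filter_upwards [hL.eventually_gt_atTop (2 * (R + 1))] with n hn
    linarith
  filter_upwards [herr.eventually_lt_const one_pos] with n hn
  rw [Measure.volume_eq_prod, ← Measure.prod_restrict,
    lintegral_prod _ (h n).measurable_cutDensity.ennreal_ofReal.aemeasurable]
  have h1 : ∀ t ∈ Icc 0 T, ∫⁻ y in (Icc (-R) R)ᶜ,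
      ENNReal.ofReal (cutDensity (L n) (c n) (N n) (fun k => x n k t) y) ≤
      ENNReal.ofReal ((Q + 1) / R) := fun t ht => by
    refine ((h n).lintegral_tail_le ht hR0).trans (ENNReal.ofReal_le_ofReal ?_)
    gcongr
  refine (setLIntegral_mono measurable_const h1).trans ?_
  rw [lintegral_const, Measure.restrict_apply_univ, Real.volume_Icc, sub_zero,
    ← ENNReal.ofReal_mul (by positivity)]
  refine ENNReal.ofReal_le_ofReal (le_of_eq ?_)
  rw [hR]; field_simp

theorem isCompactSequence (h : ∀ n, BoundedPath φ T (L n) (c n) (N n) (x n) M Q)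
    (hφ : Continuous φ) (hT : 0 < T) (hQ : 0 ≤ Q)
    (herr : Tendsto (fun n => c n / N n * L n) atTop (𝓝 0))
    (hL : Tendsto L atTop atTop ∨ ∃ L₀, ∀ n, L n = L₀) :
    IsCompactSequence φ T M Q (fun n => L n / 2)
      (fun n t => cutDensity (L n) (c n) (N n) fun k => x n k t) := by
  refine ⟨fun n => (h n).measurable_cutDensity, fun n t y => (h n).cutDensity_mem t y,
    fun n t y hy => ?_, fun R R' hRR' hℓ => ?_, fun R hℓ ζ D hD hζ ε hε => ?_, fun ε hε => ?_⟩
  · refine indicator_of_notMem (fun h' => ?_) _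
    have : |y| ≤ L n / 2 := abs_le.2 ⟨h'.1, h'.2.le⟩
    linarith
  · filter_upwards [hℓ] with n hn z hz
    exact (h n).lintegral_translate_le hφ hT.le hz.1 (by linarith [hz.2])
  · have hD0 : 0 ≤ D := by have := (abs_nonneg _).trans (hD 1 0); simpa using this
    -- First `l` makes the dissipation part at most `ε / 4`, then `δ` the remaining displacement;
    -- the quadrature errors take the other half.
    set l := ε / (4 * (D * Q + 1)) with hl
    have hl0 : 0 < l := by positivity
    set δ := ε / (4 * (D * (Q * (1 + 1 / l)) + 1)) with hδ
    have hδ0 : 0 < δ := by positivity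
    refine ⟨δ, hδ0, ?_⟩
    have h1 : Tendsto (fun n => 2 * (D * (c n / N n * L n))) atTop (𝓝 0) := by
      have := (herr.const_mul D).const_mul 2
      rwa [mul_zero, mul_zero] at this
    filter_upwards [hℓ, h1.eventually_lt_const (by positivity : 0 < ε / 2)] with n hn hn2
    have hL0 := (h n).length_pos
    have hz1 : ζ (-(L n / 2)) = 0 := hζ _ (by rw [abs_neg, abs_of_pos (by linarith)]; exact hn)
    have hz2 : ζ (L n / 2) = 0 := hζ _ (by rw [abs_of_pos (by linarith)]; exact hn)
    have hlD : D * (Q * l) ≤ ε / 4 := by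
      rw [hl, show D * (Q * (ε / (4 * (D * Q + 1)))) = ε / 4 * ((D * Q) / (D * Q + 1)) by
        field_simp]
      have : (D * Q) / (D * Q + 1) ≤ 1 := by rw [div_le_one (by positivity)]; linarith
      nlinarith
    have hδD : D * (Q * (1 + 1 / l) * δ) ≤ ε / 4 := by
      set A := D * (Q * (1 + 1 / l)) with hA
      have hA0 : 0 ≤ A := by positivity
      rw [hδ, show D * (Q * (1 + 1 / l) * (ε / (4 * (A + 1)))) = ε / 4 * (A / (A + 1)) by
        rw [hA]; field_simp]
      have : A / (A + 1) ≤ 1 := by rw [div_le_one (by positivity)]; linarith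
      nlinarith
    have key : ∀ s ∈ Icc 0 T, ∀ t ∈ Icc 0 T, s ≤ t → |t - s| ≤ δ →
        |(∫ y, cutDensity (L n) (c n) (N n) (fun k => x n k t) y * ζ y) -
          ∫ y, cutDensity (L n) (c n) (N n) (fun k => x n k s) y * ζ y| ≤ ε := by
      intro s hs t ht hst hts
      refine ((h n).abs_integral_sub_le hD hz1 hz2 hs.1 hst ht.2 hl0).trans ?_
      rw [abs_of_nonneg (by linarith)] at hts
      have h3 : D * (Q * (1 + 1 / l) * (t - s)) ≤ D * (Q * (1 + 1 / l) * δ) := by gcongr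
      rw [mul_add]
      linarith
    intro s hs t ht hts
    rcases le_total s t with hst | hst
    · exact key s hs t ht hst hts
    · rw [abs_sub_comm]
      exact key t ht s hs hst (by rwa [abs_sub_comm])
  · rcases hL with hL | ⟨L₀, hL⟩
    · exact tight_of_tendsto h hT hQ herr hL hε
    · exact tight_of_const h hT hL hε

/-- A sequence of bounded particle paths has a subsequence whose densities converge in `L¹`. -/
theorem exists_limit (hφ : AdmissibleDiffusion φ W)
    (h : ∀ n, BoundedPath φ T (L n) (c n) (N n) (x n) M Q) (hT : 0 < T) (hQ : 0 ≤ Q)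
    (herr : Tendsto (fun n => c n / N n * L n) atTop (𝓝 0))
    (hL : Tendsto L atTop atTop ∨ ∃ L₀, ∀ n, L n = L₀) :
    ∃ (s : ℕ → ℕ) (ρ : ℝ → ℝ → ℝ), StrictMono s ∧ (Measurable fun p : ℝ × ℝ => ρ p.1 p.2) ∧
      (∀ t y, ρ t y ∈ Icc 0 M) ∧
      IntegrableOn (fun p : ℝ × ℝ => ρ p.1 p.2) (Icc 0 T ×ˢ (univ : Set ℝ)) ∧
      Tendsto (fun n => ∫⁻ p in Icc 0 T ×ˢ (univ : Set ℝ),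
        ‖cutDensity (L (s n)) (c (s n)) (N (s n)) (fun k => x (s n) k p.1) p.2 - ρ p.1 p.2‖ₑ)
        atTop (𝓝 0) := by
  have hcont : Continuous fun r => φ (max 0 r) :=
    hφ.continuousOn.comp_continuous (by fun_prop) fun r => mem_Ici.2 (le_max_left _ _)
  have h' := isCompactSequence (fun n => (h n).congr (φ' := fun r => φ (max 0 r)) fun r hr => by
    simp only [max_eq_right hr]) hcont hT hQ herr hL
  refine h'.exists_limit hT hQ hcont fun ε hε => ?_
  obtain ⟨A, hA0, hA⟩ := hφ.exists_abs_sub_le M hε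
  refine ⟨A, hA0, fun a ha b hb => ?_⟩
  simp only [max_eq_right ha.1, max_eq_right hb.1]
  exact hA a b ha hb

end BoundedPath

/-! ### Test functions and their periodization. -/

/-- The quantitative properties of a test function `ψ(t, x)` with derivatives `ψt`, `ψx`, `ψxx`. -/
structure IsTestFunction (ψ ψt ψx ψxx : ℝ → ℝ → ℝ) (T R D : ℝ) : Prop where
  radius_pos : 0 < R
  bound_nonneg : 0 ≤ D
  support : ∀ t x, R < |x| → ψ t x = 0 ∧ ψt t x = 0 ∧ ψx t x = 0 ∧ ψxx t x = 0
  final : ∀ x, ψ T x = 0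
  abs_time_le : ∀ t x, |ψt t x| ≤ D
  abs_space_le : ∀ t x, |ψx t x| ≤ D
  abs_space2_le : ∀ t x, |ψxx t x| ≤ D
  lip : ∀ t x s y, |ψ t x - ψ s y| ≤ D * (|t - s| + |x - y|)
  lip_time : ∀ t x y, |ψt t x - ψt t y| ≤ D * |x - y|
  lip_space : ∀ t x y, |ψx t x - ψx t y| ≤ D * |x - y|
  continuous_time : Continuous fun p : ℝ × ℝ => ψt p.1 p.2
  continuous_space : Continuous fun p : ℝ × ℝ => ψx p.1 p.2
  continuous_space2 : Continuous fun p : ℝ × ℝ => ψxx p.1 p.2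
  hasDerivAt_comp : ∀ (y : ℝ → ℝ) (y' t : ℝ), HasDerivAt y y' t →
    HasDerivAt (fun s => ψ s (y s)) (ψt t (y t) + ψx t (y t) * y') t
  hasDerivAt_space : ∀ t x, HasDerivAt (ψx t) (ψxx t x) x

section Smooth

variable {Ψ : ℝ × ℝ → ℝ}

theorem ContDiff.hasDerivAt_left (h : ContDiff ℝ ∞ Ψ) (t x : ℝ) :
    HasDerivAt (fun t => Ψ (t, x)) (fderiv ℝ Ψ (t, x) (1, 0)) t := by
  have h1 := ((h.differentiable (by simp)) (t, x)).hasFDerivAt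
  exact h1.comp_hasDerivAt t ((hasDerivAt_id t).prodMk (hasDerivAt_const t x))

theorem ContDiff.hasDerivAt_right (h : ContDiff ℝ ∞ Ψ) (t x : ℝ) :
    HasDerivAt (fun x => Ψ (t, x)) (fderiv ℝ Ψ (t, x) (0, 1)) x := by
  have h1 := ((h.differentiable (by simp)) (t, x)).hasFDerivAt
  exact h1.comp_hasDerivAt x ((hasDerivAt_const x t).prodMk (hasDerivAt_id x))

theorem ContDiff.contDiff_fderiv_apply_const (h : ContDiff ℝ ∞ Ψ) (e : ℝ × ℝ) :
    ContDiff ℝ ∞ fun p => fderiv ℝ Ψ p e :=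
  (h.fderiv_right (m := ∞) (by simp)).clm_apply contDiff_const

theorem HasCompactSupport.exists_abs_le_and_lipschitz (hc : HasCompactSupport Ψ)
    (h : ContDiff ℝ ∞ Ψ) : ∃ D, 0 ≤ D ∧ (∀ p, |Ψ p| ≤ D) ∧
      ∀ t x s y, |Ψ (t, x) - Ψ (s, y)| ≤ D * (|t - s| + |x - y|) := by
  obtain ⟨C, hC⟩ := ContDiff.lipschitzWith_of_hasCompactSupport (𝕂 := ℝ) hc h (by simp)
  obtain ⟨B, hB⟩ := hc.exists_bound_of_continuous h.continuous
  refine ⟨max C B, C.2.trans (le_max_left _ _), fun p => (hB p).trans (le_max_right _ _),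
    fun t x s y => ?_⟩
  refine (hC.dist_le_mul (t, x) (s, y)).trans ?_
  have h1 : dist (t, x) (s, y) ≤ |t - s| + |x - y| := by
    rw [Prod.dist_eq, Real.dist_eq, Real.dist_eq]
    exact max_le_add_of_nonneg (abs_nonneg _) (abs_nonneg _)
  exact mul_le_mul (le_max_left _ _) h1 dist_nonneg (C.2.trans (le_max_left _ _))

end Smooth

/-- Smooth functions with compact support in `[0, T) × ℝ` are test functions. -/
theorem exists_isTestFunction {ψ : ℝ → ℝ → ℝ} {T : ℝ}
    (hψ : ContDiff ℝ ∞ (fun p : ℝ × ℝ => ψ p.1 p.2))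
    (hc : HasCompactSupport (fun p : ℝ × ℝ => ψ p.1 p.2))
    (hT : tsupport (fun p : ℝ × ℝ => ψ p.1 p.2) ⊆ Iio T ×ˢ univ) :
    ∃ R D, IsTestFunction ψ (fun t x => deriv (fun t => ψ t x) t) (fun t x => deriv (ψ t) x)
      (fun t x => deriv (deriv (ψ t)) x) T R D := by
  set Ψ : ℝ × ℝ → ℝ := fun p => ψ p.1 p.2 with hΨ
  set Ψt : ℝ × ℝ → ℝ := fun p => fderiv ℝ Ψ p (1, 0) with hΨt
  set Ψx : ℝ × ℝ → ℝ := fun p => fderiv ℝ Ψ p (0, 1) with hΨx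
  set Ψxx : ℝ × ℝ → ℝ := fun p => fderiv ℝ Ψx p (0, 1) with hΨxx
  have et : ∀ t x, deriv (fun t => ψ t x) t = Ψt (t, x) := fun t x => (hψ.hasDerivAt_left t x).deriv
  have ex : ∀ t x, deriv (ψ t) x = Ψx (t, x) := fun t x => (hψ.hasDerivAt_right t x).deriv
  have ht1 : ContDiff ℝ ∞ Ψt := hψ.contDiff_fderiv_apply_const _
  have hx1 : ContDiff ℝ ∞ Ψx := hψ.contDiff_fderiv_apply_const _
  have hxx1 : ContDiff ℝ ∞ Ψxx := hx1.contDiff_fderiv_apply_const _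
  have hct : HasCompactSupport Ψt := hc.fderiv_apply ℝ _
  have hcx : HasCompactSupport Ψx := hc.fderiv_apply ℝ _
  have hcxx : HasCompactSupport Ψxx := hcx.fderiv_apply ℝ _
  have exx : ∀ t x, deriv (deriv (ψ t)) x = Ψxx (t, x) := by
    intro t x
    have : deriv (ψ t) = fun x => Ψx (t, x) := funext fun x => ex t x
    rw [this]
    exact (hx1.hasDerivAt_right t x).deriv
  obtain ⟨D₀, hD₀, hb₀, hl₀⟩ := hc.exists_abs_le_and_lipschitz hψ
  obtain ⟨D₁, hD₁, hb₁, hl₁⟩ := hct.exists_abs_le_and_lipschitz ht1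
  obtain ⟨D₂, hD₂, hb₂, hl₂⟩ := hcx.exists_abs_le_and_lipschitz hx1
  obtain ⟨D₃, hD₃, hb₃, -⟩ := hcxx.exists_abs_le_and_lipschitz hxx1
  obtain ⟨r, hr⟩ := hc.isCompact.isBounded.subset_closedBall 0
  set R := max r 1 with hR
  have hout : ∀ t x, R < |x| → (t, x) ∉ tsupport Ψ := by
    intro t x hx hmem
    have h1 := hr hmem
    rw [mem_closedBall_zero_iff, Prod.norm_def] at h1
    have h2 : |x| ≤ r := (le_max_right _ _).trans h1
    exact absurd (h2.trans (le_max_left r 1)) (not_le.2 hx)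
  have htx : tsupport Ψx ⊆ tsupport Ψ := tsupport_fderiv_apply_subset ℝ _
  have htt : tsupport Ψt ⊆ tsupport Ψ := tsupport_fderiv_apply_subset ℝ _
  have htxx : tsupport Ψxx ⊆ tsupport Ψx := tsupport_fderiv_apply_subset ℝ _
  set D := D₀ + D₁ + D₂ + D₃ with hD
  refine ⟨R, D, ⟨lt_max_of_lt_right one_pos, by positivity, fun t x hx => ?_, fun x => ?_,
    fun t x => ?_, fun t x => ?_, fun t x => ?_, fun t x s y => ?_, fun t x y => ?_,
    fun t x y => ?_, ?_, ?_, ?_, fun y y' t hy => ?_, fun t x => ?_⟩⟩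
  · have h1 := hout t x hx
    refine ⟨image_eq_zero_of_notMem_tsupport (f := Ψ) (x := (t, x)) h1, ?_, ?_, ?_⟩
    · rw [et]; exact image_eq_zero_of_notMem_tsupport fun h' => h1 (htt h')
    · rw [ex]; exact image_eq_zero_of_notMem_tsupport fun h' => h1 (htx h')
    · rw [exx]; exact image_eq_zero_of_notMem_tsupport fun h' => h1 (htx (htxx h'))
  · refine image_eq_zero_of_notMem_tsupport (f := Ψ) (x := (T, x)) fun h' => ?_
    exact lt_irrefl T (hT h').1
  · rw [et]; exact (hb₁ _).trans (by linarith)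
  · rw [ex]; exact (hb₂ _).trans (by linarith)
  · rw [exx]; exact (hb₃ _).trans (by linarith)
  · exact (hl₀ t x s y).trans (mul_le_mul_of_nonneg_right (by linarith) (by positivity))
  · rw [et, et]
    have := hl₁ t x t y
    rw [sub_self, abs_zero, zero_add] at this
    exact this.trans (mul_le_mul_of_nonneg_right (by linarith) (by positivity))
  · simp only [ex]
    have := hl₂ t x t y
    rw [sub_self, abs_zero, zero_add] at this
    exact this.trans (mul_le_mul_of_nonneg_right (by linarith) (by positivity))
  · simp only [et]; exact ht1.continuous
  · simp only [ex]; exact hx1.continuous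
  · simp only [exx]; exact hxx1.continuous
  · have h1 := ((hψ.differentiable (by simp)) (t, y t)).hasFDerivAt
    have h2 := h1.comp_hasDerivAt t ((hasDerivAt_id t).prodMk hy)
    refine h2.congr_deriv ?_
    rw [et, ex]
    have : ((1 : ℝ), y') = (1, 0) + y' • ((0 : ℝ), (1 : ℝ)) := by simp
    rw [this, map_add, map_smul, smul_eq_mul, mul_comm]
  · rw [exx]
    have : deriv (ψ t) = fun x => Ψx (t, x) := funext fun x => ex t x
    simp only [this]
    exact hx1.hasDerivAt_right t x

/-- Near every point the periodization of a function supported away from the ends of the period is a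
translate of the function. -/
theorem eventually_periodicCut_eq {L R : ℝ} (hR : R < L / 2) (hL : 0 < L) (x : ℝ) :
    ∀ᶠ y in 𝓝 x, ∀ ζ : ℝ → ℝ, (∀ z, R < |z| → ζ z = 0) →
      periodicCut ζ L y = ζ (y - L * ⌊x / L + 1 / 2⌋) := by
  have hfl : ∀ y : ℝ, L * ⌊y / L + 1 / 2⌋ ≤ y + L / 2 ∧ y + L / 2 < L * (⌊y / L + 1 / 2⌋ + 1) := by
    intro y
    have h1 := mul_le_mul_of_nonneg_left (Int.floor_le (y / L + 1 / 2)) hL.le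
    have h2 := mul_lt_mul_of_pos_left (Int.lt_floor_add_one (y / L + 1 / 2)) hL
    rw [mul_add, mul_div_cancel₀ _ hL.ne'] at h1 h2
    constructor <;> linarith
  -- Within distance `L / 2 - R`, if the periods of `x` and `y` differ, both arguments fall outside
  -- the support.
  filter_upwards [Metric.ball_mem_nhds x (by linarith : 0 < L / 2 - R)] with y hy ζ hζ
  rw [Metric.mem_ball, Real.dist_eq, abs_lt] at hy
  rw [periodicCut]
  set n := ⌊x / L + 1 / 2⌋ with hn
  set m := ⌊y / L + 1 / 2⌋ with hm
  obtain ⟨hx1, hx2⟩ := hfl x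
  obtain ⟨hy1, hy2⟩ := hfl y
  rw [← hn] at hx1 hx2
  rw [← hm] at hy1 hy2
  rcases lt_trichotomy n m with h | h | h
  · have h3 : (n : ℝ) + 1 ≤ m := by exact_mod_cast h
    have h4 : L * (n + 1) ≤ L * m := mul_le_mul_of_nonneg_left h3 hL.le
    rw [hζ, hζ]
    · rw [lt_abs]; left; linarith
    · rw [lt_abs]; right; linarith
  · rw [h]
  · have h3 : (m : ℝ) + 1 ≤ n := by exact_mod_cast h
    have h4 : L * (m + 1) ≤ L * n := mul_le_mul_of_nonneg_left h3 hL.le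
    rw [hζ, hζ]
    · rw [lt_abs]; right; linarith
    · rw [lt_abs]; left; linarith

namespace IsTestFunction

variable {ψ ψt ψx ψxx : ℝ → ℝ → ℝ} {T R D L : ℝ}

theorem hasDerivAt_periodicCut (h : IsTestFunction ψ ψt ψx ψxx T R D) (hR : R < L / 2) (t x : ℝ) :
    HasDerivAt (periodicCut (ψx t) L) (periodicCut (ψxx t) L x) x := by
  have hL : 0 < L := by have := h.radius_pos; linarith
  have h1 := (h.hasDerivAt_space t (x - L * ⌊x / L + 1 / 2⌋)).comp_sub_const x
    (L * ⌊x / L + 1 / 2⌋)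
  refine h1.congr_of_eventuallyEq ?_
  filter_upwards [eventually_periodicCut_eq hR hL x] with y hy
  exact hy _ fun z hz => (h.support t z hz).2.2.1

theorem continuous_periodicCut (h : IsTestFunction ψ ψt ψx ψxx T R D) (hR : R < L / 2) (t : ℝ) :
    Continuous (periodicCut (ψxx t) L) := by
  have hL : 0 < L := by have := h.radius_pos; linarith
  rw [continuous_iff_continuousAt]
  intro x
  have h1 : Continuous fun y => ψxx t (y - L * ⌊x / L + 1 / 2⌋) :=
    h.continuous_space2.comp (continuous_const.prodMk (continuous_id.sub continuous_const))
  refine h1.continuousAt.congr ?_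
  filter_upwards [eventually_periodicCut_eq hR hL x] with y hy
  exact (hy _ fun z hz => (h.support t z hz).2.2.2).symm

/-- The neighbourhood in `eventually_periodicCut_eq` does not depend on the function, so it serves
all `ψ s` for `s` near `t`. -/
theorem hasDerivAt_periodicCut_comp (h : IsTestFunction ψ ψt ψx ψxx T R D) (hR : R < L / 2)
    {y : ℝ → ℝ} {y' t : ℝ} (hy : HasDerivAt y y' t) :
    HasDerivAt (fun s => periodicCut (ψ s) L (y s))
      (periodicCut (ψt t) L (y t) + periodicCut (ψx t) L (y t) * y') t := by
  have hL : 0 < L := by have := h.radius_pos; linarith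
  have h1 := h.hasDerivAt_comp (fun s => y s - L * ⌊y t / L + 1 / 2⌋) y' t (hy.sub_const _)
  refine h1.congr_of_eventuallyEq ?_
  filter_upwards [hy.continuousAt.eventually (eventually_periodicCut_eq hR hL (y t))] with s hs
  exact hs _ fun z hz => (h.support s z hz).1

theorem abs_periodicCut_sub_le (h : IsTestFunction ψ ψt ψx ψxx T R D) (hR : R < L / 2)
    (t x s y : ℝ) :
    |periodicCut (ψ t) L x - periodicCut (ψ s) L y| ≤ D * (|t - s| + |x - y|) := by
  have hL : 0 < L := by have := h.radius_pos; linarith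
  have hz : ∀ s, ψ s (-(L / 2)) = 0 ∧ ψ s (L / 2) = 0 := fun s =>
    ⟨(h.support s _ (by rw [abs_neg, abs_of_pos (by linarith)]; exact hR)).1,
      (h.support s _ (by rw [abs_of_pos (by linarith)]; exact hR)).1⟩
  have h1 : |periodicCut (ψ t) L x - periodicCut (ψ s) L x| ≤ D * |t - s| := by
    have := h.lip t (x - L * ⌊x / L + 1 / 2⌋) s (x - L * ⌊x / L + 1 / 2⌋)
    rwa [sub_self (x - L * _), abs_zero, add_zero] at this
  have h2 := periodicCut_lipschitz hL (fun y z => by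
    have := h.lip s y s z
    rwa [sub_self, abs_zero, zero_add] at this) (hz s).1 (hz s).2 x y
  refine (abs_sub_le _ (periodicCut (ψ s) L x) _).trans ?_
  rw [mul_add]
  exact add_le_add h1 h2

end IsTestFunction

/-! ### The weak formulation and its continuity in the density. -/

noncomputable section
/-- The integrand of the weak formulation for the density `w`. -/
def weakIntegrand (k φ : ℝ → ℝ) (ψt ψx ψxx : ℝ → ℝ → ℝ) (w : ℝ → ℝ → ℝ) (p : ℝ × ℝ) : ℝ :=
  w p.1 p.2 * ψt p.1 p.2 - w p.1 p.2 * (∫ y, k (p.2 - y) * w p.1 y) * ψx p.1 p.2 +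
    φ (w p.1 p.2) * ψxx p.1 p.2
end

section Convolution

variable {k w : ℝ → ℝ} {B Λ M : ℝ}

theorem integrable_kernel_mul (hk : Integrable k) (hw : Measurable w) (hw0 : ∀ y, w y ∈ Icc 0 M)
    (x : ℝ) : Integrable fun y => k (x - y) * w y := by
  refine (hk.comp_sub_left x).mul_bdd hw.aestronglyMeasurable (ae_of_all _ fun y => ?_) (c := M)
  rw [Real.norm_eq_abs, abs_of_nonneg (hw0 y).1]; exact (hw0 y).2

theorem abs_convolution_le_of_integrable (hk : Integrable k)
    (hw0 : ∀ y, w y ∈ Icc 0 M) (x : ℝ) : |∫ y, k (x - y) * w y| ≤ M * ∫ y, |k y| := by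
  have h1 : Integrable fun y => |k (x - y)| * M := (hk.comp_sub_left x).abs.mul_const M
  have h2 := norm_integral_le_of_norm_le (f := fun y => k (x - y) * w y) h1 (ae_of_all _ fun y => by
    rw [norm_mul, Real.norm_eq_abs, Real.norm_eq_abs, abs_of_nonneg (hw0 y).1]
    exact mul_le_mul_of_nonneg_left (hw0 y).2 (abs_nonneg _))
  rw [Real.norm_eq_abs] at h2
  refine h2.trans (le_of_eq ?_)
  rw [integral_mul_const, integral_sub_left_eq_self (fun y => |k y|), mul_comm]

theorem abs_convolution_le (hB : ∀ z, |k z| ≤ B) (hw0 : ∀ y, w y ∈ Icc 0 M)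
    (hwi : Integrable w) (x : ℝ) : |∫ y, k (x - y) * w y| ≤ B * ∫ y, w y := by
  have h2 := norm_integral_le_of_norm_le (f := fun y => k (x - y) * w y) (hwi.const_mul B)
    (ae_of_all _ fun y => by
      rw [norm_mul, Real.norm_eq_abs, Real.norm_eq_abs, abs_of_nonneg (hw0 y).1]
      exact mul_le_mul_of_nonneg_right (hB _) (hw0 y).1)
  rw [Real.norm_eq_abs, integral_const_mul] at h2
  exact h2

/-- The convolution of a bounded integrable density with a kernel that is Lipschitz off the origin
is Lipschitz. -/
theorem abs_convolution_sub_le (hk : Integrable k) (hB0 : 0 ≤ B) (hB : ∀ z, |k z| ≤ B) (hΛ : 0 ≤ Λ)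
    (hpos : ∀ z w, 0 < z → 0 < w → |k z - k w| ≤ Λ * |z - w|)
    (hneg : ∀ z w, z < 0 → w < 0 → |k z - k w| ≤ Λ * |z - w|)
    (hw : Measurable w) (hw0 : ∀ y, w y ∈ Icc 0 M) (hwi : Integrable w) (x y : ℝ) :
    |(∫ z, k (x - z) * w z) - ∫ z, k (y - z) * w z| ≤ (Λ * (∫ z, w z) + 2 * B * M) * |x - y| := by
  have hM : 0 ≤ M := (hw0 0).1.trans (hw0 0).2
  wlog hxy : x ≤ y generalizing x y
  · rw [abs_sub_comm, abs_sub_comm x]; exact this y x (not_le.1 hxy).le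
  rw [← integral_sub (integrable_kernel_mul hk hw hw0 x) (integrable_kernel_mul hk hw hw0 y)]
  have hi : Integrable ((Icc x y).indicator fun _ => 2 * B * M) :=
    (integrable_indicator_iff measurableSet_Icc).2 (integrableOn_const (by simp))
  have h1 : ∀ z, ‖k (x - z) * w z - k (y - z) * w z‖ ≤
      Λ * |x - y| * w z + (Icc x y).indicator (fun _ => 2 * B * M) z := by
    intro z
    have hwz := (hw0 z).1
    rw [← sub_mul, norm_mul, Real.norm_eq_abs, Real.norm_eq_abs, abs_of_nonneg hwz]
    -- Between `x` and `y` the two arguments may lie on opposite sides of the jump of the kernel.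
    -- There the trivial bound is used on a set of length `|x - y|`.
    by_cases hz : z ∈ Icc x y
    · rw [indicator_of_mem hz]
      have h2 : |k (x - z) - k (y - z)| ≤ 2 * B :=
        (abs_sub _ _).trans (by linarith [hB (x - z), hB (y - z)])
      have h3 := mul_le_mul h2 (hw0 z).2 hwz (by positivity)
      have : 0 ≤ Λ * |x - y| * w z := by positivity
      linarith
    · rw [indicator_of_notMem hz, add_zero]
      refine mul_le_mul_of_nonneg_right ?_ hwz
      have e : x - y = x - z - (y - z) := by ring
      rw [e]
      rcases lt_or_ge z x with h | h
      · exact hpos _ _ (by linarith) (by linarith)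
      · have h' : y < z := by
          by_contra hcon
          exact hz ⟨h, not_lt.1 hcon⟩
        exact hneg _ _ (by linarith) (by linarith)
  have h2 := norm_integral_le_of_norm_le ((hwi.const_mul (Λ * |x - y|)).add hi) (ae_of_all _ h1)
  rw [Real.norm_eq_abs] at h2
  refine h2.trans (le_of_eq ?_)
  simp only [Pi.add_apply]
  rw [integral_add (hwi.const_mul _) hi, integral_const_mul, integral_indicator_const _ measurableSet_Icc,
    Real.volume_real_Icc_of_le hxy, smul_eq_mul, abs_of_nonpos (by linarith : x - y ≤ 0)]
  ring

end Convolution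

namespace IsTestFunction

variable {ψ ψt ψx ψxx : ℝ → ℝ → ℝ} {T R D : ℝ} {k φ W : ℝ → ℝ} {w w' : ℝ → ℝ → ℝ} {B M : ℝ}

theorem measurable_convolution (hk : Measurable k)
    (hw : Measurable fun p : ℝ × ℝ => w p.1 p.2) :
    Measurable fun p : ℝ × ℝ => ∫ y, k (p.2 - y) * w p.1 y := by
  have h1 : Measurable fun q : (ℝ × ℝ) × ℝ => k (q.1.2 - q.2) * w q.1.1 q.2 :=
    (hk.comp ((measurable_snd.comp measurable_fst).sub measurable_snd)).mul
      (hw.comp ((measurable_fst.comp measurable_fst).prodMk measurable_snd))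
  exact h1.stronglyMeasurable.integral_prod_right'.measurable

theorem measurable_weakIntegrand (h : IsTestFunction ψ ψt ψx ψxx T R D)
    (hφ : AdmissibleDiffusion φ W) (hk : Measurable k)
    (hw : Measurable fun p : ℝ × ℝ => w p.1 p.2) (hw0 : ∀ t y, w t y ∈ Icc 0 M) :
    Measurable (weakIntegrand k φ ψt ψx ψxx w) := by
  have hcont : Continuous fun r => φ (max 0 r) :=
    hφ.continuousOn.comp_continuous (by fun_prop) fun r => mem_Ici.2 (le_max_left _ _)
  have h1 : Measurable fun p : ℝ × ℝ => φ (w p.1 p.2) := by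
    have h2 : (fun p : ℝ × ℝ => φ (w p.1 p.2)) = fun p : ℝ × ℝ => φ (max 0 (w p.1 p.2)) :=
      funext fun p => by rw [max_eq_right (hw0 p.1 p.2).1]
    rw [h2]
    exact hcont.measurable.comp hw
  exact ((hw.mul h.continuous_time.measurable).sub ((hw.mul (measurable_convolution hk hw)).mul
    h.continuous_space.measurable)).add (h1.mul h.continuous_space2.measurable)

theorem abs_weakIntegrand_le (h : IsTestFunction ψ ψt ψx ψxx T R D)
    (hφ : AdmissibleDiffusion φ W) (hk : Integrable k)
    (hw0 : ∀ t y, w t y ∈ Icc 0 M) (p : ℝ × ℝ) :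
    |weakIntegrand k φ ψt ψx ψxx w p| ≤
      (univ ×ˢ Icc (-R) R).indicator (fun _ => (M + M * (M * ∫ y, |k y|) + φ M) * D) p := by
  by_cases hp : |p.2| ≤ R
  · rw [indicator_of_mem (show p ∈ (univ : Set ℝ) ×ˢ Icc (-R) R from ⟨mem_univ _, abs_le.1 hp⟩)]
    have h0 := hw0 p.1 p.2
    have hM : 0 ≤ M := h0.1.trans h0.2
    have h1 := abs_convolution_le_of_integrable hk (hw0 p.1) p.2
    have h2 : |φ (w p.1 p.2)| ≤ φ M := by
      rw [abs_of_nonneg (hφ.nonneg h0.1)]; exact hφ.mono h0.1 h0.2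
    have h3 : |w p.1 p.2| ≤ M := by rw [abs_of_nonneg h0.1]; exact h0.2
    rw [weakIntegrand]
    refine (abs_add_le _ _).trans ?_
    rw [add_mul, add_mul]
    refine add_le_add ((abs_sub _ _).trans (add_le_add ?_ ?_)) ?_
    · rw [abs_mul]; exact mul_le_mul h3 (h.abs_time_le _ _) (abs_nonneg _) hM
    · rw [abs_mul, abs_mul]
      exact mul_le_mul (mul_le_mul h3 h1 (abs_nonneg _) hM) (h.abs_space_le _ _) (abs_nonneg _)
        (mul_nonneg hM ((abs_nonneg _).trans h1))
    · rw [abs_mul]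
      exact mul_le_mul h2 (h.abs_space2_le _ _) (abs_nonneg _) ((abs_nonneg _).trans h2)
  · obtain ⟨-, h1, h2, h3⟩ := h.support p.1 p.2 (not_le.1 hp)
    rw [indicator_of_notMem fun h' : p ∈ (univ : Set ℝ) ×ˢ Icc (-R) R => hp (abs_le.2 h'.2),
      weakIntegrand, h1, h2, h3]
    simp

theorem integrableOn_weakIntegrand (h : IsTestFunction ψ ψt ψx ψxx T R D)
    (hφ : AdmissibleDiffusion φ W) (hk : Integrable k) (hkm : Measurable k)
    (hw : Measurable fun p : ℝ × ℝ => w p.1 p.2) (hw0 : ∀ t y, w t y ∈ Icc 0 M) :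
    IntegrableOn (weakIntegrand k φ ψt ψx ψxx w) (Icc 0 T ×ˢ univ) := by
  have h1 : IntegrableOn ((univ ×ˢ Icc (-R) R).indicator
      (fun _ : ℝ × ℝ => (M + M * (M * ∫ y, |k y|) + φ M) * D)) (Icc 0 T ×ˢ univ) := by
    rw [IntegrableOn, integrable_indicator_iff (MeasurableSet.univ.prod measurableSet_Icc)]
    refine integrableOn_const ?_
    rw [Measure.restrict_apply (MeasurableSet.univ.prod measurableSet_Icc), prod_inter_prod,
      univ_inter, inter_univ, Measure.volume_eq_prod, Measure.prod_prod, Real.volume_Icc,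
      Real.volume_Icc]
    exact ENNReal.mul_ne_top ENNReal.ofReal_ne_top ENNReal.ofReal_ne_top
  exact h1.mono' (h.measurable_weakIntegrand hφ hkm hw hw0).aestronglyMeasurable
    (ae_of_all _ fun p => h.abs_weakIntegrand_le hφ hk hw0 p)

/-- The weak formulation depends Lipschitz continuously on the density in `L¹`. -/
theorem exists_lintegral_weakIntegrand_sub_le (h : IsTestFunction ψ ψt ψx ψxx T R D)
    (hφ : AdmissibleDiffusion φ W) (hk : Integrable k) (hB : ∀ z, |k z| ≤ B)
    (M : ℝ) : ∃ C, ∀ w w' : ℝ → ℝ → ℝ, (Measurable fun p : ℝ × ℝ => w p.1 p.2) →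
      (Measurable fun p : ℝ × ℝ => w' p.1 p.2) → (∀ t y, w t y ∈ Icc 0 M) →
      (∀ t y, w' t y ∈ Icc 0 M) →
      ∫⁻ p in Icc 0 T ×ˢ (univ : Set ℝ), ‖weakIntegrand k φ ψt ψx ψxx w p -
        weakIntegrand k φ ψt ψx ψxx w' p‖ₑ ≤
      ENNReal.ofReal C * ∫⁻ p in Icc 0 T ×ˢ (univ : Set ℝ), ‖w p.1 p.2 - w' p.1 p.2‖ₑ := by
  obtain ⟨A, hA0, hA⟩ := hφ.exists_lipschitz M
  have hD := h.bound_nonneg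
  have hR := h.radius_pos
  have hB0 : 0 ≤ B := (abs_nonneg _).trans (hB 0)
  set κ := ∫ y, |k y| with hκ
  have hκ0 : 0 ≤ κ := integral_nonneg fun y => abs_nonneg _
  by_cases hM : 0 ≤ M
  swap
  · exact ⟨0, fun w w' _ _ h1 _ => absurd ((h1 0 0).1.trans (h1 0 0).2) hM⟩
  refine ⟨(D + M * κ * D + A * D) + M * D * B * (2 * R), fun w w' hw hw' hw0 hw0' => ?_⟩
  set d : ℝ × ℝ → ℝ≥0∞ := fun p => ‖w p.1 p.2 - w' p.1 p.2‖ₑ with hd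
  have hdm : Measurable d := (hw.sub hw').enorm
  set n : ℝ → ℝ≥0∞ := fun t => ∫⁻ y, d (t, y) with hn
  have hnm : Measurable n := hdm.lintegral_prod_right'
  have hpt : ∀ p : ℝ × ℝ, ‖weakIntegrand k φ ψt ψx ψxx w p - weakIntegrand k φ ψt ψx ψxx w' p‖ₑ ≤
      ENNReal.ofReal (D + M * κ * D + A * D) * d p +
        ENNReal.ofReal (M * D * B) * (n p.1 * (Icc (-R) R).indicator 1 p.2) := by
    intro p
    by_cases hp : |p.2| ≤ R
    swap
    · obtain ⟨-, h1, h2, h3⟩ := h.support p.1 p.2 (not_le.1 hp)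
      simp only [weakIntegrand, h1, h2, h3]
      simp
    rw [indicator_of_mem (show p.2 ∈ Icc (-R) R from abs_le.1 hp), Pi.one_apply, mul_one]
    have hwr : Measurable (w p.1) := hw.comp (measurable_const.prodMk measurable_id)
    have hwr' : Measurable (w' p.1) := hw'.comp (measurable_const.prodMk measurable_id)
    set a := w p.1 p.2 with ha
    set b := w' p.1 p.2 with hb
    set G := ∫ y, k (p.2 - y) * w p.1 y with hG
    set G' := ∫ y, k (p.2 - y) * w' p.1 y with hG'
    have hGb : |G| ≤ M * κ := abs_convolution_le_of_integrable hk (hw0 p.1) p.2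
    have hGG : ‖G - G'‖ₑ ≤ ENNReal.ofReal B * n p.1 := by
      rw [hG, hG', ← integral_sub (integrable_kernel_mul hk hwr (hw0 p.1) p.2)
        (integrable_kernel_mul hk hwr' (hw0' p.1) p.2)]
      refine (enorm_integral_le_lintegral_enorm _).trans ?_
      have hdr : Measurable fun y => d (p.1, y) :=
        hdm.comp (measurable_const.prodMk measurable_id)
      refine le_trans (lintegral_mono fun y => ?_) (lintegral_const_mul _ hdr).le
      rw [← mul_sub, enorm_mul]
      refine mul_le_mul_left ?_ _
      rw [Real.enorm_eq_ofReal_abs]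
      exact ENNReal.ofReal_le_ofReal (hB _)
    -- All terms but one are local in `a - b`; the last carries the change of the convolution, which
    -- the spatial `L¹` distance at that time controls.
    have hid : weakIntegrand k φ ψt ψx ψxx w p - weakIntegrand k φ ψt ψx ψxx w' p =
        ((a - b) * ψt p.1 p.2 - (a - b) * G * ψx p.1 p.2 + (φ a - φ b) * ψxx p.1 p.2) -
          b * ψx p.1 p.2 * (G - G') := by
      simp only [weakIntegrand, ← ha, ← hb, ← hG, ← hG']; ring
    rw [hid]
    refine enorm_sub_le.trans (add_le_add ?_ ?_)
    · rw [hd]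
      simp only [← ha, ← hb]
      rw [Real.enorm_eq_ofReal_abs, Real.enorm_eq_ofReal_abs, ← ENNReal.ofReal_mul (by positivity)]
      refine ENNReal.ofReal_le_ofReal ?_
      refine (abs_add_le _ _).trans ?_
      have h1 : |(a - b) * ψt p.1 p.2| ≤ |a - b| * D := by
        rw [abs_mul]; exact mul_le_mul_of_nonneg_left (h.abs_time_le _ _) (abs_nonneg _)
      have h2 : |(a - b) * G * ψx p.1 p.2| ≤ |a - b| * (M * κ) * D := by
        rw [abs_mul, abs_mul]
        exact mul_le_mul (mul_le_mul_of_nonneg_left hGb (abs_nonneg _)) (h.abs_space_le _ _)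
          (abs_nonneg _) (by positivity)
      have h3 : |(φ a - φ b) * ψxx p.1 p.2| ≤ A * |a - b| * D := by
        rw [abs_mul]
        exact mul_le_mul (hA a b (hw0 _ _) (hw0' _ _)) (h.abs_space2_le _ _) (abs_nonneg _)
          (by positivity)
      have h4 := abs_sub ((a - b) * ψt p.1 p.2) ((a - b) * G * ψx p.1 p.2)
      nlinarith
    · rw [enorm_mul, ENNReal.ofReal_mul (by positivity), mul_assoc]
      refine mul_le_mul' ?_ hGG
      rw [Real.enorm_eq_ofReal_abs]
      refine ENNReal.ofReal_le_ofReal ?_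
      rw [abs_mul, abs_of_nonneg (hw0' _ _).1]
      exact mul_le_mul (hw0' _ _).2 (h.abs_space_le _ _) (abs_nonneg _) hM
  refine (lintegral_mono hpt).trans ?_
  rw [lintegral_add_left (hdm.const_mul _), lintegral_const_mul _ hdm,
    ENNReal.ofReal_add (p := D + M * κ * D + A * D) (by positivity) (by positivity), add_mul]
  refine add_le_add le_rfl ?_
  have hnim : Measurable fun p : ℝ × ℝ => n p.1 * (Icc (-R) R).indicator 1 p.2 :=
    (hnm.comp measurable_fst).mul ((measurable_one.indicator measurableSet_Icc).comp measurable_snd)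
  rw [lintegral_const_mul _ hnim, ENNReal.ofReal_mul (p := M * D * B) (by positivity),
    mul_assoc (ENNReal.ofReal (M * D * B))]
  -- The nonlocal bound does not depend on the position, so integrating it over `[-R, R]` gives the
  -- factor `2 * R`.
  refine mul_le_mul' le_rfl (le_of_eq ?_)
  rw [Measure.volume_eq_prod, ← Measure.prod_restrict, Measure.restrict_univ,
    lintegral_prod _ hnim.aemeasurable, lintegral_prod _ hdm.aemeasurable,
    ← lintegral_const_mul _ hnm]
  refine lintegral_congr fun t => ?_
  refine (lintegral_const_mul (n t) (measurable_one.indicator measurableSet_Icc)).trans ?_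
  rw [lintegral_indicator_one measurableSet_Icc, Real.volume_Icc, mul_comm]
  congr 2; ring

end IsTestFunction

/-! ### Consistency of the interaction with the convolution on the line. -/

/-- The properties of the derivative of an admissible kernel. -/
structure IsForceKernel (k : ℝ → ℝ) (B Λ : ℝ) : Prop where
  integrable : Integrable k
  measurable : Measurable k
  bound : ∀ z, |k z| ≤ B
  lip_nonneg : 0 ≤ Λ
  lip_pos : ∀ z w, 0 < z → 0 < w → |k z - k w| ≤ Λ * |z - w|
  lip_neg : ∀ z w, z < 0 → w < 0 → |k z - k w| ≤ Λ * |z - w|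

namespace PeriodicConfig

variable {L c B Λ κ M R R₂ D η τ : ℝ} {N : ℕ} {x : ℤ → ℝ} {S : ℝ → Set ℝ} {f k φ W : ℝ → ℝ}

theorem cutDensity_mem (h : PeriodicConfig L N x) (hc : 0 < c) (hM : ∀ k, cellDensity c N x k ≤ M)
    (y : ℝ) : cutDensity L c N x y ∈ Icc 0 M := by
  have h1 : particleDensity c N x y ∈ Icc 0 M := ⟨(h.density_pos hc y).le, h.density_le hM y⟩
  rw [cutDensity, indicator]
  split_ifs
  · exact h1
  · exact ⟨le_rfl, h1.1.trans h1.2⟩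

theorem measurable_cutDensity (h : PeriodicConfig L N x) : Measurable (cutDensity L c N x) :=
  h.measurable_density.indicator measurableSet_Ico

theorem integrable_cutDensity (h : PeriodicConfig L N x) : Integrable (cutDensity L c N x) := by
  have hL := h.length_pos
  rw [cutDensity, integrable_indicator_iff measurableSet_Ico, integrableOn_Ico_iff_integrableOn_Ioo,
    ← integrableOn_Ioc_iff_integrableOn_Ioo, ← intervalIntegrable_iff_integrableOn_Ioc_of_le
      (by linarith)]
  exact h.intervalIntegrable_density _ _

theorem integral_cutDensity (h : PeriodicConfig L N x) : ∫ y, cutDensity L c N x y = c := by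
  have h1 := integral_cutDensity_mul (c := c) h.length_pos N x fun _ => 1
  simp only [mul_one] at h1
  have h2 := h.integral_density_period (c := c) (-(L / 2))
  rw [show -(L / 2) + L = L / 2 by ring] at h2
  rw [h1, h2]

/-- The torus force exerted by the density is close to the force on the line. -/
theorem abs_integral_force_sub_le (h : PeriodicConfig L N x) (hc : 0 < c)
    (hM : ∀ k, cellDensity c N x k ≤ M) (hS : TorusForce S f L B Λ κ) (hk : IsForceKernel k B Λ)
    (hη0 : 0 ≤ η) (hτ0 : 0 ≤ τ)
    (hη : ∫⁻ z in Icc (-(R + R₂)) (R + R₂), ‖f z - k z‖ₑ ≤ ENNReal.ofReal η)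
    (hτ : ∫⁻ y in (Icc (-R₂) R₂)ᶜ, ENNReal.ofReal (cutDensity L c N x y) ≤ ENNReal.ofReal τ)
    {z : ℝ} (hz : |z| ≤ R) :
    |(∫ y in -(L / 2)..L / 2, particleDensity c N x y * f (z - y)) -
      ∫ y, k (z - y) * cutDensity L c N x y| ≤ M * η + 2 * B * τ := by
  have hB := hS.bound_nonneg
  have hmem := h.cutDensity_mem hc hM
  have hM0 : 0 ≤ M := (hmem 0).1.trans (hmem 0).2
  set v := cutDensity L c N x with hv
  have hvm : Measurable v := h.measurable_cutDensity
  have hvi : Integrable v := h.integrable_cutDensity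
  have hi1 : Integrable fun y => v y * f (z - y) :=
    hvi.mul_bdd (c := B) (hS.measurable.comp (measurable_const.sub measurable_id)).aestronglyMeasurable
      (ae_of_all _ fun y => hS.bound _)
  have hi2 : Integrable fun y => k (z - y) * v y := integrable_kernel_mul hk.integrable hvm hmem z
  have hgm : Measurable fun z => ‖f z - k z‖ₑ := (hS.measurable.sub hk.measurable).enorm
  rw [← integral_cutDensity_mul h.length_pos N x fun y => f (z - y), ← integral_sub hi1 hi2]
  rw [← ENNReal.ofReal_le_ofReal_iff (by positivity), ← Real.enorm_eq_ofReal_abs]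
  refine (enorm_integral_le_lintegral_enorm _).trans ?_
  have hpt : ∀ y, ‖v y * f (z - y) - k (z - y) * v y‖ₑ ≤
      ENNReal.ofReal M * (Icc (-(R + R₂)) (R + R₂)).indicator (fun z => ‖f z - k z‖ₑ) (z - y) +
      ENNReal.ofReal (2 * B) * (Icc (-R₂) R₂)ᶜ.indicator (fun y => ENNReal.ofReal (v y)) y := by
    intro y
    rw [mul_comm (k _), ← mul_sub, enorm_mul]
    -- For near `y` the displacement lies in the window where `f` is close to `k`; far `y` carry at
    -- most the mass `τ`, on which the forces differ by at most `2 * B`.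
    by_cases hy : y ∈ Icc (-R₂) R₂
    · refine le_add_right ?_
      rw [indicator_of_mem (s := Icc (-(R + R₂)) (R + R₂))
        ⟨by linarith [(abs_le.1 hz).1, hy.2], by linarith [(abs_le.1 hz).2, hy.1]⟩,
        Real.enorm_eq_ofReal_abs (v y), abs_of_nonneg (hmem y).1]
      exact mul_le_mul' (ENNReal.ofReal_le_ofReal (hmem y).2) le_rfl
    · refine le_add_left ?_
      rw [indicator_of_mem (s := (Icc (-R₂) R₂)ᶜ) hy, mul_comm, Real.enorm_eq_ofReal_abs (v y),
        abs_of_nonneg (hmem y).1, Real.enorm_eq_ofReal_abs]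
      refine mul_le_mul' (ENNReal.ofReal_le_ofReal ?_) le_rfl
      exact (abs_sub _ _).trans (by linarith [hS.bound (z - y), hk.bound (z - y)])
  refine (lintegral_mono hpt).trans ?_
  have hgm' : Measurable ((Icc (-(R + R₂)) (R + R₂)).indicator fun z => ‖f z - k z‖ₑ) :=
    hgm.indicator measurableSet_Icc
  have hgz : Measurable fun y =>
      (Icc (-(R + R₂)) (R + R₂)).indicator (fun z => ‖f z - k z‖ₑ) (z - y) :=
    hgm'.comp (measurable_const.sub measurable_id)
  rw [lintegral_add_left (hgz.const_mul _)]
  rw [lintegral_const_mul _ (hvm.ennreal_ofReal.indicator measurableSet_Icc.compl),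
    lintegral_indicator measurableSet_Icc.compl]
  have e : ∫⁻ y, ENNReal.ofReal M *
      (Icc (-(R + R₂)) (R + R₂)).indicator (fun z => ‖f z - k z‖ₑ) (z - y) =
      ENNReal.ofReal M * ∫⁻ z in Icc (-(R + R₂)) (R + R₂), ‖f z - k z‖ₑ := by
    rw [lintegral_const_mul _ hgz, lintegral_sub_left_eq_self
      ((Icc (-(R + R₂)) (R + R₂)).indicator fun z => ‖f z - k z‖ₑ) z,
      lintegral_indicator measurableSet_Icc]
  rw [e, ENNReal.ofReal_add (by positivity) (by positivity), ENNReal.ofReal_mul hM0,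
    ENNReal.ofReal_mul (by positivity : 0 ≤ 2 * B)]
  exact add_le_add (mul_le_mul' le_rfl hη) (mul_le_mul' le_rfl hτ)

/-- The work of the interaction forces against a field `ζ` is asymptotically that of the
convolution with the kernel. -/
theorem abs_sum_force_add_integral_le (h : PeriodicConfig L N x) (hc : 0 < c)
    (hM : ∀ k, cellDensity c N x k ≤ M) (hS : TorusForce S f L B Λ κ) (hk : IsForceKernel k B Λ)
    (hη0 : 0 ≤ η) (hτ0 : 0 ≤ τ)
    (hη : ∫⁻ z in Icc (-(R + R₂)) (R + R₂), ‖f z - k z‖ₑ ≤ ENNReal.ofReal η)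
    (hτ : ∫⁻ y in (Icc (-R₂) R₂)ᶜ, ENNReal.ofReal (cutDensity L c N x y) ≤ ENNReal.ofReal τ)
    (hR : R < L / 2) (hR0 : 0 < R) {ζ : ℝ → ℝ} (hD : 0 ≤ D) (hζ : ∀ y, |ζ y| ≤ D)
    (hζl : ∀ y z, |ζ y - ζ z| ≤ D * |y - z|) (hζs : ∀ y, R < |y| → ζ y = 0)
    {V : ℤ → ℝ} (hV : ∀ k, IsForceSum S c N x k (V k)) :
    |∑ i ∈ Finset.range N, c / N * (periodicCut ζ L (x i) * V i) +
      ∫ y, cutDensity L c N x y * (ζ y * ∫ z, k (y - z) * cutDensity L c N x z)| ≤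
      c * (D * (c / N * (Λ * L + 4 * B) + (M * η + 2 * B * τ))) +
        (D * (Λ * c + 2 * B * M) + D * (B * c)) * (c / N) * L := by
  have hL := h.length_pos
  have hB := hS.bound_nonneg
  have hN := h.cast_pos
  have hmem := h.cutDensity_mem hc hM
  set v := cutDensity L c N x with hv
  have hvm : Measurable v := h.measurable_cutDensity
  have hvi : Integrable v := h.integrable_cutDensity
  have hvc : ∫ y, v y = c := h.integral_cutDensity
  set G : ℝ → ℝ := fun y => ∫ z, k (y - z) * v z with hG
  -- The product of `ζ` with the convolution is Lipschitz and vanishes at the ends of the period, so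
  -- the quadrature estimate applies to it.
  set A : ℝ → ℝ := fun y => ζ y * G y with hA
  have hGl : ∀ y z, |G y - G z| ≤ (Λ * c + 2 * B * M) * |y - z| := by
    intro y z
    have := abs_convolution_sub_le hk.integrable hB hk.bound hk.lip_nonneg hk.lip_pos hk.lip_neg hvm
      hmem hvi y z
    rwa [hvc] at this
  have hGb : ∀ y, |G y| ≤ B * c := by
    intro y
    have := abs_convolution_le hk.bound hmem hvi y
    rwa [hvc] at this
  have hAl : ∀ y z, |A y - A z| ≤ (D * (Λ * c + 2 * B * M) + D * (B * c)) * |y - z| := by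
    intro y z
    have e : A y - A z = ζ y * (G y - G z) + (ζ y - ζ z) * G z := by simp only [hA]; ring
    rw [e]
    refine (abs_add_le _ _).trans ?_
    rw [abs_mul, abs_mul]
    have h1 := mul_le_mul (hζ y) (hGl y z) (abs_nonneg _) hD
    have h2 := mul_le_mul (hζl y z) (hGb z) (abs_nonneg _) (by positivity)
    linarith
  have hA1 : A (-(L / 2)) = 0 := by
    simp only [hA]
    rw [hζs _ (by rw [abs_neg, abs_of_pos (by linarith)]; exact hR), zero_mul]
  have hA2 : A (L / 2) = 0 := by
    simp only [hA]
    rw [hζs _ (by rw [abs_of_pos (by linarith)]; exact hR), zero_mul]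
  have hAc0 : 0 ≤ D * (Λ * c + 2 * B * M) + D * (B * c) := by
    have := (abs_nonneg _).trans (hAl 1 0); simpa using this
  have h1 := h.abs_sum_sub_integral_period_le hc hAc0 (periodicCut_lipschitz hL hAl hA1 hA2)
    (periodicCut_periodic A hL)
  have h2 : ∫ y in -(L / 2)..L / 2, particleDensity c N x y * periodicCut A L y =
      ∫ y, v y * A y := by
    rw [hv, integral_cutDensity_mul hL, intervalIntegral.integral_of_le (by linarith),
      intervalIntegral.integral_of_le (by linarith), ← integral_Ico_eq_integral_Ioc,
      ← integral_Ico_eq_integral_Ioc]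
    refine setIntegral_congr_fun measurableSet_Ico fun y hy => ?_
    rw [periodicCut_eq A hL hy]
  rw [h2] at h1
  have h3 : ∀ i : ℤ, |periodicCut ζ L (x i) * V i + periodicCut A L (x i)| ≤
      D * (c / N * (Λ * L + 4 * B) + (M * η + 2 * B * τ)) := by
    intro i
    -- The representative of `x i` in the fundamental period. The integral of force times density is
    -- the same at both points by periodicity, while the convolution on the line makes sense only at
    -- `z`.
    set z := x i - L * ⌊x i / L + 1 / 2⌋ with hz
    have e1 : periodicCut ζ L (x i) = ζ z := rfl
    have e2 : periodicCut A L (x i) = ζ z * G z := rfl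
    rw [e1, e2, ← mul_add, abs_mul]
    by_cases hzR : |z| ≤ R
    · refine mul_le_mul (hζ z) ?_ (abs_nonneg _) hD
      have h4 := (hV i).abs_add_integral_le hS h hc
      have h5 := h.abs_integral_force_sub_le hc hM hS hk hη0 hτ0 hη hτ hzR
      have e3 : ∫ y in x i..x i + L, particleDensity c N x y * f (x i - y) =
          ∫ y in -(L / 2)..L / 2, particleDensity c N x y * f (z - y) := by
        have hper : Function.Periodic (fun y => particleDensity c N x y * f (x i - y)) L := by
          intro y
          simp only
          rw [h.density_periodic (c := c) y, ← hS.periodic (x i - (y + L))]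
          congr 2; ring
        have h6 := hper.intervalIntegral_add_eq (x i) (-(L / 2))
        rw [show -(L / 2) + L = L / 2 by ring] at h6
        rw [h6]
        refine intervalIntegral.integral_congr fun y _ => ?_
        have h7 := hS.periodic.sub_zsmul_eq (x := x i - y) ⌊x i / L + 1 / 2⌋
        rw [← h7, hz]
        congr 2
        rw [zsmul_eq_mul]; ring
      rw [e3] at h4
      have e4 : V i + G z = (V i + ∫ y in -(L / 2)..L / 2, particleDensity c N x y * f (z - y)) -
          ((∫ y in -(L / 2)..L / 2, particleDensity c N x y * f (z - y)) - G z) := by ring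
      rw [e4]
      exact (abs_sub _ _).trans (add_le_add h4 h5)
    · rw [hζs z (not_le.1 hzR), abs_zero, zero_mul]
      have hM0 : 0 ≤ M := (hmem 0).1.trans (hmem 0).2
      have := hk.lip_nonneg
      positivity
  have hcN : 0 ≤ c / N := (div_pos hc hN).le
  have h4 : |∑ i ∈ Finset.range N, c / N * (periodicCut ζ L (x i) * V i) +
      ∑ i ∈ Finset.range N, c / N * periodicCut A L (x i)| ≤
      c * (D * (c / N * (Λ * L + 4 * B) + (M * η + 2 * B * τ))) := by
    rw [← Finset.sum_add_distrib]
    refine (Finset.abs_sum_le_sum_abs _ _).trans ((Finset.sum_le_card_nsmul _ _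
      (c / N * (D * (c / N * (Λ * L + 4 * B) + (M * η + 2 * B * τ)))) fun i _ => ?_).trans
        (le_of_eq ?_))
    · rw [← mul_add, abs_mul, abs_of_nonneg hcN]
      exact mul_le_mul_of_nonneg_left (h3 i) hcN
    · rw [Finset.card_range, nsmul_eq_mul]; field_simp
  rw [abs_le] at h1 h4 ⊢
  constructor <;> linarith [h1.1, h1.2, h4.1, h4.2]

end PeriodicConfig

/-! ### The approximate weak formulation for the particles. -/

namespace ParticleFlow

variable {φ W : ℝ → ℝ} {S : ℝ → Set ℝ} {T L c B Λ κ M Q R R₂ D η τ : ℝ} {N : ℕ} {x : ℤ → ℝ → ℝ}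
  {f k : ℝ → ℝ} {ψ ψt ψx ψxx : ℝ → ℝ → ℝ}

theorem exists_lipschitzOnWith_sum_periodicCut (h : ParticleFlow φ S T L c N x)
    (hψ : IsTestFunction ψ ψt ψx ψxx T R D) (hR : R < L / 2) :
    ∃ C, LipschitzOnWith C
      (fun t => ∑ i ∈ Finset.range N, c / N * periodicCut (ψ t) L (x i t)) (Icc 0 T) := by
  refine exists_lipschitzOnWith_sum _ fun i _ => ?_
  obtain ⟨C, hC⟩ := h.lip i
  refine ⟨(|c / N| * (D * (1 + C))).toNNReal, LipschitzOnWith.of_dist_le_mul fun s hs t ht => ?_⟩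
  have hD := hψ.bound_nonneg
  rw [Real.coe_toNNReal _ (by positivity), Real.dist_eq, Real.dist_eq, ← mul_sub, abs_mul, mul_assoc]
  refine mul_le_mul_of_nonneg_left ?_ (abs_nonneg _)
  refine (hψ.abs_periodicCut_sub_le hR s (x i s) t (x i t)).trans ?_
  have h1 := hC.dist_le_mul s hs t ht
  rw [Real.dist_eq, Real.dist_eq] at h1
  rw [mul_assoc]
  refine mul_le_mul_of_nonneg_left ?_ hD
  linarith

/-- Particle flows solve the weak formulation up to an explicit error. -/
theorem abs_sum_add_integral_weakIntegrand_le (h : ParticleFlow φ S T L c N x)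
    (hb : BoundedPath φ T L c N (clampTime T x) M Q) (hφ : AdmissibleDiffusion φ W) (hT : 0 ≤ T)
    (hS : TorusForce S f L B Λ κ) (hk : IsForceKernel k B Λ)
    (hψ : IsTestFunction ψ ψt ψx ψxx T R D) (hR : R < L / 2) (hη0 : 0 ≤ η) (hτ0 : 0 ≤ τ)
    (hη : ∫⁻ z in Icc (-(R + R₂)) (R + R₂), ‖f z - k z‖ₑ ≤ ENNReal.ofReal η)
    (hτ : ∀ t ∈ Icc 0 T, ∫⁻ y in (Icc (-R₂) R₂)ᶜ,
      ENNReal.ofReal (cutDensity L c N (fun i => clampTime T x i t) y) ≤ ENNReal.ofReal τ) :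
    |∑ i ∈ Finset.range N, c / N * periodicCut (ψ 0) L (x i 0) +
      ∫ p in Icc 0 T ×ˢ (univ : Set ℝ), weakIntegrand k φ ψt ψx ψxx
        (fun t => cutDensity L c N fun i => clampTime T x i t) p| ≤
      (D * (c / N) * L + (c * (D * (c / N * (Λ * L + 4 * B) + (M * η + 2 * B * τ))) +
        (D * (Λ * c + 2 * B * M) + D * (B * c)) * (c / N) * L)) * T := by
  have hL := hb.length_pos
  have hc := hb.mass_pos
  have hN := (hb.path.config 0).cast_pos
  have hD := hψ.bound_nonneg
  set w : ℝ → ℝ → ℝ := fun t => cutDensity L c N fun i => clampTime T x i t with hw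
  have hwm : Measurable fun p : ℝ × ℝ => w p.1 p.2 := hb.measurable_cutDensity
  have hw0 : ∀ t y, w t y ∈ Icc 0 M := hb.cutDensity_mem
  have hFi := hψ.integrableOn_weakIntegrand hφ hk.integrable hk.measurable hwm hw0
  set F := weakIntegrand k φ ψt ψx ψxx w with hF
  set H : ℝ → ℝ := fun t => ∫ y, F (t, y) with hH
  have hFi' : Integrable F ((volume.restrict (Icc 0 T)).prod volume) := by
    have := hFi
    rw [IntegrableOn, Measure.volume_eq_prod, ← Measure.prod_restrict, Measure.restrict_univ] at this
    exact this
  have hHi : IntervalIntegrable H volume 0 T := by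
    rw [intervalIntegrable_iff_integrableOn_Icc_of_le hT]
    exact hFi'.integral_prod_left
  have hFH : ∫ p in Icc 0 T ×ˢ (univ : Set ℝ), F p = ∫ t in 0..T, H t := by
    rw [Measure.volume_eq_prod, ← Measure.prod_restrict, Measure.restrict_univ,
      integral_prod _ hFi', intervalIntegral.integral_of_le hT, ← integral_Icc_eq_integral_Ioc]
  obtain ⟨C, hC⟩ := h.exists_lipschitzOnWith_sum_periodicCut hψ hR
  set g : ℝ → ℝ := fun t => ∑ i ∈ Finset.range N, c / N * periodicCut (ψ t) L (x i t) with hg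
  -- The test function vanishes at the final time, so only the initial sum remains at the boundary.
  have hgT : g T = 0 := by
    refine Finset.sum_eq_zero fun i _ => ?_
    rw [periodicCut, hψ.final, mul_zero]
  -- Compares the derivative of the particle sum with the spatial integral `H t` of the weak
  -- integrand. The first error is from the time derivative, the others from the interaction.
  have key := abs_sub_sub_integral_le_of_lipschitzOnWith (e := D * (c / N) * L +
    (c * (D * (c / N * (Λ * L + 4 * B) + (M * η + 2 * B * τ))) +
        (D * (Λ * c + 2 * B * M) + D * (B * c)) * (c / N) * L)) hT hC hHi ?_
  · rw [hgT, sub_zero] at key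
    rw [hFH, ← abs_neg]
    refine le_trans (le_of_eq ?_) key
    congr 1
    simp only [hg]; ring
  filter_upwards [h.ode, ae_restrict_mem measurableSet_Icc] with t ⟨V, hV⟩ ht
  have hxt : (fun i => clampTime T x i t) = fun i => x i t := funext fun i => clampTime_eq ht x i
  set X : ℤ → ℝ := fun i => x i t with hX
  have hconf : PeriodicConfig L N X := h.config t ht
  have hcell : ∀ i, cellDensity c N X i ≤ M := by
    have := hb.density_le t
    rwa [hxt] at this
  have hwt : w t = cutDensity L c N X := by simp only [hw]; rw [hxt]
  set Δ : ℤ → ℝ := fun i => φ (cellDensity c N X i) - φ (cellDensity c N X (i - 1)) with hΔ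
  refine ⟨∑ i ∈ Finset.range N, c / N * (periodicCut (ψt t) L (X i) +
    periodicCut (ψx t) L (X i) * (V i - N / c * Δ i)), HasDerivAt.fun_sum fun i _ =>
      ((hψ.hasDerivAt_periodicCut_comp hR (hV i).2).const_mul _), ?_⟩
  have e1 : ∑ i ∈ Finset.range N, c / N * (periodicCut (ψt t) L (X i) +
      periodicCut (ψx t) L (X i) * (V i - N / c * Δ i)) =
      ∑ i ∈ Finset.range N, c / N * periodicCut (ψt t) L (X i) +
      ∑ i ∈ Finset.range N, c / N * (periodicCut (ψx t) L (X i) * V i) -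
      ∑ i ∈ Finset.range N, periodicCut (ψx t) L (X i) * Δ i := by
    rw [← Finset.sum_add_distrib, ← Finset.sum_sub_distrib]
    refine Finset.sum_congr rfl fun i _ => ?_
    field_simp
    ring
  have hmem := hconf.cutDensity_mem hc hcell
  have hz : ∀ ζ : ℝ → ℝ, (∀ y, R < |y| → ζ y = 0) → ζ (-(L / 2)) = 0 ∧ ζ (L / 2) = 0 := fun ζ hζ =>
    ⟨hζ _ (by rw [abs_neg, abs_of_pos (by linarith)]; exact hR),
      hζ _ (by rw [abs_of_pos (by linarith)]; exact hR)⟩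
  have h1 := hb.abs_sum_sub_integral_le (hψ.lip_time t)
    (hz _ fun y hy => (hψ.support t y hy).2.1).1 (hz _ fun y hy => (hψ.support t y hy).2.1).2 t
  rw [hxt] at h1
  have h1' : ∑ i ∈ Finset.range N, c / N * periodicCut (ψt t) L (clampTime T x i t) =
      ∑ i ∈ Finset.range N, c / N * periodicCut (ψt t) L (X i) :=
    Finset.sum_congr rfl fun i _ => by rw [clampTime_eq ht]
  rw [h1'] at h1
  have hτt := hτ t ht
  rw [hxt] at hτt
  have h2 := hconf.abs_sum_force_add_integral_le hc hcell hS hk hη0 hτ0 hη hτt hR hψ.radius_pos hD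
    (hψ.abs_space_le t) (hψ.lip_space t) (fun y hy => (hψ.support t y hy).2.2.1) fun i => (hV i).1
  -- The diffusion term carries no error: summation by parts is exact for the piecewise constant
  -- density.
  have h3 := hconf.sum_mul_sub_eq_neg_integral (c := c) φ (hψ.hasDerivAt_periodicCut hR t)
    (hψ.continuous_periodicCut hR t) (periodicCut_periodic _ hL) (periodicCut_periodic _ hL)
  -- Since `φ 0 = 0`, the integral extends from the period to the line.
  have h4 : ∫ y in -(L / 2)..L / 2, φ (particleDensity c N X y) * periodicCut (ψxx t) L y =
      ∫ y, φ (cutDensity L c N X y) * ψxx t y := by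
    rw [intervalIntegral.integral_of_le (by linarith), ← integral_Ico_eq_integral_Ioc,
      ← integral_indicator measurableSet_Ico]
    refine integral_congr_ae (ae_of_all _ fun y => ?_)
    by_cases hy : y ∈ Ico (-(L / 2)) (L / 2)
    · simp only [indicator_of_mem hy, cutDensity]
      rw [periodicCut_eq _ hL hy]
    · simp only [indicator_of_notMem hy, cutDensity]
      rw [hφ.map_zero, zero_mul]
  rw [h4] at h3
  have hv : Measurable (cutDensity L c N X) := hconf.measurable_cutDensity
  have hvi : Integrable (cutDensity L c N X) := hconf.integrable_cutDensity
  have hi1 : Integrable fun y => cutDensity L c N X y * ψt t y :=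
    hvi.mul_bdd (c := D) (hψ.continuous_time.comp (by fun_prop :
      Continuous fun y : ℝ => (t, y))).aestronglyMeasurable (ae_of_all _ fun y => hψ.abs_time_le t y)
  have hGm : Measurable fun y => ∫ z, k (y - z) * cutDensity L c N X z := by
    have := (IsTestFunction.measurable_convolution hk.measurable hwm).comp
      (measurable_const.prodMk measurable_id : Measurable fun y : ℝ => (t, y))
    simp only [Function.comp_def, hwt] at this
    exact this
  have hi2 : Integrable fun y => cutDensity L c N X y *
      (ψx t y * ∫ z, k (y - z) * cutDensity L c N X z) := by
    refine hvi.mul_bdd (c := D * (B * c)) (((hψ.continuous_space.comp (by fun_prop :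
      Continuous fun y : ℝ => (t, y))).measurable.mul hGm).aestronglyMeasurable)
      (ae_of_all _ fun y => ?_)
    rw [norm_mul]
    refine mul_le_mul (hψ.abs_space_le t y) ?_ (norm_nonneg _) hD
    have := abs_convolution_le hk.bound hmem hvi y
    rwa [hconf.integral_cutDensity] at this
  have hi12 : Integrable fun y => F (t, y) := by
    have hi : Integrable ((Icc (-R) R).indicator
        fun _ => (M + M * (M * ∫ y, |k y|) + φ M) * D) :=
      (integrable_indicator_iff measurableSet_Icc).2 (integrableOn_const (by simp))
    refine hi.mono' ((hψ.measurable_weakIntegrand hφ hk.measurable hwm hw0).comp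
      (measurable_const.prodMk measurable_id)).aestronglyMeasurable (ae_of_all _ fun y => ?_)
    refine (hψ.abs_weakIntegrand_le hφ hk.integrable hw0 (t, y)).trans (le_of_eq ?_)
    simp only [indicator, mem_prod, mem_univ, true_and]
  have hHt : H t = (∫ y, cutDensity L c N X y * ψt t y) - (∫ y, cutDensity L c N X y *
      (ψx t y * ∫ z, k (y - z) * cutDensity L c N X z)) +
      ∫ y, φ (cutDensity L c N X y) * ψxx t y := by
    have e2 : ∀ y, φ (cutDensity L c N X y) * ψxx t y = F (t, y) -
        (cutDensity L c N X y * ψt t y - cutDensity L c N X y *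
          (ψx t y * ∫ z, k (y - z) * cutDensity L c N X z)) := by
      intro y
      simp only [hF, weakIntegrand, hwt]; ring
    simp only [e2]
    have hi3 : Integrable fun y => cutDensity L c N X y * ψt t y - cutDensity L c N X y *
          (ψx t y * ∫ z, k (y - z) * cutDensity L c N X z) := hi1.sub hi2
    rw [integral_sub hi12 hi3, integral_sub hi1 hi2]
    simp only [hH]; ring
  rw [e1, hHt, h3]
  rw [abs_le] at h1 h2 ⊢
  constructor <;> linarith [h1.1, h1.2, h2.1, h2.2]

end ParticleFlow

/-! ### Constants for the torus forces that are uniform in the period. -/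

theorem TorusForce.mono {S : ℝ → Set ℝ} {f : ℝ → ℝ} {L B Λ κ B' Λ' : ℝ} (h : TorusForce S f L B Λ κ)
    (hB : B ≤ B') (hΛ : Λ ≤ Λ') : TorusForce S f L B' Λ' κ where
  periodic := h.periodic
  measurable := h.measurable
  bound_nonneg := h.bound_nonneg.trans hB
  lip_nonneg := h.lip_nonneg.trans hΛ
  jump_nonneg := h.jump_nonneg
  jump_le := h.jump_le.trans hB
  bound z := (h.bound z).trans hB
  lip_left z hz w hw :=
    (h.lip_left z hz w hw).trans (mul_le_mul_of_nonneg_right hΛ (abs_nonneg _))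
  lip_right z hz w hw :=
    (h.lip_right z hz w hw).trans (mul_le_mul_of_nonneg_right hΛ (abs_nonneg _))
  eq_singleton := h.eq_singleton
  eq_mid := h.eq_mid
  near_mid z hz hz2 := (h.near_mid z hz hz2).trans
    (add_le_add le_rfl (mul_le_mul_of_nonneg_right hΛ (abs_nonneg _)))

theorem AdmissibleKernel.exists_isForceKernel {K : ℝ → ℝ} (hK : AdmissibleKernel K) (B₀ : ℝ) :
    ∃ B Λ, B₀ ≤ B ∧ B₀ ≤ Λ ∧ 0 ≤ B ∧ IsForceKernel (deriv K) B Λ := by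
  obtain ⟨B, hB0, hB⟩ := hK.exists_deriv_le
  obtain ⟨Λ, hΛ0, hp, hn⟩ := hK.exists_lipschitz
  refine ⟨max B₀ B, max B₀ Λ, le_max_left _ _, le_max_left _ _, hB0.trans (le_max_right _ _),
    hK.deriv_integrable, measurable_deriv K, fun z => (hB z).trans (le_max_right _ _),
    hΛ0.trans (le_max_right _ _), fun z w hz hw => (hp z w hz hw).trans ?_,
    fun z w hz hw => (hn z w hz hw).trans ?_⟩
  all_goals exact mul_le_mul_of_nonneg_right (le_max_right _ _) (abs_nonneg _)

theorem tendsto_lintegral_compl_Ioc {g : ℝ → ℝ} (hg : Integrable g) (hm : Measurable g) :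
    Tendsto (fun L : ℝ => ∫⁻ z in (Ioc (-(L / 2)) (L / 2))ᶜ, ‖g z‖ₑ) atTop (𝓝 0) := by
  have h1 : ∀ L : ℝ, ∫⁻ z in (Ioc (-(L / 2)) (L / 2))ᶜ, ‖g z‖ₑ =
      ∫⁻ z, (Ioc (-(L / 2)) (L / 2))ᶜ.indicator (fun z => ‖g z‖ₑ) z := fun L =>
    (lintegral_indicator measurableSet_Ioc.compl _).symm
  simp only [h1]
  rw [← lintegral_zero (α := ℝ) (μ := volume)]
  refine tendsto_lintegral_filter_of_dominated_convergence (fun z => ‖g z‖ₑ)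
    (Eventually.of_forall fun L => hm.enorm.indicator measurableSet_Ioc.compl)
    (Eventually.of_forall fun L => ae_of_all _ fun z => indicator_le_self _ _ z) hg.2.ne
    (ae_of_all _ fun z => ?_)
  refine tendsto_const_nhds.congr' ?_
  filter_upwards [eventually_gt_atTop (2 * |z|)] with L hL
  rw [indicator_of_notMem]
  have h2 : |z| < L / 2 := by linarith
  exact fun h3 => h3 ⟨(abs_lt.1 h2).1, (abs_lt.1 h2).2.le⟩

section Forces

variable {K : ℝ → ℝ} {F : ℝ → ℝ → Set ℝ}

theorem exists_torusForce (hK : AdmissibleKernel K)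
    (hF : F = nearestImageForce K ∨ (HasBoundedPeriodization K ∧ F = periodizedForce K)) {L : ℝ}
    (hL : 0 < L) : ∃ f B Λ κ, TorusForce (F L) f L B Λ κ := by
  rcases hF with rfl | ⟨hP, rfl⟩
  · obtain ⟨B, hB0, hB⟩ := hK.exists_deriv_le
    obtain ⟨Λ, hΛ0, hp, hn⟩ := hK.exists_lipschitz
    exact ⟨_, _, _, _, torusForce_nearestImage hK hL hB0 hB hΛ0 hp hn⟩
  · obtain ⟨M, hM⟩ := hP.exists_of_pos hL
    exact ⟨_, _, _, _, torusForce_periodization hK hL hM⟩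

/-- The torus forces are uniformly bounded and Lipschitz for large periods, and converge to the
force on the line. -/
theorem exists_torusForce_uniform (hK : AdmissibleKernel K)
    (hF : F = nearestImageForce K ∨ (HasBoundedPeriodization K ∧ F = periodizedForce K)) :
    ∃ B Λ, 0 ≤ B ∧ IsForceKernel (deriv K) B Λ ∧ ∃ f : ℝ → ℝ → ℝ,
      (∀ L, 1 ≤ L → ∃ κ, TorusForce (F L) (f L) L B Λ κ) ∧
      ∀ R, Tendsto (fun L => ∫⁻ z in Icc (-R) R, ‖f L z - deriv K z‖ₑ) atTop (𝓝 0) := by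
  rcases hF with rfl | ⟨⟨M, hM⟩, rfl⟩
  · obtain ⟨B, Λ, -, -, hB0, hk⟩ := hK.exists_isForceKernel 0
    refine ⟨B, Λ, hB0, hk, nearestImage K, fun L hL => ⟨_, torusForce_nearestImage hK (by linarith)
      hB0 hk.bound hk.lip_nonneg hk.lip_pos hk.lip_neg⟩, fun R => ?_⟩
    -- The nearest image force coincides with `K'` on `[-R, R]` once `L > 2 * R`.
    refine tendsto_const_nhds.congr' ?_
    filter_upwards [eventually_gt_atTop (2 * R)] with L hL
    rw [setLIntegral_congr_fun (g := fun _ => 0) measurableSet_Icc fun z hz => ?_, lintegral_zero]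
    have h1 := nearestImage_eq (K := K) (L := L) (z := z) 0 (by
      rw [Int.cast_zero, zero_mul, add_zero, abs_lt]
      constructor <;> linarith [hz.1, hz.2])
    rw [Int.cast_zero, zero_mul, add_zero] at h1
    simp only [h1, sub_self, enorm_zero]
  · obtain ⟨B, Λ, hB, hΛ, hB0, hk⟩ := hK.exists_isForceKernel M
    refine ⟨B, Λ, hB0, hk, periodization K, fun L hL => ⟨0, (torusForce_periodization hK
      (by linarith) (hM L hL)).mono hB hΛ⟩, fun R => ?_⟩
    refine tendsto_of_tendsto_of_tendsto_of_le_of_le' tendsto_const_nhds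
      (tendsto_lintegral_compl_Ioc hK.deriv_integrable (measurable_deriv K))
      (Eventually.of_forall fun L => zero_le) ?_
    filter_upwards [eventually_ge_atTop 1, eventually_gt_atTop (2 * R)] with L hL1 hLR
    refine le_trans (lintegral_mono_set fun z hz => ?_)
      (lintegral_periodization_sub_le (by linarith) fun z hz => (hM L hL1 z hz).1)
    constructor <;> linarith [hz.1, hz.2]

end Forces

/-! ### Passage to the limit in the weak formulation. -/

section WeakSolution

variable {K φ W ρ₀ : ℝ → ℝ} {F : ℝ → ℝ → Set ℝ} {T B Λ M Q : ℝ} {L : ℕ → ℝ} {N : ℕ → ℕ}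
  {x : ℕ → ℤ → ℝ → ℝ} {f : ℕ → ℝ → ℝ} {κ : ℕ → ℝ}

/-- The particle approximations satisfy the weak formulation asymptotically. -/
theorem tendsto_sum_add_integral_weakIntegrand (hφ : AdmissibleDiffusion φ W)
    (hint : Integrable ρ₀) (hpos : ∀ᵐ x, 0 < ρ₀ x) (hT : 0 < T) (hB : 0 ≤ B) (hM : 0 ≤ M)
    (hQ : 0 ≤ Q) (hk : IsForceKernel (deriv K) B Λ)
    (hF : ∀ n, TorusForce (F (L n)) (f n) (L n) B Λ (κ n))
    (hsys : ∀ n, IsParticleSystem φ ρ₀ F T (L n) (N n) (x n))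
    (hb : ∀ n, BoundedPath φ T (L n) (cutMass ρ₀ (L n)) (N n) (clampTime T (x n)) M Q)
    (hL : Tendsto L atTop atTop)
    (herr : Tendsto (fun n => cutMass ρ₀ (L n) / N n * L n) atTop (𝓝 0))
    (hconv : ∀ R, Tendsto (fun n => ∫⁻ z in Icc (-R) R, ‖f n z - deriv K z‖ₑ) atTop (𝓝 0))
    {ψ ψt ψx ψxx : ℝ → ℝ → ℝ} {R D : ℝ} (hψ : IsTestFunction ψ ψt ψx ψxx T R D) :
    Tendsto (fun n => ∑ i ∈ Finset.range (N n),
        cutMass ρ₀ (L n) / N n * periodicCut (ψ 0) (L n) (x n i 0) +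
      ∫ p in Icc 0 T ×ˢ (univ : Set ℝ), weakIntegrand (deriv K) φ ψt ψx ψxx
        (fun t => cutDensity (L n) (cutMass ρ₀ (L n)) (N n) fun i => clampTime T (x n) i t) p)
      atTop (𝓝 0) := by
  rw [Metric.tendsto_nhds]
  intro ε hε
  set m := ∫ x, ρ₀ x with hm
  have hm0 : 0 ≤ m := integral_nonneg_of_ae (hpos.mono fun x hx => hx.le)
  have hD := hψ.bound_nonneg
  have hΛ := hk.lip_nonneg
  -- `P` collects all factors of `δ` in the consistency error, with the mass of each particle system
  -- bounded by `m`.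
  set P := D + m * (D * (Λ + 4 * B)) + (D * (Λ * m + 2 * B * M) + D * (B * m)) +
    m * (D * (M + 2 * B)) with hP
  have hP0 : 0 ≤ P := by positivity
  set δ := ε / (2 * (P * T + 1)) with hδ
  have hδ0 : 0 < δ := by positivity
  -- By the moment bound, with the quadrature error at most 1, the mass outside `[-R₂, R₂]` is at
  -- most `δ`.
  set R₂ := (Q + 1) / δ with hR₂
  have hR₂0 : 0 < R₂ := by positivity
  filter_upwards [hL.eventually_gt_atTop (2 * R), hL.eventually_ge_atTop 1,
    herr.eventually_le_const hδ0, herr.eventually_le_const one_pos,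
    (hconv (R + R₂)).eventually_le_const (ENNReal.ofReal_pos.2 hδ0)] with n hn1 hn2 hn3 hn4 hn5
  have hc := (hb n).mass_pos
  have hcm : cutMass ρ₀ (L n) ≤ m := cutMass_le hint hpos (by linarith)
  set c := cutMass ρ₀ (L n) with hcdef
  have hN : 0 < N n := ((hb n).path.config 0).pos
  have hNr : (0 : ℝ) < N n := by exact_mod_cast hN
  have hτ : ∀ t ∈ Icc 0 T, ∫⁻ y in (Icc (-R₂) R₂)ᶜ,
      ENNReal.ofReal (cutDensity (L n) c (N n) (fun i => clampTime T (x n) i t) y) ≤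
      ENNReal.ofReal δ := by
    intro t ht
    refine ((hb n).lintegral_tail_le ht hR₂0).trans (ENNReal.ofReal_le_ofReal ?_)
    rw [div_le_iff₀ hR₂0, hR₂, mul_div_cancel₀ _ hδ0.ne']
    linarith
  have key := ((hsys n).particleFlow hN).abs_sum_add_integral_weakIntegrand_le (hb n) hφ hT.le
    (hF n) hk hψ (by linarith : R < L n / 2) hδ0.le hδ0.le hn5 hτ
  have hα : c / N n ≤ c / N n * L n := le_mul_of_one_le_right (div_pos hc hNr).le hn2
  set α := c / N n with hαdef
  have hα0 : 0 < α := div_pos hc hNr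
  rw [Real.dist_eq, sub_zero]
  refine key.trans_lt ?_
  have h1 : D * α * L n ≤ D * δ := by
    rw [mul_assoc]; exact mul_le_mul_of_nonneg_left hn3 hD
  have h2 : α * (Λ * L n + 4 * B) ≤ (Λ + 4 * B) * δ := by
    have h3 : α * (4 * B) ≤ δ * (4 * B) :=
      mul_le_mul_of_nonneg_right (hα.trans hn3) (by positivity)
    have h4 := mul_le_mul_of_nonneg_left hn3 hΛ
    nlinarith
  have h3 : c * (D * (α * (Λ * L n + 4 * B) + (M * δ + 2 * B * δ))) ≤
      m * (D * ((Λ + 4 * B) * δ + (M * δ + 2 * B * δ))) := by gcongr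
  have h4 : (D * (Λ * c + 2 * B * M) + D * (B * c)) * α * L n ≤
      (D * (Λ * m + 2 * B * M) + D * (B * m)) * δ := by
    rw [mul_assoc]; gcongr
  have h5 : D * α * L n + (c * (D * (α * (Λ * L n + 4 * B) + (M * δ + 2 * B * δ))) +
      (D * (Λ * c + 2 * B * M) + D * (B * c)) * α * L n) ≤ P * δ := by
    rw [hP]; linarith
  refine (mul_le_mul_of_nonneg_right h5 hT.le).trans_lt ?_
  rw [hδ, show P * (ε / (2 * (P * T + 1))) * T = ε / 2 * (P * T / (P * T + 1)) by field_simp]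
  have h6 : P * T / (P * T + 1) ≤ 1 := by rw [div_le_one (by positivity)]; linarith
  nlinarith

/-- The initial cells carry equal mass of the initial datum, so these are quadrature sums with an
error proportional to `c L / N`. -/
theorem tendsto_sum_periodicCut_initial (hint : Integrable ρ₀) (hpos : ∀ᵐ x, 0 < ρ₀ x)
    (hLpos : ∀ n, 0 < L n) (hN : ∀ n, 0 < N n)
    (hsys : ∀ n, IsParticleSystem φ ρ₀ F T (L n) (N n) (x n))
    (hL : Tendsto L atTop atTop)
    (herr : Tendsto (fun n => cutMass ρ₀ (L n) / N n * L n) atTop (𝓝 0)) {ζ : ℝ → ℝ} {R D : ℝ}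
    (hD : 0 ≤ D) (hζ : ∀ y z, |ζ y - ζ z| ≤ D * |y - z|) (hζs : ∀ y, R < |y| → ζ y = 0) :
    Tendsto (fun n => ∑ i ∈ Finset.range (N n),
        cutMass ρ₀ (L n) / N n * periodicCut ζ (L n) (x n i 0)) atTop (𝓝 (∫ y, ρ₀ y * ζ y)) := by
  rw [tendsto_iff_norm_sub_tendsto_zero]
  have h1 : Tendsto (fun n => D * (cutMass ρ₀ (L n) / N n * L n)) atTop (𝓝 0) := by
    have := herr.const_mul D
    rwa [mul_zero] at this
  refine squeeze_zero' (Eventually.of_forall fun n => norm_nonneg _) ?_ h1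
  filter_upwards [hL.eventually_gt_atTop (2 * R)] with n hn
  have h2 := abs_sum_initialPosition_sub_le hint hpos (hLpos n) (hN n) hD hζ
  have h3 : ∑ i ∈ Finset.range (N n), cutMass ρ₀ (L n) / N n * periodicCut ζ (L n) (x n i 0) =
      ∑ i ∈ Finset.range (N n), cutMass ρ₀ (L n) / N n * ζ (initialPosition ρ₀ (L n) (N n) i) := by
    refine Finset.sum_congr rfl fun i hi => ?_
    have hi' := Finset.mem_range.1 hi
    have h4 := (initialPosition_spec hint hpos (hLpos n) (hN n) i hi'.le).1
    have h5 := (initialPosition_spec hint hpos (hLpos n) (hN n) (i + 1) hi').1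
    have h6 := initialPosition_lt hint hpos (hLpos n) (hN n) hi'
    rw [(hsys n).initial i hi', periodicCut_eq ζ (hLpos n) ⟨h4.1, h6.trans_le h5.2⟩]
  have h4 : ∫ y in -(L n / 2)..L n / 2, ρ₀ y * ζ y = ∫ y, ρ₀ y * ζ y := by
    rw [intervalIntegral.integral_of_le (by linarith [hLpos n])]
    refine setIntegral_eq_integral_of_forall_compl_eq_zero fun y hy => ?_
    rw [hζs y, mul_zero]
    by_contra hcon
    have h5 : |y| < L n / 2 := by linarith [not_lt.1 hcon]
    exact hy ⟨(abs_lt.1 h5).1, (abs_lt.1 h5).2.le⟩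
  rw [h3, ← h4, Real.norm_eq_abs]
  exact h2.trans (le_of_eq (mul_assoc _ _ _))

/-- Limits of the particle densities are weak solutions. -/
theorem isBoundedWeakSolution_of_tendsto (hφ : AdmissibleDiffusion φ W)
    (hint : Integrable ρ₀) (hpos : ∀ᵐ x, 0 < ρ₀ x) (hT : 0 < T) (hB : 0 ≤ B)
    (hQ : 0 ≤ Q) (hk : IsForceKernel (deriv K) B Λ)
    (hF : ∀ n, TorusForce (F (L n)) (f n) (L n) B Λ (κ n))
    (hsys : ∀ n, IsParticleSystem φ ρ₀ F T (L n) (N n) (x n))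
    (hb : ∀ n, BoundedPath φ T (L n) (cutMass ρ₀ (L n)) (N n) (clampTime T (x n)) M Q)
    (hL : Tendsto L atTop atTop)
    (herr : Tendsto (fun n => cutMass ρ₀ (L n) / N n * L n) atTop (𝓝 0))
    (hconv : ∀ R, Tendsto (fun n => ∫⁻ z in Icc (-R) R, ‖f n z - deriv K z‖ₑ) atTop (𝓝 0))
    {ρ : ℝ → ℝ → ℝ} (hρm : Measurable fun p : ℝ × ℝ => ρ p.1 p.2) (hρ : ∀ t y, ρ t y ∈ Icc 0 M)
    (hρi : IntegrableOn (fun p : ℝ × ℝ => ρ p.1 p.2) (Icc 0 T ×ˢ (univ : Set ℝ)))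
    (hlim : Tendsto (fun n => ∫⁻ p in Icc 0 T ×ˢ (univ : Set ℝ), ‖cutDensity (L n)
      (cutMass ρ₀ (L n)) (N n) (fun k => clampTime T (x n) k p.1) p.2 - ρ p.1 p.2‖ₑ)
        atTop (𝓝 0)) :
    IsBoundedWeakSolution K φ ρ₀ T ρ := by
  refine ⟨hρm, fun t y => (hρ t y).1, ⟨M, fun t y => (hρ t y).2⟩, hρi, fun ψ hψ hc hsupp => ?_⟩
  have hM : 0 ≤ M := (hρ 0 0).1.trans (hρ 0 0).2
  obtain ⟨R, D, hψ⟩ := exists_isTestFunction hψ hc hsupp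
  set ψt : ℝ → ℝ → ℝ := fun t x => deriv (fun t => ψ t x) t
  set ψx : ℝ → ℝ → ℝ := fun t x => deriv (ψ t) x
  set ψxx : ℝ → ℝ → ℝ := fun t x => deriv (deriv (ψ t)) x
  have h1 := tendsto_sum_add_integral_weakIntegrand hφ hint hpos hT hB hM hQ hk hF hsys hb hL herr
    hconv hψ
  have h2 := tendsto_sum_periodicCut_initial hint hpos (fun n => (hb n).length_pos)
    (fun n => ((hb n).path.config 0).pos) hsys hL herr hψ.bound_nonneg (ζ := ψ 0) (fun y z => by
      have := hψ.lip 0 y 0 z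
      rwa [sub_self, abs_zero, zero_add] at this) fun y hy => (hψ.support 0 y hy).1
  set w : ℕ → ℝ → ℝ → ℝ := fun n t => cutDensity (L n) (cutMass ρ₀ (L n)) (N n)
    fun i => clampTime T (x n) i t with hw
  have hwm : ∀ n, Measurable fun p : ℝ × ℝ => w n p.1 p.2 := fun n => (hb n).measurable_cutDensity
  have hwmem : ∀ n t y, w n t y ∈ Icc 0 M := fun n => (hb n).cutDensity_mem
  have h3 : Tendsto (fun n => ∫ p in Icc 0 T ×ˢ (univ : Set ℝ),
      weakIntegrand (deriv K) φ ψt ψx ψxx (w n) p) atTop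
      (𝓝 (∫ p in Icc 0 T ×ˢ (univ : Set ℝ), weakIntegrand (deriv K) φ ψt ψx ψxx ρ p)) := by
    obtain ⟨C, hC⟩ := hψ.exists_lintegral_weakIntegrand_sub_le hφ hk.integrable hk.bound M
    refine tendsto_integral_of_L1 _
      (hψ.integrableOn_weakIntegrand hφ hk.integrable hk.measurable hρm hρ).aestronglyMeasurable
      (Eventually.of_forall fun n => hψ.integrableOn_weakIntegrand hφ hk.integrable hk.measurable
        (hwm n) (hwmem n)) ?_
    have h4 := ENNReal.Tendsto.const_mul (a := ENNReal.ofReal C) hlim (Or.inr ENNReal.ofReal_ne_top)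
    rw [mul_zero] at h4
    exact tendsto_of_tendsto_of_tendsto_of_le_of_le tendsto_const_nhds h4 (fun n => zero_le)
      fun n => hC _ _ (hwm n) hρm (hwmem n) hρ
  -- The same sequence tends to the weak formulation of the limit and to zero.
  have h4 := tendsto_nhds_unique (h2.add h3) h1
  rw [add_comm] at h4
  exact h4

end WeakSolution

/-! ### Torus limits and the diagonal argument. -/

section TorusLimit

variable {K φ W ρ₀ : ℝ → ℝ} {F : ℝ → ℝ → Set ℝ} {T L c : ℝ} {N : ℕ} {x : ℤ → ℝ → ℝ}

theorem cutDensity_clampTime_eq {t y : ℝ} (ht : t ∈ Icc 0 T) (hy : y ∈ Ico (-(L / 2)) (L / 2)) :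
    cutDensity L c N (fun k => clampTime T x k t) y = particleDensity c N (fun k => x k t) y := by
  have hxt : (fun i => clampTime T x i t) = fun i => x i t := funext fun i => clampTime_eq ht x i
  rw [cutDensity, indicator_of_mem hy, hxt]

theorem lintegral_particleDensity_sub_le (ρ : ℝ → ℝ → ℝ) :
    ∫⁻ p in Icc 0 T ×ˢ Ico (-(L / 2)) (L / 2),
      ‖particleDensity c N (fun k => x k p.1) p.2 - ρ p.1 p.2‖ₑ ≤
    ∫⁻ p in Icc 0 T ×ˢ (univ : Set ℝ),
      ‖cutDensity L c N (fun k => clampTime T x k p.1) p.2 - ρ p.1 p.2‖ₑ := by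
  refine le_trans (le_of_eq ?_) (lintegral_mono_set (prod_mono_right (subset_univ (Ico (-(L / 2)) (L / 2)))))
  refine setLIntegral_congr_fun (measurableSet_Icc.prod measurableSet_Ico) fun p hp => ?_
  rw [cutDensity_clampTime_eq hp.1 hp.2]

/-- A triangle inequality on the period. Outside it both the extended `r` and the cut density
vanish, so the second integral alone suffices. -/
theorem lintegral_indicator_sub_le {r ρ : ℝ → ℝ → ℝ}
    (hm : Measurable fun p : ℝ × ℝ => cutDensity L c N (fun k => clampTime T x k p.1) p.2)
    (hρ : Measurable fun p : ℝ × ℝ => ρ p.1 p.2) :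
    ∫⁻ p in Icc 0 T ×ˢ (univ : Set ℝ),
      ‖(Ico (-(L / 2)) (L / 2)).indicator (r p.1) p.2 - ρ p.1 p.2‖ₑ ≤
    (∫⁻ p in Icc 0 T ×ˢ Ico (-(L / 2)) (L / 2),
      ‖particleDensity c N (fun k => x k p.1) p.2 - r p.1 p.2‖ₑ) +
    ∫⁻ p in Icc 0 T ×ˢ (univ : Set ℝ),
      ‖cutDensity L c N (fun k => clampTime T x k p.1) p.2 - ρ p.1 p.2‖ₑ := by
  have hms : MeasurableSet ((univ : Set ℝ) ×ˢ Ico (-(L / 2)) (L / 2)) :=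
    MeasurableSet.univ.prod measurableSet_Ico
  have h1 : ∫⁻ p in Icc 0 T ×ˢ Ico (-(L / 2)) (L / 2),
      ‖particleDensity c N (fun k => x k p.1) p.2 - r p.1 p.2‖ₑ =
      ∫⁻ p in Icc 0 T ×ˢ (univ : Set ℝ), ((univ : Set ℝ) ×ˢ Ico (-(L / 2)) (L / 2)).indicator
        (fun p : ℝ × ℝ => ‖particleDensity c N (fun k => x k p.1) p.2 - r p.1 p.2‖ₑ) p := by
    rw [lintegral_indicator hms, Measure.restrict_restrict hms, prod_inter_prod, univ_inter,
      inter_univ]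
  have hm' : Measurable fun p : ℝ × ℝ =>
      ‖cutDensity L c N (fun k => clampTime T x k p.1) p.2 - ρ p.1 p.2‖ₑ := (hm.sub hρ).enorm
  rw [h1, ← lintegral_add_right _ hm']
  refine setLIntegral_mono' (measurableSet_Icc.prod MeasurableSet.univ) fun p hp => ?_
  by_cases hy : p.2 ∈ Ico (-(L / 2)) (L / 2)
  · rw [indicator_of_mem hy, indicator_of_mem (show p ∈ univ ×ˢ _ from ⟨mem_univ _, hy⟩),
      cutDensity_clampTime_eq hp.1 hy, ← edist_eq_enorm_sub, ← edist_eq_enorm_sub,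
      ← edist_eq_enorm_sub, edist_comm _ (r p.1 p.2)]
    exact edist_triangle _ _ _
  · rw [indicator_of_notMem hy, cutDensity, indicator_of_notMem hy]
    exact le_add_self

/-- The compactness theorem at a fixed period, along all numbers of particles beyond a threshold;
the shift by `m + 1` ensures `cutMass ρ₀ L * L ≤ N`. -/
theorem exists_isTorusLimit (hK : AdmissibleKernel K) (hφ : AdmissibleDiffusion φ W)
    (hF : F = nearestImageForce K ∨ (HasBoundedPeriodization K ∧ F = periodizedForce K))
    (hint : Integrable ρ₀) (hbdd : ∃ M, ∀ᵐ x, ρ₀ x ≤ M) (hpos : ∀ᵐ x, 0 < ρ₀ x)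
    (hmom : Integrable fun x => |x| * ρ₀ x) (hT : 0 < T) (hL : 0 < L) :
    ∃ r : ℝ → ℝ → ℝ, IsTorusLimit φ ρ₀ F T L r := by
  obtain ⟨f, B, Λ, κ, hf⟩ := exists_torusForce hK hF hL
  obtain ⟨M, Q, -, hQ, hpath⟩ :=
    exists_boundedPath hφ hint hpos hbdd hmom hT hL hf.bound_nonneg hf.lip_nonneg
  obtain ⟨m, hm⟩ := exists_nat_ge (cutMass ρ₀ L * L)
  have hsys : ∀ N : ℕ, ∃ x : ℤ → ℝ → ℝ, 0 < N → IsParticleSystem φ ρ₀ F T L N x := fun N => by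
    by_cases hN : 0 < N
    · obtain ⟨x, hx⟩ := exists_particleSystem hφ hint hpos hT hL hf hN
      exact ⟨x, fun _ => hx⟩
    · exact ⟨fun _ _ => 0, fun h => absurd h hN⟩
  choose x hx using hsys
  have hb : ∀ n, BoundedPath φ T L (cutMass ρ₀ L) (n + (m + 1)) (clampTime T (x (n + (m + 1))))
      M Q := fun n => by
    refine hpath F f L κ _ _ le_rfl (by omega) (hm.trans ?_) hf (hx _ (by omega))
    exact_mod_cast (by omega : m ≤ n + (m + 1))
  have herr : Tendsto (fun n : ℕ => cutMass ρ₀ L / ((n + (m + 1) : ℕ) : ℝ) * L) atTop (𝓝 0) := by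
    have := ((tendsto_const_div_atTop_nhds_zero_nat (cutMass ρ₀ L)).comp
      (tendsto_add_atTop_nat (m + 1))).mul_const L
    rwa [zero_mul] at this
  obtain ⟨s, ρ, hs, -, -, hρi, hlim⟩ :=
    BoundedPath.exists_limit hφ hb hT hQ herr (Or.inr ⟨L, fun _ => rfl⟩)
  refine ⟨ρ, hρi.mono_set (prod_mono_right (subset_univ _)), x,
    ⟨m + 1, by omega, fun N hN => hx N (by omega)⟩, fun n => s n + (m + 1),
    fun a b hab => Nat.add_lt_add_right (hs hab) _, ?_⟩
  exact tendsto_of_tendsto_of_tendsto_of_le_of_le tendsto_const_nhds hlim (fun n => zero_le)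
    fun n => lintegral_particleDensity_sub_le ρ

/-- A torus limit is approximated by particle densities with arbitrarily many particles. -/
theorem IsTorusLimit.exists_particleSystem_near {r : ℝ → ℝ → ℝ} (h : IsTorusLimit φ ρ₀ F T L r)
    {ε : ℝ} (hε : 0 < ε) : ∃ (N : ℕ) (x : ℤ → ℝ → ℝ), 0 < N ∧ cutMass ρ₀ L * L ≤ N ∧
      cutMass ρ₀ L / N * L ≤ ε ∧ IsParticleSystem φ ρ₀ F T L N x ∧
      ∫⁻ p in Icc 0 T ×ˢ Ico (-(L / 2)) (L / 2),
        ‖particleDensity (cutMass ρ₀ L) N (fun k => x k p.1) p.2 - r p.1 p.2‖ₑ ≤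
          ENNReal.ofReal ε := by
  obtain ⟨-, x, ⟨N₀, hN₀, hx⟩, s, hs, hlim⟩ := h
  have h1 : Tendsto (fun n => cutMass ρ₀ L / (s n : ℝ) * L) atTop (𝓝 0) := by
    have := ((tendsto_const_div_atTop_nhds_zero_nat (cutMass ρ₀ L)).comp
      hs.tendsto_atTop).mul_const L
    rwa [zero_mul] at this
  have h2 : Tendsto (fun n => (s n : ℝ)) atTop atTop :=
    tendsto_natCast_atTop_atTop.comp hs.tendsto_atTop
  obtain ⟨n, hn1, hn2, hn3, hn4⟩ := ((h1.eventually_le_const hε).and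
    ((h2.eventually_ge_atTop (cutMass ρ₀ L * L)).and
    ((hs.tendsto_atTop.eventually_ge_atTop N₀).and
    (hlim.eventually_le_const (ENNReal.ofReal_pos.2 hε))))).exists
  exact ⟨s n, x (s n), hN₀.trans_le hn3, hn2, hn1, hx _ hn3, hn4⟩

/-- Each torus limit is replaced by a particle density within `1 / (n + 1)` of it. The resulting
sequence, with period and number of particles both varying, has the uniform bounds, and its limit is
also that of the torus limits. -/
theorem exists_isBoundedWeakSolution (hK : AdmissibleKernel K) (hφ : AdmissibleDiffusion φ W)
    (hF : F = nearestImageForce K ∨ (HasBoundedPeriodization K ∧ F = periodizedForce K))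
    (hint : Integrable ρ₀) (hbdd : ∃ M, ∀ᵐ x, ρ₀ x ≤ M) (hpos : ∀ᵐ x, 0 < ρ₀ x)
    (hmom : Integrable fun x => |x| * ρ₀ x) (hT : 0 < T) {L : ℕ → ℝ} {r : ℕ → ℝ → ℝ → ℝ}
    (hL1 : ∀ n, 1 ≤ L n) (hL : Tendsto L atTop atTop)
    (hr : ∀ n, IsTorusLimit φ ρ₀ F T (L n) (r n)) :
    ∃ (s : ℕ → ℕ) (ρ : ℝ → ℝ → ℝ), StrictMono s ∧ IsBoundedWeakSolution K φ ρ₀ T ρ ∧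
      Tendsto (fun n => ∫⁻ p in Icc 0 T ×ˢ (univ : Set ℝ),
        ‖(Ico (-(L (s n) / 2)) (L (s n) / 2)).indicator (r (s n) p.1) p.2 - ρ p.1 p.2‖ₑ)
        atTop (𝓝 0) := by
  obtain ⟨B, Λ, hB, hk, f, hf, hconv⟩ := exists_torusForce_uniform hK hF
  obtain ⟨M, Q, -, hQ, hpath⟩ :=
    exists_boundedPath hφ hint hpos hbdd hmom hT one_pos hB hk.lip_nonneg
  choose κ hκ using fun n => hf (L n) (hL1 n)
  choose N x hN hNL hNε hsys hnear using fun n =>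
    (hr n).exists_particleSystem_near (Nat.one_div_pos_of_nat (α := ℝ) (n := n))
  have hb : ∀ n, BoundedPath φ T (L n) (cutMass ρ₀ (L n)) (N n) (clampTime T (x n)) M Q := fun n =>
    hpath F (f (L n)) (L n) (κ n) _ _ (hL1 n) (hN n) (hNL n) (hκ n) (hsys n)
  have herr : Tendsto (fun n => cutMass ρ₀ (L n) / N n * L n) atTop (𝓝 0) := by
    refine squeeze_zero (fun n => ?_) hNε tendsto_one_div_add_atTop_nhds_zero_nat
    have hLn : 0 < L n := one_pos.trans_le (hL1 n)
    have := cutMass_pos hint hpos hLn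
    positivity
  obtain ⟨s, ρ, hs, hρm, hρ, hρi, hlim⟩ := BoundedPath.exists_limit hφ hb hT hQ herr (Or.inl hL)
  have hst := hs.tendsto_atTop
  refine ⟨s, ρ, hs, isBoundedWeakSolution_of_tendsto hφ hint hpos hT hB hQ hk (fun n => hκ (s n))
    (fun n => hsys (s n)) (fun n => hb (s n)) (hL.comp hst) (herr.comp hst)
    (fun R => (hconv R).comp (hL.comp hst)) hρm hρ hρi hlim, ?_⟩
  have h0 : Tendsto (fun n : ℕ => ENNReal.ofReal (1 / ((s n : ℝ) + 1))) atTop (𝓝 0) := by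
    rw [← ENNReal.ofReal_zero]
    exact ENNReal.tendsto_ofReal (tendsto_one_div_add_atTop_nhds_zero_nat.comp hst)
  have h1 := h0.add hlim
  rw [add_zero] at h1
  exact tendsto_of_tendsto_of_tendsto_of_le_of_le tendsto_const_nhds h1 (fun n => zero_le)
    fun n => (lintegral_indicator_sub_le (hb (s n)).measurable_cutDensity hρm).trans
      (add_le_add_left (hnear (s n)) _)

end TorusLimit

theorem theorem3 (K φ W : ℝ → ℝ) (hK : AdmissibleKernel K) (hφ : AdmissibleDiffusion φ W)
    (F : ℝ → ℝ → Set ℝ)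
    (hF : F = nearestImageForce K ∨ (HasBoundedPeriodization K ∧ F = periodizedForce K))
    (ρ₀ : ℝ → ℝ) (hρ₀_int : Integrable ρ₀) (hρ₀_bdd : ∃ M, ∀ᵐ x, ρ₀ x ≤ M)
    (hρ₀_pos : ∀ᵐ x, 0 < ρ₀ x) (hρ₀_moment : Integrable (fun x => |x| * ρ₀ x))
    (T : ℝ) (hT : 0 < T) :
    (∀ L : ℝ, 0 < L → ∃ r : ℝ → ℝ → ℝ, IsTorusLimit φ ρ₀ F T L r) ∧
    ∀ (L : ℕ → ℝ) (r : ℕ → ℝ → ℝ → ℝ), (∀ n, 0 < L n) → Tendsto L atTop atTop →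
      (∀ n, IsTorusLimit φ ρ₀ F T (L n) (r n)) →
      ∃ (s : ℕ → ℕ) (ρ : ℝ → ℝ → ℝ), StrictMono s ∧
        IsBoundedWeakSolution K φ ρ₀ T ρ ∧
        Tendsto (fun n => ∫⁻ p in Icc 0 T ×ˢ (univ : Set ℝ),
          ‖(Ico (-(L (s n) / 2)) (L (s n) / 2)).indicator (r (s n) p.1) p.2 - ρ p.1 p.2‖ₑ)
          atTop (𝓝 0) := by
  refine ⟨fun L hL => exists_isTorusLimit hK hφ hF hρ₀_int hρ₀_bdd hρ₀_pos hρ₀_moment hT hL,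
    fun L r _ hL hr => ?_⟩
  -- The uniform force bounds need periods at least 1, so finitely many terms are dropped and the
  -- subsequence is shifted back.
  obtain ⟨n₀, hn₀⟩ := eventually_atTop.1 (hL.eventually_ge_atTop 1)
  obtain ⟨s, ρ, hs, hρ, hlim⟩ := exists_isBoundedWeakSolution hK hφ hF hρ₀_int hρ₀_bdd hρ₀_pos
    hρ₀_moment hT (L := fun n => L (n + n₀)) (r := fun n => r (n + n₀))
    (fun n => hn₀ _ (Nat.le_add_left _ _)) (hL.comp (tendsto_add_atTop_nat n₀))
    fun n => hr (n + n₀)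
  exact ⟨fun n => s n + n₀, ρ, fun a b hab => Nat.add_lt_add_right (hs hab) _, hρ, hlim⟩
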